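/- Let $v:\mathbb R^3\to\mathbb R$ be a repulsive potential of the form $v(x)=\chi(|x|)/|x|$, where $\chi$ is smooth and nonincreasing on $(0,\infty)$ and vanishes for large arguments (hence $\chi\ge 0$), and assume $v\in L^2(\mathbb R^3)$. Let $\phi$ be a global smooth solution on $[0,\infty)\times\mathbb R^3$ of the Hartree equation $$ i\,\partial_t\phi+\Delta\phi-(v*|\phi|^2)\phi=0, $$ meaning that $\phi\in C^\infty([0,\infty)\times\mathbb R^3)$, that $\|\phi(t)\|_{H^2}$ is bounded on bounded time intervals, and that the equation holds pointwise. Assume that the pseudoconformal energy of $\phi$ at time $1$ is finite, i.e. that at $t=1$ the density $$ e_c=\tfrac{|x|^2}{2}\rho+t\,x\cdot P+t^2\big(|\nabla\phi|^2+(v*|\phi|^2)\rho\big),\qquad \rho=\tfrac12|\phi|^2,\quad P=\tfrac1{2i}\big(\phi\nabla\overline\phi-\overline\phi\nabla\phi\big), $$ is integrable over $\mathbb R^3$. Products of kernels on $\mathbb R^3\times\mathbb R^3$ denote compositions, $(ab)(x,y)=\int a(x,z)b(z,y)\,dz$; $\overline a$ is the complex conjugate kernel and $a^T(x,y)=a(y,x)$.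 For a symmetric kernel $k\in L^2(\mathbb R^3\times\mathbb R^3)$ put $$ u=\mathrm{sh}(k)=k+\tfrac1{3!}k\overline kk+\cdots,\qquad \delta(x-y)+p=\mathrm{ch}(k)=\delta(x-y)+\tfrac1{2!}k\overline k+\cdots, $$ and let $$ g(t,x,y)=-\Delta_x\delta(x-y)+v(x-y)\phi(t,x)\overline\phi(t,y)+(v*|\phi|^2)(t,x)\,\delta(x-y),\qquad m(t,x,y)=-v(x-y)\overline\phi(t,x)\overline\phi(t,y). $$ A solution on $[0,T]$ of $$ i u_t+ug^T+gu-(1+p)m=\big(ip_t+[g,p]+u\overline m\big)(1+p)^{-1}u \qquad (*)$$ is a family of symmetric kernels $k\in C([0,T];L^2(\mathbb R^3\times\mathbb R^3))$ such that the distributions $(i\partial_t-\Delta_x-\Delta_y)u$ and $(i\partial_t-\Delta_x+\Delta_y)p$ belong to $L^1([0,T];L^2(\mathbb R^3\times\mathbb R^3))$ and $(*)$ holds as an identity of kernels for almost every $t\in[0,T]$. Then there is a constant $C$, depending only on $v$ and $\phi$, such that for every $T\ge0$ and every solution $u=\mathrm{sh}(k)$ of $(*)$ on $[0,T]$, $$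 \|u(T)\|_{L^2(\mathbb R^3\times\mathbb R^3)}\le C\big(1+\|u(0)\|_{L^2(\mathbb R^3\times\mathbb R^3)}\big). $$ -/

import Mathlib

open MeasureTheory Set
open scoped ENNReal NNReal ContDiff SchwartzMap ComplexConjugate

noncomputable section

namespace PairExcitation

/-- Physical space `ℝ³` with its Euclidean norm. -/
abbrev R3 : Type := EuclideanSpace ℝ (Fin 3)

/-! ### The potential and the Hartree equation -/

/-- Cut-off Coulomb type repulsive potentials: `v(x) = χ(|x|) / |x|` where `χ` is smooth and
nonincreasing on `(0, ∞)` and vanishes for large arguments (so that `χ ≥ 0`). -/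
def IsCutoffPotential (v : R3 → ℝ) : Prop :=
  ∃ χ : ℝ → ℝ, ContDiffOn ℝ ∞ χ (Ioi 0) ∧ AntitoneOn χ (Ioi 0) ∧
    (∃ R : ℝ, ∀ r > R, χ r = 0) ∧ ∀ x : R3, x ≠ 0 → v x = χ ‖x‖ / ‖x‖

/-- The mean-field potential `(v * |f|²)(x) = ∫ v(x - y) |f(y)|² dy`. -/
def meanField (v : R3 → ℝ) (f : R3 → ℂ) (x : R3) : ℝ :=
  ∫ y, v (x - y) * ‖f y‖ ^ 2

/-- `φ` is a global (forward in time) smooth solution of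
`i ∂ₜφ + Δφ - (v * |φ|²) φ = 0`: it is jointly smooth on `[0, ∞) × ℝ³`, belongs to `H²` with norm
bounded on bounded time intervals, and satisfies the equation at every point. -/
structure IsSmoothHartreeSolution (v : R3 → ℝ) (φ : ℝ → R3 → ℂ) : Prop where
  smooth : ContDiffOn ℝ ∞ (fun z : ℝ × R3 => φ z.1 z.2) (Ici 0 ×ˢ univ)
  sobolev : ∀ T : ℝ, ∃ M : ℝ≥0, ∀ t ∈ Icc 0 T, ∀ n ≤ 2,
    eLpNorm (iteratedFDeriv ℝ n (φ t)) 2 volume ≤ M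
  equation : ∀ t, 0 ≤ t → ∀ x : R3,
    Complex.I * derivWithin (fun s => φ s x) (Ici 0) t + Laplacian.laplacian (φ t) x
      - (meanField v (φ t) x : ℂ) * φ t x = 0

/-- The partial derivative `∂ⱼ f`. -/
def pderiv (j : Fin 3) (f : R3 → ℂ) (x : R3) : ℂ :=
  fderiv ℝ f x (EuclideanSpace.single j 1)

/-- The density `ρ = |f|² / 2`. -/
def massDensity (f : R3 → ℂ) (x : R3) : ℝ := ‖f x‖ ^ 2 / 2

/-- The momentum density `pⱼ = (1 / 2i) (f ∂ⱼ f̄ - f̄ ∂ⱼ f)`, which is real; it equals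
`-Im (f̄ ∂ⱼ f)`. -/
def momentumDensity (j : Fin 3) (f : R3 → ℂ) (x : R3) : ℝ :=
  -(conj (f x) * pderiv j f x).im

/-- The energy density `e = |∇f|² + (v * |f|²) ρ`. -/
def energyDensity (v : R3 → ℝ) (f : R3 → ℂ) (x : R3) : ℝ :=
  ∑ j, ‖pderiv j f x‖ ^ 2 + meanField v f x * massDensity f x

/-- The pseudoconformal energy density `e_c = (|x|² / 2) ρ + t xʲ pⱼ + t² e` at time `t`. -/
def pseudoconformalDensity (v : R3 → ℝ) (t : ℝ) (f : R3 → ℂ) (x : R3) : ℝ :=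
  ‖x‖ ^ 2 / 2 * massDensity f x + t * ∑ j, x j * momentumDensity j f x
    + t ^ 2 * energyDensity v f x

/-! ### Kernels and their compositions -/

/-- Spatial composition of kernels, `(a b)(x, y) = ∫ a(x, z) b(z, y) dz`. -/
def kcomp (a b : R3 × R3 → ℂ) (z : R3 × R3) : ℂ :=
  ∫ w, a (z.1, w) * b (w, z.2)

/-- The space `L²(ℝ³ × ℝ³)` of Hilbert–Schmidt kernels. -/
abbrev Kernel : Type := Lp ℂ 2 (volume : Measure (R3 × R3))

theorem memLp_kcomp (a b : Kernel) : MemLp (kcomp a b) 2 volume := by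
  have ha := Lp.stronglyMeasurable a
  have hb := Lp.stronglyMeasurable b
  have hm : StronglyMeasurable (kcomp a b) := by
    have h : StronglyMeasurable
        (fun q : (R3 × R3) × R3 => a (q.1.1, q.2) * b (q.2, q.1.2)) :=
      (ha.comp_measurable (by fun_prop)).mul (hb.comp_measurable (by fun_prop))
    exact h.integral_prod_right'
  have key : ∀ f : Kernel, ∫⁻ z, ‖f z‖ₑ ^ (2 : ℝ) < ⊤ := by
    intro f
    have := lintegral_rpow_enorm_lt_top_of_eLpNorm_lt_top (p := 2) (f := f) (μ := volume)
      (by simp) (by simp) (Lp.eLpNorm_lt_top f)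
    simpa using this
  refine ⟨hm.aestronglyMeasurable, ?_⟩
  rw [eLpNorm_lt_top_iff_lintegral_rpow_enorm_lt_top (by simp) (by simp)]
  simp only [ENNReal.toReal_ofNat]
  have hae : Measurable (fun q : R3 × R3 => ‖a q‖ₑ ^ (2 : ℝ)) := ha.enorm.pow_const _
  have hbe : Measurable (fun q : R3 × R3 => ‖b q‖ₑ ^ (2 : ℝ)) := hb.enorm.pow_const _
  have bound : ∀ z : R3 × R3, ‖kcomp a b z‖ₑ ^ (2 : ℝ) ≤
      (∫⁻ w, ‖a (z.1, w)‖ₑ ^ (2 : ℝ)) * ∫⁻ w, ‖b (w, z.2)‖ₑ ^ (2 : ℝ) := by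
    intro z
    have h1 : ‖kcomp a b z‖ₑ ≤ ∫⁻ w, ‖a (z.1, w)‖ₑ * ‖b (w, z.2)‖ₑ := by
      refine (enorm_integral_le_lintegral_enorm _).trans (le_of_eq ?_)
      simp [enorm_mul]
    have h2 := ENNReal.lintegral_mul_le_Lp_mul_Lq (volume : Measure R3)
      Real.HolderConjugate.two_two
      (f := fun w => ‖a (z.1, w)‖ₑ) (g := fun w => ‖b (w, z.2)‖ₑ)
      (ha.enorm.comp (by fun_prop : Measurable fun w : R3 => (z.1, w))).aemeasurable
      (hb.enorm.comp (by fun_prop : Measurable fun w : R3 => (w, z.2))).aemeasurable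
    have h3 := ENNReal.rpow_le_rpow (h1.trans h2) (by norm_num : (0 : ℝ) ≤ 2)
    refine h3.trans (le_of_eq ?_)
    rw [ENNReal.mul_rpow_of_nonneg _ _ (by norm_num), ← ENNReal.rpow_mul, ← ENNReal.rpow_mul]
    norm_num
  refine (lintegral_mono bound).trans_lt ?_
  have e1 := lintegral_prod_mul (μ := (volume : Measure R3)) (ν := (volume : Measure R3))
    (f := fun x => ∫⁻ w, ‖a (x, w)‖ₑ ^ (2 : ℝ)) (g := fun y => ∫⁻ w, ‖b (w, y)‖ₑ ^ (2 : ℝ))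
    hae.lintegral_prod_right'.aemeasurable hbe.lintegral_prod_left'.aemeasurable
  have e2 := lintegral_prod (μ := (volume : Measure R3)) (ν := (volume : Measure R3))
    _ hae.aemeasurable
  have e3 := lintegral_prod_symm (μ := (volume : Measure R3)) (ν := (volume : Measure R3))
    _ hbe.aemeasurable
  rw [← e2, ← e3] at e1
  exact lt_of_eq_of_lt e1 (ENNReal.mul_lt_top (key a) (key b))

/-- Composition of Hilbert–Schmidt kernels. -/
def comp (a b : Kernel) : Kernel := (memLp_kcomp a b).toLp

/-- The kernel `a(y, x)`. -/
def transpose (a : Kernel) : Kernel :=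
  Lp.compMeasurePreserving Prod.swap
    (Measure.measurePreserving_swap (μ := (volume : Measure R3)) (ν := (volume : Measure R3))) a

/-- `shTerm k n = (k k̄)ⁿ k`; here `star k` is the complex conjugate kernel. -/
def shTerm (k : Kernel) : ℕ → Kernel
  | 0 => k
  | n + 1 => comp (comp k (star k)) (shTerm k n)

/-- `chTerm k n = (k k̄)ⁿ⁺¹`. -/
def chTerm (k : Kernel) : ℕ → Kernel
  | 0 => comp k (star k)
  | n + 1 => comp (comp k (star k)) (chTerm k n)

/-- `sh(k) = k + k k̄ k / 3! + ⋯`, a series converging in `L²`. -/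
def sh (k : Kernel) : Kernel := ∑' n : ℕ, ((Nat.factorial (2 * n + 1) : ℂ)⁻¹) • shTerm k n

/-- `p(k) = ch(k) - 1 = k k̄ / 2! + ⋯`, a series converging in `L²`. -/
def pch (k : Kernel) : Kernel := ∑' n : ℕ, ((Nat.factorial (2 * n + 2) : ℂ)⁻¹) • chTerm k n

/-- `1 + ρ` is the operator inverse of `1 + p`, with `ρ` a Hilbert–Schmidt kernel. -/
def IsInverseKernel (p ρ : Kernel) : Prop :=
  p + ρ + comp p ρ = 0 ∧ p + ρ + comp ρ p = 0

/-! ### The evolution equation for the pair excitation kernel -/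

/-- `m(x, y) = -v(x - y) f̄(x) f̄(y)`. -/
def mKernel (v : R3 → ℝ) (f : R3 → ℂ) (z : R3 × R3) : ℂ :=
  -((v (z.1 - z.2) : ℂ) * conj (f z.1) * conj (f z.2))

/-- `v(x - y) f(x) f̄(y)`, the integral kernel part of `g`. -/
def wKernel (v : R3 → ℝ) (f : R3 → ℂ) (z : R3 × R3) : ℂ :=
  (v (z.1 - z.2) : ℂ) * f z.1 * conj (f z.2)

/-- The pairing `∫∫ a(x) b(y) h(x, y) dx dy`. -/
def pairing (a b : R3 → ℂ) (h : Kernel) : ℂ :=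
  ∫ z : R3 × R3, a z.1 * b z.2 * h z

/-- `i ∂ₜh - Δₓh - ε Δ_y h = F` on `[0, T]` in the sense of (tempered) distributions in space,
integrated in time: the test functions are the products `a(x) b(y)` of Schwartz functions, whose
linear span is dense in the Schwartz space of `ℝ³ × ℝ³`. -/
def IsWeakSolution (ε : ℂ) (T : ℝ) (h F : ℝ → Kernel) : Prop :=
  ∀ a b : 𝓢(R3, ℂ), ∀ t ∈ Icc 0 T,
    Complex.I * (pairing a b (h t) - pairing a b (h 0)) =
      ∫ s in (0 : ℝ)..t,
        (pairing (Laplacian.laplacian (a : R3 → ℂ)) b (h s)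
          + ε * pairing a (Laplacian.laplacian (b : R3 → ℂ)) (h s)
          + pairing a b (F s))

/-- The kernel `g u + u gᵀ` without the Laplacians, where
`g(x, y) = -Δₓ δ(x - y) + v(x - y) f(x) f̄(y) + (v * |f|²)(x) δ(x - y)`. -/
def lowerS (v : R3 → ℝ) (f : R3 → ℂ) (u : R3 × R3 → ℂ) (z : R3 × R3) : ℂ :=
  kcomp (wKernel v f) u z + kcomp u (fun q => wKernel v f q.swap) z
    + (meanField v f z.1 + meanField v f z.2 : ℂ) * u z

/-- The kernel `[g, p]` without the Laplacians. -/
def lowerW (v : R3 → ℝ) (f : R3 → ℂ) (p : R3 × R3 → ℂ) (z : R3 × R3) : ℂ :=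
  kcomp (wKernel v f) p z - kcomp p (wKernel v f) z
    + (meanField v f z.1 - meanField v f z.2 : ℂ) * p z

/-- The symmetric kernel `k ∈ C([0, T]; L²(ℝ³ × ℝ³))` solves, with `u = sh(k)` and `1 + p = ch(k)`,
`i uₜ + u gᵀ + g u - (1 + p) m = (i pₜ + [g, p] + u m̄) (1 + p)⁻¹ u` on `[0, T]`.
Here `F = (i ∂ₜ - Δₓ - Δ_y) u` and `G = (i ∂ₜ - Δₓ + Δ_y) p` are the distributional expressions,
which lie in `L¹([0, T]; L²)`, and the equation is an identity of kernels for almost every time. -/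
def IsPairSolution (v : R3 → ℝ) (φ : ℝ → R3 → ℂ) (T : ℝ) (k : ℝ → Kernel) : Prop :=
  ContinuousOn k (Icc 0 T) ∧ (∀ t ∈ Icc 0 T, transpose (k t) = k t) ∧
  ∃ F G : ℝ → Kernel,
    IntegrableOn F (Icc 0 T) ∧ IntegrableOn G (Icc 0 T) ∧
    IsWeakSolution 1 T (fun t => sh (k t)) F ∧
    IsWeakSolution (-1) T (fun t => pch (k t)) G ∧
    ∀ᵐ t ∂(volume.restrict (Icc 0 T)), ∃ ρ : Kernel, IsInverseKernel (pch (k t)) ρ ∧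
      let u : R3 × R3 → ℂ := sh (k t)
      let p : R3 × R3 → ℂ := pch (k t)
      let m : R3 × R3 → ℂ := mKernel v (φ t)
      let S : R3 × R3 → ℂ := F t + lowerS v (φ t) u
      let W : R3 × R3 → ℂ := G t + lowerW v (φ t) p
      let Y : R3 × R3 → ℂ := W + kcomp u (fun z => conj (m z))
      S - (m + kcomp p m) =ᵐ[volume] kcomp (Y + kcomp Y ρ) u

end PairExcitation

end

open MeasureTheory Set
open scoped ENNReal NNReal ContDiff SchwartzMap ComplexConjugate InnerProductSpace FourierTransform

noncomputable section

namespace PairExcitation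

/-! ### The algebra of Hilbert–Schmidt kernels -/

/-! Write `u = sh(k)`, `1 + p = ch(k)`, and collect the terms of the equation as `S = i uₜ + g u + u
gᵀ` and `W = i pₜ + [g, p]`, so that it reads `S = (1 + p) m + (W + u m̄)(1 + p)⁻¹ u`. Since `g` is
self-adjoint, `d/dt ‖u‖² = 2 Im ⟨u, S⟩`, and a bound for `S` that is linear in `‖u‖` with a
time-integrable coefficient suffices for Grönwall.

The bound for `S` comes from the hyperbolic identity `(1 + p)² = 1 + u ū` (`pch_mul_pch`).
Differentiating it gives `W (1 + p) + (1 + p) W = S ū - u S̄`. Multiplying the equation by `ū` and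
subtracting the adjoint then cancels everything except `Y (1 + p)⁻¹ = (1 + p)⁻¹ Y*` with `Y = W + u
m̄`. This is a Sylvester equation `(1 + p) W + W (1 + p) = m ū (1 + p) - (1 + p) u m̄`. Because `p ≥
0`, its solution satisfies `‖W‖ ≤ 2 ‖m‖ ‖u‖` (`norm_le_of_sylvester`), however large `p` is.
Moreover `(1 + p)⁻¹ u` is a contraction and `‖(1 + p) m‖ ≤ ‖m‖ (1 + ‖u‖)`, so `‖S‖ ≤ ‖m‖ (1 + 4
‖u‖)` (`norm_source_le`). The equations hold only weakly in time; conjugating by the free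
Schrödinger group (`evo`, `IsWeakSolution.duhamel`) turns `u` and `p` into primitives of integrable
`L²`-valued functions, where the product rule `bilinear_primitive` is available.

It remains to see that `‖m(t)‖` is integrable in time. By Cauchy–Schwarz `‖m‖² ≤ ∫ v² ∫ |φ|⁴`, so
the decay `∫ |φ|⁴ = O(t⁻³)` is needed. It follows from the pseudoconformal energy `E(t) = ∑ⱼ ∫
|(xⱼ/2 + i t ∂ⱼ) φ|² + t² I / 2` with `I = ∫ (v * |φ|²) |φ|²`. Multiplying `φ` by `exp(-i|x|²/4t)`
turns the first term into `t²` times a Dirichlet integral, so Sobolev and mass conservation give `∫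
|φ|⁴ ≤ c E^{3/2} / t³`. Since `r v(r)` is nonincreasing, a virial inequality (`virial_le`) yields
`E' ≤ t I / 2` in integrated form. A first Grönwall argument gives `E ≤ E(1) t`. As `v` is
integrable, `I ≤ ‖v‖₁ ∫ |φ|⁴`, and inserting the first bound makes `t I / 2 ≤ a t^{-3/2} E`; a
second Grönwall argument shows that `E` is bounded (`exists_pcEnergy_le`). Finiteness of `E` for `t
> 1` is itself propagated from `t = 1` with spatial cut-offs. -/

/-- The one-particle space `L²(ℝ³)`. -/
abbrev L2 : Type := Lp ℂ 2 (volume : Measure R3)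

theorem ae_fst {P : R3 → Prop} (h : ∀ᵐ x, P x) : ∀ᵐ z : R3 × R3, P z.1 :=
  Measure.quasiMeasurePreserving_fst.ae h

theorem ae_snd {P : R3 → Prop} (h : ∀ᵐ x, P x) : ∀ᵐ z : R3 × R3, P z.2 :=
  Measure.quasiMeasurePreserving_snd.ae h

theorem ae_swap {P : R3 × R3 → Prop} (h : ∀ᵐ z, P z) : ∀ᵐ z : R3 × R3, P z.swap :=
  (Measure.measurePreserving_swap (μ := (volume : Measure R3))
    (ν := (volume : Measure R3))).quasiMeasurePreserving.ae h

theorem ae_slice_fst {P : R3 × R3 → Prop} (h : ∀ᵐ z, P z) :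
    ∀ᵐ z : R3 × R3, ∀ᵐ w, P (z.1, w) :=
  ae_fst (Measure.ae_ae_of_ae_prod h)

theorem ae_slice_snd {P : R3 × R3 → Prop} (h : ∀ᵐ z, P z) :
    ∀ᵐ z : R3 × R3, ∀ᵐ w, P (w, z.2) :=
  ae_snd (Measure.ae_ae_of_ae_prod (ae_swap h))

theorem kcomp_congr_ae {a a' b b' : R3 × R3 → ℂ} (ha : a =ᵐ[volume] a') (hb : b =ᵐ[volume] b') :
    kcomp a b =ᵐ[volume] kcomp a' b' := by
  filter_upwards [ae_slice_fst ha, ae_slice_snd hb] with z h1 h2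
  refine integral_congr_ae ?_
  filter_upwards [h1, h2] with w h3 h4
  rw [h3, h4]

theorem memLp_two_slice {a : R3 × R3 → ℂ} (ha : MemLp a 2) :
    ∀ᵐ x, MemLp (fun w => a (x, w)) 2 := by
  have h1 := (memLp_two_iff_integrable_sq_norm ha.1).1 ha
  filter_upwards [h1.prod_right_ae, ha.1.prodMk_left] with x h2 h3
  exact (memLp_two_iff_integrable_sq_norm h3).2 h2

theorem memLp_two_swap {a : R3 × R3 → ℂ} (ha : MemLp a 2) :
    MemLp (fun z : R3 × R3 => a z.swap) 2 :=
  ha.comp_measurePreserving (Measure.measurePreserving_swap (μ := (volume : Measure R3))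
    (ν := (volume : Measure R3)))

theorem integrable_kcomp {a b : R3 × R3 → ℂ} (ha : MemLp a 2) (hb : MemLp b 2) :
    ∀ᵐ z : R3 × R3, Integrable (fun w => a (z.1, w) * b (w, z.2)) := by
  filter_upwards [ae_fst (memLp_two_slice ha), ae_snd (memLp_two_slice (memLp_two_swap hb))]
    with z h1 h2
  exact h1.integrable_mul h2

theorem coeFn_comp (a b : Kernel) : comp a b =ᵐ[volume] kcomp a b :=
  MemLp.coeFn_toLp _

theorem coeFn_transpose (a : Kernel) : transpose a =ᵐ[volume] fun z => a z.swap :=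
  Lp.coeFn_compMeasurePreserving _ _

theorem comp_add (a b c : Kernel) : comp a (b + c) = comp a b + comp a c := by
  refine Lp.ext ?_
  have e := kcomp_congr_ae (Filter.EventuallyEq.rfl (f := a)) (Lp.coeFn_add b c)
  filter_upwards [coeFn_comp a (b + c), coeFn_comp a b, coeFn_comp a c,
    Lp.coeFn_add (comp a b) (comp a c), e, integrable_kcomp (Lp.memLp a) (Lp.memLp b),
    integrable_kcomp (Lp.memLp a) (Lp.memLp c)] with z h1 h2 h3 h4 h5 h6 h7
  rw [h1, h4, Pi.add_apply, h2, h3, h5]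
  simp only [kcomp, Pi.add_apply, mul_add]
  exact integral_add h6 h7

theorem add_comp (a b c : Kernel) : comp (a + b) c = comp a c + comp b c := by
  refine Lp.ext ?_
  have e := kcomp_congr_ae (Lp.coeFn_add a b) (Filter.EventuallyEq.rfl (f := c))
  filter_upwards [coeFn_comp (a + b) c, coeFn_comp a c, coeFn_comp b c,
    Lp.coeFn_add (comp a c) (comp b c), e, integrable_kcomp (Lp.memLp a) (Lp.memLp c),
    integrable_kcomp (Lp.memLp b) (Lp.memLp c)] with z h1 h2 h3 h4 h5 h6 h7
  rw [h1, h4, Pi.add_apply, h2, h3, h5]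
  simp only [kcomp, Pi.add_apply, add_mul]
  exact integral_add h6 h7

theorem comp_smul (r : ℂ) (a b : Kernel) : comp a (r • b) = r • comp a b := by
  refine Lp.ext ?_
  have e := kcomp_congr_ae (Filter.EventuallyEq.rfl (f := a)) (Lp.coeFn_smul r b)
  filter_upwards [coeFn_comp a (r • b), coeFn_comp a b, Lp.coeFn_smul r (comp a b), e]
    with z h1 h2 h4 h5
  rw [h1, h4, Pi.smul_apply, h2, h5]
  simp only [kcomp, Pi.smul_apply, smul_eq_mul, ← integral_const_mul]
  congr 1; ext w; ring

theorem smul_comp (r : ℂ) (a b : Kernel) : comp (r • a) b = r • comp a b := by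
  refine Lp.ext ?_
  have e := kcomp_congr_ae (Lp.coeFn_smul r a) (Filter.EventuallyEq.rfl (f := b))
  filter_upwards [coeFn_comp (r • a) b, coeFn_comp a b, Lp.coeFn_smul r (comp a b), e]
    with z h1 h2 h4 h5
  rw [h1, h4, Pi.smul_apply, h2, h5]
  simp only [kcomp, Pi.smul_apply, smul_eq_mul, ← integral_const_mul]
  congr 1; ext w; ring

theorem enorm_sq_eq_lintegral {α : Type*} [MeasurableSpace α] {μ : Measure α} (f : Lp ℂ 2 μ) :
    ‖f‖ₑ ^ 2 = ∫⁻ z, ‖f z‖ₑ ^ 2 ∂μ := by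
  rw [Lp.enorm_def, eLpNorm_eq_lintegral_rpow_enorm_toReal (by simp) (by simp)]
  simp only [ENNReal.toReal_ofNat, ENNReal.rpow_ofNat, one_div]
  rw [← ENNReal.rpow_ofNat, ← ENNReal.rpow_mul]
  norm_num

theorem norm_comp_le (a b : Kernel) : ‖comp a b‖ ≤ ‖a‖ * ‖b‖ := by
  have ha := Lp.stronglyMeasurable a
  have hb := Lp.stronglyMeasurable b
  have hae : Measurable (fun q : R3 × R3 => ‖a q‖ₑ ^ 2) := ha.enorm.pow_const _
  have hbe : Measurable (fun q : R3 × R3 => ‖b q‖ₑ ^ 2) := hb.enorm.pow_const _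
  have bound : ∀ z : R3 × R3, ‖kcomp a b z‖ₑ ^ 2 ≤
      (∫⁻ w, ‖a (z.1, w)‖ₑ ^ 2) * ∫⁻ w, ‖b (w, z.2)‖ₑ ^ 2 := by
    intro z
    have h1 : ‖kcomp a b z‖ₑ ≤ ∫⁻ w, ‖a (z.1, w)‖ₑ * ‖b (w, z.2)‖ₑ := by
      refine (enorm_integral_le_lintegral_enorm _).trans (le_of_eq ?_)
      simp [enorm_mul]
    have h2 := ENNReal.lintegral_mul_le_Lp_mul_Lq (volume : Measure R3)
      Real.HolderConjugate.two_two
      (f := fun w => ‖a (z.1, w)‖ₑ) (g := fun w => ‖b (w, z.2)‖ₑ)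
      (ha.enorm.comp (by fun_prop : Measurable fun w : R3 => (z.1, w))).aemeasurable
      (hb.enorm.comp (by fun_prop : Measurable fun w : R3 => (w, z.2))).aemeasurable
    have h3 := ENNReal.rpow_le_rpow (h1.trans h2) (by norm_num : (0 : ℝ) ≤ 2)
    rw [ENNReal.mul_rpow_of_nonneg _ _ (by norm_num), ← ENNReal.rpow_mul, ← ENNReal.rpow_mul] at h3
    simpa using h3
  have key : ‖comp a b‖ₑ ^ 2 ≤ (‖a‖ₑ * ‖b‖ₑ) ^ 2 := by
    rw [mul_pow, enorm_sq_eq_lintegral, enorm_sq_eq_lintegral, enorm_sq_eq_lintegral]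
    have e0 : ∫⁻ z, ‖comp a b z‖ₑ ^ 2 = ∫⁻ z, ‖kcomp a b z‖ₑ ^ 2 := by
      refine lintegral_congr_ae ?_
      filter_upwards [coeFn_comp a b] with z hz
      rw [hz]
    rw [e0]
    refine (lintegral_mono bound).trans (le_of_eq ?_)
    have e1 := lintegral_prod_mul (μ := (volume : Measure R3)) (ν := (volume : Measure R3))
      (f := fun x => ∫⁻ w, ‖a (x, w)‖ₑ ^ 2) (g := fun y => ∫⁻ w, ‖b (w, y)‖ₑ ^ 2)
      hae.lintegral_prod_right'.aemeasurable hbe.lintegral_prod_left'.aemeasurable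
    have e2 := lintegral_prod (μ := (volume : Measure R3)) (ν := (volume : Measure R3))
      _ hae.aemeasurable
    have e3 := lintegral_prod_symm (μ := (volume : Measure R3)) (ν := (volume : Measure R3))
      _ hbe.aemeasurable
    rw [← e2, ← e3] at e1
    exact e1
  have h4 := (ENNReal.pow_le_pow_left_iff (n := 2) (by norm_num)).1 key
  rw [← enorm_norm (comp a b), ← enorm_norm a, ← enorm_norm b, ← enorm_mul] at h4
  simpa using (enorm_le_iff_norm_le.1 h4)

/-- Composition as a continuous bilinear map. -/
def compL : Kernel →L[ℂ] Kernel →L[ℂ] Kernel :=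
  LinearMap.mkContinuous₂ (LinearMap.mk₂ ℂ comp add_comp (fun r a b => smul_comp r a b)
    comp_add (fun r a b => comp_smul r a b)) 1 (fun a b => by
      simpa using norm_comp_le a b)

theorem compL_apply (a b : Kernel) : compL a b = comp a b := rfl

/-! #### Elementary tensors -/

theorem memLp_tensor (f g : L2) : MemLp (fun z : R3 × R3 => f z.1 * g z.2) 2 := by
  have h1 := (memLp_two_iff_integrable_sq_norm (Lp.aestronglyMeasurable f)).1 (Lp.memLp f)
  have h2 := (memLp_two_iff_integrable_sq_norm (Lp.aestronglyMeasurable g)).1 (Lp.memLp g)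
  have hm : AEStronglyMeasurable (fun z : R3 × R3 => f z.1 * g z.2) volume :=
    ((Lp.stronglyMeasurable f).comp_measurable measurable_fst).aestronglyMeasurable.mul
      ((Lp.stronglyMeasurable g).comp_measurable measurable_snd).aestronglyMeasurable
  rw [memLp_two_iff_integrable_sq_norm hm]
  have h3 := h1.mul_prod h2
  rw [← Measure.volume_eq_prod] at h3
  simpa [mul_pow] using h3

/-- The kernel `f(x) g(y)`. -/
def tensor (f g : L2) : Kernel := (memLp_tensor f g).toLp

theorem coeFn_tensor (f g : L2) : tensor f g =ᵐ[volume] fun z => f z.1 * g z.2 :=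
  MemLp.coeFn_toLp _

theorem inner_tensor (f g f' g' : L2) :
    ⟪tensor f g, tensor f' g'⟫_ℂ = ⟪f, f'⟫_ℂ * ⟪g, g'⟫_ℂ := by
  rw [L2.inner_def, L2.inner_def, L2.inner_def]
  have := integral_prod_mul (μ := (volume : Measure R3)) (ν := (volume : Measure R3))
    (fun x => ⟪f x, f' x⟫_ℂ) (fun y => ⟪g y, g' y⟫_ℂ)
  rw [← this]
  refine integral_congr_ae ?_
  filter_upwards [coeFn_tensor f g, coeFn_tensor f' g'] with z h1 h2
  rw [h1, h2]
  simp only [RCLike.inner_apply, map_mul]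
  ring

theorem norm_tensor (f g : L2) : ‖tensor f g‖ = ‖f‖ * ‖g‖ := by
  have h := inner_tensor f g f g
  simp only [inner_self_eq_norm_sq_to_K] at h
  have h2 : ‖tensor f g‖ ^ 2 = (‖f‖ * ‖g‖) ^ 2 := by
    rw [mul_pow]; exact_mod_cast h
  exact (pow_left_inj₀ (norm_nonneg _) (by positivity) (by norm_num)).1 h2

theorem tensor_add (f g g' : L2) : tensor f (g + g') = tensor f g + tensor f g' := by
  refine Lp.ext ?_
  filter_upwards [coeFn_tensor f (g + g'), coeFn_tensor f g, coeFn_tensor f g',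
    Lp.coeFn_add (tensor f g) (tensor f g'), ae_snd (Lp.coeFn_add g g')] with z h1 h2 h3 h4 h5
  rw [h1, h4, Pi.add_apply, h2, h3, h5, Pi.add_apply, mul_add]

theorem add_tensor (f f' g : L2) : tensor (f + f') g = tensor f g + tensor f' g := by
  refine Lp.ext ?_
  filter_upwards [coeFn_tensor (f + f') g, coeFn_tensor f g, coeFn_tensor f' g,
    Lp.coeFn_add (tensor f g) (tensor f' g), ae_fst (Lp.coeFn_add f f')] with z h1 h2 h3 h4 h5
  rw [h1, h4, Pi.add_apply, h2, h3, h5, Pi.add_apply, add_mul]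

theorem tensor_smul (r : ℂ) (f g : L2) : tensor f (r • g) = r • tensor f g := by
  refine Lp.ext ?_
  filter_upwards [coeFn_tensor f (r • g), coeFn_tensor f g,
    Lp.coeFn_smul r (tensor f g), ae_snd (Lp.coeFn_smul r g)] with z h1 h2 h4 h5
  rw [h1, h4, Pi.smul_apply, h2, h5, Pi.smul_apply, smul_eq_mul, smul_eq_mul]; ring

theorem smul_tensor (r : ℂ) (f g : L2) : tensor (r • f) g = r • tensor f g := by
  refine Lp.ext ?_
  filter_upwards [coeFn_tensor (r • f) g, coeFn_tensor f g,
    Lp.coeFn_smul r (tensor f g), ae_fst (Lp.coeFn_smul r f)] with z h1 h2 h4 h5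
  rw [h1, h4, Pi.smul_apply, h2, h5, Pi.smul_apply, smul_eq_mul, smul_eq_mul]; ring

/-- The elementary tensor as a continuous bilinear map. -/
def tensorL : L2 →L[ℂ] L2 →L[ℂ] Kernel :=
  LinearMap.mkContinuous₂ (LinearMap.mk₂ ℂ tensor add_tensor (fun r a b => smul_tensor r a b)
    tensor_add (fun r a b => tensor_smul r a b)) 1 (fun a b => by
      simpa using (norm_tensor a b).le)

theorem tensorL_apply (f g : L2) : tensorL f g = tensor f g := rfl

/-- Tensors of indicators test `h` on rectangles of finite measure. Rectangles are a π-system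
generating the product σ-algebra, so `h` has zero integral over every measurable subset of a bounded
box. The boxes make `h`, which is only square integrable, integrable, and they exhaust the space. -/
theorem eq_zero_of_inner_tensor (h : Kernel) (H : ∀ f g, ⟪tensor f g, h⟫_ℂ = 0) : h = 0 := by
  have rect : ∀ s t : Set R3, MeasurableSet s → MeasurableSet t → volume s ≠ ⊤ → volume t ≠ ⊤ →
      ∫ z in s ×ˢ t, h z = 0 := by
    intro s t hs ht hs' ht'
    have h0 := H (indicatorConstLp 2 hs hs' 1) (indicatorConstLp 2 ht ht' 1)
    rw [L2.inner_def] at h0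
    rw [← h0, ← integral_indicator (hs.prod ht)]
    refine integral_congr_ae ?_
    filter_upwards [coeFn_tensor (indicatorConstLp 2 hs hs' 1) (indicatorConstLp 2 ht ht' 1),
      ae_fst (indicatorConstLp_coeFn (p := 2) (hs := hs) (hμs := hs') (c := (1 : ℂ))),
      ae_snd (indicatorConstLp_coeFn (p := 2) (hs := ht) (hμs := ht') (c := (1 : ℂ)))]
      with z h1 h2 h3
    rw [h1, h2, h3]
    by_cases hz1 : z.1 ∈ s <;> by_cases hz2 : z.2 ∈ t <;>
      simp [indicator, hz1, hz2]
  have loc : ∀ N : ℕ, ∀ᵐ z ∂(volume.restrict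
      (Metric.ball (0 : R3) N ×ˢ Metric.ball (0 : R3) N)), h z = 0 := by
    intro N
    set B := Metric.ball (0 : R3) N with hB
    have hBm : MeasurableSet B := Metric.isOpen_ball.measurableSet
    have hBf : volume B ≠ ⊤ := measure_ball_lt_top.ne
    have hBB : volume (B ×ˢ B) ≠ ⊤ := by
      rw [Measure.volume_eq_prod, Measure.prod_prod]; exact ENNReal.mul_ne_top hBf hBf
    have : IsFiniteMeasure (volume.restrict (B ×ˢ B)) := ⟨by simpa using hBB.lt_top⟩
    have hint : Integrable h (volume.restrict (B ×ˢ B)) :=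
      ((Lp.memLp h).restrict _).integrable (by norm_num)
    refine hint.ae_eq_zero_of_forall_setIntegral_eq_zero ?_
    intro s hs _
    refine MeasurableSpace.induction_on_inter
      (C := fun s _ => ∫ z in s, h z ∂(volume.restrict (B ×ˢ B)) = 0)
      generateFrom_prod.symm isPiSystem_prod (by simp) ?_ ?_ ?_ s hs
    · rintro _ ⟨s, hs, t, ht, rfl⟩
      replace hs : MeasurableSet s := hs
      replace ht : MeasurableSet t := ht
      rw [Measure.restrict_restrict (MeasurableSet.prod hs ht), prod_inter_prod]
      exact rect _ _ (hs.inter hBm) (ht.inter hBm)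
        (measure_ne_top_of_subset inter_subset_right hBf)
        (measure_ne_top_of_subset inter_subset_right hBf)
    · intro t ht h0
      rw [setIntegral_compl ht hint, h0, rect B B hBm hBm hBf hBf, sub_zero]
    · intro f hd hm h0
      rw [integral_iUnion hm hd hint.integrableOn]
      simp [h0]
  have hU : (⋃ N : ℕ, Metric.ball (0 : R3) N ×ˢ Metric.ball (0 : R3) N) = univ := by
    refine eq_univ_of_forall fun z => ?_
    obtain ⟨N, hN⟩ := exists_nat_gt (max ‖z.1‖ ‖z.2‖)
    refine mem_iUnion.2 ⟨N, ?_⟩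
    simp only [mem_prod, mem_ball_zero_iff]
    exact max_lt_iff.1 hN
  have hall := (ae_restrict_iUnion_iff _ _).2 loc
  rw [hU, Measure.restrict_univ] at hall
  refine Lp.ext ?_
  filter_upwards [hall, Lp.coeFn_zero ℂ 2 (volume : Measure (R3 × R3))] with z h1 h2
  rw [h1, h2, Pi.zero_apply]

theorem topologicalClosure_span_tensor :
    (Submodule.span ℂ (range fun q : L2 × L2 => tensor q.1 q.2)).topologicalClosure = ⊤ := by
  rw [Submodule.topologicalClosure_eq_top_iff, Submodule.eq_bot_iff]
  intro h hh
  refine eq_zero_of_inner_tensor h fun f g => ?_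
  exact (Submodule.mem_orthogonal _ _).1 hh _ (Submodule.subset_span ⟨(f, g), rfl⟩)

/-- A closed additive property of kernels that holds on elementary tensors holds everywhere. -/
theorem tensor_induction {P : Kernel → Prop} (hc : IsClosed {a | P a})
    (ht : ∀ f g, P (tensor f g)) (ha : ∀ a b, P a → P b → P (a + b)) (a : Kernel) : P a := by
  have h1 : ∀ a ∈ Submodule.span ℂ (range fun q : L2 × L2 => tensor q.1 q.2),
      ∀ r : ℂ, P (r • a) := by
    intro a hm
    induction hm using Submodule.span_induction with
    | mem x hx => obtain ⟨q, rfl⟩ := hx; intro r; rw [← smul_tensor]; exact ht _ _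
    | zero =>
      have h0 : tensor 0 0 = 0 := by simp [← tensorL_apply]
      intro r; rw [smul_zero, ← h0]; exact ht 0 0
    | add x y _ _ hx hy => intro r; rw [smul_add]; exact ha _ _ (hx r) (hy r)
    | smul s x _ hx => intro r; rw [smul_smul]; exact hx _
  have h2 : (a : Kernel) ∈ closure
      (Submodule.span ℂ (range fun q : L2 × L2 => tensor q.1 q.2) : Set Kernel) := by
    rw [← Submodule.topologicalClosure_coe, topologicalClosure_span_tensor]; trivial
  exact closure_minimal (fun x hx => by simpa using h1 x hx 1) hc h2

/-! #### Conjugation, transposition and adjoints -/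

section Star

variable {α : Type*} [MeasurableSpace α] {μ : Measure α}

theorem star_add_Lp (a b : Lp ℂ 2 μ) : star (a + b) = star a + star b := by
  refine Lp.ext ?_
  filter_upwards [Lp.coeFn_star (a + b), Lp.coeFn_add a b, Lp.coeFn_add (star a) (star b),
    Lp.coeFn_star a, Lp.coeFn_star b] with z h1 h2 h3 h4 h5
  rw [h1, h3, Pi.add_apply, h4, h5, Pi.star_apply, h2, Pi.add_apply, star_add, Pi.star_apply,
    Pi.star_apply]

theorem star_smul_Lp (r : ℂ) (a : Lp ℂ 2 μ) : star (r • a) = conj r • star a := by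
  refine Lp.ext ?_
  filter_upwards [Lp.coeFn_star (r • a), Lp.coeFn_smul r a, Lp.coeFn_smul (conj r) (star a),
    Lp.coeFn_star a] with z h1 h2 h3 h4
  rw [h1, h3, Pi.smul_apply, h4, Pi.star_apply, h2, Pi.smul_apply, star_smul, Pi.star_apply]
  rfl

theorem norm_star_Lp (a : Lp ℂ 2 μ) : ‖star a‖ = ‖a‖ := by
  rw [Lp.norm_def, Lp.norm_def]
  congr 1
  refine eLpNorm_congr_norm_ae ?_
  filter_upwards [Lp.coeFn_star a] with z h1
  rw [h1, Pi.star_apply, norm_star]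

/-- Complex conjugation as a conjugate-linear isometry. -/
def starL : Lp ℂ 2 μ →ₗᵢ⋆[ℂ] Lp ℂ 2 μ where
  toFun := star
  map_add' := star_add_Lp
  map_smul' := star_smul_Lp
  norm_map' := norm_star_Lp

theorem starL_apply (a : Lp ℂ 2 μ) : starL a = star a := rfl

theorem inner_star_star (a b : Lp ℂ 2 μ) : ⟪star a, star b⟫_ℂ = ⟪b, a⟫_ℂ := by
  rw [L2.inner_def, L2.inner_def]
  refine integral_congr_ae ?_
  filter_upwards [Lp.coeFn_star a, Lp.coeFn_star b] with z h1 h2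
  rw [h1, h2]
  simp [RCLike.inner_apply, mul_comm]

theorem continuous_star_Lp : Continuous (star : Lp ℂ 2 μ → Lp ℂ 2 μ) := starL.continuous

end Star

/-- Transposition as a linear isometry. -/
def transposeL : Kernel →ₗᵢ[ℂ] Kernel :=
  Lp.compMeasurePreservingₗᵢ ℂ Prod.swap
    (Measure.measurePreserving_swap (μ := (volume : Measure R3)) (ν := (volume : Measure R3)))

theorem transposeL_apply (a : Kernel) : transposeL a = transpose a := rfl

theorem continuous_transpose : Continuous transpose := transposeL.continuous

theorem transpose_transpose (a : Kernel) : transpose (transpose a) = a := by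
  refine Lp.ext ?_
  filter_upwards [coeFn_transpose (transpose a), ae_swap (coeFn_transpose a)] with z h1 h2
  rw [h1, h2, Prod.swap_swap]

theorem transpose_star (a : Kernel) : transpose (star a) = star (transpose a) := by
  refine Lp.ext ?_
  filter_upwards [coeFn_transpose (star a), ae_swap (Lp.coeFn_star a),
    Lp.coeFn_star (transpose a), coeFn_transpose a] with z h1 h2 h3 h4
  rw [h1, h2, h3, Pi.star_apply, Pi.star_apply, h4]

/-- The adjoint kernel `conj (a(y, x))`. -/
def adj (a : Kernel) : Kernel := transpose (star a)

theorem continuous_adj : Continuous adj := continuous_transpose.comp continuous_star_Lp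

theorem adj_adj (a : Kernel) : adj (adj a) = a := by
  simp only [adj, ← transpose_star, star_star, transpose_transpose]

theorem adj_add (a b : Kernel) : adj (a + b) = adj a + adj b := by
  simp only [adj, star_add_Lp, ← transposeL_apply, map_add]

theorem adj_smul (r : ℂ) (a : Kernel) : adj (r • a) = conj r • adj a := by
  simp only [adj, star_smul_Lp, ← transposeL_apply, map_smul]

theorem inner_adj_adj (a b : Kernel) : ⟪adj a, adj b⟫_ℂ = ⟪b, a⟫_ℂ := by
  rw [adj, adj, ← transposeL_apply, ← transposeL_apply, transposeL.inner_map_map,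
    inner_star_star]

theorem star_tensor (f g : L2) : star (tensor f g) = tensor (star f) (star g) := by
  refine Lp.ext ?_
  filter_upwards [Lp.coeFn_star (tensor f g), coeFn_tensor f g, coeFn_tensor (star f) (star g),
    ae_fst (Lp.coeFn_star f), ae_snd (Lp.coeFn_star g)] with z h1 h2 h3 h4 h5
  rw [h1, h3, Pi.star_apply, h2, h4, h5, Pi.star_apply, Pi.star_apply, star_mul']

theorem transpose_tensor (f g : L2) : transpose (tensor f g) = tensor g f := by
  refine Lp.ext ?_
  filter_upwards [coeFn_transpose (tensor f g), ae_swap (coeFn_tensor f g), coeFn_tensor g f]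
    with z h1 h2 h3
  rw [h1, h3, h2, mul_comm]; rfl

theorem adj_tensor (f g : L2) : adj (tensor f g) = tensor (star g) (star f) := by
  rw [adj, star_tensor, transpose_tensor]

theorem comp_tensor (f g f' g' : L2) :
    comp (tensor f g) (tensor f' g') = ⟪star g, f'⟫_ℂ • tensor f g' := by
  refine Lp.ext ?_
  have e := kcomp_congr_ae (coeFn_tensor f g) (coeFn_tensor f' g')
  filter_upwards [coeFn_comp (tensor f g) (tensor f' g'), e, coeFn_tensor f g',
    Lp.coeFn_smul ⟪star g, f'⟫_ℂ (tensor f g')] with z h1 h2 h3 h4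
  rw [h1, h2, h4, Pi.smul_apply, h3, kcomp, L2.inner_def, smul_eq_mul, mul_comm,
    ← integral_const_mul]
  refine integral_congr_ae ?_
  filter_upwards [Lp.coeFn_star g] with w hw
  rw [hw]
  simp only [RCLike.inner_apply, Pi.star_apply, RCLike.star_def, Complex.conj_conj]
  ring

/-- Both sides are continuous and additive in each kernel, so elementary tensors suffice, where
composition is a scalar product. The other algebraic identities for kernels are reduced in the same
way, which avoids Fubini for iterated kernels. -/
theorem comp_assoc (a b c : Kernel) : comp (comp a b) c = comp a (comp b c) := by
  induction a using tensor_induction with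
  | hc => simp only [← compL_apply]; exact isClosed_eq (by fun_prop) (by fun_prop)
  | ha a a' h h' => simp only [add_comp, h, h']
  | ht f g =>
    induction b using tensor_induction with
    | hc => simp only [← compL_apply]; exact isClosed_eq (by fun_prop) (by fun_prop)
    | ha a a' h h' => simp only [add_comp, comp_add, h, h']
    | ht f' g' =>
      induction c using tensor_induction with
      | hc => simp only [← compL_apply]; exact isClosed_eq (by fun_prop) (by fun_prop)
      | ha a a' h h' => simp only [comp_add, h, h']
      | ht f'' g'' =>
        simp only [comp_tensor, smul_comp, comp_smul, smul_smul]
        rw [mul_comm]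

theorem continuous_comp_right (a : Kernel) : Continuous fun b => comp a b := (compL a).continuous

theorem continuous_comp_left (b : Kernel) : Continuous fun a => comp a b :=
  (compL.flip b).continuous

theorem transpose_comp (a b : Kernel) : transpose (comp a b) = comp (transpose b) (transpose a) := by
  induction a using tensor_induction with
  | hc =>
    exact isClosed_eq (continuous_transpose.comp (continuous_comp_left b))
      ((continuous_comp_right _).comp continuous_transpose)
  | ha a a' h h' =>
    simp only [← transposeL_apply, map_add, add_comp, comp_add] at h h' ⊢; rw [h, h']
  | ht f g =>
    induction b using tensor_induction with
    | hc =>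
      exact isClosed_eq (continuous_transpose.comp (continuous_comp_right _))
        ((continuous_comp_left _).comp continuous_transpose)
    | ha a a' h h' =>
      simp only [← transposeL_apply, map_add, add_comp, comp_add] at h h' ⊢; rw [h, h']
    | ht f' g' =>
      rw [comp_tensor, ← transposeL_apply, map_smul, transposeL_apply]
      simp only [transpose_tensor, comp_tensor]
      congr 1
      rw [← inner_star_star, star_star]

theorem star_comp (a b : Kernel) : star (comp a b) = comp (star a) (star b) := by
  induction a using tensor_induction with
  | hc =>
    exact isClosed_eq (continuous_star_Lp.comp (continuous_comp_left b))
      ((continuous_comp_left _).comp continuous_star_Lp)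
  | ha a a' h h' => simp only [star_add_Lp, add_comp, h, h']
  | ht f g =>
    induction b using tensor_induction with
    | hc =>
      exact isClosed_eq (continuous_star_Lp.comp (continuous_comp_right _))
        ((continuous_comp_right _).comp continuous_star_Lp)
    | ha a a' h h' => simp only [star_add_Lp, comp_add, h, h']
    | ht f' g' =>
      rw [comp_tensor, star_smul_Lp]
      simp only [star_tensor, comp_tensor]
      congr 1
      rw [inner_conj_symm, ← inner_star_star, star_star]

theorem adj_comp (a b : Kernel) : adj (comp a b) = comp (adj b) (adj a) := by
  rw [adj, star_comp, transpose_comp]; rfl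

/-- With its companion for the right factor, this turns left and right composition into commuting
operators on the Hilbert space `Kernel` with explicit adjoints. All later positivity and norm
estimates take place there. -/
theorem inner_comp_left (a b c : Kernel) : ⟪comp a b, c⟫_ℂ = ⟪b, comp (adj a) c⟫_ℂ := by
  induction a using tensor_induction with
  | hc =>
    exact isClosed_eq (Continuous.inner (continuous_comp_left b) continuous_const)
      (Continuous.inner continuous_const ((continuous_comp_left c).comp continuous_adj))
  | ha a a' h h' => simp only [adj_add, add_comp, inner_add_left, inner_add_right, h, h']
  | ht f g =>
    induction b using tensor_induction with
    | hc =>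
      exact isClosed_eq (Continuous.inner (continuous_comp_right _) continuous_const)
        (Continuous.inner continuous_id continuous_const)
    | ha a a' h h' => simp only [comp_add, inner_add_left, h, h']
    | ht f' g' =>
      induction c using tensor_induction with
      | hc =>
        exact isClosed_eq (Continuous.inner continuous_const continuous_id)
          (Continuous.inner continuous_const (continuous_comp_right _))
      | ha a a' h h' => simp only [comp_add, inner_add_right, h, h']
      | ht f'' g'' =>
        simp only [adj_tensor, comp_tensor, inner_smul_left, inner_smul_right, inner_tensor,
          star_star, inner_conj_symm]
        ring

theorem inner_comp_right (a b c : Kernel) : ⟪comp a b, c⟫_ℂ = ⟪a, comp c (adj b)⟫_ℂ := by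
  rw [← inner_adj_adj, adj_comp, ← inner_adj_adj (comp c (adj b)), adj_comp, adj_adj,
    inner_comp_left]

/-- A substitute for evaluating at the missing unit kernel: up to the scalar `‖g‖²`, `f ⊗ g` equals
`(f ⊗ g)(ḡ ⊗ g)`, and the second factor can be moved onto `a`. -/
theorem eq_zero_of_forall_comp_eq_zero (a : Kernel) (h : ∀ x, comp a x = 0) : a = 0 := by
  refine eq_zero_of_inner_tensor a fun f g => ?_
  by_cases hg : g = 0
  · have : tensor f (0 : L2) = 0 := by simp [← tensorL_apply]
    rw [hg, this, inner_zero_left]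
  · have e : tensor f g = ((‖g‖ : ℂ) ^ 2)⁻¹ • comp (tensor f g) (tensor (star g) g) := by
      have : (‖g‖ : ℂ) ^ 2 ≠ 0 := by simpa using hg
      rw [comp_tensor, smul_smul, inner_self_eq_norm_sq_to_K, norm_star_Lp]
      rw [show ((‖g‖ : ℂ) ^ 2)⁻¹ * (RCLike.ofReal ‖g‖ : ℂ) ^ 2 = 1 from inv_mul_cancel₀ this,
        one_smul]
    rw [e, inner_smul_left, inner_comp_right, h, inner_zero_right, mul_zero]

/-! ### Kernels as a ring under composition. -/

instance : Mul Kernel := ⟨comp⟩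

theorem mul_def (a b : Kernel) : a * b = comp a b := rfl

/-- The product is composition, not the pointwise product. There is no unit, because the identity
operator is not Hilbert–Schmidt; hence every identity involving `1 + p` or `(1 + p)⁻¹ = 1 + ρ` below
is written in expanded form. -/
instance (priority := 50) : NonUnitalRing Kernel :=
  { (inferInstance : AddCommGroup Kernel) with
    mul := comp
    left_distrib := comp_add
    right_distrib := add_comp
    zero_mul := fun a => by change compL 0 a = 0; simp
    mul_zero := fun a => by change compL a 0 = 0; simp
    mul_assoc := comp_assoc }

/-! ### Hyperbolic functions of a kernel -/

theorem norm_mul_le_kernel (a b : Kernel) : ‖a * b‖ ≤ ‖a‖ * ‖b‖ := norm_comp_le a b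

theorem smul_mul_kernel (r : ℂ) (a b : Kernel) : (r • a) * b = r • (a * b) := smul_comp r a b

theorem mul_smul_kernel (r : ℂ) (a b : Kernel) : a * (r • b) = r • (a * b) := comp_smul r a b

theorem Continuous.kernel_mul {X : Type*} [TopologicalSpace X] {f g : X → Kernel}
    (hf : Continuous f) (hg : Continuous g) : Continuous fun x => f x * g x :=
  (compL.continuous.comp hf).clm_apply hg

theorem norm_mul_star_le (k : Kernel) : ‖k * star k‖ ≤ ‖k‖ ^ 2 := by
  refine (norm_mul_le_kernel _ _).trans (le_of_eq ?_)
  rw [norm_star_Lp]; ring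

theorem shTerm_succ (k : Kernel) (n : ℕ) : shTerm k (n + 1) = (k * star k) * shTerm k n := rfl

theorem chTerm_succ (k : Kernel) (n : ℕ) : chTerm k (n + 1) = (k * star k) * chTerm k n := rfl

theorem chTerm_zero (k : Kernel) : chTerm k 0 = k * star k := rfl

theorem norm_shTerm_le (k : Kernel) (n : ℕ) : ‖shTerm k n‖ ≤ ‖k‖ ^ (2 * n + 1) := by
  induction n with
  | zero => simp [shTerm]
  | succ n ih =>
    calc ‖shTerm k (n + 1)‖ ≤ ‖k * star k‖ * ‖shTerm k n‖ := norm_mul_le_kernel _ _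
      _ ≤ ‖k‖ ^ 2 * ‖k‖ ^ (2 * n + 1) := by gcongr; exact norm_mul_star_le k
      _ = ‖k‖ ^ (2 * (n + 1) + 1) := by ring

theorem norm_chTerm_le (k : Kernel) (n : ℕ) : ‖chTerm k n‖ ≤ ‖k‖ ^ (2 * n + 2) := by
  induction n with
  | zero => simpa [chTerm_zero] using norm_mul_star_le k
  | succ n ih =>
    calc ‖chTerm k (n + 1)‖ ≤ ‖k * star k‖ * ‖chTerm k n‖ := norm_mul_le_kernel _ _
      _ ≤ ‖k‖ ^ 2 * ‖k‖ ^ (2 * n + 2) := by gcongr; exact norm_mul_star_le k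
      _ = ‖k‖ ^ (2 * (n + 1) + 2) := by ring

theorem norm_shTerm_smul_le {r : ℝ} {k : Kernel} (hk : ‖k‖ ≤ r) (n : ℕ) :
    ‖((Nat.factorial (2 * n + 1) : ℂ)⁻¹) • shTerm k n‖
      ≤ r ^ (2 * n + 1) / (Nat.factorial (2 * n + 1) : ℝ) := by
  rw [norm_smul, norm_inv, Complex.norm_natCast, div_eq_inv_mul]
  gcongr
  exact (norm_shTerm_le k n).trans (by gcongr)

theorem norm_chTerm_smul_le {r : ℝ} {k : Kernel} (hk : ‖k‖ ≤ r) (n : ℕ) :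
    ‖((Nat.factorial (2 * n + 2) : ℂ)⁻¹) • chTerm k n‖
      ≤ r ^ (2 * n + 2) / (Nat.factorial (2 * n + 2) : ℝ) := by
  rw [norm_smul, norm_inv, Complex.norm_natCast, div_eq_inv_mul]
  gcongr
  exact (norm_chTerm_le k n).trans (by gcongr)

theorem summable_odd_pow_div_factorial (r : ℝ) :
    Summable fun n : ℕ => r ^ (2 * n + 1) / (Nat.factorial (2 * n + 1) : ℝ) :=
  (Real.summable_pow_div_factorial r).comp_injective
    (i := fun n : ℕ => 2 * n + 1) (fun a b h => by simpa using h)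

theorem summable_even_pow_div_factorial (r : ℝ) :
    Summable fun n : ℕ => r ^ (2 * n + 2) / (Nat.factorial (2 * n + 2) : ℝ) :=
  (Real.summable_pow_div_factorial r).comp_injective
    (i := fun n : ℕ => 2 * n + 2) (fun a b h => by simpa using h)

theorem hasSum_sh (k : Kernel) :
    HasSum (fun n : ℕ => ((Nat.factorial (2 * n + 1) : ℂ)⁻¹) • shTerm k n) (sh k) :=
  (Summable.of_norm_bounded (summable_odd_pow_div_factorial ‖k‖)
    (norm_shTerm_smul_le le_rfl)).hasSum

theorem hasSum_pch (k : Kernel) :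
    HasSum (fun n : ℕ => ((Nat.factorial (2 * n + 2) : ℂ)⁻¹) • chTerm k n) (pch k) :=
  (Summable.of_norm_bounded (summable_even_pow_div_factorial ‖k‖)
    (norm_chTerm_smul_le le_rfl)).hasSum

theorem continuous_shTerm (n : ℕ) : Continuous fun k => shTerm k n := by
  induction n with
  | zero => exact continuous_id
  | succ n ih =>
    exact Continuous.kernel_mul
      (Continuous.kernel_mul continuous_id continuous_star_Lp) ih

theorem continuous_chTerm (n : ℕ) : Continuous fun k => chTerm k n := by
  induction n with
  | zero => exact Continuous.kernel_mul continuous_id continuous_star_Lp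
  | succ n ih =>
    exact Continuous.kernel_mul
      (Continuous.kernel_mul continuous_id continuous_star_Lp) ih

theorem continuous_of_continuousOn_closedBall {X Y : Type*} [SeminormedAddCommGroup X]
    [TopologicalSpace Y] {f : X → Y} (h : ∀ r, ContinuousOn f (Metric.closedBall 0 r)) :
    Continuous f := by
  refine continuous_iff_continuousAt.2 fun x => (h (‖x‖ + 1)).continuousAt ?_
  refine Filter.mem_of_superset (Metric.ball_mem_nhds x one_pos) fun y hy => ?_
  rw [mem_closedBall_zero_iff]
  have h1 := norm_le_norm_add_norm_sub' y x
  have h2 := mem_ball_iff_norm.1 hy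
  linarith

theorem continuous_sh : Continuous sh := by
  refine continuous_of_continuousOn_closedBall fun r => ?_
  exact continuousOn_tsum (fun n => (Continuous.comp (continuous_const_smul _) (continuous_shTerm n)).continuousOn)
    (summable_odd_pow_div_factorial r)
    (fun n k hk => norm_shTerm_smul_le (mem_closedBall_zero_iff.1 hk) n)

theorem continuous_pch : Continuous pch := by
  refine continuous_of_continuousOn_closedBall fun r => ?_
  exact continuousOn_tsum (fun n => (Continuous.comp (continuous_const_smul _) (continuous_chTerm n)).continuousOn)
    (summable_even_pow_div_factorial r)
    (fun n k hk => norm_chTerm_smul_le (mem_closedBall_zero_iff.1 hk) n)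

theorem shTerm_succ' (k : Kernel) (n : ℕ) : shTerm k (n + 1) = shTerm k n * (star k * k) := by
  induction n with
  | zero => exact mul_assoc k (star k) k
  | succ n ih =>
    rw [shTerm_succ k (n + 1)]
    nth_rewrite 1 [ih]
    rw [← mul_assoc, ← shTerm_succ]

theorem chTerm_succ' (k : Kernel) (n : ℕ) : chTerm k (n + 1) = chTerm k n * (k * star k) := by
  induction n with
  | zero => rfl
  | succ n ih =>
    rw [chTerm_succ k (n + 1)]
    nth_rewrite 1 [ih]
    rw [← mul_assoc, ← chTerm_succ]

theorem transpose_mul (a b : Kernel) : transpose (a * b) = transpose b * transpose a :=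
  transpose_comp a b

theorem star_mul_kernel (a b : Kernel) : star (a * b) = star a * star b := star_comp a b

theorem adj_mul (a b : Kernel) : adj (a * b) = adj b * adj a := adj_comp a b

theorem transpose_shTerm {k : Kernel} (hk : transpose k = k) (n : ℕ) :
    transpose (shTerm k n) = shTerm k n := by
  induction n with
  | zero => exact hk
  | succ n ih =>
    rw [shTerm_succ, transpose_mul, transpose_mul, ih, transpose_star, hk, ← shTerm_succ',
      shTerm_succ]

theorem adj_eq_star {k : Kernel} (hk : transpose k = k) : adj k = star k := by
  rw [adj, transpose_star, hk]

theorem adj_star_eq {k : Kernel} (hk : transpose k = k) : adj (star k) = k := by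
  rw [adj, star_star, hk]

theorem adj_mul_star {k : Kernel} (hk : transpose k = k) : adj (k * star k) = k * star k := by
  rw [adj_mul, adj_star_eq hk, adj_eq_star hk]

theorem adj_chTerm {k : Kernel} (hk : transpose k = k) (n : ℕ) :
    adj (chTerm k n) = chTerm k n := by
  induction n with
  | zero => exact adj_mul_star hk
  | succ n ih => rw [chTerm_succ, adj_mul, adj_mul_star hk, ih, ← chTerm_succ', chTerm_succ]

theorem transpose_sh {k : Kernel} (hk : transpose k = k) : transpose (sh k) = sh k := by
  have h := (hasSum_sh k).map transposeL.toLinearMap.toAddMonoidHom transposeL.continuous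
  refine h.unique ?_
  convert hasSum_sh k using 1
  ext1 n
  have := transpose_shTerm hk n
  rw [← transposeL_apply] at this
  simp [this]

theorem adj_pch {k : Kernel} (hk : transpose k = k) : adj (pch k) = pch k := by
  have h := (hasSum_pch k).map (AddMonoidHom.mk' adj adj_add) continuous_adj
  refine h.unique ?_
  convert hasSum_pch k using 1
  ext1 n
  simp [adj_smul, adj_chTerm hk n]

/-- For symmetric `k` the kernel `T = k k̄ = k k*` is nonnegative and `chTerm k n = T ^ (n + 1)`.
Moving one factor `T` to the other side of the inner product lowers the power by two, hence the two
base cases. -/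
theorem re_inner_chTerm_mul_nonneg {k : Kernel} (hk : transpose k = k) (n : ℕ) (x : Kernel) :
    0 ≤ (⟪chTerm k n * x, x⟫_ℂ).re := by
  induction n using Nat.strong_induction_on generalizing x with
  | _ n ih =>
    match n with
    | 0 =>
      rw [chTerm_zero, mul_assoc, mul_def, inner_comp_left, adj_eq_star hk]
      exact inner_self_nonneg (𝕜 := ℂ)
    | 1 =>
      rw [chTerm_succ, chTerm_zero, mul_assoc, mul_def (k * star k), inner_comp_left,
        adj_mul_star hk]
      exact inner_self_nonneg (𝕜 := ℂ)
    | n + 2 =>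
      rw [chTerm_succ, chTerm_succ', mul_assoc, mul_def (k * star k), inner_comp_left,
        adj_mul_star hk, mul_assoc]
      exact ih n (by omega) _

theorem re_inner_pch_mul_nonneg {k : Kernel} (hk : transpose k = k) (x : Kernel) :
    0 ≤ (⟪pch k * x, x⟫_ℂ).re := by
  have h1 := (hasSum_pch k).mapL (compL.flip x)
  have h2 := (h1.mapL (innerSL ℂ x)).mapL Complex.reCLM
  have h3 : 0 ≤ (⟪x, pch k * x⟫_ℂ).re := by
    refine h2.nonneg fun n => ?_
    have h4 := re_inner_chTerm_mul_nonneg hk n x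
    rw [← inner_conj_symm, Complex.conj_re] at h4
    have e : ⟪x, compL.flip x (((Nat.factorial (2 * n + 2) : ℂ)⁻¹) • chTerm k n)⟫_ℂ
        = (((Nat.factorial (2 * n + 2) : ℝ)⁻¹ : ℝ) : ℂ) * ⟪x, chTerm k n * x⟫_ℂ := by
      rw [map_smul, inner_smul_right]; simp [mul_def, compL_apply]
    simp only [innerSL_apply_apply, Complex.reCLM_apply]
    rw [e, Complex.re_ofReal_mul]
    positivity
  rwa [← inner_conj_symm, Complex.conj_re] at h3

/-- Left multiplication by a nonnegative kernel is a positive operator. -/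
theorem compL_nonneg {p : Kernel} (hp : adj p = p) (h : ∀ x, 0 ≤ (⟪p * x, x⟫_ℂ).re) :
    0 ≤ compL p := by
  rw [ContinuousLinearMap.nonneg_iff_isPositive]
  refine ⟨fun x y => ?_, fun x => h x⟩
  have := inner_comp_left p x y
  rwa [hp] at this

/-- Right multiplication by a nonnegative kernel is a positive operator. -/
theorem compL_flip_nonneg {p : Kernel} (hp : adj p = p) (h : ∀ x, 0 ≤ (⟪p * x, x⟫_ℂ).re) :
    0 ≤ compL.flip p := by
  rw [ContinuousLinearMap.nonneg_iff_isPositive]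
  refine ⟨fun x y => ?_, fun x => ?_⟩
  · have := inner_comp_right x p y
    rwa [hp] at this
  · have h1 := h (adj x)
    have h2 := inner_adj_adj (x * p) x
    rw [adj_mul, hp] at h2
    rw [h2] at h1
    rwa [← inner_conj_symm, Complex.conj_re] at h1

/-! #### The identity `ch² - sh sh̄ = 1` -/

/-- The block operator `(x, y) ↦ (k y, k̄ x)`. -/
def blockOp (k : Kernel) : (Kernel × Kernel) →L[ℂ] (Kernel × Kernel) :=
  ((compL k).comp (ContinuousLinearMap.snd ℂ _ _)).prod
    ((compL (star k)).comp (ContinuousLinearMap.fst ℂ _ _))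

theorem blockOp_apply (k : Kernel) (z : Kernel × Kernel) :
    blockOp k z = (k * z.2, star k * z.1) := rfl

theorem star_shTerm (k : Kernel) (n : ℕ) : star (shTerm k n) = shTerm (star k) n := by
  induction n with
  | zero => rfl
  | succ n ih => rw [shTerm_succ, star_mul_kernel, star_mul_kernel, ih, shTerm_succ]

theorem star_sh (k : Kernel) : star (sh k) = sh (star k) := by
  have h := (hasSum_sh k).map (AddMonoidHom.mk' (star : Kernel → Kernel) star_add_Lp)
    continuous_star_Lp
  refine h.unique ?_
  convert hasSum_sh (star k) using 1
  ext1 n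
  simp [star_smul_Lp, star_shTerm]

theorem sh_neg (k : Kernel) : sh (-k) = -sh k := by
  have e : ∀ n, shTerm (-k) n = -shTerm k n := by
    have hs : star (-k) = -star k := by rw [← starL_apply, map_neg, starL_apply]
    intro n
    induction n with
    | zero => rfl
    | succ n ih => rw [shTerm_succ, ih, hs, shTerm_succ]; simp
  simp only [sh, e, smul_neg, tsum_neg]

theorem pch_neg (k : Kernel) : pch (-k) = pch k := by
  have e : ∀ n, chTerm (-k) n = chTerm k n := by
    have hs : star (-k) = -star k := by rw [← starL_apply, map_neg, starL_apply]
    intro n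
    induction n with
    | zero => rw [chTerm_zero, hs, chTerm_zero]; simp
    | succ n ih => rw [chTerm_succ, ih, hs, chTerm_succ]; simp
  simp only [pch, e]

theorem blockOp_pow_odd_snd (k y : Kernel) (n : ℕ) :
    (blockOp k ^ (2 * n + 1)) (0, y) = (shTerm k n * y, 0) := by
  induction n with
  | zero => simp [blockOp_apply, shTerm]
  | succ n ih =>
    rw [show 2 * (n + 1) + 1 = 2 + (2 * n + 1) by ring, pow_add, mul_apply_eq_comp, ih,
      pow_two, mul_apply_eq_comp, blockOp_apply, blockOp_apply, shTerm_succ]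
    simp [mul_assoc]

theorem blockOp_pow_odd_fst (k x : Kernel) (n : ℕ) :
    (blockOp k ^ (2 * n + 1)) (x, 0) = (0, shTerm (star k) n * x) := by
  induction n with
  | zero => simp [blockOp_apply, shTerm]
  | succ n ih =>
    rw [show 2 * (n + 1) + 1 = 2 + (2 * n + 1) by ring, pow_add, mul_apply_eq_comp, ih,
      pow_two, mul_apply_eq_comp, blockOp_apply, blockOp_apply, shTerm_succ]
    simp [mul_assoc]

theorem blockOp_pow_even_fst (k x : Kernel) (n : ℕ) :
    (blockOp k ^ (2 * n + 2)) (x, 0) = (chTerm k n * x, 0) := by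
  induction n with
  | zero => simp [pow_two, blockOp_apply, chTerm_zero, mul_assoc]
  | succ n ih =>
    rw [show 2 * (n + 1) + 2 = 2 + (2 * n + 2) by ring, pow_add, mul_apply_eq_comp, ih,
      pow_two, mul_apply_eq_comp, blockOp_apply, blockOp_apply, chTerm_succ]
    simp [mul_assoc]

theorem blockOp_pow_even_snd (k y : Kernel) (n : ℕ) :
    ((blockOp k ^ (2 * n)) (0, y)).1 = 0 := by
  induction n with
  | zero => simp
  | succ n ih =>
    rw [show 2 * (n + 1) = 2 + 2 * n by ring, pow_add, mul_apply_eq_comp,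
      pow_two, mul_apply_eq_comp, blockOp_apply, blockOp_apply]
    change k * (star k * ((blockOp k ^ (2 * n)) (0, y)).1) = 0
    rw [ih, mul_zero, mul_zero]

theorem hasSum_exp_blockOp (k : Kernel) (z : Kernel × Kernel) :
    HasSum (fun n : ℕ => ((Nat.factorial n : ℂ)⁻¹) • (blockOp k ^ n) z)
      (NormedSpace.exp (blockOp k) z) := by
  have h := NormedSpace.exp_series_hasSum_exp' (𝕂 := ℂ) (blockOp k)
  exact h.mapL (ContinuousLinearMap.apply ℂ (Kernel × Kernel) z)

/-- Even powers of the block operator are diagonal and odd powers are off-diagonal, so splitting the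
exponential series by parity produces the hyperbolic cosine and sine. -/
theorem exp_blockOp_fst (k x : Kernel) :
    NormedSpace.exp (blockOp k) (x, 0) = (x + pch k * x, star (sh k) * x) := by
  refine (hasSum_exp_blockOp k (x, 0)).unique ?_
  have h1 : HasSum (fun n : ℕ => ((Nat.factorial (2 * n) : ℂ)⁻¹) • (blockOp k ^ (2 * n)) (x, 0))
      (x + pch k * x, 0) := by
    -- The zeroth even term is the identity, which `pch` omits; it is split off and the index
    -- shifted by one.
    rw [← hasSum_nat_add_iff' 1]
    have h2 := ((hasSum_pch k).mapL (compL.flip x)).mapL (ContinuousLinearMap.inl ℂ Kernel Kernel)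
    have e1 : (fun n : ℕ => ((Nat.factorial (2 * (n + 1)) : ℂ)⁻¹) •
        (blockOp k ^ (2 * (n + 1))) (x, 0)) = fun n => ContinuousLinearMap.inl ℂ Kernel Kernel
          (compL.flip x (((Nat.factorial (2 * n + 2) : ℂ)⁻¹) • chTerm k n)) := by
      funext n
      rw [show 2 * (n + 1) = 2 * n + 2 by ring, blockOp_pow_even_fst, map_smul, map_smul]
      rfl
    have e2 : (x + pch k * x, (0 : Kernel)) - ∑ i ∈ Finset.range 1,
        ((Nat.factorial (2 * i) : ℂ)⁻¹) • (blockOp k ^ (2 * i)) (x, 0) =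
        ContinuousLinearMap.inl ℂ Kernel Kernel (compL.flip x (pch k)) := by
      rw [Finset.sum_range_one, mul_zero, pow_zero, Nat.factorial_zero, Nat.cast_one, inv_one,
        one_smul]
      ext1
      · exact add_sub_cancel_left x _
      · exact sub_self 0
    rw [e1, e2]
    exact h2
  have h2 : HasSum (fun n : ℕ => ((Nat.factorial (2 * n + 1) : ℂ)⁻¹) •
      (blockOp k ^ (2 * n + 1)) (x, 0)) (0, star (sh k) * x) := by
    have h3 := ((hasSum_sh (star k)).mapL (compL.flip x)).mapL
      (ContinuousLinearMap.inr ℂ Kernel Kernel)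
    rw [← star_sh] at h3
    have e1 : (fun n : ℕ => ((Nat.factorial (2 * n + 1) : ℂ)⁻¹) •
        (blockOp k ^ (2 * n + 1)) (x, 0)) = fun n => ContinuousLinearMap.inr ℂ Kernel Kernel
          (compL.flip x (((Nat.factorial (2 * n + 1) : ℂ)⁻¹) • shTerm (star k) n)) := by
      funext n
      rw [blockOp_pow_odd_fst, map_smul, map_smul]
      rfl
    rw [e1]
    exact h3
  have e : (x + pch k * x, star (sh k) * x) =
      (x + pch k * x, (0 : Kernel)) + (0, star (sh k) * x) :=
    Prod.ext (add_zero _).symm (zero_add _).symm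
  rw [e]
  exact HasSum.even_add_odd (f := fun n : ℕ => ((Nat.factorial n : ℂ)⁻¹) • (blockOp k ^ n) (x, 0))
    h1 h2

theorem exp_blockOp_snd (k y : Kernel) :
    (NormedSpace.exp (blockOp k) (0, y)).1 = sh k * y := by
  refine ((hasSum_exp_blockOp k (0, y)).mapL (ContinuousLinearMap.fst ℂ Kernel Kernel)).unique ?_
  have h1 : HasSum (fun n : ℕ => ContinuousLinearMap.fst ℂ Kernel Kernel
      (((Nat.factorial (2 * n) : ℂ)⁻¹) • (blockOp k ^ (2 * n)) (0, y))) 0 := by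
    have e1 : (fun n : ℕ => ContinuousLinearMap.fst ℂ Kernel Kernel
        (((Nat.factorial (2 * n) : ℂ)⁻¹) • (blockOp k ^ (2 * n)) (0, y))) = fun _ => 0 := by
      funext n
      rw [map_smul, ContinuousLinearMap.coe_fst', blockOp_pow_even_snd, smul_zero]
    rw [e1]
    exact hasSum_zero
  have h2 : HasSum (fun n : ℕ => ContinuousLinearMap.fst ℂ Kernel Kernel
      (((Nat.factorial (2 * n + 1) : ℂ)⁻¹) • (blockOp k ^ (2 * n + 1)) (0, y))) (sh k * y) := by
    have e1 : (fun n : ℕ => ContinuousLinearMap.fst ℂ Kernel Kernel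
        (((Nat.factorial (2 * n + 1) : ℂ)⁻¹) • (blockOp k ^ (2 * n + 1)) (0, y))) =
        fun n => compL.flip y (((Nat.factorial (2 * n + 1) : ℂ)⁻¹) • shTerm k n) := by
      funext n
      rw [blockOp_pow_odd_snd, map_smul, map_smul]
      rfl
    rw [e1]
    exact (hasSum_sh k).mapL (compL.flip y)
  have h3 := HasSum.even_add_odd (f := fun n : ℕ => ContinuousLinearMap.fst ℂ Kernel Kernel
    (((Nat.factorial n : ℂ)⁻¹) • (blockOp k ^ n) (0, y))) h1 h2
  rw [zero_add] at h3
  exact h3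

theorem exp_neg_mul_exp_self {A : Type*} [NormedRing A] [NormedAlgebra ℂ A] [CompleteSpace A]
    (a : A) : NormedSpace.exp (-a) * NormedSpace.exp a = 1 := by
  let _ : NormedAlgebra ℚ A := NormedAlgebra.restrictScalars ℚ ℂ A
  rw [← NormedSpace.exp_add_of_commute ((Commute.refl a).neg_left), neg_add_cancel,
    NormedSpace.exp_zero]

theorem blockOp_neg (k : Kernel) : blockOp (-k) = -blockOp k := by
  have hs : star (-k) = -star k := by rw [← starL_apply, map_neg, starL_apply]
  ext z <;> simp [blockOp, hs]

/-- `(1 + p)² = 1 + u ū`. -/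
theorem pch_mul_pch (k : Kernel) :
    pch k * pch k + pch k + pch k = sh k * star (sh k) := by
  rw [← sub_eq_zero]
  refine eq_zero_of_forall_comp_eq_zero _ fun x => ?_
  -- Replacing `k` by `-k` keeps `p` and changes the sign of `u`, so the first component of `exp(-K)
  -- exp(K) (x, 0) = (x, 0)` is `(1 + p)² x - u ū x = x`.
  have h1 : NormedSpace.exp (blockOp (-k)) * NormedSpace.exp (blockOp k) = 1 := by
    rw [blockOp_neg]
    exact exp_neg_mul_exp_self _
  have h2 := congrArg Prod.fst (DFunLike.congr_fun h1 (x, 0))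
  rw [mul_apply_eq_comp, exp_blockOp_fst] at h2
  have e : (x + pch k * x, star (sh k) * x) =
      (x + pch k * x, (0 : Kernel)) + (0, star (sh k) * x) := by simp
  rw [e, map_add, Prod.fst_add, exp_blockOp_fst, exp_blockOp_snd, pch_neg, sh_neg] at h2
  have h3 : x + pch k * x + pch k * (x + pch k * x) + -sh k * (star (sh k) * x) = x := h2
  change (_ - _) * x = 0
  have h4 : (pch k * pch k + pch k + pch k - sh k * star (sh k)) * x =
      x + pch k * x + pch k * (x + pch k * x) + -sh k * (star (sh k) * x) - x := by
    noncomm_ring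
  rw [h4, h3, sub_self]

/-! ### The bound at a fixed time -/

section Sylvester

variable {H : Type*} [NormedAddCommGroup H] [InnerProductSpace ℂ H]

theorem norm_le_norm_add_of_re_inner_nonneg {x y : H} (h : 0 ≤ (⟪x, y⟫_ℂ).re) :
    ‖x‖ ≤ ‖x + y‖ := by
  have h1 := @norm_add_sq ℂ H _ _ _ x y
  have h2 : (0 : ℝ) ≤ RCLike.re ⟪x, y⟫_ℂ := h
  refine abs_le_of_sq_le_sq' ?_ (norm_nonneg _) |>.2
  nlinarith [sq_nonneg ‖y‖]

/-- A bound for the solution of the Sylvester equation `L w + R w = R x - L y` with commuting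
positive operators `L = 1 + A` and `R = 1 + B`. -/
theorem norm_le_of_sylvester [CompleteSpace H] {A B : H →L[ℂ] H} (hA : 0 ≤ A) (hB : 0 ≤ B) (hAB : Commute A B)
    {w x y : H} (h : (1 + A) w + (1 + B) w = (1 + B) x - (1 + A) y) :
    ‖w‖ ≤ ‖x‖ + ‖y‖ := by
  have hAB0 : 0 ≤ A * B := Commute.mul_nonneg hA hB hAB
  have hT1 : (1 : H →L[ℂ] H) ≤ (1 + A) + (1 + B) := by
    have h0 : (0 : H →L[ℂ] H) ≤ 1 := zero_le_one
    calc (1 : H →L[ℂ] H) ≤ 1 + (A + (1 + B)) :=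
          le_add_of_nonneg_right (add_nonneg hA (add_nonneg h0 hB))
      _ = (1 + A) + (1 + B) := by abel
  -- `T = L + R` is at least `1`, hence invertible, and it commutes with `L` and `R`. So `w = R T⁻¹
  -- x - L T⁻¹ y`, and it is enough that `R T⁻¹` and `L T⁻¹` are contractions.
  obtain ⟨T, hT⟩ : IsUnit ((1 + A) + (1 + B)) := CStarAlgebra.isUnit_of_le 1 hT1
  -- The product `L R = 1 + A + B + A B` of commuting positive operators is positive. Thus `L z` and
  -- `R z` form an acute angle, and each is at most `‖L z + R z‖ = ‖T z‖` in norm.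
  have pos : ∀ z : H, 0 ≤ (⟪(1 + A) z, (1 + B) z⟫_ℂ).re := by
    intro z
    have hsa : ⟪(1 + A) z, (1 + B) z⟫_ℂ = ⟪z, ((1 + A) * (1 + B)) z⟫_ℂ := by
      have h2 := (ContinuousLinearMap.nonneg_iff_isPositive _).1 hA
      have h3 := h2.isSymmetric z ((1 + B) z)
      simp only [ContinuousLinearMap.coe_coe] at h3
      rw [mul_apply_eq_comp]
      simp only [add_apply, one_apply_eq_self, inner_add_left,
        inner_add_right] at h3 ⊢
      linear_combination h3
    have h0 : (0 : H →L[ℂ] H) ≤ 1 := zero_le_one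
    have h4 : 0 ≤ (1 + A) * (1 + B) := by
      have : (1 + A) * (1 + B) = 1 + A + (B + A * B) := by noncomm_ring
      rw [this]
      exact add_nonneg (add_nonneg h0 hA) (add_nonneg hB hAB0)
    have h5 := ((ContinuousLinearMap.nonneg_iff_isPositive _).1 h4).2 z
    rw [hsa, ← inner_conj_symm, Complex.conj_re]
    exact h5
  have hTv : ∀ z, T.val z = (1 + A) z + (1 + B) z := fun z => by
    rw [hT]; rfl
  have hinv : ∀ z, T.val (T⁻¹.val z) = z := fun z => by
    rw [← mul_apply_eq_comp, Units.mul_inv]; rfl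
  have hL : Commute (1 + A) T.val := by
    rw [hT]
    exact (Commute.refl _).add_right
      (((Commute.one_left _).add_left ((Commute.one_right A).add_right hAB)))
  have hR : Commute (1 + B) T.val := by
    rw [hT]
    exact (((Commute.one_left _).add_left ((Commute.one_right B).add_right hAB.symm))).add_right
      (Commute.refl _)
  have key : w = (1 + B) (T⁻¹.val x) - (1 + A) (T⁻¹.val y) := by
    have h6 : T.val w = T.val ((1 + B) (T⁻¹.val x) - (1 + A) (T⁻¹.val y)) := by
      rw [hTv, h, map_sub, ← mul_apply_eq_comp T.val, ← hR.eq, ← mul_apply_eq_comp T.val, ← hL.eq,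
        mul_apply_eq_comp, mul_apply_eq_comp, hinv, hinv]
    have h7 := congrArg T⁻¹.val h6
    simpa only [← mul_apply_eq_comp, Units.inv_mul, one_apply_eq_self] using h7
  have b1 : ‖(1 + B) (T⁻¹.val x)‖ ≤ ‖x‖ := by
    have h8 := norm_le_norm_add_of_re_inner_nonneg (x := (1 + B) (T⁻¹.val x))
      (y := (1 + A) (T⁻¹.val x))
      (by rw [← inner_conj_symm, Complex.conj_re]; exact pos _)
    rwa [add_comm ((1 + B) _), ← hTv, hinv] at h8
  have b2 : ‖(1 + A) (T⁻¹.val y)‖ ≤ ‖y‖ := by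
    have h8 := norm_le_norm_add_of_re_inner_nonneg (pos (T⁻¹.val y))
    rwa [← hTv, hinv] at h8
  rw [key]
  exact (norm_sub_le _ _).trans (add_le_add b1 b2)

end Sylvester

/-! ### Unit-free identities for `(1 + p)⁻¹ = 1 + ρ`. -/

section Algebra

variable {R : Type*} [NonUnitalRing R]

theorem inverse_unique {p ρ ρ' : R} (h : p + ρ + p * ρ = 0) (h' : p + ρ' + ρ' * p = 0) :
    ρ' = ρ := by
  linear_combination (norm := noncomm_ring) h' - h + h' * ρ - ρ' * h

/-- With `q = (1 + p)² - 1` this is `y (1 + p)⁻¹ q = y (1 + p) - y (1 + p)⁻¹`. -/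
theorem mul_hyperbolic {p ρ q y : R} (hq : p * p + p + p = q) (h : p + ρ + ρ * p = 0) :
    (y + y * ρ) * q = y * p - y * ρ := by
  rw [← hq]
  linear_combination (norm := noncomm_ring) y * h * p + y * h + y * h - y * h

/-- The relation `y (1 + p)⁻¹ = (1 + p)⁻¹ z` multiplied by `1 + p` on both sides. -/
theorem sylvester_of_intertwining {p ρ y z : R} (h : p + ρ + ρ * p = 0) (h' : p + ρ + p * ρ = 0)
    (e : y + y * ρ = z + ρ * z) : y + p * y = z + z * p := by
  linear_combination (norm := noncomm_ring) e + p * e + e * p + p * e * p - y * h + h' * z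
    - p * y * h + h' * z * p

end Algebra

/-- Put `a = y (1 + p)⁻¹`. Since `u ū = (1 + p)² - 1`, one gets `‖a u‖² = ‖a (1 + p)‖² - ‖a‖² = ‖y‖²
- ‖a‖²`. So right multiplication by `(1 + p)⁻¹ u` is a contraction whatever the size of `u`. -/
theorem norm_mul_sub_sq {p ρ u y : Kernel} (hu : transpose u = u) (hp : adj p = p)
    (hid : p * p + p + p = u * star u) (hρ : p + ρ + ρ * p = 0) :
    ‖(y + y * ρ) * u‖ ≤ ‖y‖ := by
  set a := y + y * ρ with ha
  have h1 : ⟪a * u, a * u⟫_ℂ = ⟪a, (y + y * p) - a⟫_ℂ := by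
    rw [mul_def a u, inner_comp_right, adj_eq_star hu, ← mul_def, ← mul_def, mul_assoc,
      mul_hyperbolic hid hρ]
    congr 1
    rw [ha]; abel
  have h2 : ⟪a, y + y * p⟫_ℂ = ⟪y, y⟫_ℂ := by
    have h3 : a + a * p = y := by
      rw [ha]
      linear_combination (norm := noncomm_ring) y * hρ
    have h4 := inner_comp_right a p y
    rw [hp] at h4
    rw [inner_add_right, mul_def y p, ← h4, ← inner_add_left, ← mul_def, h3]
  rw [inner_sub_right, h2] at h1
  simp only [inner_self_eq_norm_sq_to_K] at h1
  have h5 : ‖a * u‖ ^ 2 = ‖y‖ ^ 2 - ‖a‖ ^ 2 := by exact_mod_cast h1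
  refine abs_le_of_sq_le_sq' ?_ (norm_nonneg _) |>.2
  nlinarith [sq_nonneg ‖a‖]

/-- Again by `(1 + p)² = 1 + u ū`, `‖(1 + p) m‖² = ‖m‖² + ‖ū m‖²`. This gives growth linear in `‖u‖`
and needs no separate estimate of `p`. -/
theorem norm_add_mul_le {p u m : Kernel} (hu : transpose u = u) (hp : adj p = p)
    (hid : p * p + p + p = u * star u) : ‖m + p * m‖ ≤ ‖m‖ * (1 + ‖u‖) := by
  have h1 : ⟪m + p * m, m + p * m⟫_ℂ = ⟪m, m⟫_ℂ + ⟪star u * m, star u * m⟫_ℂ := by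
    have h2 : ∀ b, ⟪p * m, b⟫_ℂ = ⟪m, p * b⟫_ℂ := fun b => by
      rw [mul_def, inner_comp_left, hp]; rfl
    have h3 : ⟪star u * m, star u * m⟫_ℂ = ⟪m, (p * p + p + p) * m⟫_ℂ := by
      rw [mul_def (star u) m, inner_comp_left, adj_star_eq hu, hid, mul_assoc]; rfl
    rw [inner_add_left, h2, h3, ← inner_add_right, ← inner_add_right]
    congr 1
    noncomm_ring
  simp only [inner_self_eq_norm_sq_to_K] at h1
  have h5 : ‖m + p * m‖ ^ 2 = ‖m‖ ^ 2 + ‖star u * m‖ ^ 2 := by exact_mod_cast h1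
  have h6 := norm_mul_le_kernel (star u) m
  rw [norm_star_Lp] at h6
  refine abs_le_of_sq_le_sq' ?_ (by positivity) |>.2
  have h7 := norm_nonneg u
  have h8 := norm_nonneg m
  have h9 : ‖star u * m‖ ^ 2 ≤ (‖u‖ * ‖m‖) ^ 2 := by gcongr
  nlinarith [mul_nonneg h7 (sq_nonneg ‖m‖)]

/-- The pointwise-in-time estimate for the source term of the equation for `u`. -/
theorem norm_source_le {u p ρ m W S : Kernel} (hu : transpose u = u) (hp : adj p = p)
    (hpos : ∀ x, 0 ≤ (⟪p * x, x⟫_ℂ).re) (hid : p * p + p + p = u * star u)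
    (hρ : p + ρ + p * ρ = 0) (hρ' : p + ρ + ρ * p = 0) (hm : transpose m = m)
    (hW : adj W = -W) (hS : transpose S = S)
    (hder : W * p + p * W + W + W = S * star u - u * star S)
    (heq : S - (m + p * m) = ((W + u * star m) + (W + u * star m) * ρ) * u) :
    ‖S‖ ≤ ‖m‖ * (1 + 4 * ‖u‖) := by
  set Y := W + u * star m with hY
  set Z := -W + m * star u with hZ
  have hadjρ : adj ρ = ρ := by
    refine inverse_unique hρ ?_
    have h := congrArg adj hρ
    have h0 : adj (0 : Kernel) = 0 := by simpa using adj_smul 0 0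
    simpa only [adj_add, adj_mul, hp, h0] using h
  have hadjY : adj Y = Z := by
    rw [hY, adj_add, hW, adj_mul, adj_star_eq hm, adj_eq_star hu]
  -- The equation times `ū` on the right, with `(1 + p)⁻¹ u ū = (1 + p) - (1 + p)⁻¹`. The next
  -- identity is its adjoint, in which `Y` becomes `Z`.
  have hSu : S * star u = m * star u + p * (m * star u) + Y * p - Y * ρ := by
    have h1 := mul_hyperbolic (y := Y) hid hρ'
    linear_combination (norm := noncomm_ring) heq * star u + h1
  have huS : u * star S = u * star m + u * star m * p + p * Z - ρ * Z := by
    have h1 : u * star S = adj (S * star u) := by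
      rw [adj_mul, adj_star_eq hu, adj_eq_star hS]
    have hsub : ∀ a b : Kernel, adj (a - b) = adj a - adj b := fun a b => by
      have h3 := adj_add (a - b) b
      rw [sub_add_cancel] at h3
      exact eq_sub_of_add_eq h3.symm
    rw [h1, hSu, hsub]
    simp only [adj_add, adj_mul, adj_star_eq hu, adj_eq_star hm, hp, hadjρ, hadjY]
  -- In the difference of the two identities the terms without an inverse add up to `W (1 + p) + (1
  -- + p) W`, which is the left side of `hder`. Only the terms carrying `(1 + p)⁻¹` survive.
  have hint : Y + Y * ρ = Z + ρ * Z := by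
    rw [hSu, huS] at hder
    linear_combination (norm := (simp only [hY, hZ]; noncomm_ring)) hder
  have hsyl := sylvester_of_intertwining hρ' hρ hint
  -- Unfolding `Y` and `Z`, the relation becomes `(1 + p) W + W (1 + p) = m ū (1 + p) - (1 + p) u
  -- m̄`, which is a Sylvester equation for left and right multiplication by `p`.
  have hWb : ‖W‖ ≤ ‖m * star u‖ + ‖u * star m‖ := by
    refine norm_le_of_sylvester (compL_nonneg hp hpos) (compL_flip_nonneg hp hpos) ?_ ?_
    · ext1 x
      exact (comp_assoc p x p).symm
    · change W + p * W + (W + W * p) = m * star u + m * star u * p - (u * star m + p * (u * star m))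
      linear_combination (norm := (simp only [hY, hZ]; noncomm_ring)) hsyl
  have b1 := norm_mul_le_kernel m (star u)
  have b2 := norm_mul_le_kernel u (star m)
  rw [norm_star_Lp] at b1 b2
  have b3 : ‖(Y + Y * ρ) * u‖ ≤ ‖Y‖ := norm_mul_sub_sq hu hp hid hρ'
  have b4 : ‖Y‖ ≤ ‖W‖ + ‖u * star m‖ := norm_add_le _ _
  have b5 := norm_add_mul_le (m := m) hu hp hid
  have hSe : S = (m + p * m) + (Y + Y * ρ) * u := by rw [← heq]; abel
  have b6 : ‖S‖ ≤ ‖m + p * m‖ + ‖(Y + Y * ρ) * u‖ := by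
    conv_lhs => rw [hSe]
    exact norm_add_le _ _
  -- The coefficient 4 of `‖m‖ ‖u‖` is 1 from `(1 + p) m`, 2 from `W`, and 1 from `u m̄`.
  nlinarith

/-! ### Primitives of Bochner integrable functions -/

section Primitive

variable {E F G : Type*} [NormedAddCommGroup E] [NormedSpace ℝ E]
  [NormedAddCommGroup F] [NormedSpace ℝ F] [NormedAddCommGroup G] [NormedSpace ℝ G]

theorem integrable_bilinear_prod {α β : Type*} [MeasurableSpace α] [MeasurableSpace β]
    {μ : Measure α} {ν : Measure β} [SFinite μ] [SFinite ν] (B : E →L[ℝ] F →L[ℝ] G)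
    {f : α → E} {g : β → F} (hf : Integrable f μ) (hg : Integrable g ν) :
    Integrable (fun q : α × β => B (f q.1) (g q.2)) (μ.prod ν) := by
  have h1 : Integrable (fun q : α × β => ‖B‖ * (‖f q.1‖ * ‖g q.2‖)) (μ.prod ν) :=
    (hf.norm.mul_prod hg.norm).const_mul _
  refine h1.mono ?_ (Filter.Eventually.of_forall fun q => ?_)
  · exact B.aestronglyMeasurable_comp₂ hf.1.comp_fst hg.1.comp_snd
  · rw [Real.norm_of_nonneg (by positivity), ← mul_assoc]
    exact B.le_opNorm₂ _ _

theorem primitive_eq_indicator_Iic (h : ℝ → E) {s t : ℝ} (hs : s ∈ Ioc 0 t) :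
    ∫ r in (0 : ℝ)..s, h r = ∫ r in Ioc 0 t, (Iic s).indicator h r := by
  rw [integral_indicator measurableSet_Iic, Measure.restrict_restrict measurableSet_Iic,
    intervalIntegral.integral_of_le hs.1.le]
  congr 2
  ext r; simp only [mem_Ioc, mem_inter_iff, mem_Iic]
  exact ⟨fun h => ⟨h.2, h.1, h.2.trans hs.2⟩, fun h => ⟨h.2.1, h.1⟩⟩

/-- The strict version differs by a null set; it is the one that matches the complement of the
closed triangle `r ≤ s`. -/
theorem primitive_eq_indicator_Iio (h : ℝ → E) {s t : ℝ} (hs : s ∈ Ioc 0 t) :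
    ∫ r in (0 : ℝ)..s, h r = ∫ r in Ioc 0 t, (Iio s).indicator h r := by
  rw [primitive_eq_indicator_Iic h hs]
  refine integral_congr_ae ?_
  have : ∀ᵐ r ∂(volume.restrict (Ioc 0 t)), r ≠ s := ae_restrict_of_ae (Measure.ae_ne volume s)
  filter_upwards [this] with r hr
  by_cases h : r < s
  · simp [indicator, h, h.le]
  · have h2 : ¬ r ≤ s := fun h' => h (lt_of_le_of_ne h' hr)
    simp [indicator, h, h2]

/-- The product rule for primitives of integrable functions. -/
theorem bilinear_primitive [CompleteSpace E] [CompleteSpace F] [CompleteSpace G]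
    (B : E →L[ℝ] F →L[ℝ] G) {f' : ℝ → E} {g' : ℝ → F} (f₀ : E) (g₀ : F) {t : ℝ} (ht : 0 ≤ t)
    (hf : IntegrableOn f' (Ioc 0 t)) (hg : IntegrableOn g' (Ioc 0 t)) :
    B (f₀ + ∫ s in (0 : ℝ)..t, f' s) (g₀ + ∫ s in (0 : ℝ)..t, g' s) =
      B f₀ g₀ + ∫ s in (0 : ℝ)..t, (B (f' s) (g₀ + ∫ r in (0 : ℝ)..s, g' r)
        + B (f₀ + ∫ r in (0 : ℝ)..s, f' r) (g' s)) := by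
  set μ := volume.restrict (Ioc 0 t) with hμ
  -- Fubini on the square `(0, t]²`: the function `B (f' q.1) (g' q.2)` is integrable there, and the
  -- two sides of the diagonal integrate to the two terms of the product rule.
  have hK := integrable_bilinear_prod B hf hg
  have hm1 : MeasurableSet {q : ℝ × ℝ | q.2 ≤ q.1} := measurableSet_le measurable_snd measurable_fst
  have hK1 := hK.indicator hm1
  have hK2 := hK.indicator hm1.compl
  have slice1 : ∀ᵐ s ∂μ, ∫ r, {q : ℝ × ℝ | q.2 ≤ q.1}.indicator
      (fun q => B (f' q.1) (g' q.2)) (s, r) ∂μ = B (f' s) (∫ r in (0 : ℝ)..s, g' r) := by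
    filter_upwards [ae_restrict_mem measurableSet_Ioc] with s hs
    rw [primitive_eq_indicator_Iic g' hs,
      ← (B (f' s)).integral_comp_comm (hg.indicator measurableSet_Iic)]
    congr 1; ext r
    by_cases h : r ≤ s <;> simp [indicator, h]
  have slice2 : ∀ᵐ s ∂μ, ∫ r, {q : ℝ × ℝ | q.2 ≤ q.1}ᶜ.indicator
      (fun q => B (f' q.1) (g' q.2)) (r, s) ∂μ = B (∫ r in (0 : ℝ)..s, f' r) (g' s) := by
    filter_upwards [ae_restrict_mem measurableSet_Ioc] with s hs
    rw [primitive_eq_indicator_Iio f' hs]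
    have := (B.flip (g' s)).integral_comp_comm (hf.indicator (measurableSet_Iio (a := s)))
    simp only [ContinuousLinearMap.flip_apply] at this
    rw [← this]
    congr 1; ext r
    by_cases h : s ≤ r
    · simp [indicator, h, not_lt.2 h]
    · simp [indicator, h, not_le.1 h]
  have e1 : ∫ q, {q : ℝ × ℝ | q.2 ≤ q.1}.indicator (fun q => B (f' q.1) (g' q.2)) q ∂(μ.prod μ)
      = ∫ s, B (f' s) (∫ r in (0 : ℝ)..s, g' r) ∂μ := by
    rw [integral_prod _ hK1]
    exact integral_congr_ae slice1
  have e2 : ∫ q, {q : ℝ × ℝ | q.2 ≤ q.1}ᶜ.indicator (fun q => B (f' q.1) (g' q.2)) q ∂(μ.prod μ)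
      = ∫ s, B (∫ r in (0 : ℝ)..s, f' r) (g' s) ∂μ := by
    rw [integral_prod_symm _ hK2]
    exact integral_congr_ae slice2
  have e3 : ∫ q, B (f' q.1) (g' q.2) ∂(μ.prod μ)
      = B (∫ s, f' s ∂μ) (∫ s, g' s ∂μ) := by
    rw [integral_prod _ hK]
    refine Eq.trans (integral_congr_ae (Filter.Eventually.of_forall fun s =>
      (B (f' s)).integral_comp_comm hg)) ?_
    exact (B.flip (∫ r, g' r ∂μ)).integral_comp_comm hf
  have e4 : ∫ q, B (f' q.1) (g' q.2) ∂(μ.prod μ)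
      = (∫ s, B (f' s) (∫ r in (0 : ℝ)..s, g' r) ∂μ)
        + ∫ s, B (∫ r in (0 : ℝ)..s, f' r) (g' s) ∂μ := by
    rw [← e1, ← e2, ← integral_add hK1 hK2]
    congr 1; ext q
    exact (indicator_self_add_compl_apply {q : ℝ × ℝ | q.2 ≤ q.1}
      (fun q => B (f' q.1) (g' q.2)) q).symm
  have i1 : Integrable (fun s => B (f' s) (∫ r in (0 : ℝ)..s, g' r)) μ :=
    hK1.integral_prod_left.congr slice1
  have i2 : Integrable (fun s => B (∫ r in (0 : ℝ)..s, f' r) (g' s)) μ :=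
    hK2.integral_prod_right.congr slice2
  have j1 : Integrable (fun s => B (f' s) g₀) μ := (B.flip g₀).integrable_comp hf
  have j2 : Integrable (fun s => B f₀ (g' s)) μ := (B f₀).integrable_comp hg
  have k1 : ∫ s, B (f' s) g₀ ∂μ = B (∫ s, f' s ∂μ) g₀ := (B.flip g₀).integral_comp_comm hf
  have k2 : ∫ s, B f₀ (g' s) ∂μ = B f₀ (∫ s, g' s ∂μ) := (B f₀).integral_comp_comm hg
  have k3 : ∫ s, (B (f' s) (g₀ + ∫ r in (0 : ℝ)..s, g' r)
        + B (f₀ + ∫ r in (0 : ℝ)..s, f' r) (g' s)) ∂μ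
      = (∫ s, B (f' s) g₀ ∂μ + ∫ s, B (f' s) (∫ r in (0 : ℝ)..s, g' r) ∂μ)
        + (∫ s, B f₀ (g' s) ∂μ + ∫ s, B (∫ r in (0 : ℝ)..s, f' r) (g' s) ∂μ) := by
    rw [← integral_add j1 i1, ← integral_add j2 i2, ← integral_add]
    · congr 1; ext s; simp
    · exact j1.add i1
    · exact j2.add i2
  rw [intervalIntegral.integral_of_le ht, intervalIntegral.integral_of_le ht,
    intervalIntegral.integral_of_le ht, k3, k1, k2]
  simp only [map_add, add_apply]
  rw [← e3, e4]
  abel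

end Primitive

/-! ### The free Schrödinger group -/

theorem hasTemperateGrowth_exp_I : (fun s : ℝ => Complex.exp (Complex.I * s)).HasTemperateGrowth := by
  have hd : ∀ n : ℕ, iteratedDeriv n (fun s : ℝ => Complex.exp (Complex.I * s)) =
      fun s : ℝ => Complex.I ^ n * Complex.exp (Complex.I * s) := by
    intro n
    induction n with
    | zero => simp
    | succ n ih =>
      rw [iteratedDeriv_succ, ih]
      funext s
      have h1 : HasDerivAt (fun s : ℝ => Complex.I * (s : ℂ)) Complex.I s := by
        simpa using (Complex.ofRealCLM.hasDerivAt (x := s)).const_mul Complex.I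
      have h2 := (h1.cexp.const_mul (Complex.I ^ n)).deriv
      rw [h2]; ring
  refine ⟨(contDiff_const.mul Complex.ofRealCLM.contDiff).cexp, fun n => ⟨0, 1, fun s => ?_⟩⟩
  rw [norm_iteratedFDeriv_eq_norm_iteratedDeriv, hd, norm_mul, norm_pow, Complex.norm_I, one_pow,
    one_mul, mul_comm, Complex.norm_exp_ofReal_mul_I]
  simp

/-- The symbol `exp (-i t |2πξ|²)` of `exp (i t Δ)`. -/
def freeSymbol (t : ℝ) (ξ : R3) : ℂ :=
  Complex.exp (Complex.I * ((-(t * (2 * Real.pi) ^ 2 * ‖ξ‖ ^ 2) : ℝ) : ℂ))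

theorem hasTemperateGrowth_freeSymbol (t : ℝ) : (freeSymbol t).HasTemperateGrowth := by
  have h : (fun ξ : R3 => -(t * (2 * Real.pi) ^ 2 * ‖ξ‖ ^ 2)).HasTemperateGrowth :=
    ((Function.HasTemperateGrowth.const _).mul (Function.hasTemperateGrowth_norm_sq R3)).neg
  exact hasTemperateGrowth_exp_I.comp h

theorem norm_freeSymbol (t : ℝ) (ξ : R3) : ‖freeSymbol t ξ‖ = 1 := by
  rw [freeSymbol, mul_comm, Complex.norm_exp_ofReal_mul_I]

theorem freeSymbol_mul_neg (t : ℝ) : freeSymbol t * freeSymbol (-t) = fun _ => 1 := by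
  funext ξ
  rw [Pi.mul_apply, freeSymbol, freeSymbol, ← Complex.exp_add]
  push_cast
  rw [show Complex.I * (-((t : ℂ) * (2 * Real.pi) ^ 2 * (‖ξ‖ : ℂ) ^ 2)) +
    Complex.I * (-(-(t : ℂ) * (2 * Real.pi) ^ 2 * (‖ξ‖ : ℂ) ^ 2)) = 0 by ring, Complex.exp_zero]

/-- The free evolution on Schwartz functions. -/
def freeS (t : ℝ) : 𝓢(R3, ℂ) →L[ℂ] 𝓢(R3, ℂ) :=
  SchwartzMap.fourierMultiplierCLM ℂ (freeSymbol t)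

theorem freeS_freeS_neg (t : ℝ) (a : 𝓢(R3, ℂ)) : freeS t (freeS (-t) a) = a := by
  rw [freeS, freeS, SchwartzMap.fourierMultiplierCLM_fourierMultiplierCLM_apply
    (hasTemperateGrowth_freeSymbol _) (hasTemperateGrowth_freeSymbol _), freeSymbol_mul_neg,
    SchwartzMap.fourierMultiplierCLM_const]
  simp

theorem freeS_zero (a : 𝓢(R3, ℂ)) : freeS 0 a = a := by
  have : freeSymbol 0 = fun _ => 1 := by funext ξ; simp [freeSymbol]
  rw [freeS, this, SchwartzMap.fourierMultiplierCLM_const]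
  simp

/-- The inclusion of the Schwartz functions into `L²(ℝ³)`. -/
def sL : 𝓢(R3, ℂ) →L[ℂ] L2 := SchwartzMap.toLpCLM ℂ ℂ 2 (volume : Measure R3)

theorem coeFn_sL (a : 𝓢(R3, ℂ)) : sL a =ᵐ[volume] a := a.coeFn_toLp 2

theorem norm_sL_fourier (a : 𝓢(R3, ℂ)) : ‖sL (𝓕 a)‖ = ‖sL a‖ :=
  SchwartzMap.norm_fourier_toL2_eq a

theorem fourier_freeS (t : ℝ) (a : 𝓢(R3, ℂ)) (ξ : R3) :
    𝓕 (freeS t a) ξ = freeSymbol t ξ * 𝓕 a ξ := by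
  rw [freeS, SchwartzMap.fourierMultiplierCLM_apply, FourierTransform.fourier_fourierInv_eq,
    SchwartzMap.smulLeftCLM_apply_apply (hasTemperateGrowth_freeSymbol t), smul_eq_mul]

theorem norm_sL_le_of_fourier {a b : 𝓢(R3, ℂ)} {c : ℝ} (h : ∀ ξ, ‖𝓕 a ξ‖ ≤ c * ‖𝓕 b ξ‖) :
    ‖sL a‖ ≤ c * ‖sL b‖ := by
  rw [← norm_sL_fourier a, ← norm_sL_fourier b]
  refine Lp.norm_le_mul_norm_of_ae_le_mul ?_
  filter_upwards [coeFn_sL (𝓕 a), coeFn_sL (𝓕 b)] with ξ h1 h2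
  rw [h1, h2]
  exact h ξ

theorem norm_freeS (t : ℝ) (a : 𝓢(R3, ℂ)) : ‖sL (freeS t a)‖ = ‖sL a‖ := by
  refine le_antisymm ?_ ?_
  · simpa using norm_sL_le_of_fourier (c := 1) (a := freeS t a) (b := a) fun ξ => by
      rw [fourier_freeS, norm_mul, norm_freeSymbol]
  · simpa using norm_sL_le_of_fourier (c := 1) (a := a) (b := freeS t a) fun ξ => by
      rw [fourier_freeS, norm_mul, norm_freeSymbol, one_mul, one_mul]

open Laplacian in
theorem fourier_laplacian (a : 𝓢(R3, ℂ)) (ξ : R3) :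
    𝓕 (Δ a) ξ = -((2 * Real.pi) ^ 2 * ‖ξ‖ ^ 2 : ℝ) * 𝓕 a ξ := by
  have hg : (fun ξ : R3 => ‖ξ‖ ^ 2).HasTemperateGrowth := (Function.hasTemperateGrowth_norm_sq R3)
  have h1 := SchwartzMap.laplacian_eq_fourierMultiplierCLM a
  have h2 : 𝓕 (Δ a) = -(2 * Real.pi) ^ 2 • SchwartzMap.smulLeftCLM ℂ (fun ξ : R3 => ‖ξ‖ ^ 2) (𝓕 a) := by
    rw [h1]
    change 𝓕 (-(2 * Real.pi) ^ 2 • SchwartzMap.fourierMultiplierCLM ℂ (fun ξ : R3 => ‖ξ‖ ^ 2) a) = _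
    rw [SchwartzMap.fourierMultiplierCLM_apply, ← FourierTransform.fourierInv_smul,
      FourierTransform.fourier_fourierInv_eq]
  rw [h2, smul_apply, SchwartzMap.smulLeftCLM_apply_apply hg]
  simp only [Complex.real_smul]
  push_cast
  ring

open Laplacian in
theorem freeS_laplacian (t : ℝ) (a : 𝓢(R3, ℂ)) : freeS t (Δ a) = Δ (freeS t a) := by
  have : 𝓕 (freeS t (Δ a)) = 𝓕 (Δ (freeS t a)) := by
    ext ξ
    rw [fourier_freeS, fourier_laplacian, fourier_laplacian, fourier_freeS]; ring
  exact (FourierTransform.fourierEquiv ℂ 𝓢(R3, ℂ)).injective this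

theorem norm_exp_I_sub_le (y : ℝ) :
    ‖Complex.exp (Complex.I * y) - 1 - Complex.I * y‖ ≤ 2 * y ^ 2 := by
  rcases le_total |y| 1 with h | h
  · have h1 : ‖Complex.I * (y : ℂ)‖ = |y| := by simp
    have h2 := Complex.norm_exp_sub_one_sub_id_le (x := Complex.I * y) (by rw [h1]; exact h)
    rw [h1, sq_abs] at h2
    nlinarith [sq_nonneg y]
  · have h1 := Real.norm_exp_I_mul_ofReal_sub_one_le (x := y)
    have h2 := norm_sub_le (Complex.exp (Complex.I * y) - 1) (Complex.I * y)
    have h3 : ‖Complex.I * (y : ℂ)‖ = |y| := by simp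
    rw [Real.norm_eq_abs] at h1
    nlinarith [sq_abs y]

open Laplacian in
/-- The free evolution of a Schwartz function is differentiable in `L²`. -/
theorem hasDerivAt_freeS (t : ℝ) (a : 𝓢(R3, ℂ)) :
    HasDerivAt (fun s => sL (freeS s a))
      (Complex.I • sL (Δ (freeS t a))) t := by
  rw [hasDerivAt_iff_isLittleO_nhds_zero]
  -- On the Fourier side the remainder at increment `h` is a second-order Taylor remainder of the
  -- exponential, at most `2 h² (2π|ξ|)⁴ |𝓕 a|`. The weight is that of `Δ Δ a`, so the remainder is
  -- quadratic in `h` in `L²`.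
  have hO : (fun h : ℝ => sL (freeS (t + h) a)
      - sL (freeS t a) - h • Complex.I • sL (Δ (freeS t a)))
      =O[nhds 0] fun h : ℝ => h ^ 2 := by
    refine Asymptotics.IsBigO.of_bound (2 * ‖sL (Δ (Δ a))‖)
      (Filter.Eventually.of_forall fun h => ?_)
    have e : sL (freeS (t + h) a)
      - sL (freeS t a) - h • Complex.I • sL (Δ (freeS t a)) =
        sL (freeS (t + h) a - freeS t a - ((h : ℂ) * Complex.I) • Δ (freeS t a)) := by
      simp only [map_sub, map_smul]
      rw [mul_smul]; rfl
    rw [e]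
    have key := norm_sL_le_of_fourier (c := 2 * h ^ 2)
      (a := freeS (t + h) a - freeS t a - ((h : ℂ) * Complex.I) • Δ (freeS t a)) (b := Δ (Δ a)) ?_
    · rw [Real.norm_of_nonneg (sq_nonneg h)]
      linarith
    · intro ξ
      have h1 : 𝓕 (freeS (t + h) a - freeS t a - ((h : ℂ) * Complex.I) • Δ (freeS t a)) ξ =
          freeSymbol t ξ * (Complex.exp (Complex.I * ((-(h * (2 * Real.pi) ^ 2 * ‖ξ‖ ^ 2) : ℝ) : ℂ))
            - 1 - Complex.I * ((-(h * (2 * Real.pi) ^ 2 * ‖ξ‖ ^ 2) : ℝ) : ℂ)) * 𝓕 a ξ := by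
        have h2 : freeSymbol (t + h) ξ = freeSymbol t ξ *
            Complex.exp (Complex.I * ((-(h * (2 * Real.pi) ^ 2 * ‖ξ‖ ^ 2) : ℝ) : ℂ)) := by
          rw [freeSymbol, freeSymbol, ← Complex.exp_add]
          congr 1; push_cast; ring
        simp only [← FourierTransform.fourierCLM_apply (R := ℂ), map_sub, map_smul]
        simp only [FourierTransform.fourierCLM_apply, sub_apply, smul_apply,
          fourier_freeS, fourier_laplacian, h2, smul_eq_mul]
        push_cast
        ring
      rw [h1, fourier_laplacian, fourier_laplacian, norm_mul, norm_mul, norm_freeSymbol, one_mul,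
        norm_mul, norm_mul, ← mul_assoc]
      have h3 := norm_exp_I_sub_le (-(h * (2 * Real.pi) ^ 2 * ‖ξ‖ ^ 2))
      have h4 : ‖(-((2 * Real.pi) ^ 2 * ‖ξ‖ ^ 2 : ℝ) : ℂ)‖ = (2 * Real.pi) ^ 2 * ‖ξ‖ ^ 2 := by
        rw [norm_neg, Complex.norm_real, Real.norm_of_nonneg (by positivity)]
      rw [h4]
      calc _ ≤ 2 * (-(h * (2 * Real.pi) ^ 2 * ‖ξ‖ ^ 2)) ^ 2 * ‖𝓕 a ξ‖ := by gcongr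
        _ = _ := by ring
  refine hO.trans_isLittleO ?_
  exact Asymptotics.isLittleO_pow_id (by norm_num)

theorem denseRange_sL : DenseRange sL :=
  SchwartzMap.denseRange_toLpCLM (E := R3) (F := ℂ) (p := 2) (μ := volume) (by norm_num)

/-- The free evolution `exp (i t Δ)` on `L²(ℝ³)`. -/
def free (t : ℝ) : L2 ≃ₗᵢ[ℂ] L2 :=
  LinearEquiv.extendOfIsometry
    (LinearEquiv.ofLinearMap (freeS t).toLinearMap (freeS (-t)).toLinearMap
      (by ext1 a; exact freeS_freeS_neg t a)
      (by ext1 a; simpa using freeS_freeS_neg (-t) a))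
    sL.toLinearMap
    sL.toLinearMap
    denseRange_sL denseRange_sL (fun a => norm_freeS t a)

theorem free_sL (t : ℝ) (a : 𝓢(R3, ℂ)) : free t (sL a) = sL (freeS t a) :=
  LinearEquiv.extendOfIsometry_eq _ _ _ _ _ _ a

theorem free_free_neg (t : ℝ) (f : L2) : free t (free (-t) f) = f := by
  refine denseRange_sL.induction_on (p := fun f => free t (free (-t) f) = f) f
    (isClosed_eq ((free t).continuous.comp (free (-t)).continuous) continuous_id) fun a => ?_
  rw [free_sL, free_sL, freeS_freeS_neg]

theorem inner_free (t : ℝ) (f g : L2) : ⟪free t f, g⟫_ℂ = ⟪f, free (-t) g⟫_ℂ := by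
  rw [← (free t).inner_map_map f, free_free_neg]

theorem inner_star_sL (a b : 𝓢(R3, ℂ)) :
    ⟪star (sL a), sL b⟫_ℂ = ∫ x, a x * b x := by
  rw [L2.inner_def]
  refine integral_congr_ae ?_
  filter_upwards [Lp.coeFn_star (sL a), coeFn_sL a, coeFn_sL b] with x h1 h2 h3
  rw [h1, Pi.star_apply, h2, h3]
  simp [RCLike.inner_apply, mul_comm]

/-- The free evolution is symmetric for the bilinear pairing. -/
theorem inner_star_free (t : ℝ) (f g : L2) :
    ⟪star (free t f), g⟫_ℂ = ⟪star f, free t g⟫_ℂ := by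
  have e : ∀ a : 𝓢(R3, ℂ), ∀ ξ, 𝓕⁻ a (-ξ) = 𝓕 a ξ := fun a ξ => by
    rw [SchwartzMap.fourierInv_coe, SchwartzMap.fourier_coe, Real.fourierInv_eq_fourier_neg, neg_neg]
  -- The Fourier transform can be moved from one factor of a bilinear integral to the other, and the
  -- symbol is even in `ξ`.
  have hs : ∀ a b : 𝓢(R3, ℂ), ∫ x, freeS t a x * b x = ∫ x, a x * freeS t b x := by
    intro a b
    have h1 : ∫ x, freeS t a x * b x = ∫ ξ, freeSymbol t ξ * 𝓕 a ξ * 𝓕⁻ b ξ := by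
      rw [freeS, SchwartzMap.fourierMultiplierCLM_apply, SchwartzMap.integral_fourierInv_mul_eq]
      simp only [SchwartzMap.smulLeftCLM_apply_apply (hasTemperateGrowth_freeSymbol t), smul_eq_mul]
    have h2 : ∫ x, a x * freeS t b x = ∫ ξ, 𝓕⁻ a ξ * (freeSymbol t ξ * 𝓕 b ξ) := by
      rw [freeS, SchwartzMap.fourierMultiplierCLM_apply,
        ← SchwartzMap.integral_fourierInv_mul_eq a]
      simp only [SchwartzMap.smulLeftCLM_apply_apply (hasTemperateGrowth_freeSymbol t), smul_eq_mul]
    rw [h1, h2, ← integral_neg_eq_self]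
    congr 1; ext ξ
    have e2 := e a (-ξ)
    rw [neg_neg] at e2
    have e3 : freeSymbol t (-ξ) = freeSymbol t ξ := by simp [freeSymbol]
    rw [e3, e b, ← e2]; ring
  refine denseRange_sL.induction_on
    (p := fun f => ⟪star (free t f), g⟫_ℂ = ⟪star f, free t g⟫_ℂ) f
    (isClosed_eq ((continuous_star_Lp.comp (free t).continuous).inner continuous_const)
      (continuous_star_Lp.inner continuous_const)) fun a => ?_
  refine denseRange_sL.induction_on
    (p := fun g => ⟪star (free t (sL a)), g⟫_ℂ = ⟪star (sL a), free t g⟫_ℂ) g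
    (isClosed_eq (continuous_const.inner continuous_id)
      (continuous_const.inner (free t).continuous)) fun b => ?_
  rw [free_sL, free_sL, inner_star_sL, inner_star_sL, hs]

/-- The free evolution `U` is unitary and also symmetric for the bilinear pairing, so its complex
conjugate is its inverse: conjugation reverses time. -/
theorem star_free (t : ℝ) (f : L2) : star (free t f) = free (-t) (star f) := by
  refine ext_inner_right ℂ fun g => ?_
  rw [inner_star_free, inner_free, neg_neg]

/-! ### The free evolution of kernels -/

/-- For an orthonormal basis `b` of `L²(ℝ³)` the tensors `bᵢ ⊗ bⱼ` form an orthonormal basis of the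
kernels, and isometries send them to the orthonormal family `A bᵢ ⊗ B bⱼ`. The formula extends from
basis vectors to all `f` and `g` by density, one slot at a time. -/
theorem exists_tensorMap (A B : L2 →ₗᵢ[ℂ] L2) :
    ∃ V : Kernel →ₗᵢ[ℂ] Kernel, ∀ f g, V (tensor f g) = tensor (A f) (B g) := by
  classical
  obtain ⟨w, b, -⟩ := exists_hilbertBasis ℂ L2
  have hd : Dense (Submodule.span ℂ (range b) : Set L2) := by
    rw [Submodule.dense_iff_topologicalClosure_eq_top]
    exact b.dense_span
  have orth : ∀ A B : L2 →ₗᵢ[ℂ] L2,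
      Orthonormal ℂ fun q : w × w => tensor (A (b q.1)) (B (b q.2)) := by
    intro A B
    rw [orthonormal_iff_ite]
    intro q q'
    have h := orthonormal_iff_ite.1 b.orthonormal
    rw [inner_tensor, A.inner_map_map, B.inner_map_map, h, h]
    by_cases h1 : q.1 = q'.1 <;> by_cases h2 : q.2 = q'.2 <;> simp [Prod.ext_iff, h1, h2]
  have o1 := orth LinearIsometry.id LinearIsometry.id
  simp only [LinearIsometry.id_apply] at o1
  have hbot : (Submodule.span ℂ (range fun q : w × w => tensor (b q.1) (b q.2)))ᗮ = ⊥ := by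
    rw [Submodule.eq_bot_iff]
    intro h hh
    have h0 : ∀ i j, ⟪h, tensor (b i) (b j)⟫_ℂ = 0 := fun i j =>
      Submodule.mem_orthogonal' _ _ |>.1 hh _ (Submodule.subset_span ⟨(i, j), rfl⟩)
    have h1 : ∀ f j, ⟪h, tensor f (b j)⟫_ℂ = 0 := fun f j => by
      have : (innerSL ℂ h).comp (tensorL.flip (b j)) = 0 :=
        ContinuousLinearMap.ext_on hd (by rintro _ ⟨i, rfl⟩; exact h0 i j)
      exact DFunLike.congr_fun this f
    refine eq_zero_of_inner_tensor h fun f g => ?_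
    have : (innerSL ℂ h).comp (tensorL f) = 0 :=
      ContinuousLinearMap.ext_on hd (by rintro _ ⟨j, rfl⟩; exact h1 f j)
    rw [← inner_conj_symm, show ⟪h, tensor f g⟫_ℂ = 0 from DFunLike.congr_fun this g, map_zero]
  let bb := HilbertBasis.mkOfOrthogonalEqBot o1 hbot
  have hbb : ∀ q, bb q = tensor (b q.1) (b q.2) := fun q => by
    rw [HilbertBasis.coe_mkOfOrthogonalEqBot]
  let V : Kernel →ₗᵢ[ℂ] Kernel :=
    (orth A B).orthogonalFamily.linearIsometry.comp bb.repr.toLinearIsometry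
  have hV : ∀ i j, V (tensor (b i) (b j)) = tensor (A (b i)) (B (b j)) := by
    intro i j
    have e1 : V (tensor (b i) (b j)) =
        (orth A B).orthogonalFamily.linearIsometry (bb.repr (bb (i, j))) := by
      rw [hbb]; rfl
    rw [e1, bb.repr_self, OrthogonalFamily.linearIsometry_apply_single]
    simp
  refine ⟨V, ?_⟩
  have h1 : ∀ f j, V (tensor f (b j)) = tensor (A f) (B (b j)) := fun f j => by
    have : V.toContinuousLinearMap.comp (tensorL.flip (b j)) =
        (tensorL.flip (B (b j))).comp A.toContinuousLinearMap :=
      ContinuousLinearMap.ext_on hd (by rintro _ ⟨i, rfl⟩; exact hV i j)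
    exact DFunLike.congr_fun this f
  intro f g
  have : V.toContinuousLinearMap.comp (tensorL f) =
      (tensorL (A f)).comp B.toContinuousLinearMap :=
    ContinuousLinearMap.ext_on hd (by rintro _ ⟨j, rfl⟩; exact h1 f j)
  exact DFunLike.congr_fun this g

/-- The evolution `exp (i t (Δₓ + r Δ_y))` of kernels. -/
def evo (r t : ℝ) : Kernel →ₗᵢ[ℂ] Kernel :=
  (exists_tensorMap (free t).toLinearIsometry (free (r * t)).toLinearIsometry).choose

theorem evo_tensor (r t : ℝ) (f g : L2) :
    evo r t (tensor f g) = tensor (free t f) (free (r * t) g) :=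
  (exists_tensorMap (free t).toLinearIsometry (free (r * t)).toLinearIsometry).choose_spec f g

theorem free_zero (f : L2) : free 0 f = f := by
  refine denseRange_sL.induction_on (p := fun f => free 0 f = f) f
    (isClosed_eq (free 0).continuous continuous_id) fun a => ?_
  rw [free_sL, freeS_zero]

theorem evo_zero (r : ℝ) (a : Kernel) : evo r 0 a = a := by
  induction a using tensor_induction with
  | hc => exact isClosed_eq (evo r 0).continuous continuous_id
  | ha a b h h' => rw [map_add, h, h']
  | ht f g => rw [evo_tensor, mul_zero, free_zero, free_zero]

theorem inner_star_evo (r t : ℝ) (a h : Kernel) :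
    ⟪star (evo r t a), h⟫_ℂ = ⟪star a, evo r t h⟫_ℂ := by
  induction a using tensor_induction with
  | hc =>
    exact isClosed_eq ((continuous_star_Lp.comp (evo r t).continuous).inner continuous_const)
      (continuous_star_Lp.inner continuous_const)
  | ha a b h h' => simp only [map_add, star_add_Lp, inner_add_left, h, h']
  | ht f g =>
    induction h using tensor_induction with
    | hc =>
      exact isClosed_eq (continuous_const.inner continuous_id)
        (continuous_const.inner (evo r t).continuous)
    | ha a b h h' => simp only [map_add, inner_add_right, h, h']
    | ht f' g' =>
      simp only [evo_tensor, star_tensor, inner_tensor, inner_star_free]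

/-- With the symmetric unitary `U = exp(i t Δ)`, `evo 1` is `a ↦ U a U` and `evo (-1)` is `a ↦ U a
U*`. The inner factors of `(U a U)(U* b̄ U*)` cancel. This is why `u` and `p` carry opposite signs
of `Δ_y`, and why `(1 + p)² = 1 + u ū` survives conjugation by the free flow. -/
theorem evo_mul_star (t : ℝ) (a b : Kernel) :
    evo 1 t a * star (evo 1 t b) = evo (-1) t (a * star b) := by
  induction a using tensor_induction with
  | hc =>
    exact isClosed_eq (Continuous.kernel_mul (evo 1 t).continuous continuous_const)
      ((evo (-1) t).continuous.comp (Continuous.kernel_mul continuous_id continuous_const))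
  | ha a b h h' => simp only [map_add, add_mul, h, h']
  | ht f g =>
    induction b using tensor_induction with
    | hc =>
      exact isClosed_eq (Continuous.kernel_mul continuous_const
          (continuous_star_Lp.comp (evo 1 t).continuous))
        ((evo (-1) t).continuous.comp (Continuous.kernel_mul continuous_const continuous_star_Lp))
    | ha a b h h' => simp only [map_add, star_add_Lp, mul_add, h, h']
    | ht f' g' =>
      simp only [evo_tensor, star_tensor, mul_def, comp_tensor, map_smul, one_mul, neg_mul,
        star_free, inner_free]
      rw [neg_neg, free_free_neg]

theorem evo_mul (t : ℝ) (a b : Kernel) :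
    evo (-1) t a * evo (-1) t b = evo (-1) t (a * b) := by
  induction a using tensor_induction with
  | hc =>
    exact isClosed_eq (Continuous.kernel_mul (evo (-1) t).continuous continuous_const)
      ((evo (-1) t).continuous.comp (Continuous.kernel_mul continuous_id continuous_const))
  | ha a b h h' => simp only [map_add, add_mul, h, h']
  | ht f g =>
    induction b using tensor_induction with
    | hc =>
      exact isClosed_eq (Continuous.kernel_mul continuous_const (evo (-1) t).continuous)
        ((evo (-1) t).continuous.comp (Continuous.kernel_mul continuous_const continuous_id))
    | ha a b h h' => simp only [map_add, mul_add, h, h']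
    | ht f' g' =>
      simp only [evo_tensor, mul_def, comp_tensor, map_smul, one_mul, neg_mul,
        star_free, inner_free, neg_neg]
      have h := free_free_neg (-t) f'
      rw [neg_neg] at h
      rw [h]

theorem transpose_evo (t : ℝ) (a : Kernel) : transpose (evo 1 t a) = evo 1 t (transpose a) := by
  induction a using tensor_induction with
  | hc =>
    exact isClosed_eq (continuous_transpose.comp (evo 1 t).continuous)
      ((evo 1 t).continuous.comp continuous_transpose)
  | ha a b h h' =>
    simp only [← transposeL_apply, map_add] at h h' ⊢; rw [h, h']
  | ht f g => simp only [evo_tensor, transpose_tensor, one_mul]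

theorem adj_evo (t : ℝ) (a : Kernel) : adj (evo (-1) t a) = evo (-1) t (adj a) := by
  induction a using tensor_induction with
  | hc =>
    exact isClosed_eq (continuous_adj.comp (evo (-1) t).continuous)
      ((evo (-1) t).continuous.comp continuous_adj)
  | ha a b h h' => simp only [adj_add, map_add, h, h']
  | ht f g => simp only [evo_tensor, adj_tensor, star_free, neg_mul, one_mul, neg_neg]

theorem tensor_schwartz_induction {P : Kernel → Prop} (hc : IsClosed {a | P a})
    (ht : ∀ a b : 𝓢(R3, ℂ), P (tensor (sL a) (sL b))) (ha : ∀ a b, P a → P b → P (a + b))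
    (a : Kernel) : P a := by
  refine tensor_induction hc (fun f g => ?_) ha a
  refine denseRange_sL.induction_on (p := fun f => P (tensor f g)) f
    (hc.preimage (tensorL.flip g).continuous) fun a => ?_
  exact denseRange_sL.induction_on (p := fun g => P (tensor (sL a) g)) g
    (hc.preimage (tensorL (sL a)).continuous) fun b => ht a b

theorem hasDerivAt_evo_tensor (r t : ℝ) (a b : 𝓢(R3, ℂ)) :
    HasDerivAt (fun s => evo r s (tensor (sL a) (sL b)))
      (Complex.I • (tensor (sL (Laplacian.laplacian (freeS t a))) (sL (freeS (r * t) b))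
        + (r : ℂ) • tensor (sL (freeS t a)) (sL (Laplacian.laplacian (freeS (r * t) b))))) t := by
  have h1 := hasDerivAt_freeS t a
  have h2 : HasDerivAt (fun s => sL (freeS (r * s) b))
      (r • Complex.I • sL (Laplacian.laplacian (freeS (r * t) b))) t := by
    have h3 : HasDerivAt (fun s : ℝ => r * s) r t := by simpa using (hasDerivAt_id t).const_mul r
    exact (hasDerivAt_freeS (r * t) b).scomp t h3
  have h4 := (tensorL.bilinearRestrictScalars ℝ).hasFDerivAt_of_bilinear h1.hasFDerivAt
    h2.hasFDerivAt
  have e : (fun s => evo r s (tensor (sL a) (sL b))) =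
      fun s => (tensorL.bilinearRestrictScalars ℝ) (sL (freeS s a)) (sL (freeS (r * s) b)) := by
    funext s
    rw [evo_tensor, free_sL, free_sL]; rfl
  rw [e]
  refine h4.hasDerivAt.congr_deriv ?_
  change tensor (sL (freeS t a)) ((1 : ℝ) • r • Complex.I • sL (Laplacian.laplacian (freeS (r * t) b)))
    + tensor ((1 : ℝ) • Complex.I • sL (Laplacian.laplacian (freeS t a))) (sL (freeS (r * t) b)) = _
  have hr : ∀ f : L2, r • f = (r : ℂ) • f := fun f => (algebraMap_smul ℂ r f).symm
  rw [one_smul, one_smul, add_comm, hr, tensor_smul, tensor_smul, smul_tensor,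
    smul_comm, smul_add]

/-- On tensors of Schwartz functions the orbit is differentiable. Each `evo r t` is an isometry, so
approximating the initial kernel approximates the orbit uniformly in time, and continuity passes to
the limit. -/
theorem continuous_evo_apply (r : ℝ) (a : Kernel) : Continuous fun t => evo r t a := by
  refine tensor_schwartz_induction (P := fun a => Continuous fun t => evo r t a) ?_ ?_ ?_ a
  · refine isClosed_of_closure_subset fun a ha => ?_
    refine continuous_of_uniform_approx_of_continuous fun s hs => ?_
    obtain ⟨ε, hε, h⟩ := Metric.mem_uniformity_dist.1 hs
    obtain ⟨b, hb, hab⟩ := Metric.mem_closure_iff.1 ha ε hε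
    exact ⟨fun t => evo r t b, hb, fun t => h (by rwa [LinearIsometry.dist_map])⟩
  · intro a b
    exact continuous_iff_continuousAt.2 fun t => (hasDerivAt_evo_tensor r t a b).continuousAt
  · intro a b h h'
    exact (h.add h').congr fun t => ((evo r t).map_add a b).symm

theorem continuous_evo (r : ℝ) : Continuous fun q : ℝ × Kernel => evo r q.1 q.2 := by
  refine continuous_iff_continuousAt.2 fun q => ?_
  have h1 : ContinuousAt (fun q' : ℝ × Kernel => evo r q'.1 q.2) q :=
    ((continuous_evo_apply r q.2).comp continuous_fst).continuousAt
  have h2 : Filter.Tendsto (fun q' : ℝ × Kernel => evo r q'.1 (q'.2 - q.2)) (nhds q) (nhds 0) := by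
    rw [tendsto_zero_iff_norm_tendsto_zero]
    simp only [LinearIsometry.norm_map]
    have : Continuous fun q' : ℝ × Kernel => ‖q'.2 - q.2‖ := by fun_prop
    simpa using this.tendsto q
  have h3 := Filter.Tendsto.add h1 h2
  simpa [ContinuousAt] using h3

/-! ### Duhamel's formula -/

/-- The bilinear pairing `∫ a h` of kernels. -/
def bil : Kernel →L[ℂ] Kernel →L[ℂ] ℂ :=
  (innerSL ℂ).comp (starL (μ := (volume : Measure (R3 × R3)))).toContinuousLinearMap

theorem bil_apply (a h : Kernel) : bil a h = ⟪star a, h⟫_ℂ := rfl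

theorem bil_evo (r t : ℝ) (a h : Kernel) : bil (evo r t a) h = bil a (evo r t h) :=
  inner_star_evo r t a h

theorem continuousOn_bil {f g : ℝ → Kernel} {s : Set ℝ} (hf : ContinuousOn f s)
    (hg : ContinuousOn g s) : ContinuousOn (fun t => bil (f t) (g t)) s :=
  (bil.continuous.comp_continuousOn hf).clm_apply hg

theorem eq_of_bil_tensor {z w : Kernel}
    (H : ∀ a b : 𝓢(R3, ℂ), bil (tensor (sL a) (sL b)) z = bil (tensor (sL a) (sL b)) w) :
    z = w := by
  have h : ∀ x, bil x z = bil x w := fun x => by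
    refine tensor_schwartz_induction (P := fun x => bil x z = bil x w)
      (isClosed_eq (bil.flip z).continuous (bil.flip w).continuous) H (fun a b h h' => ?_) x
    simp only [map_add, add_apply, h, h']
  have h1 : bil (star (z - w)) (z - w) = 0 := by rw [map_sub, h, sub_self]
  rw [bil_apply, star_star, inner_self_eq_zero] at h1
  exact sub_eq_zero.1 h1

theorem pairing_eq_bil (a b : 𝓢(R3, ℂ)) (h : Kernel) :
    pairing a b h = bil (tensor (sL a) (sL b)) h := by
  rw [bil_apply, L2.inner_def, pairing]
  refine integral_congr_ae ?_
  filter_upwards [Lp.coeFn_star (tensor (sL a) (sL b)), coeFn_tensor (sL a) (sL b),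
    ae_fst (coeFn_sL a), ae_snd (coeFn_sL b)] with z h1 h2 h3 h4
  rw [h1, Pi.star_apply, h2, h3, h4]
  simp [RCLike.inner_apply, mul_comm]

theorem coe_laplacian (a : 𝓢(R3, ℂ)) :
    Laplacian.laplacian (a : R3 → ℂ) = ((Laplacian.laplacian a : 𝓢(R3, ℂ)) : R3 → ℂ) :=
  funext fun x => (SchwartzMap.laplacian_apply a x).symm

/-- For curves `h` that are differentiable only weakly: the pairing with the one fixed element `A t`
has to be differentiable, and continuity of `h` handles the variation of `A`. -/
theorem hasDerivAt_bilinear_of_continuousAt {E F G : Type*} [NormedAddCommGroup E]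
    [NormedSpace ℝ E] [NormedAddCommGroup F] [NormedSpace ℝ F] [NormedAddCommGroup G]
    [NormedSpace ℝ G] (B : E →L[ℝ] F →L[ℝ] G) {A : ℝ → E} {A' : E} {h : ℝ → F} {g : G} {t : ℝ}
    (hA : HasDerivAt A A' t) (hh : ContinuousAt h t)
    (hg : HasDerivAt (fun s => B (A t) (h s)) g t) :
    HasDerivAt (fun s => B (A s) (h s)) (B A' (h t) + g) t := by
  have h1 : HasDerivAt (fun s => B (A s - A t) (h s)) (B A' (h t)) t := by
    rw [hasDerivAt_iff_tendsto_slope] at hA ⊢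
    have h2 : Filter.Tendsto (fun s => B (slope A t s) (h s)) (nhdsWithin t {t}ᶜ)
        (nhds (B A' (h t))) :=
      (B.isBoundedBilinearMap.continuous.tendsto (A', h t)).comp
        (hA.prodMk_nhds (hh.tendsto.mono_left nhdsWithin_le_nhds))
    refine h2.congr fun s => ?_
    simp only [slope_def_module, sub_self, map_zero, zero_apply, sub_zero, map_smul, smul_apply]
  refine (h1.add hg).congr_of_eventuallyEq (Filter.Eventually.of_forall fun s => ?_)
  simp only [map_sub, sub_apply, Pi.add_apply, sub_add_cancel]

theorem integrableOn_evo (r : ℝ) {F : ℝ → Kernel} {s : Set ℝ} (hF : IntegrableOn F s) :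
    IntegrableOn (fun t => evo r t (F t)) s := by
  have h1 : AEStronglyMeasurable (fun t : ℝ => (t, F t)) (volume.restrict s) :=
    AEStronglyMeasurable.prodMk (f := fun t : ℝ => t) aestronglyMeasurable_id
      hF.aestronglyMeasurable
  have hm : AEStronglyMeasurable (fun t => evo r t (F t)) (volume.restrict s) :=
    Continuous.comp_aestronglyMeasurable (g := fun q : ℝ × Kernel => evo r q.1 q.2)
      (f := fun t : ℝ => (t, F t)) (continuous_evo r) h1
  exact (Integrable.norm hF).mono' hm (Filter.Eventually.of_forall fun t => by
    rw [LinearIsometry.norm_map])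

-- The weak equation is tested against the moving tensor `A s = evo r s (a ⊗ b)`. It remains a
-- tensor of Schwartz functions, so it is admissible at each time, and its time derivative cancels
-- the Laplacian terms. Only the source is left, and the symmetry of `evo` for `bil` moves the
-- evolution onto `h`.
set_option maxHeartbeats 1000000 in
theorem IsWeakSolution.duhamel {r T : ℝ} {h F : ℝ → Kernel} (hw : IsWeakSolution r T h F)
    (hh : ContinuousOn h (Icc 0 T)) (hF : IntegrableOn F (Icc 0 T)) {t : ℝ} (ht : t ∈ Icc 0 T) :
    evo r t (h t) = h 0 - Complex.I • ∫ s in (0 : ℝ)..t, evo r s (F s) := by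
  have hFi : ∀ s ∈ Icc 0 T, IntervalIntegrable F volume 0 s := fun s hs =>
    (intervalIntegrable_iff_integrableOn_Icc_of_le hs.1).2 (hF.mono_set (Icc_subset_Icc_right hs.2))
  set y : ℝ → Kernel := fun s => ∫ τ in (0 : ℝ)..s, F τ with hy
  have hyc : ContinuousOn y (Icc 0 T) := by
    have := intervalIntegral.continuousOn_primitive_interval (a := 0) (b := T) (μ := volume)
      (f := F) (by rwa [uIcc_of_le (ht.1.trans ht.2)])
    rwa [uIcc_of_le (ht.1.trans ht.2)] at this
  set L : 𝓢(R3, ℂ) → 𝓢(R3, ℂ) → Kernel := fun a b =>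
    tensor (sL (Laplacian.laplacian a)) (sL b)
      + (r : ℂ) • tensor (sL a) (sL (Laplacian.laplacian b)) with hL
  -- `F` is only integrable in time. Adding `i` times its primitive to `h` removes it from the weak
  -- equation, and pairings with `h2` become classically differentiable.
  set h2 : ℝ → Kernel := fun s => h s + Complex.I • y s with hh2
  have hh2c : ContinuousOn h2 (Icc 0 T) := hh.add (hyc.const_smul Complex.I)
  have hsub : ∀ s ∈ Icc 0 T, Icc 0 s ⊆ Icc 0 T := fun s hs => Icc_subset_Icc_right hs.2
  have weak : ∀ a b, ∀ s ∈ Icc 0 T, bil (tensor (sL a) (sL b)) (h2 s) =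
      bil (tensor (sL a) (sL b)) (h 0) - Complex.I * ∫ τ in (0 : ℝ)..s, bil (L a b) (h τ) := by
    intro a b s hs
    have h1 := hw a b s hs
    simp only [coe_laplacian, pairing_eq_bil] at h1
    have h3 : ∀ τ, bil (tensor (sL (Laplacian.laplacian a)) (sL b)) (h τ)
        + (r : ℂ) * bil (tensor (sL a) (sL (Laplacian.laplacian b))) (h τ)
        + bil (tensor (sL a) (sL b)) (F τ) = bil (L a b) (h τ) + bil (tensor (sL a) (sL b)) (F τ) := by
      intro τ
      simp only [hL, map_add, map_smul, add_apply, smul_apply, smul_eq_mul]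
    simp only [h3] at h1
    have i1 : IntervalIntegrable (fun τ => bil (L a b) (h τ)) volume 0 s := by
      refine ContinuousOn.intervalIntegrable ?_
      rw [uIcc_of_le hs.1]
      exact (bil (L a b)).continuous.comp_continuousOn (hh.mono (hsub s hs))
    have i2 : IntervalIntegrable (fun τ => bil (tensor (sL a) (sL b)) (F τ)) volume 0 s :=
      ⟨(bil (tensor (sL a) (sL b))).integrable_comp (hFi s hs).1,
        (bil (tensor (sL a) (sL b))).integrable_comp (hFi s hs).2⟩
    rw [intervalIntegral.integral_add i1 i2,
      ContinuousLinearMap.intervalIntegral_comp_comm _ (hFi s hs)] at h1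
    simp only [hh2, map_add, map_smul, smul_eq_mul]
    linear_combination (-Complex.I) * h1 + (bil (tensor (sL a) (sL b)) (h s)
      - bil (tensor (sL a) (sL b)) (h 0)) * Complex.I_sq
  have weakDeriv : ∀ a b, ∀ s ∈ Ioo 0 T, HasDerivAt (fun τ => bil (tensor (sL a) (sL b)) (h2 τ))
      (-(Complex.I * bil (L a b) (h s))) s := by
    intro a b s hs
    have hnb : Icc 0 T ∈ nhds s := Icc_mem_nhds hs.1 hs.2
    have hc : ContinuousOn (fun τ => bil (L a b) (h τ)) (Icc 0 T) :=
      (bil (L a b)).continuous.comp_continuousOn hh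
    have h1 := intervalIntegral.integral_hasDerivAt_right (a := 0) (b := s)
      (f := fun τ => bil (L a b) (h τ))
      (ContinuousOn.intervalIntegrable (by
        rw [uIcc_of_le hs.1.le]; exact hc.mono (hsub s (Ioo_subset_Icc_self hs))))
      ((hc.mono Ioo_subset_Icc_self).stronglyMeasurableAtFilter isOpen_Ioo s hs)
      (hc.continuousAt hnb)
    have h3 := (h1.const_mul Complex.I).const_sub (bil (tensor (sL a) (sL b)) (h 0))
    refine h3.congr_of_eventuallyEq ?_
    filter_upwards [hnb] with τ hτ using weak a b τ hτ
  refine eq_of_bil_tensor fun a b => ?_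
  set A : ℝ → Kernel := fun s => evo r s (tensor (sL a) (sL b)) with hA
  set A' : ℝ → Kernel := fun s => Complex.I • evo r s (L a b) with hA'
  have hAd : ∀ s, HasDerivAt A (A' s) s := by
    intro s
    refine (hasDerivAt_evo_tensor r s a b).congr_deriv ?_
    simp only [hA', hL, map_add, map_smul, evo_tensor, free_sL, freeS_laplacian]
  have hAL : ∀ s, A s = tensor (sL (freeS s a)) (sL (freeS (r * s) b)) := fun s => by
    simp only [hA, evo_tensor, free_sL]
  have hA'L : ∀ s, A' s = Complex.I • L (freeS s a) (freeS (r * s) b) := fun s => by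
    simp only [hA', hL, map_add, map_smul, evo_tensor, free_sL, freeS_laplacian]
  have hA'c : Continuous A' := (continuous_evo_apply r (L a b)).const_smul Complex.I
  have hAc : Continuous A := continuous_evo_apply r _
  let bR := bil.bilinearRestrictScalars ℝ
  -- The Laplacian of `h` cancels between the moving test function and the weak equation. What is
  -- left is the contribution of the added primitive `y`.
  have hΦ : ∀ s ∈ Ioo 0 T, HasDerivAt (fun τ => bil (A τ) (h2 τ))
      (Complex.I * bil (A' s) (y s)) s := by
    intro s hs
    have h1 := weakDeriv (freeS s a) (freeS (r * s) b) s hs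
    rw [← hAL] at h1
    have h3 := hasDerivAt_bilinear_of_continuousAt bR (hAd s)
      (hh2c.continuousAt (Icc_mem_nhds hs.1 hs.2)) h1
    refine h3.congr_deriv ?_
    change bil (A' s) (h2 s) + _ = _
    rw [hA'L]
    simp only [hh2, map_smul, smul_apply, map_add, smul_eq_mul]
    ring
  have hcont : ContinuousOn (fun τ => bil (A τ) (h2 τ)) (Icc 0 T) :=
    continuousOn_bil hAc.continuousOn hh2c
  have hsubt := hsub t ht
  have hcy : ContinuousOn (fun s => bil (A' s) (y s)) (Icc 0 t) :=
    continuousOn_bil hA'c.continuousOn (hyc.mono hsubt)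
  have iy : IntervalIntegrable (fun s => bil (A' s) (y s)) volume 0 t :=
    ContinuousOn.intervalIntegrable (by rwa [uIcc_of_le ht.1])
  have ftc := intervalIntegral.integral_eq_sub_of_hasDerivAt_of_le ht.1 (hcont.mono hsubt)
    (fun s hs => hΦ s ⟨hs.1, hs.2.trans_le ht.2⟩) (iy.const_mul Complex.I)
  have prim : ∀ s, A s = tensor (sL a) (sL b) + ∫ τ in (0 : ℝ)..s, A' τ := fun s => by
    have hi : IntervalIntegrable A' volume 0 s := hA'c.intervalIntegrable 0 s
    have h1 : ∫ τ in (0 : ℝ)..s, A' τ = A s - A 0 :=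
      intervalIntegral.integral_eq_sub_of_hasDerivAt (f := A) (f' := A') (fun τ _ => hAd τ) hi
    have h3 : A 0 = tensor (sL a) (sL b) := evo_zero r _
    rw [h1, h3, add_sub_cancel]
  -- Integration by parts in time trades the integral of `bil (A' s) (y s)` for that of `bil (A s)
  -- (F s)`.
  have leib := bilinear_primitive bR (tensor (sL a) (sL b)) (0 : Kernel) ht.1
    (hA'c.integrableOn_Ioc) (hF.mono_set (Ioc_subset_Icc_self.trans hsubt))
  simp only [← prim, zero_add] at leib
  change bil (A t) (y t) = bil _ 0 + ∫ s in (0 : ℝ)..t, (bil (A' s) (y s) + bil (A s) (F s)) at leib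
  have iF : IntervalIntegrable (fun s => evo r s (F s)) volume 0 t := by
    rw [intervalIntegrable_iff_integrableOn_Ioc_of_le ht.1]
    exact integrableOn_evo r (hF.mono_set (Ioc_subset_Icc_self.trans hsubt))
  have iF2 : IntervalIntegrable (fun s => bil (A s) (F s)) volume 0 t := by
    simp only [hA, bil_evo]
    exact ⟨(bil (tensor (sL a) (sL b))).integrable_comp iF.1,
        (bil (tensor (sL a) (sL b))).integrable_comp iF.2⟩
  rw [intervalIntegral.integral_add iy iF2] at leib
  rw [intervalIntegral.integral_const_mul] at ftc
  have e1 : ∫ s in (0 : ℝ)..t, bil (A s) (F s) =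
      bil (tensor (sL a) (sL b)) (∫ s in (0 : ℝ)..t, evo r s (F s)) := by
    simp only [hA, bil_evo]
    rw [ContinuousLinearMap.intervalIntegral_comp_comm _ iF]
  have e2 : A 0 = tensor (sL a) (sL b) := evo_zero r _
  have e3 : h2 0 = h 0 := by simp only [hh2, hy, intervalIntegral.integral_same, smul_zero, add_zero]
  rw [e1, map_zero] at leib
  rw [e2, e3] at ftc
  simp only [hh2, map_add, map_smul, smul_eq_mul] at ftc
  rw [← bil_evo, map_sub, map_smul, smul_eq_mul]
  change bil (A t) (h t) = _
  linear_combination -ftc - Complex.I * leib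

/-! ### Consequences of Duhamel's formula -/

theorem ae_eq_zero_of_primitive {E : Type*} [NormedAddCommGroup E] [NormedSpace ℝ E]
    [CompleteSpace E] {f : ℝ → E} {T : ℝ} (hf : IntegrableOn f (Icc 0 T))
    (h : ∀ t ∈ Icc 0 T, ∫ s in (0 : ℝ)..t, f s = 0) :
    ∀ᵐ t ∂(volume.restrict (Icc 0 T)), f t = 0 := by
  rcases lt_or_ge T 0 with hT | hT
  · simp [Icc_eq_empty_of_lt hT]
  rw [ae_restrict_iff' measurableSet_Icc]
  have hi : IntervalIntegrable f volume 0 T :=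
    (intervalIntegrable_iff_integrableOn_Icc_of_le hT).2 hf
  have h1 := hi.ae_hasDerivAt_integral
  have h0 : ∀ᵐ t : ℝ, t ≠ 0 ∧ t ≠ T := by
    filter_upwards [Measure.ae_ne volume (0 : ℝ), Measure.ae_ne volume T] with t h h'
      using ⟨h, h'⟩
  filter_upwards [h1, h0] with t ht ht0 htT
  have htI : t ∈ Ioo 0 T := ⟨lt_of_le_of_ne htT.1 ht0.1.symm, lt_of_le_of_ne htT.2 ht0.2⟩
  have h2 := ht (by rwa [uIcc_of_le hT]) 0 (by simp [hT])
  refine h2.unique ((hasDerivAt_const t (0 : E)).congr_of_eventuallyEq ?_)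
  filter_upwards [Icc_mem_nhds htI.1 htI.2] with s hs using h s hs

theorem real_inner_eq_re (x y : Kernel) : ⟪x, y⟫_ℝ = (⟪x, y⟫_ℂ).re := by
  rw [L2.inner_def, L2.inner_def, ← RCLike.re_eq_complex_re,
    ← integral_re (L2.integrable_inner (𝕜 := ℂ) x y)]
  rfl

/-- Complex conjugation of kernels as a real linear map. -/
def starR : Kernel →L[ℝ] Kernel where
  toFun := star
  map_add' := star_add_Lp
  map_smul' c a := by
    rw [RCLike.real_smul_eq_coe_smul (K := ℂ), star_smul_Lp, RCLike.real_smul_eq_coe_smul (K := ℂ)]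
    simp
  cont := continuous_star_Lp

theorem starR_apply (a : Kernel) : starR a = star a := rfl

/-- The composition of kernels as a real bilinear map. -/
def mulR : Kernel →L[ℝ] Kernel →L[ℝ] Kernel := compL.bilinearRestrictScalars ℝ

theorem mulR_apply (a b : Kernel) : mulR a b = a * b := rfl

section

variable {r T : ℝ} {h F : ℝ → Kernel}

theorem IsWeakSolution.evo_eq (hw : IsWeakSolution r T h F)
    (hh : ContinuousOn h (Icc 0 T)) (hF : IntegrableOn F (Icc 0 T)) {t : ℝ} (ht : t ∈ Icc 0 T) :
    evo r t (h t) = h 0 + ∫ s in (0 : ℝ)..t, (-Complex.I) • evo r s (F s) := by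
  rw [hw.duhamel hh hF ht, intervalIntegral.integral_smul, neg_smul, sub_eq_add_neg]

theorem integrableOn_smul_evo (hF : IntegrableOn F (Icc 0 T)) {t : ℝ} (ht : t ∈ Icc 0 T) :
    IntegrableOn (fun s => (-Complex.I) • evo r s (F s)) (Ioc 0 t) :=
  (integrableOn_evo r (hF.mono_set
    (Ioc_subset_Icc_self.trans (Icc_subset_Icc_right ht.2)))).smul (-Complex.I)

/-- Since `evo` is isometric, `‖h‖` is the norm of a primitive with density `-i evo F`, and `2 Re
⟨h, -i F⟩ = 2 Im ⟨h, F⟩`. -/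
theorem IsWeakSolution.norm_sq (hw : IsWeakSolution r T h F)
    (hh : ContinuousOn h (Icc 0 T)) (hF : IntegrableOn F (Icc 0 T)) {t : ℝ} (ht : t ∈ Icc 0 T) :
    ‖h t‖ ^ 2 = ‖h 0‖ ^ 2 + ∫ s in (0 : ℝ)..t, 2 * (⟪h s, F s⟫_ℂ).im := by
  have hi := integrableOn_smul_evo (r := r) hF ht
  have key := bilinear_primitive (innerSL ℝ) (h 0) (h 0) ht.1 hi hi
  rw [← hw.evo_eq hh hF ht] at key
  change ⟪evo r t (h t), evo r t (h t)⟫_ℝ = ⟪h 0, h 0⟫_ℝ + _ at key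
  rw [real_inner_self_eq_norm_sq, LinearIsometry.norm_map, real_inner_self_eq_norm_sq] at key
  rw [key]
  congr 1
  refine intervalIntegral.integral_congr fun s hs => ?_
  rw [uIcc_of_le ht.1] at hs
  have e := hw.evo_eq hh hF ⟨hs.1, hs.2.trans ht.2⟩
  simp only [← e]
  change ⟪(-Complex.I) • evo r s (F s), evo r s (h s)⟫_ℝ
    + ⟪evo r s (h s), (-Complex.I) • evo r s (F s)⟫_ℝ = _
  rw [real_inner_comm, real_inner_eq_re, inner_smul_right, LinearIsometry.inner_map_map]
  simp
  ring

/-- By Duhamel's formula the primitive of `evo 1 s (F s)` is determined by the symmetric kernels `h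
t` and `h 0`, and transposition commutes with `evo 1`. So the primitive is symmetric at all times,
and its density is symmetric almost everywhere. -/
theorem IsWeakSolution.transpose_source {h F : ℝ → Kernel} (hw : IsWeakSolution (1 : ℝ) T h F)
    (hh : ContinuousOn h (Icc 0 T)) (hF : IntegrableOn F (Icc 0 T))
    (hs : ∀ t ∈ Icc 0 T, transpose (h t) = h t) :
    ∀ᵐ t ∂(volume.restrict (Icc 0 T)), transpose (F t) = F t := by
  have hi : IntegrableOn (fun s => evo 1 s (F s)) (Icc 0 T) := integrableOn_evo 1 hF
  have hi' : IntegrableOn (fun s => transposeL (evo 1 s (F s))) (Icc 0 T) :=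
    transposeL.toContinuousLinearMap.integrable_comp hi
  have h0 := ae_eq_zero_of_primitive
    (f := fun s => transposeL (evo 1 s (F s)) - evo 1 s (F s)) (hi'.sub hi) ?_
  · filter_upwards [h0] with t ht
    rw [transposeL_apply, transpose_evo, sub_eq_zero] at ht
    exact (evo 1 t).injective ht
  · intro t ht
    have hsub : Icc 0 t ⊆ Icc 0 T := Icc_subset_Icc_right ht.2
    have j : IntervalIntegrable (fun s => evo 1 s (F s)) volume 0 t :=
      (intervalIntegrable_iff_integrableOn_Icc_of_le ht.1).2 (hi.mono_set hsub)
    have j' : IntervalIntegrable (fun s => transposeL (evo 1 s (F s))) volume 0 t :=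
      (intervalIntegrable_iff_integrableOn_Icc_of_le ht.1).2 (hi'.mono_set hsub)
    rw [intervalIntegral.integral_sub j' j]
    have e1 : ∫ s in (0 : ℝ)..t, transposeL (evo 1 s (F s)) =
        transposeL (∫ s in (0 : ℝ)..t, evo 1 s (F s)) :=
      ContinuousLinearMap.intervalIntegral_comp_comm transposeL.toContinuousLinearMap j
    have d := hw.duhamel hh hF ht
    have d' := congrArg transposeL d
    rw [map_sub, map_smul, transposeL_apply, transpose_evo, hs t ht, d, transposeL_apply,
      hs 0 ⟨le_rfl, ht.1.trans ht.2⟩, sub_right_inj] at d'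
    have d2 := smul_right_injective Kernel Complex.I_ne_zero d'
    rw [e1, ← d2, sub_self]

/-- As for the transpose, except that the adjoint conjugates the factor `i` in Duhamel's formula. A
self-adjoint solution therefore has an anti-self-adjoint source. -/
theorem IsWeakSolution.adj_source {h F : ℝ → Kernel} (hw : IsWeakSolution (-1 : ℝ) T h F)
    (hh : ContinuousOn h (Icc 0 T)) (hF : IntegrableOn F (Icc 0 T))
    (hs : ∀ t ∈ Icc 0 T, adj (h t) = h t) :
    ∀ᵐ t ∂(volume.restrict (Icc 0 T)), adj (F t) = -F t := by
  let A : Kernel →L[ℝ] Kernel :=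
    (transposeL.toContinuousLinearMap.restrictScalars ℝ).comp starR
  have hA : ∀ a, A a = adj a := fun a => rfl
  have hi : IntegrableOn (fun s => evo (-1) s (F s)) (Icc 0 T) := integrableOn_evo (-1) hF
  have hi' : IntegrableOn (fun s => A (evo (-1) s (F s))) (Icc 0 T) := A.integrable_comp hi
  have h0 := ae_eq_zero_of_primitive
    (f := fun s => A (evo (-1) s (F s)) + evo (-1) s (F s)) (hi'.add hi) ?_
  · filter_upwards [h0] with t ht
    rw [hA, adj_evo] at ht
    refine (evo (-1) t).injective ?_
    rw [map_neg]
    exact eq_neg_of_add_eq_zero_left ht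
  · intro t ht
    have hsub : Icc 0 t ⊆ Icc 0 T := Icc_subset_Icc_right ht.2
    have j : IntervalIntegrable (fun s => evo (-1) s (F s)) volume 0 t :=
      (intervalIntegrable_iff_integrableOn_Icc_of_le ht.1).2 (hi.mono_set hsub)
    have j' : IntervalIntegrable (fun s => A (evo (-1) s (F s))) volume 0 t :=
      (intervalIntegrable_iff_integrableOn_Icc_of_le ht.1).2 (hi'.mono_set hsub)
    rw [intervalIntegral.integral_add j' j, ContinuousLinearMap.intervalIntegral_comp_comm A j]
    have d := hw.duhamel hh hF ht
    have d' := congrArg A d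
    rw [map_sub, hA, hA, hA, adj_smul, adj_evo, hs t ht, d,
      hs 0 ⟨le_rfl, ht.1.trans ht.2⟩, sub_right_inj] at d'
    have d2 : Complex.I • (adj (∫ s in (0 : ℝ)..t, evo (-1) s (F s))
        + ∫ s in (0 : ℝ)..t, evo (-1) s (F s)) = 0 := by
      rw [smul_add, d']
      simp
    rw [hA]
    exact (smul_eq_zero_iff_right Complex.I_ne_zero).1 d2

theorem integrableOn_bilinear {E F G : Type*} [NormedAddCommGroup E] [NormedSpace ℝ E]
    [NormedAddCommGroup F] [NormedSpace ℝ F] [NormedAddCommGroup G] [NormedSpace ℝ G]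
    (B : E →L[ℝ] F →L[ℝ] G) {f : ℝ → E} {g : ℝ → F} {T : ℝ} (hf : IntegrableOn f (Icc 0 T))
    (hg : ContinuousOn g (Icc 0 T)) : IntegrableOn (fun s => B (f s) (g s)) (Icc 0 T) := by
  obtain ⟨C, hC⟩ := isCompact_Icc.exists_bound_of_continuousOn hg
  have hm := B.aestronglyMeasurable_comp₂ hf.aestronglyMeasurable
    (hg.aestronglyMeasurable_of_isCompact isCompact_Icc measurableSet_Icc)
  refine (((Integrable.norm hf).const_mul ‖B‖).mul_const C).mono' hm ?_
  filter_upwards [ae_restrict_mem measurableSet_Icc] with s hs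
  exact (B.le_opNorm₂ _ _).trans (by gcongr; exact hC s hs)

theorem primitive_bilinear_self {E G : Type*} [NormedAddCommGroup E] [NormedSpace ℝ E]
    [CompleteSpace E] [NormedAddCommGroup G] [NormedSpace ℝ G] [CompleteSpace G]
    (B : E →L[ℝ] E →L[ℝ] G) {f f' : ℝ → E} {T : ℝ} (hf' : IntegrableOn f' (Icc 0 T))
    (hf : ∀ t ∈ Icc 0 T, f t = f 0 + ∫ s in (0 : ℝ)..t, f' s) {t : ℝ} (ht : t ∈ Icc 0 T) :
    B (f t) (f t) = B (f 0) (f 0) + ∫ s in (0 : ℝ)..t, (B (f' s) (f s) + B (f s) (f' s)) := by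
  have hi := hf'.mono_set (Ioc_subset_Icc_self.trans (Icc_subset_Icc_right ht.2))
  have key := bilinear_primitive B (f 0) (f 0) ht.1 hi hi
  rw [← hf t ht] at key
  rw [key]
  congr 1
  refine intervalIntegral.integral_congr fun s hs => ?_
  rw [uIcc_of_le ht.1] at hs
  simp only [← hf s ⟨hs.1, hs.2.trans ht.2⟩]

theorem continuousOn_evo_comp (r : ℝ) {h : ℝ → Kernel} {s : Set ℝ} (hh : ContinuousOn h s) :
    ContinuousOn (fun t => evo r t (h t)) s :=
  Continuous.comp_continuousOn (g := fun q : ℝ × Kernel => evo r q.1 q.2)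
    (f := fun t : ℝ => (t, h t)) (continuous_evo r) (continuousOn_id.prodMk hh)

/-- Differentiates `P² + 2 P = S(U, U)` along primitives of integrable functions. The bilinear maps
are over `ℝ` because the intended `S` contains a complex conjugation. -/
theorem ae_derivative_of_quadratic_identity {E : Type*} [NormedAddCommGroup E] [NormedSpace ℝ E]
    [CompleteSpace E] (B S : E →L[ℝ] E →L[ℝ] E) {P P' U U' : ℝ → E} {T : ℝ}
    (hP'i : IntegrableOn P' (Icc 0 T)) (hU'i : IntegrableOn U' (Icc 0 T))
    (hPc : ContinuousOn P (Icc 0 T)) (hUc : ContinuousOn U (Icc 0 T))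
    (hP : ∀ t ∈ Icc 0 T, P t = P 0 + ∫ s in (0 : ℝ)..t, P' s)
    (hU : ∀ t ∈ Icc 0 T, U t = U 0 + ∫ s in (0 : ℝ)..t, U' s)
    (hid : ∀ t ∈ Icc 0 T, B (P t) (P t) + P t + P t = S (U t) (U t)) :
    ∀ᵐ t ∂(volume.restrict (Icc 0 T)), (B (P' t) (P t) + B (P t) (P' t)) + P' t + P' t
      - (S (U' t) (U t) + S (U t) (U' t)) = 0 := by
  have i1 : IntegrableOn (fun s => B (P' s) (P s) + B (P s) (P' s)) (Icc 0 T) :=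
    (integrableOn_bilinear B hP'i hPc).add (integrableOn_bilinear B.flip hP'i hPc)
  have i2 : IntegrableOn (fun s => S (U' s) (U s) + S (U s) (U' s)) (Icc 0 T) :=
    (integrableOn_bilinear S hU'i hUc).add (integrableOn_bilinear S.flip hU'i hUc)
  refine ae_eq_zero_of_primitive (((i1.add hP'i).add hP'i).sub i2) fun t ht => ?_
  have hsub : Icc 0 t ⊆ Icc 0 T := Icc_subset_Icc_right ht.2
  have e1 := primitive_bilinear_self B hP'i hP ht
  have e2 := primitive_bilinear_self S hU'i hU ht
  have j1 := (intervalIntegrable_iff_integrableOn_Icc_of_le ht.1).2 (i1.mono_set hsub)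
  have j2 := (intervalIntegrable_iff_integrableOn_Icc_of_le ht.1).2 (i2.mono_set hsub)
  have j3 := (intervalIntegrable_iff_integrableOn_Icc_of_le ht.1).2 (hP'i.mono_set hsub)
  rw [intervalIntegral.integral_sub ((j1.add j3).add j3) j2,
    intervalIntegral.integral_add (j1.add j3) j3, intervalIntegral.integral_add j1 j3]
  have e3 := hid t ht
  have e4 := hid 0 ⟨le_rfl, ht.1.trans ht.2⟩
  rw [e1, e2, ← e4] at e3
  have e6 : ∫ s in (0 : ℝ)..t, P' s = P t - P 0 := by rw [hP t ht]; abel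
  rw [e6, ← sub_eq_zero.2 e3]
  abel

/-- The quadratic identity is transported by the free flow, where the derivatives are `-i evo F` and
`-i evo G`. Conjugation turns `-i` into `i` in the second product, hence the minus sign on the
right; then the common factor and `evo (-1)` are removed. -/
theorem ae_derivative_identity {u p F G : ℝ → Kernel} (hu : IsWeakSolution (1 : ℝ) T u F)
    (hp : IsWeakSolution (-1 : ℝ) T p G) (huc : ContinuousOn u (Icc 0 T))
    (hpc : ContinuousOn p (Icc 0 T)) (hF : IntegrableOn F (Icc 0 T))
    (hG : IntegrableOn G (Icc 0 T))
    (hid : ∀ t ∈ Icc 0 T, p t * p t + p t + p t = u t * star (u t)) :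
    ∀ᵐ t ∂(volume.restrict (Icc 0 T)),
      G t * p t + p t * G t + G t + G t = F t * star (u t) - u t * star (F t) := by
  have h0 := ae_derivative_of_quadratic_identity mulR (mulR.bilinearComp (.id ℝ Kernel) starR)
    (P := fun t => evo (-1) t (p t)) (P' := fun t => (-Complex.I) • evo (-1) t (G t))
    (U := fun t => evo 1 t (u t)) (U' := fun t => (-Complex.I) • evo 1 t (F t))
    (T := T) ((integrableOn_evo (-1) hG).smul (-Complex.I))
    ((integrableOn_evo 1 hF).smul (-Complex.I)) (continuousOn_evo_comp (-1) hpc)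
    (continuousOn_evo_comp 1 huc)
    (fun t ht => by rw [hp.evo_eq hpc hG ht, evo_zero])
    (fun t ht => by rw [hu.evo_eq huc hF ht, evo_zero])
    (fun t ht => by
      change evo (-1) t (p t) * evo (-1) t (p t) + evo (-1) t (p t) + evo (-1) t (p t) =
        evo 1 t (u t) * star (evo 1 t (u t))
      rw [evo_mul, evo_mul_star, ← hid t ht, map_add, map_add])
  filter_upwards [h0] with t ht
  refine (evo (-1) t).injective ?_
  rw [map_sub, ← evo_mul_star, ← evo_mul_star, map_add, map_add, map_add, ← evo_mul, ← evo_mul]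
  change ((-Complex.I) • evo (-1) t (G t)) * evo (-1) t (p t)
    + evo (-1) t (p t) * ((-Complex.I) • evo (-1) t (G t))
    + (-Complex.I) • evo (-1) t (G t) + (-Complex.I) • evo (-1) t (G t)
    - (((-Complex.I) • evo 1 t (F t)) * star (evo 1 t (u t))
      + evo 1 t (u t) * star ((-Complex.I) • evo 1 t (F t))) = 0 at ht
  rw [star_smul_Lp] at ht
  simp only [smul_mul_kernel, mul_smul_kernel] at ht
  have h1 : (-Complex.I) • ((evo (-1) t (G t) * evo (-1) t (p t)
      + evo (-1) t (p t) * evo (-1) t (G t) + evo (-1) t (G t) + evo (-1) t (G t))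
      - (evo 1 t (F t) * star (evo 1 t (u t)) - evo 1 t (u t) * star (evo 1 t (F t)))) = 0 := by
    rw [← ht]
    simp only [map_neg, Complex.conj_I]
    module
  exact sub_eq_zero.1 ((smul_eq_zero_iff_right (neg_ne_zero.2 Complex.I_ne_zero)).1 h1)

end

/-! ### Lower order terms of the kernel equation -/

section Multiplication

variable {V : R3 → ℝ} (hV : MemLp V ∞ volume)

theorem memLp_top_complex_fst {V : R3 → ℝ} (hV : MemLp V ∞ volume) :
    MemLp (fun z : R3 × R3 => (V z.1 : ℂ)) ∞ volume := by
  have h1 : MemLp (fun x => (V x : ℂ)) ∞ volume := hV.ofReal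
  refine memLp_top_of_bound (h1.1.comp_fst) (lpNorm (fun x => (V x : ℂ)) ∞ volume) ?_
  exact ae_fst (ae_le_lpNorm_exponent_top h1)

theorem memLp_mulFst {V : R3 → ℝ} (hV : MemLp V ∞ volume) (a : Kernel) :
    MemLp (fun z => (V z.1 : ℂ) * a z) 2 volume :=
  (Lp.memLp a).mul (memLp_top_complex_fst hV)

/-- Multiplication of a kernel by `V(x)`. -/
def mulFst (a : Kernel) : Kernel := (memLp_mulFst hV a).toLp

/-- Multiplication of a kernel by `V(y)`. -/
def mulSnd (a : Kernel) : Kernel := transpose (mulFst hV (transpose a))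

theorem coeFn_mulFst (a : Kernel) : mulFst hV a =ᵐ[volume] fun z => (V z.1 : ℂ) * a z :=
  MemLp.coeFn_toLp _

theorem coeFn_mulSnd (a : Kernel) : mulSnd hV a =ᵐ[volume] fun z => (V z.2 : ℂ) * a z := by
  filter_upwards [coeFn_transpose (mulFst hV (transpose a)), ae_swap (coeFn_mulFst hV (transpose a)),
    ae_swap (coeFn_transpose a)] with z h1 h2 h3
  rw [mulSnd, h1, h2, h3, Prod.swap_swap, Prod.fst_swap]

theorem transpose_mulFst (a : Kernel) : transpose (mulFst hV a) = mulSnd hV (transpose a) := by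
  rw [mulSnd, transpose_transpose]

theorem transpose_mulSnd (a : Kernel) : transpose (mulSnd hV a) = mulFst hV (transpose a) := by
  rw [mulSnd, transpose_transpose]

theorem star_mulFst (a : Kernel) : star (mulFst hV a) = mulFst hV (star a) := by
  refine Lp.ext ?_
  filter_upwards [Lp.coeFn_star (mulFst hV a), coeFn_mulFst hV a, coeFn_mulFst hV (star a),
    Lp.coeFn_star a] with z h1 h2 h3 h4
  rw [h1, Pi.star_apply, h2, h3, h4, Pi.star_apply]
  simp

theorem star_mulSnd (a : Kernel) : star (mulSnd hV a) = mulSnd hV (star a) := by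
  rw [mulSnd, mulSnd, ← transpose_star, star_mulFst, transpose_star]

theorem adj_mulFst (a : Kernel) : adj (mulFst hV a) = mulSnd hV (adj a) := by
  rw [adj, star_mulFst, transpose_mulFst]; rfl

theorem adj_mulSnd (a : Kernel) : adj (mulSnd hV a) = mulFst hV (adj a) := by
  rw [adj, star_mulSnd, transpose_mulSnd]; rfl

theorem mulFst_add (a b : Kernel) : mulFst hV (a + b) = mulFst hV a + mulFst hV b := by
  refine Lp.ext ?_
  filter_upwards [coeFn_mulFst hV (a + b), coeFn_mulFst hV a, coeFn_mulFst hV b,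
    Lp.coeFn_add a b, Lp.coeFn_add (mulFst hV a) (mulFst hV b)] with z h1 h2 h3 h4 h5
  rw [h1, h5, h4, Pi.add_apply, Pi.add_apply, h2, h3, mul_add]

theorem mulSnd_add (a b : Kernel) : mulSnd hV (a + b) = mulSnd hV a + mulSnd hV b := by
  simp only [mulSnd, ← transposeL_apply, map_add, mulFst_add]

theorem mulFst_mul (a b : Kernel) : mulFst hV (a * b) = mulFst hV a * b := by
  refine Lp.ext ?_
  filter_upwards [coeFn_mulFst hV (a * b), coeFn_comp a b, coeFn_comp (mulFst hV a) b,
    kcomp_congr_ae (coeFn_mulFst hV a) (Filter.EventuallyEq.refl _ (b : R3 × R3 → ℂ))]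
    with z h1 h2 h3 h4
  rw [h1, mul_def, mul_def, h2, h3, h4, kcomp, kcomp, ← integral_const_mul]
  simp only [mul_assoc]

/-- A potential acting at the intermediate variable belongs equally to either factor. -/
theorem mul_mulFst (a b : Kernel) : a * mulFst hV b = mulSnd hV a * b := by
  refine Lp.ext ?_
  filter_upwards [coeFn_comp a (mulFst hV b), coeFn_comp (mulSnd hV a) b,
    kcomp_congr_ae (coeFn_mulSnd hV a) (Filter.EventuallyEq.refl _ (b : R3 × R3 → ℂ)),
    kcomp_congr_ae (Filter.EventuallyEq.refl _ (a : R3 × R3 → ℂ)) (coeFn_mulFst hV b)]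
    with z h1 h2 h3 h4
  rw [mul_def, mul_def, h1, h2, h3, h4, kcomp, kcomp]
  refine integral_congr_ae (Filter.Eventually.of_forall fun w => ?_)
  ring

theorem mulSnd_mul (a b : Kernel) : mulSnd hV (a * b) = a * mulSnd hV b := by
  rw [mulSnd, transpose_mul, mulFst_mul, transpose_mul, transpose_transpose]; rfl

theorem inner_mulFst (a b : Kernel) : ⟪mulFst hV a, b⟫_ℂ = ⟪a, mulFst hV b⟫_ℂ := by
  rw [L2.inner_def, L2.inner_def]
  refine integral_congr_ae ?_
  filter_upwards [coeFn_mulFst hV a, coeFn_mulFst hV b] with z h1 h2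
  rw [h1, h2]
  simp only [RCLike.inner_apply, map_mul, Complex.conj_ofReal]
  ring

theorem inner_mulSnd (a b : Kernel) : ⟪mulSnd hV a, b⟫_ℂ = ⟪a, mulSnd hV b⟫_ℂ := by
  rw [L2.inner_def, L2.inner_def]
  refine integral_congr_ae ?_
  filter_upwards [coeFn_mulSnd hV a, coeFn_mulSnd hV b] with z h1 h2
  rw [h1, h2]
  simp only [RCLike.inner_apply, map_mul, Complex.conj_ofReal]
  ring

end Multiplication

section LowerOrder

variable {V : R3 → ℝ} (hV : MemLp V ∞ volume) (w : Kernel)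

/-- The kernel `A u + u Aᵀ` for the operator `A = w + V`. -/
def symPart (u : Kernel) : Kernel := w * u + u * transpose w + (mulFst hV u + mulSnd hV u)

/-- The commutator `[A, p]` with the operator `A = w + V`. -/
def commPart (p : Kernel) : Kernel := w * p - p * w + (mulFst hV p - mulSnd hV p)

variable {w}

theorem adj_sub (a b : Kernel) : adj (a - b) = adj a - adj b :=
  map_sub (AddMonoidHom.mk' adj adj_add) a b

theorem transpose_symPart {u : Kernel} (hu : transpose u = u) :
    transpose (symPart hV w u) = symPart hV w u := by
  simp only [symPart, ← transposeL_apply, map_add]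
  simp only [transposeL_apply, transpose_mul, transpose_mulFst, transpose_mulSnd, hu,
    transpose_transpose]
  abel

theorem adj_commPart (hw : adj w = w) {p : Kernel} (hp : adj p = p) :
    adj (commPart hV w p) = -commPart hV w p := by
  simp only [commPart, adj_add, adj_sub, adj_mul, adj_mulFst, adj_mulSnd, hw, hp]
  abel

/-- For self-adjoint `A` the map `u ↦ A u + u Aᵀ` is symmetric, so the lower-order terms do not
affect the growth of `‖u‖`. -/
theorem im_inner_symPart (hw : adj w = w) (u : Kernel) : (⟪u, symPart hV w u⟫_ℂ).im = 0 := by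
  have hw' : adj (transpose w) = transpose w := by
    rw [adj, ← transpose_star]; exact congrArg transpose hw
  have : ⟪u, symPart hV w u⟫_ℂ = ⟪symPart hV w u, u⟫_ℂ := by
    simp only [symPart, inner_add_left, inner_add_right, mul_def, inner_comp_left w, hw,
      inner_comp_right u (transpose w), hw', inner_mulFst, inner_mulSnd]
  rw [← inner_conj_symm] at this
  have h2 := congrArg Complex.im this
  rw [Complex.conj_im] at h2
  have h3 : (⟪symPart hV w u, u⟫_ℂ).im = 0 := by linarith
  rw [← inner_conj_symm, this]
  exact h3

/-- Both sides are `[A, (1 + p)²] = [A, u ū]`: the left by the Leibniz rule, the right because `Aᵀ`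
is the complex conjugate of `A`. Adding the lower-order terms to `F` and `G` thus preserves the
differentiated identity. -/
theorem commPart_identity (hw : adj w = w) {u p : Kernel} (hid : p * p + p + p = u * star u) :
    commPart hV w p * p + p * commPart hV w p + commPart hV w p + commPart hV w p =
      symPart hV w u * star u - u * star (symPart hV w u) := by
  have hw' : transpose w = star w := by
    have h := congrArg transpose hw
    rw [adj, transpose_transpose] at h
    exact h.symm
  have hl : mulFst hV (p * p) + mulFst hV p + mulFst hV p = mulFst hV u * star u := by
    rw [← mulFst_mul, ← hid, mulFst_add, mulFst_add]
  have hr : mulSnd hV (p * p) + mulSnd hV p + mulSnd hV p = u * mulSnd hV (star u) := by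
    rw [← mulSnd_mul, ← hid, mulSnd_add, mulSnd_add]
  rw [mulFst_mul] at hl
  rw [mulSnd_mul] at hr
  have hmix := mul_mulFst hV p p
  have hmix' := mul_mulFst hV u (star u)
  simp only [commPart, symPart, star_add_Lp, star_mul_kernel, star_mulFst, star_mulSnd, hw',
    star_star]
  linear_combination (norm := noncomm_ring) w * hid - hid * w + hl - hr + hmix + hmix'

end LowerOrder

/-! ### The pair equation as an identity between Hilbert–Schmidt kernels. -/

theorem coeFn_toLp_swap {f : R3 × R3 → ℂ} (hf : MemLp f 2 volume) :
    transpose hf.toLp =ᵐ[volume] fun z => f z.swap := by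
  filter_upwards [coeFn_transpose hf.toLp, ae_swap hf.coeFn_toLp] with z h1 h2
  rw [h1, h2]

theorem coeFn_star_toLp {f : R3 × R3 → ℂ} (hf : MemLp f 2 volume) :
    (star hf.toLp : Kernel) =ᵐ[volume] fun z => conj (f z) := by
  filter_upwards [Lp.coeFn_star hf.toLp, hf.coeFn_toLp] with z h1 h2
  rw [h1, Pi.star_apply, h2]; rfl

section FixedTime

variable {v : R3 → ℝ} {f : R3 → ℂ}

theorem adj_wKernel (hev : ∀ x, v (-x) = v x) (hw : MemLp (wKernel v f) 2 volume) :
    adj hw.toLp = hw.toLp := by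
  refine Lp.ext ?_
  filter_upwards [coeFn_transpose (star hw.toLp), ae_swap (coeFn_star_toLp hw), hw.coeFn_toLp]
    with z h1 h2 h3
  rw [adj, h1, h2, h3]
  simp only [wKernel, Prod.fst_swap, Prod.snd_swap, map_mul, Complex.conj_ofReal, Complex.conj_conj]
  rw [← hev, neg_sub]; ring

theorem transpose_mKernel (hev : ∀ x, v (-x) = v x) (hm : MemLp (mKernel v f) 2 volume) :
    transpose hm.toLp = hm.toLp := by
  refine Lp.ext ?_
  filter_upwards [coeFn_toLp_swap hm, hm.coeFn_toLp] with z h1 h2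
  rw [h1, h2]
  simp only [mKernel, Prod.fst_swap, Prod.snd_swap]
  rw [← hev, neg_sub]; ring

theorem coeFn_symPart (hV : MemLp (meanField v f) ∞ volume) (hw : MemLp (wKernel v f) 2 volume)
    (u : Kernel) : symPart hV hw.toLp u =ᵐ[volume] lowerS v f u := by
  unfold symPart
  filter_upwards [Lp.coeFn_add (hw.toLp * u + u * transpose hw.toLp) (mulFst hV u + mulSnd hV u),
    Lp.coeFn_add (hw.toLp * u) (u * transpose hw.toLp), Lp.coeFn_add (mulFst hV u) (mulSnd hV u),
    coeFn_comp hw.toLp u, coeFn_comp u (transpose hw.toLp), coeFn_mulFst hV u, coeFn_mulSnd hV u,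
    kcomp_congr_ae hw.coeFn_toLp (Filter.EventuallyEq.refl _ (u : R3 × R3 → ℂ)),
    kcomp_congr_ae (Filter.EventuallyEq.refl _ (u : R3 × R3 → ℂ)) (coeFn_toLp_swap hw)]
    with z h1 h2 h3 h4 h5 h6 h7 h8 h9
  rw [h1, Pi.add_apply, h2, h3, Pi.add_apply, Pi.add_apply, mul_def, mul_def, h4, h5, h6, h7, h8,
    h9, lowerS]
  ring

theorem coeFn_commPart (hV : MemLp (meanField v f) ∞ volume) (hw : MemLp (wKernel v f) 2 volume)
    (p : Kernel) : commPart hV hw.toLp p =ᵐ[volume] lowerW v f p := by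
  unfold commPart
  filter_upwards [Lp.coeFn_add (hw.toLp * p - p * hw.toLp) (mulFst hV p - mulSnd hV p),
    Lp.coeFn_sub (hw.toLp * p) (p * hw.toLp), Lp.coeFn_sub (mulFst hV p) (mulSnd hV p),
    coeFn_comp hw.toLp p, coeFn_comp p hw.toLp, coeFn_mulFst hV p, coeFn_mulSnd hV p,
    kcomp_congr_ae hw.coeFn_toLp (Filter.EventuallyEq.refl _ (p : R3 × R3 → ℂ)),
    kcomp_congr_ae (Filter.EventuallyEq.refl _ (p : R3 × R3 → ℂ)) hw.coeFn_toLp]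
    with z h1 h2 h3 h4 h5 h6 h7 h8 h9
  rw [h1, Pi.add_apply, h2, h3, Pi.sub_apply, Pi.sub_apply, mul_def, mul_def, h4, h5, h6, h7, h8,
    h9, lowerW]
  ring

/-- `F` and `S` differ by `symPart`, whose inner product with `u` is real, so the imaginary part
sees only `S`, to which `norm_source_le` applies. -/
theorem abs_im_inner_source_le (hev : ∀ x, v (-x) = v x) (hV : MemLp (meanField v f) ∞ volume)
    (hw : MemLp (wKernel v f) 2 volume) (hm : MemLp (mKernel v f) 2 volume) {k F G ρ : Kernel}
    (hk : transpose k = k) (hF : transpose F = F) (hG : adj G = -G)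
    (hder : G * pch k + pch k * G + G + G = F * star (sh k) - sh k * star F)
    (hρ : IsInverseKernel (pch k) ρ)
    (heq : let u : R3 × R3 → ℂ := sh k
      let p : R3 × R3 → ℂ := pch k
      let m : R3 × R3 → ℂ := mKernel v f
      let S : R3 × R3 → ℂ := F + lowerS v f u
      let W : R3 × R3 → ℂ := G + lowerW v f p
      let Y : R3 × R3 → ℂ := W + kcomp u (fun z => conj (m z))
      S - (m + kcomp p m) =ᵐ[volume] kcomp (Y + kcomp Y ρ) u) :
    |(⟪sh k, F⟫_ℂ).im| ≤ ‖sh k‖ * (‖hm.toLp‖ * (1 + 4 * ‖sh k‖)) := by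
  have haw := adj_wKernel hev hw
  set w := hw.toLp with hwdef
  set m := hm.toLp with hmdef
  set u := sh k with hu
  set p := pch k with hp
  have hid : p * p + p + p = u * star u := pch_mul_pch k
  have hut : transpose u = u := transpose_sh hk
  have hpa : adj p = p := adj_pch hk
  set S := F + symPart hV w u with hS
  set W := G + commPart hV w p with hW
  -- The hypothesis is an almost everywhere equality of functions. Its terms are matched one by one
  -- with elements of the ring `Kernel`.
  have cS : S =ᵐ[volume] ⇑F + lowerS v f u :=
    (Lp.coeFn_add F _).trans ((Filter.EventuallyEq.refl _ (F : R3 × R3 → ℂ)).add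
      (coeFn_symPart hV hw u))
  have cW : W =ᵐ[volume] ⇑G + lowerW v f p :=
    (Lp.coeFn_add G _).trans ((Filter.EventuallyEq.refl _ (G : R3 × R3 → ℂ)).add
      (coeFn_commPart hV hw p))
  have cum : (u * star m : Kernel) =ᵐ[volume] kcomp u (fun z => conj (mKernel v f z)) :=
    (coeFn_comp u (star m)).trans
      (kcomp_congr_ae (Filter.EventuallyEq.refl _ _) (coeFn_star_toLp hm))
  have cY : (W + u * star m : Kernel) =ᵐ[volume]
      (⇑G + lowerW v f p) + kcomp u (fun z => conj (mKernel v f z)) :=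
    (Lp.coeFn_add _ _).trans (cW.add cum)
  have cYρ : ((W + u * star m) * ρ : Kernel) =ᵐ[volume]
      kcomp ((⇑G + lowerW v f p) + kcomp u (fun z => conj (mKernel v f z))) ρ :=
    (coeFn_comp _ ρ).trans (kcomp_congr_ae cY (Filter.EventuallyEq.refl _ _))
  have cR : (((W + u * star m) + (W + u * star m) * ρ) * u : Kernel) =ᵐ[volume]
      kcomp (((⇑G + lowerW v f p) + kcomp u (fun z => conj (mKernel v f z)))
        + kcomp ((⇑G + lowerW v f p) + kcomp u (fun z => conj (mKernel v f z))) ρ) u :=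
    (coeFn_comp _ u).trans (kcomp_congr_ae ((Lp.coeFn_add _ _).trans (cY.add cYρ))
      (Filter.EventuallyEq.refl _ _))
  have cpm : (p * m : Kernel) =ᵐ[volume] kcomp p (mKernel v f) :=
    (coeFn_comp p m).trans (kcomp_congr_ae (Filter.EventuallyEq.refl _ _) hm.coeFn_toLp)
  have cL : (S - (m + p * m) : Kernel) =ᵐ[volume]
      (⇑F + lowerS v f u) - (mKernel v f + kcomp p (mKernel v f)) :=
    (Lp.coeFn_sub _ _).trans (cS.sub ((Lp.coeFn_add _ _).trans (hm.coeFn_toLp.add cpm)))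
  have hkey : S - (m + p * m) = ((W + u * star m) + (W + u * star m) * ρ) * u :=
    Lp.ext (cL.trans (Filter.EventuallyEq.trans heq cR.symm))
  have hST : transpose S = S := by
    have := transpose_symPart hV (w := w) hut
    rw [← transposeL_apply] at this hF ⊢
    rw [hS, map_add, this, hF]
  have hWa : adj W = -W := by
    rw [hW, adj_add, hG, adj_commPart hV haw hpa, neg_add]
  have hder' : W * p + p * W + W + W = S * star u - u * star S := by
    have h1 := commPart_identity hV haw hid
    rw [hW, hS, star_add_Lp]
    linear_combination (norm := noncomm_ring) h1 + hder
  have hbound := norm_source_le hut hpa (re_inner_pch_mul_nonneg hk) hid hρ.1 hρ.2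
    (transpose_mKernel hev hm) hWa hST hder' hkey
  have hFS : (⟪u, F⟫_ℂ).im = (⟪u, S⟫_ℂ).im := by
    rw [hS, inner_add_right, Complex.add_im, im_inner_symPart hV haw, add_zero]
  rw [hFS]
  calc |(⟪u, S⟫_ℂ).im| ≤ ‖⟪u, S⟫_ℂ‖ := Complex.abs_im_le_norm _
    _ ≤ ‖u‖ * ‖S‖ := norm_inner_le_norm _ _
    _ ≤ _ := by gcongr

end FixedTime

/-! ### Growth of the pair excitation kernel -/

/-- Let `R` be the right-hand side of the integral inequality. Then `R' = β y ≤ β R`, so `R exp(-B)`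
is nonincreasing. No sign of `y` or `A` is needed, and the primitive `B` is left free so that it can
be explicit. -/
theorem le_mul_exp_of_le_add_integral {a b A : ℝ} {y β B : ℝ → ℝ} (hy : ContinuousOn y (Icc a b))
    (hβ : ContinuousOn β (Icc a b)) (hβ0 : ∀ t ∈ Icc a b, 0 ≤ β t)
    (hBc : ContinuousOn B (Icc a b)) (hB : ∀ t ∈ Ioo a b, HasDerivAt B (β t) t)
    (h : ∀ t ∈ Icc a b, y t ≤ A + ∫ s in a..t, β s * y s) {t : ℝ} (ht : t ∈ Icc a b) :
    y t ≤ A * Real.exp (B t - B a) := by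
  have hab : a ≤ b := ht.1.trans ht.2
  have hc : ContinuousOn (fun s => β s * y s) (Icc a b) := hβ.mul hy
  let R : ℝ → ℝ := fun t => A + ∫ s in a..t, β s * y s
  have hRd : ∀ t ∈ Ioo a b, HasDerivAt R (β t * y t) t := fun s hs => by
    refine HasDerivAt.const_add A ?_
    refine intervalIntegral.integral_hasDerivAt_right ?_
      ((hc.mono Ioo_subset_Icc_self).stronglyMeasurableAtFilter isOpen_Ioo s hs)
      (hc.continuousAt (Icc_mem_nhds hs.1 hs.2))
    refine ContinuousOn.intervalIntegrable ?_
    rw [uIcc_of_le hs.1.le]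
    exact hc.mono (Icc_subset_Icc_right hs.2.le)
  have hRc : ContinuousOn R (Icc a b) := by
    refine continuousOn_const.add ?_
    have := intervalIntegral.continuousOn_primitive_interval (a := a) (b := b) (μ := volume)
      (f := fun s => β s * y s) (by rw [uIcc_of_le hab]; exact hc.integrableOn_Icc)
    rwa [uIcc_of_le hab] at this
  have hanti : AntitoneOn (fun t => R t * Real.exp (-B t)) (Icc a b) := by
    refine antitoneOn_of_deriv_nonpos (convex_Icc a b)
      (hRc.mul (Real.continuous_exp.comp_continuousOn hBc.neg)) ?_ ?_
    · rw [interior_Icc]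
      exact fun s hs =>
        ((hRd s hs).mul ((hB s hs).neg.exp)).differentiableAt.differentiableWithinAt
    · rw [interior_Icc]
      intro s hs
      have hd : HasDerivAt (fun t => R t * Real.exp (-B t)) _ s := (hRd s hs).mul ((hB s hs).neg.exp)
      rw [hd.deriv]
      have h1 := mul_le_mul_of_nonneg_left (h s (Ioo_subset_Icc_self hs))
        (hβ0 s (Ioo_subset_Icc_self hs))
      have h2 : (β s * y s - β s * R s) * Real.exp (-B s) ≤ 0 :=
        mul_nonpos_of_nonpos_of_nonneg (sub_nonpos.2 h1) (Real.exp_pos _).le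
      simp only [Pi.neg_apply]
      linarith
  have h1 := hanti ⟨le_rfl, hab⟩ ht ht.1
  have h2 : R a = A := by simp [R]
  simp only [h2] at h1
  refine (h t ht).trans ?_
  have h3 : R t = R t * Real.exp (-B t) * Real.exp (B t) := by
    rw [mul_assoc, ← Real.exp_add, neg_add_cancel, Real.exp_zero, mul_one]
  change R t ≤ _
  rw [h3, sub_eq_add_neg, add_comm, Real.exp_add, ← mul_assoc]
  gcongr

theorem IsPairSolution.norm_sq_le {v : R3 → ℝ} {φ : ℝ → R3 → ℂ} {T C : ℝ} {k : ℝ → Kernel}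
    (hev : ∀ x, v (-x) = v x) (hC : 0 ≤ C) (hT : 0 ≤ T)
    (hV : ∀ t, 0 ≤ t → MemLp (meanField v (φ t)) ∞ volume)
    (hw : ∀ t, 0 ≤ t → MemLp (wKernel v (φ t)) 2 volume)
    (hm : ∀ t, 0 ≤ t → MemLp (mKernel v (φ t)) 2 volume)
    (hN : ∀ t (ht : 0 ≤ t), ‖(hm t ht).toLp‖ ≤ C * (1 + t) ^ (-(3 / 2) : ℝ))
    (hk : IsPairSolution v φ T k) :
    1 + ‖sh (k T)‖ ^ 2 ≤ (1 + ‖sh (k 0)‖ ^ 2) * Real.exp (18 * C) := by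
  obtain ⟨hkc, hks, F, G, hF, hG, hwF, hwG, heq⟩ := hk
  have huc : ContinuousOn (fun t => sh (k t)) (Icc 0 T) := continuous_sh.comp_continuousOn hkc
  have hpc : ContinuousOn (fun t => pch (k t)) (Icc 0 T) := continuous_pch.comp_continuousOn hkc
  have hwF' : IsWeakSolution ((1 : ℝ) : ℂ) T (fun t => sh (k t)) F := by
    rwa [Complex.ofReal_one]
  have hwG' : IsWeakSolution ((-1 : ℝ) : ℂ) T (fun t => pch (k t)) G := by
    rwa [Complex.ofReal_neg, Complex.ofReal_one]
  have hFt := hwF'.transpose_source huc hF fun t ht => transpose_sh (hks t ht)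
  have hGa := hwG'.adj_source hpc hG fun t ht => adj_pch (hks t ht)
  have hder := ae_derivative_identity hwF' hwG' huc hpc hF hG fun t _ => pch_mul_pch (k t)
  let N : ℝ → ℝ := fun t => C * (1 + t) ^ (-(3 / 2) : ℝ)
  have hN0 : ∀ t, 0 ≤ t → 0 ≤ N t := fun t ht => by positivity
  have hNc : ContinuousOn (fun t => 9 * N t) (Icc 0 T) := by
    refine continuousOn_const.mul (continuousOn_const.mul ?_)
    exact ContinuousOn.rpow_const (by fun_prop) fun t ht => Or.inl (by linarith [ht.1])
  -- The constant 9 comes from `2 x (1 + 4 x) = 2 x + 8 x² ≤ 9 (1 + x²)`.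
  have hbound : ∀ᵐ t ∂(volume.restrict (Icc 0 T)),
      2 * (⟪sh (k t), F t⟫_ℂ).im ≤ 9 * N t * (1 + ‖sh (k t)‖ ^ 2) := by
    filter_upwards [hFt, hGa, hder, heq, ae_restrict_mem measurableSet_Icc] with t h1 h2 h3 h4 ht
    obtain ⟨ρ, hρ, h4⟩ := h4
    have h5 := abs_im_inner_source_le hev (hV t ht.1) (hw t ht.1) (hm t ht.1) (hks t ht) h1 h2 h3
      hρ h4
    have h6 := (le_abs_self _).trans h5
    have h7 := hN t ht.1
    have h8 := hN0 t ht.1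
    change _ ≤ N t at h7
    have hn := norm_nonneg (sh (k t))
    calc 2 * (⟪sh (k t), F t⟫_ℂ).im
        ≤ 2 * (‖sh (k t)‖ * (‖(hm t ht.1).toLp‖ * (1 + 4 * ‖sh (k t)‖))) := by linarith
      _ ≤ 2 * (‖sh (k t)‖ * (N t * (1 + 4 * ‖sh (k t)‖))) := by gcongr
      _ = N t * (2 * ‖sh (k t)‖ + 8 * ‖sh (k t)‖ ^ 2) := by ring
      _ ≤ N t * (9 * (1 + ‖sh (k t)‖ ^ 2)) := by
        gcongr
        nlinarith [sq_nonneg (‖sh (k t)‖ - 1)]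
      _ = _ := by ring
  have hyc : ContinuousOn (fun t => 1 + ‖sh (k t)‖ ^ 2) (Icc 0 T) :=
    continuousOn_const.add (huc.norm.pow 2)
  have hi : IntegrableOn (fun t => 2 * (⟪sh (k t), F t⟫_ℂ).im) (Icc 0 T) := by
    have h1 := integrableOn_bilinear (innerSL ℝ).flip (hF.smul (-Complex.I)) huc
    refine (Integrable.const_mul h1 2).congr (Filter.Eventually.of_forall fun t => ?_)
    change 2 * ⟪sh (k t), (-Complex.I) • F t⟫_ℝ = _
    rw [real_inner_eq_re, inner_smul_right]
    simp
  have hineq : ∀ t ∈ Icc 0 T, 1 + ‖sh (k t)‖ ^ 2 ≤ (1 + ‖sh (k 0)‖ ^ 2)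
      + ∫ s in (0 : ℝ)..t, 9 * N s * (1 + ‖sh (k s)‖ ^ 2) := by
    intro t ht
    have hsub : Icc 0 t ⊆ Icc 0 T := Icc_subset_Icc_right ht.2
    rw [hwF'.norm_sq huc hF ht, add_assoc]
    gcongr
    refine intervalIntegral.integral_mono_ae_restrict ht.1
      ((intervalIntegrable_iff_integrableOn_Icc_of_le ht.1).2 (hi.mono_set hsub)) ?_
      (ae_restrict_of_ae_restrict_of_subset hsub hbound)
    refine ContinuousOn.intervalIntegrable ?_
    rw [uIcc_of_le ht.1]
    exact (hNc.mul hyc).mono hsub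
  -- An explicit primitive of `9 C (1 + t)^{-3/2}`. Its increase over `[0, ∞)` is `18 C`, so the
  -- final bound does not depend on `T`.
  let B : ℝ → ℝ := fun t => -(18 * C) * (1 + t) ^ (-(1 / 2) : ℝ)
  have hBc : ContinuousOn B (Icc 0 T) :=
    continuousOn_const.mul (ContinuousOn.rpow_const (by fun_prop)
      fun t ht => Or.inl (by linarith [ht.1]))
  have hB : ∀ t ∈ Ioo 0 T, HasDerivAt B (9 * N t) t := fun t ht => by
    have h1 : HasDerivAt (fun t : ℝ => 1 + t) 1 t := (hasDerivAt_id t).const_add 1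
    have h2 := (h1.rpow_const (p := -(1 / 2)) (Or.inl (by linarith [ht.1]))).const_mul (-(18 * C))
    refine h2.congr_deriv ?_
    have : (-(1 / 2) - 1 : ℝ) = -(3 / 2) := by norm_num
    rw [this]
    simp only [N]
    ring
  have hfin := le_mul_exp_of_le_add_integral hyc hNc
    (fun t ht => mul_nonneg (by norm_num) (hN0 t ht.1)) hBc hB hineq ⟨hT, le_rfl⟩
  refine hfin.trans ?_
  gcongr
  have h0 : B 0 = -(18 * C) := by simp [B]
  have hBT : B T ≤ 0 := by
    have : 0 ≤ (1 + T) ^ (-(1 / 2) : ℝ) := by positivity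
    simp only [B]
    nlinarith
  linarith

theorem exists_bound_of_decay {v : R3 → ℝ} {φ : ℝ → R3 → ℂ} {C : ℝ}
    (hev : ∀ x, v (-x) = v x) (hC : 0 ≤ C)
    (hV : ∀ t, 0 ≤ t → MemLp (meanField v (φ t)) ∞ volume)
    (hw : ∀ t, 0 ≤ t → MemLp (wKernel v (φ t)) 2 volume)
    (hm : ∀ t, 0 ≤ t → MemLp (mKernel v (φ t)) 2 volume)
    (hN : ∀ t (ht : 0 ≤ t), ‖(hm t ht).toLp‖ ≤ C * (1 + t) ^ (-(3 / 2) : ℝ)) :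
    ∃ C : ℝ, ∀ T : ℝ, 0 ≤ T → ∀ k : ℝ → Kernel, IsPairSolution v φ T k →
      ‖sh (k T)‖ ≤ C * (1 + ‖sh (k 0)‖) := by
  refine ⟨Real.exp (9 * C), fun T hT k hk => ?_⟩
  have h := hk.norm_sq_le hev hC hT hV hw hm hN
  have e : Real.exp (18 * C) = Real.exp (9 * C) ^ 2 := by
    rw [← Real.exp_nat_mul]; congr 1; push_cast; ring
  have h0 := norm_nonneg (sh (k 0))
  refine abs_le_of_sq_le_sq' ?_ (by positivity) |>.2
  rw [mul_pow, ← e]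
  have h1 : 1 + ‖sh (k 0)‖ ^ 2 ≤ (1 + ‖sh (k 0)‖) ^ 2 := by nlinarith
  nlinarith [mul_le_mul_of_nonneg_right h1 (Real.exp_pos (18 * C)).le]

/-! ### Partial derivatives, jointly smooth functions and cut-offs -/

section Calculus

variable {E : Type*} [NormedAddCommGroup E] [NormedSpace ℝ E]

/-- The partial derivative `∂ₖ f` of a vector valued function. -/
def pd (k : Fin 3) (f : R3 → E) (x : R3) : E := fderiv ℝ f x (EuclideanSpace.single k 1)

theorem pderiv_eq_pd (k : Fin 3) (f : R3 → ℂ) : pderiv k f = pd k f := rfl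

theorem contDiff_pd {f : R3 → E} (hf : ContDiff ℝ ∞ f) (k : Fin 3) : ContDiff ℝ ∞ (pd k f) :=
  (hf.fderiv_right (m := ∞) (by simp)).clm_apply contDiff_const

theorem norm_pd_le (k : Fin 3) (f : R3 → E) (x : R3) : ‖pd k f x‖ ≤ ‖fderiv ℝ f x‖ := by
  refine ((fderiv ℝ f x).le_opNorm _).trans ?_
  simp

theorem norm_fderiv_le_sum_pd (f : R3 → E) (x : R3) : ‖fderiv ℝ f x‖ ≤ ∑ k, ‖pd k f x‖ := by
  refine ContinuousLinearMap.opNorm_le_bound _ (by positivity) fun y => ?_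
  have hy : y = ∑ k, y k • EuclideanSpace.single k (1 : ℝ) := by
    have := (EuclideanSpace.basisFun (Fin 3) ℝ).sum_repr y
    simpa using this.symm
  have h1 : fderiv ℝ f x y = ∑ k, y k • pd k f x := by
    conv_lhs => rw [hy]
    simp only [map_sum, map_smul]; rfl
  rw [h1, Finset.sum_mul]
  refine (norm_sum_le _ _).trans (Finset.sum_le_sum fun k _ => ?_)
  rw [norm_smul, mul_comm]
  gcongr
  exact PiLp.norm_apply_le y k

theorem fderiv_fderiv_apply_comm {X : Type*} [NormedAddCommGroup X] [NormedSpace ℝ X] {F : X → E}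
    (hF : ContDiff ℝ ∞ F) (z a b : X) :
    fderiv ℝ (fun w => fderiv ℝ F w a) z b = fderiv ℝ (fun w => fderiv ℝ F w b) z a := by
  have hd : DifferentiableAt ℝ (fderiv ℝ F) z :=
    ((hF.fderiv_right (m := ∞) (by simp)).differentiable (by simp)) z
  have e : ∀ a b, fderiv ℝ (fun w => fderiv ℝ F w a) z b = fderiv ℝ (fderiv ℝ F) z b a := by
    intro a b
    rw [fderiv_clm_apply hd (differentiableAt_const a)]
    simp
  rw [e, e]
  exact (hF.contDiffAt.isSymmSndFDerivAt (by simp; exact WithTop.coe_le_coe.2 le_top)) b a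

theorem pd_pd_comm {f : R3 → E} (hf : ContDiff ℝ ∞ f) (j k : Fin 3) :
    pd j (pd k f) = pd k (pd j f) :=
  funext fun x => fderiv_fderiv_apply_comm hf x _ _

theorem norm_pd_pd_le {f : R3 → E} (hf : ContDiff ℝ ∞ f) (j k : Fin 3) (x : R3) :
    ‖pd j (pd k f) x‖ ≤ ‖iteratedFDeriv ℝ 2 f x‖ := by
  have hd : DifferentiableAt ℝ (fderiv ℝ f) x :=
    ((hf.fderiv_right (m := ∞) (by simp)).differentiable (by simp)) x
  have e : pd j (pd k f) x = iteratedFDeriv ℝ 2 f x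
      ![EuclideanSpace.single j 1, EuclideanSpace.single k 1] := by
    rw [iteratedFDeriv_two_apply]
    change fderiv ℝ (fun w => fderiv ℝ f w (EuclideanSpace.single k 1)) x _ = _
    rw [fderiv_clm_apply hd (differentiableAt_const _)]
    simp
  rw [e]
  refine (ContinuousMultilinearMap.le_opNorm _ _).trans ?_
  simp [Fin.prod_univ_two]

theorem laplacian_eq_sum_pd {f : R3 → ℂ} (hf : ContDiff ℝ ∞ f) (x : R3) :
    Laplacian.laplacian f x = ∑ k, pd k (pd k f) x := by
  have hd : DifferentiableAt ℝ (fderiv ℝ f) x :=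
    ((hf.fderiv_right (m := ∞) (by simp)).differentiable (by simp)) x
  rw [InnerProductSpace.laplacian_eq_iteratedFDeriv_orthonormalBasis f
    (EuclideanSpace.basisFun (Fin 3) ℝ)]
  refine Finset.sum_congr rfl fun k _ => ?_
  rw [iteratedFDeriv_two_apply]
  change _ = fderiv ℝ (fun w => fderiv ℝ f w (EuclideanSpace.single k 1)) x _
  rw [fderiv_clm_apply hd (differentiableAt_const _)]
  simp

theorem integral_pd_eq_zero {g : R3 → ℝ} (k : Fin 3) (hg : Differentiable ℝ g)
    (hi : Integrable g) (hi' : Integrable (pd k g)) : ∫ x, pd k g x = 0 := by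
  have h := integral_mul_fderiv_eq_neg_fderiv_mul_of_integrable (μ := (volume : Measure R3))
    (f := fun _ : R3 => (1 : ℝ)) (g := g) (v := EuclideanSpace.single k 1)
    (by simp) (by simpa using! hi') (by simpa using hi)
    (fun x _ => differentiableAt_const _) (fun x _ => hg x)
  simpa using! h

/-- Joint smoothness of a function of time and space. -/
def JSmooth (Φ : ℝ → R3 → E) : Prop := ContDiff ℝ ∞ fun z : ℝ × R3 => Φ z.1 z.2

/-- The time derivative. -/
def td (Φ : ℝ → R3 → E) (t : ℝ) (x : R3) : E := deriv (fun s => Φ s x) t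

namespace JSmooth

variable {Φ : ℝ → R3 → E}

theorem slice (h : JSmooth Φ) (t : ℝ) : ContDiff ℝ ∞ (Φ t) :=
  ContDiff.comp (g := fun z : ℝ × R3 => Φ z.1 z.2) (f := fun x => (t, x)) h (by fun_prop)

theorem timeSlice (h : JSmooth Φ) (x : R3) : ContDiff ℝ ∞ (fun t => Φ t x) :=
  ContDiff.comp (g := fun z : ℝ × R3 => Φ z.1 z.2) (f := fun t => (t, x)) h (by fun_prop)

theorem pd (h : JSmooth Φ) (k : Fin 3) : JSmooth fun t => pd k (Φ t) := by
  have h1 : ContDiff ℝ ∞ (Function.uncurry fun (z : ℝ × R3) (y : R3) => Φ z.1 y) :=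
    ContDiff.comp (g := fun z : ℝ × R3 => Φ z.1 z.2)
      (f := fun q : (ℝ × R3) × R3 => (q.1.1, q.2)) h (by fun_prop)
  exact (h1.fderiv (g := Prod.snd) (n := ∞) (by fun_prop) (by simp)).clm_apply contDiff_const

theorem td (h : JSmooth Φ) : JSmooth (td Φ) := by
  have h1 : ContDiff ℝ ∞ (Function.uncurry fun (z : ℝ × R3) (s : ℝ) => Φ s z.2) :=
    ContDiff.comp (g := fun z : ℝ × R3 => Φ z.1 z.2)
      (f := fun q : (ℝ × R3) × ℝ => (q.2, q.1.2)) h (by fun_prop)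
  exact (h1.fderiv (g := Prod.fst) (n := ∞) (by fun_prop) (by simp)).clm_apply contDiff_const

theorem hasDerivAt (h : JSmooth Φ) (t : ℝ) (x : R3) :
    HasDerivAt (fun s => Φ s x) (PairExcitation.td Φ t x) t :=
  ((h.timeSlice x).differentiable (by simp) t).hasDerivAt

theorem pd_eq (h : JSmooth Φ) (k : Fin 3) (t : ℝ) (x : R3) : PairExcitation.pd k (Φ t) x =
    fderiv ℝ (fun z : ℝ × R3 => Φ z.1 z.2) (t, x) (0, EuclideanSpace.single k 1) := by
  have h1 : HasFDerivAt (fun y : R3 => (t, y)) (ContinuousLinearMap.inr ℝ ℝ R3) x :=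
    hasFDerivAt_prodMk_right t x
  have h2 := (ContDiff.differentiable h (by simp) (t, x)).hasFDerivAt.comp x h1
  have h3 : fderiv ℝ (Φ t) x = _ := h2.fderiv
  rw [PairExcitation.pd, h3]; rfl

theorem td_eq (h : JSmooth Φ) (t : ℝ) (x : R3) : PairExcitation.td Φ t x =
    fderiv ℝ (fun z : ℝ × R3 => Φ z.1 z.2) (t, x) (1, 0) := by
  have h1 : HasFDerivAt (fun s : ℝ => (s, x)) (ContinuousLinearMap.inl ℝ ℝ R3) t :=
    hasFDerivAt_prodMk_left t x
  have h2 := (ContDiff.differentiable h (by simp) (t, x)).hasFDerivAt.comp t h1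
  have h3 : fderiv ℝ (fun s => Φ s x) t = _ := h2.fderiv
  change fderiv ℝ (fun s => Φ s x) t 1 = _
  rw [h3]; rfl

theorem td_pd (h : JSmooth Φ) (k : Fin 3) (t : ℝ) :
    PairExcitation.td (fun s => PairExcitation.pd k (Φ s)) t
      = PairExcitation.pd k (PairExcitation.td Φ t) := by
  funext x
  rw [(h.pd k).td_eq, h.td.pd_eq]
  simp only [h.pd_eq, h.td_eq, Prod.mk.eta]
  exact fderiv_fderiv_apply_comm h _ _ _

theorem continuous (h : JSmooth Φ) : Continuous fun z : ℝ × R3 => Φ z.1 z.2 :=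
  ContDiff.continuous h

end JSmooth

end Calculus

/-- A fixed bump function equal to `1` on the unit ball and supported in the ball of radius two. -/
def bump : ContDiffBump (0 : R3) := ⟨1, 2, one_pos, one_lt_two⟩

/-- Smooth cut-offs equal to `1` on the ball of radius `R`. -/
def cutoff (R : ℝ) (x : R3) : ℝ := bump (R⁻¹ • x)

theorem contDiff_cutoff (R : ℝ) : ContDiff ℝ ∞ (cutoff R) :=
  bump.contDiff.comp (by fun_prop)

theorem cutoff_nonneg (R : ℝ) (x : R3) : 0 ≤ cutoff R x := bump.nonneg

theorem cutoff_le_one (R : ℝ) (x : R3) : cutoff R x ≤ 1 := bump.le_one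

theorem cutoff_eq_one {R : ℝ} (hR : 0 < R) {x : R3} (hx : ‖x‖ ≤ R) : cutoff R x = 1 := by
  refine bump.one_of_mem_closedBall ?_
  rw [mem_closedBall_zero_iff, norm_smul, norm_inv, Real.norm_of_nonneg hR.le]
  change _ ≤ (1 : ℝ)
  rw [inv_mul_le_iff₀ hR]; linarith

theorem cutoff_eq_zero {R : ℝ} (hR : 0 < R) {x : R3} (hx : 2 * R ≤ ‖x‖) : cutoff R x = 0 := by
  refine bump.zero_of_le_dist ?_
  rw [dist_zero_right, norm_smul, norm_inv, Real.norm_of_nonneg hR.le]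
  change (2 : ℝ) ≤ _
  rw [le_inv_mul_iff₀ hR]; linarith

theorem hasCompactSupport_cutoff {R : ℝ} (hR : 0 < R) : HasCompactSupport (cutoff R) :=
  HasCompactSupport.intro (isCompact_closedBall (0 : R3) (2 * R)) fun x hx => by
    rw [mem_closedBall_zero_iff, not_le] at hx
    exact cutoff_eq_zero hR hx.le

theorem exists_pd_cutoff_le : ∃ C : ℝ, 0 ≤ C ∧ ∀ R, 0 < R → ∀ k x,
    |pd k (cutoff R) x| ≤ C / R := by
  have hc : Continuous (fderiv ℝ (bump : R3 → ℝ)) :=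
    (bump.contDiff (n := 1)).continuous_fderiv (by simp)
  obtain ⟨C, hC⟩ := (bump.hasCompactSupport.fderiv (𝕜 := ℝ)).exists_bound_of_continuous hc
  refine ⟨C, (norm_nonneg _).trans (hC 0), fun R hR k x => ?_⟩
  have h1 : HasFDerivAt (fun y : R3 => R⁻¹ • y) (R⁻¹ • ContinuousLinearMap.id ℝ R3) x :=
    (hasFDerivAt_id x).const_smul R⁻¹
  have h2 := ((bump.contDiff (n := 1)).differentiable (by simp) (R⁻¹ • x)).hasFDerivAt.comp x h1
  have h3 : fderiv ℝ (cutoff R) x = _ := h2.fderiv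
  refine (norm_pd_le k (cutoff R) x).trans ?_
  rw [h3, ContinuousLinearMap.comp_smul, ContinuousLinearMap.comp_id, norm_smul, norm_inv,
    Real.norm_of_nonneg hR.le, inv_mul_eq_div]
  gcongr
  exact hC _

theorem pd_cutoff_eq_zero_of_lt {R : ℝ} (hR : 0 < R) (k : Fin 3) {x : R3} (hx : ‖x‖ < R) :
    pd k (cutoff R) x = 0 := by
  have h : cutoff R =ᶠ[nhds x] fun _ => 1 := by
    filter_upwards [(isOpen_lt continuous_norm continuous_const).mem_nhds hx] with y hy
      using cutoff_eq_one hR (le_of_lt hy)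
  rw [pd, h.fderiv_eq]; simp

theorem pd_cutoff_eq_zero_of_gt {R : ℝ} (hR : 0 < R) (k : Fin 3) {x : R3} (hx : 2 * R < ‖x‖) :
    pd k (cutoff R) x = 0 := by
  have h : cutoff R =ᶠ[nhds x] fun _ => 0 := by
    filter_upwards [(isOpen_lt continuous_const continuous_norm).mem_nhds hx] with y hy
      using cutoff_eq_zero hR (le_of_lt hy)
  rw [pd, h.fderiv_eq]; simp

theorem tendsto_cutoff (x : R3) :
    Filter.Tendsto (fun N : ℕ => cutoff (N + 1) x) Filter.atTop (nhds 1) := by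
  refine tendsto_const_nhds.congr' ?_
  filter_upwards [Filter.eventually_ge_atTop ⌈‖x‖⌉₊] with N hN
  have : ‖x‖ ≤ N := (Nat.le_ceil _).trans (by exact_mod_cast hN)
  exact (cutoff_eq_one (by positivity) (by linarith)).symm

/-! ### Sobolev and interpolation inequalities -/

theorem eLpNorm_pow_eq_lintegral {X E : Type*} [MeasurableSpace X] [NormedAddCommGroup E]
    {μ : Measure X} (f : X → E) {n : ℕ} (hn : n ≠ 0) :
    eLpNorm f n μ ^ n = ∫⁻ x, ‖f x‖ₑ ^ n ∂μ := by
  have h := eLpNorm_nnreal_pow_eq_lintegral (f := f) (μ := μ) (p := (n : ℝ≥0))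
    (by exact_mod_cast hn)
  simpa [ENNReal.rpow_natCast] using h

theorem lintegral_mul_sq_le {X : Type*} [MeasurableSpace X] {μ : Measure X} {f g : X → ℝ≥0∞}
    (hf : AEMeasurable f μ) (hg : AEMeasurable g μ) :
    (∫⁻ x, f x * g x ∂μ) ^ 2 ≤ (∫⁻ x, f x ^ 2 ∂μ) * ∫⁻ x, g x ^ 2 ∂μ := by
  have h := ENNReal.lintegral_mul_le_Lp_mul_Lq μ Real.HolderConjugate.two_two hf hg
  have h2 := pow_le_pow_left' h 2
  refine h2.trans (le_of_eq ?_)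
  rw [mul_pow, ← ENNReal.rpow_natCast, ← ENNReal.rpow_natCast, ← ENNReal.rpow_mul,
    ← ENNReal.rpow_mul]
  norm_num

/-- The Sobolev inequality for compactly supported functions, `1/6 = 1/2 - 1/3`, is applied to `f`
times a cut-off at radius `N + 1`. The gradient of the cut-off costs `O(1/N) ‖f‖₂`, and Fatou's
lemma gives the limit. -/
theorem exists_eLpNorm_six_le : ∃ C : ℝ≥0, ∀ f : R3 → ℂ, ContDiff ℝ ∞ f → MemLp f 2 volume →
    eLpNorm f 6 volume ≤ C * eLpNorm (fderiv ℝ f) 2 volume := by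
  obtain ⟨C, hC0, hC⟩ := exists_pd_cutoff_le
  refine ⟨SNormLESNormFDerivOfEqConst ℂ (volume : Measure R3) 2, fun f hf hf2 => ?_⟩
  set C₀ := SNormLESNormFDerivOfEqConst ℂ (volume : Measure R3) 2
  have hbound : ∀ N : ℕ, eLpNorm (fun x => cutoff (N + 1) x • f x) 6 volume ≤
      C₀ * (eLpNorm (fderiv ℝ f) 2 volume
        + ENNReal.ofReal (3 * C / (N + 1)) * eLpNorm f 2 volume) := by
    intro N
    have hN : (0 : ℝ) < N + 1 := by positivity
    have hcs : HasCompactSupport fun x => cutoff (N + 1) x • f x :=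
      (hasCompactSupport_cutoff hN).smul_right
    have hcd : ContDiff ℝ ∞ fun x => cutoff (N + 1) x • f x := (contDiff_cutoff _).smul hf
    have h := eLpNorm_le_eLpNorm_fderiv_of_eq (volume : Measure R3) (hcd.of_le (by simp)) hcs
      (p := 2) (p' := 6) (by norm_num) (by simp) (by simp; norm_num)
    rw [ENNReal.coe_ofNat, ENNReal.coe_ofNat] at h
    refine h.trans (mul_le_mul' le_rfl ?_)
    have hdc : ∀ x, DifferentiableAt ℝ (cutoff (N + 1)) x := fun x =>
      (contDiff_cutoff _).differentiable (by simp) x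
    have hdf : ∀ x, DifferentiableAt ℝ f x := fun x => hf.differentiable (by simp) x
    have hpt : ∀ x, ‖fderiv ℝ (fun x => cutoff (N + 1) x • f x) x‖ ≤
        ‖(fun x => ‖fderiv ℝ f x‖ + (3 * C / (N + 1)) * ‖f x‖) x‖ := by
      intro x
      rw [fderiv_fun_smul (hdc x) (hdf x)]
      rw [Real.norm_of_nonneg (by positivity)]
      refine (norm_add_le _ _).trans (add_le_add ?_ ?_)
      · rw [norm_smul, Real.norm_of_nonneg (cutoff_nonneg _ _)]
        exact mul_le_of_le_one_left (norm_nonneg _) (cutoff_le_one _ _)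
      · rw [ContinuousLinearMap.norm_smulRight_apply]
        gcongr
        refine (norm_fderiv_le_sum_pd _ _).trans ?_
        refine (Finset.sum_le_sum fun k _ => hC (N + 1) hN k x).trans (le_of_eq ?_)
        simp; ring
    refine (eLpNorm_mono hpt).trans ?_
    have hm1 : AEStronglyMeasurable (fun x => ‖fderiv ℝ f x‖) volume :=
      ((hf.continuous_fderiv (by simp)).norm).aestronglyMeasurable
    have hm2 : AEStronglyMeasurable (fun x => (3 * C / (N + 1)) * ‖f x‖) volume :=
      (continuous_const.mul hf.continuous.norm).aestronglyMeasurable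
    refine (eLpNorm_add_le hm1 hm2 (by norm_num)).trans ?_
    gcongr
    · rw [eLpNorm_norm]
    · have : (fun x => (3 * C / (N + 1)) * ‖f x‖) = (3 * C / (N + 1)) • fun x => ‖f x‖ := rfl
      rw [this, eLpNorm_const_smul, eLpNorm_norm, Real.enorm_eq_ofReal (by positivity)]
  have hlim := Lp.eLpNorm_lim_le_liminf_eLpNorm (p := 6) (μ := (volume : Measure R3))
    (f := fun (N : ℕ) x => cutoff (N + 1) x • f x)
    (fun N => ((contDiff_cutoff _).continuous.smul hf.continuous).aestronglyMeasurable) f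
    (Filter.Eventually.of_forall fun x => by simpa using (tendsto_cutoff x).smul_const (f x))
  refine hlim.trans ?_
  have ht : Filter.Tendsto (fun N : ℕ => C₀ * (eLpNorm (fderiv ℝ f) 2 volume
        + ENNReal.ofReal (3 * C / (N + 1)) * eLpNorm f 2 volume)) Filter.atTop
      (nhds (C₀ * (eLpNorm (fderiv ℝ f) 2 volume + ENNReal.ofReal 0 * eLpNorm f 2 volume))) := by
    refine ENNReal.Tendsto.const_mul (tendsto_const_nhds.add (ENNReal.Tendsto.mul_const
      (ENNReal.tendsto_ofReal ?_) (Or.inr hf2.2.ne))) (Or.inr (by simp))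
    have h := (tendsto_one_div_add_atTop_nhds_zero_nat (𝕜 := ℝ)).const_mul (3 * C)
    simpa [div_eq_mul_inv] using h
  refine (Filter.liminf_le_liminf (Filter.Eventually.of_forall hbound)).trans ?_
  rw [ht.liminf_eq]
  simp

theorem lintegral_fderiv_sq_le {f : R3 → ℂ} (hf : ContDiff ℝ ∞ f) :
    ∫⁻ x, ‖fderiv ℝ f x‖ₑ ^ 2 ≤ 3 * ∑ k, ∫⁻ x, ‖pd k f x‖ₑ ^ 2 := by
  rw [← lintegral_finsetSum]
  · rw [← lintegral_const_mul]
    · refine lintegral_mono fun x => ?_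
      have h1 : ‖fderiv ℝ f x‖ ^ 2 ≤ 3 * ∑ k, ‖pd k f x‖ ^ 2 := by
        refine (pow_le_pow_left₀ (norm_nonneg _) (norm_fderiv_le_sum_pd f x) 2).trans ?_
        have := sq_sum_le_card_mul_sum_sq (s := Finset.univ) (f := fun k => ‖pd k f x‖)
        simpa using this
      have h2 := ENNReal.ofReal_le_ofReal h1
      rw [ENNReal.ofReal_mul (by norm_num), ENNReal.ofReal_sum_of_nonneg (fun _ _ => by positivity),
        ENNReal.ofReal_pow (norm_nonneg _)] at h2
      simpa [ENNReal.ofReal_pow] using h2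
    · exact Finset.measurable_fun_sum _ fun k _ =>
        ((contDiff_pd hf k).continuous.enorm.measurable.pow_const 2)
  · exact fun k _ => ((contDiff_pd hf k).continuous.enorm.measurable.pow_const 2)

/-- The `L⁴` bound following from the Sobolev inequality `‖f‖₆ ≤ C ‖∇ f‖₂`. -/
theorem exists_lintegral_four_le : ∃ C : ℝ≥0, ∀ f : R3 → ℂ, ContDiff ℝ ∞ f → MemLp f 2 volume →
    (∫⁻ x, ‖f x‖ₑ ^ 4) ^ 2 ≤
      C * (∫⁻ x, ‖f x‖ₑ ^ 2) * (∑ k, ∫⁻ x, ‖pd k f x‖ₑ ^ 2) ^ 3 := by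
  obtain ⟨C, hC⟩ := exists_eLpNorm_six_le
  -- Cauchy–Schwarz for `|f| · |f|³` gives `(∫|f|⁴)² ≤ ∫|f|² ∫|f|⁶`. The sixth power of the Sobolev
  -- inequality yields `C ^ 6`, and `27 = 3³` comes from comparing the operator norm of the
  -- derivative with its three partial derivatives.
  refine ⟨C ^ 6 * 27, fun f hf hf2 => ?_⟩
  have hm : Measurable fun x => ‖f x‖ₑ := hf.continuous.enorm.measurable
  have h1 := lintegral_mul_sq_le (μ := (volume : Measure R3)) hm.aemeasurable
    (hm.pow_const 3).aemeasurable
  have e1 : ∀ x, ‖f x‖ₑ * ‖f x‖ₑ ^ 3 = ‖f x‖ₑ ^ 4 := fun x => by ring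
  have e2 : ∀ x, (‖f x‖ₑ ^ 3) ^ 2 = ‖f x‖ₑ ^ 6 := fun x => by ring
  simp only [e1, e2] at h1
  refine h1.trans ?_
  have h6 := pow_le_pow_left' (hC f hf hf2) 6
  have e6 := eLpNorm_pow_eq_lintegral (μ := (volume : Measure R3)) f (n := 6) (by norm_num)
  have e22 := eLpNorm_pow_eq_lintegral (μ := (volume : Measure R3)) (fderiv ℝ f) (n := 2)
    (by norm_num)
  push_cast at e6 e22
  rw [e6, mul_pow, show (6 : ℕ) = 2 * 3 from rfl, pow_mul (eLpNorm _ _ _), e22] at h6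
  have h7 := pow_le_pow_left' (lintegral_fderiv_sq_le hf) 3
  calc (∫⁻ x, ‖f x‖ₑ ^ 2) * ∫⁻ x, ‖f x‖ₑ ^ 6
      ≤ (∫⁻ x, ‖f x‖ₑ ^ 2) * (C ^ 6 * (3 * ∑ k, ∫⁻ x, ‖pd k f x‖ₑ ^ 2) ^ 3) := by
        gcongr
        exact h6.trans (by gcongr)
    _ = _ := by
      push_cast
      ring

/-! ### The potential and its convolutions -/

/-- The properties of the cut-off Coulomb potentials that are used below. -/
structure IsRegularPotential (v : R3 → ℝ) : Prop where
  measurable : Measurable v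
  even : ∀ x, v (-x) = v x
  nonneg : ∀ x, x ≠ 0 → 0 ≤ v x
  support : ∃ R : ℝ, ∀ x, R < ‖x‖ → v x = 0
  memLp : MemLp v 2 volume
  -- The integrated form of `x · ∇v ≤ -v`, that is, of `|x| v(x)` being nonincreasing along rays; it
  -- avoids derivatives of the singular `v`.
  scaling : ∀ σ : ℝ, 1 ≤ σ → ∀ x, x ≠ 0 → σ * v x ≤ v (σ⁻¹ • x)
  continuousAt : ∀ x, x ≠ 0 → ContinuousAt v x

theorem IsCutoffPotential.isRegular {v : R3 → ℝ} (hv : IsCutoffPotential v)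
    (hv2 : MemLp v 2 volume) : IsRegularPotential v := by
  obtain ⟨χ, hχ, hanti, ⟨R, hR⟩, hvχ⟩ := hv
  -- A nonincreasing function that eventually vanishes is nonnegative.
  have hχ0 : ∀ r, 0 < r → 0 ≤ χ r := fun r hr => by
    have h1 : χ (max r (R + 1)) = 0 := hR _ (by linarith [le_max_right r (R + 1)])
    rw [← h1]
    exact hanti hr (lt_max_of_lt_left hr) (le_max_left _ _)
  have hca : ∀ x, x ≠ 0 → ContinuousAt v x := fun x hx => by
    have hx' : 0 < ‖x‖ := norm_pos_iff.2 hx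
    have h1 : ContinuousAt (fun y : R3 => χ ‖y‖ / ‖y‖) x :=
      ContinuousAt.div (ContinuousAt.comp
        ((hχ.continuousOn).continuousAt (Ioi_mem_nhds hx')) continuous_norm.continuousAt)
        continuous_norm.continuousAt hx'.ne'
    refine h1.congr ?_
    filter_upwards [isOpen_ne.mem_nhds hx] with y hy using (hvχ y hy).symm
  refine ⟨?_, ?_, ?_, ⟨max R 0, fun x hx => ?_⟩, hv2, ?_, hca⟩
  · exact measurable_of_continuousOn_compl_singleton 0 fun x hx => (hca x hx).continuousWithinAt
  · intro x
    rcases eq_or_ne x 0 with rfl | hx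
    · simp
    · rw [hvχ x hx, hvχ (-x) (neg_ne_zero.2 hx), norm_neg]
  · intro x hx
    rw [hvχ x hx]
    exact div_nonneg (hχ0 _ (norm_pos_iff.2 hx)) (norm_nonneg x)
  · have hx0 : x ≠ 0 := norm_pos_iff.1 ((le_max_right _ _).trans_lt hx)
    rw [hvχ x hx0, hR _ ((le_max_left _ _).trans_lt hx), zero_div]
  · intro σ hσ x hx
    have hσ0 : 0 < σ := one_pos.trans_le hσ
    have hx' : 0 < ‖x‖ := norm_pos_iff.2 hx
    rw [hvχ x hx, hvχ (σ⁻¹ • x) (smul_ne_zero (inv_ne_zero hσ0.ne') hx), norm_smul, norm_inv,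
      Real.norm_of_nonneg hσ0.le]
    have h1 : χ ‖x‖ ≤ χ (σ⁻¹ * ‖x‖) := by
      refine hanti (mul_pos (inv_pos.2 hσ0) hx') hx' ?_
      exact mul_le_of_le_one_left hx'.le (inv_le_one_of_one_le₀ hσ)
    rw [div_mul_eq_div_div, div_inv_eq_mul, mul_comm σ, div_mul_eq_mul_div]
    gcongr

namespace IsRegularPotential

variable {v : R3 → ℝ} (hv : IsRegularPotential v)

include hv

theorem integrable_sq : Integrable fun x => v x ^ 2 := hv.memLp.integrable_sq

/-- On its bounded support, `|v| ≤ v² + 1`. -/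
theorem integrable : Integrable v := by
  obtain ⟨R, hR⟩ := hv.support
  have h1 : Integrable ((Metric.closedBall (0 : R3) R).indicator fun _ => (1 : ℝ)) :=
    (integrable_indicator_iff measurableSet_closedBall).2
      (integrableOn_const (by exact (isCompact_closedBall 0 R).measure_lt_top.ne))
  refine (hv.integrable_sq.add h1).mono' hv.measurable.aestronglyMeasurable
    (Filter.Eventually.of_forall fun x => ?_)
  rcases le_or_gt ‖x‖ R with hx | hx
  · simp only [Pi.add_apply]
    rw [indicator_of_mem (by simpa using hx), Real.norm_eq_abs]
    nlinarith [sq_abs (v x), sq_nonneg (|v x| - 1), abs_nonneg (v x)]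
  · rw [hR x hx, norm_zero]
    exact add_nonneg (sq_nonneg _) (indicator_nonneg (fun _ _ => zero_le_one) _)

theorem ae_nonneg : ∀ᵐ x, 0 ≤ v x := by
  filter_upwards [Measure.ae_ne volume (0 : R3)] with x hx using hv.nonneg x hx

theorem ae_nonneg_sub (x : R3) : ∀ᵐ y, 0 ≤ v (x - y) := by
  filter_upwards [Measure.ae_ne volume x] with y hy using hv.nonneg _ (sub_ne_zero.2 hy.symm)

theorem memLp_sub (x : R3) : MemLp (fun y => v (x - y)) 2 volume := by
  have hm : Measurable fun y => v (x - y) := hv.measurable.comp (by fun_prop)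
  rw [memLp_two_iff_integrable_sq hm.aestronglyMeasurable]
  exact hv.integrable_sq.comp_sub_left x

end IsRegularPotential

/-- The convolution `v * g`. -/
def conv (v g : R3 → ℝ) (x : R3) : ℝ := ∫ y, v (x - y) * g y

theorem meanField_eq_conv (v : R3 → ℝ) (f : R3 → ℂ) :
    meanField v f = conv v fun y => ‖f y‖ ^ 2 := rfl

theorem lintegral_enorm_sq_eq {X E : Type*} [MeasurableSpace X] [NormedAddCommGroup E]
    {μ : Measure X} {f : X → E} (hf : MemLp f 2 μ) :
    ∫⁻ x, ‖f x‖ₑ ^ 2 ∂μ = ENNReal.ofReal (∫ x, ‖f x‖ ^ 2 ∂μ) := by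
  rw [ofReal_integral_eq_lintegral_ofReal ((memLp_two_iff_integrable_sq_norm hf.1).1 hf)
    (Filter.Eventually.of_forall fun x => by positivity)]
  refine lintegral_congr fun x => ?_
  rw [ENNReal.ofReal_pow (norm_nonneg _), ofReal_norm]

theorem integral_norm_mul_sq_le {X E F : Type*} [MeasurableSpace X] [NormedAddCommGroup E]
    [NormedAddCommGroup F] {μ : Measure X} {f : X → E} {g : X → F} (hf : MemLp f 2 μ)
    (hg : MemLp g 2 μ) :
    (∫ x, ‖f x‖ * ‖g x‖ ∂μ) ^ 2 ≤ (∫ x, ‖f x‖ ^ 2 ∂μ) * ∫ x, ‖g x‖ ^ 2 ∂μ := by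
  have h := lintegral_mul_sq_le (μ := μ) hf.1.enorm hg.1.enorm
  have e2 : ∫⁻ x, ‖f x‖ₑ * ‖g x‖ₑ ∂μ = ENNReal.ofReal (∫ x, ‖f x‖ * ‖g x‖ ∂μ) := by
    have hi : Integrable (fun x => ‖f x‖ * ‖g x‖) μ := hf.norm.integrable_mul hg.norm
    rw [ofReal_integral_eq_lintegral_ofReal hi
      (Filter.Eventually.of_forall fun x => by positivity)]
    refine lintegral_congr fun x => ?_
    rw [ENNReal.ofReal_mul (norm_nonneg _), ofReal_norm, ofReal_norm]
  have h2 : 0 ≤ ∫ x, ‖f x‖ ^ 2 ∂μ := integral_nonneg fun x => by positivity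
  have h3 : 0 ≤ ∫ x, ‖g x‖ ^ 2 ∂μ := integral_nonneg fun x => by positivity
  rw [e2, lintegral_enorm_sq_eq hf, lintegral_enorm_sq_eq hg, ← ENNReal.ofReal_pow (integral_nonneg fun x => by positivity),
    ← ENNReal.ofReal_mul h2] at h
  exact (ENNReal.ofReal_le_ofReal_iff (by positivity)).1 h

namespace IsRegularPotential

variable {v : R3 → ℝ} (hv : IsRegularPotential v)

include hv

theorem integrable_conv {g : R3 → ℝ} (hg : MemLp g 2 volume) (x : R3) :
    Integrable fun y => v (x - y) * g y :=
  (hv.memLp_sub x).integrable_mul hg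

theorem integral_abs_conv_sq_le {g : R3 → ℝ} (hg : MemLp g 2 volume) (x : R3) :
    (∫ y, |v (x - y)| * |g y|) ^ 2 ≤ (∫ y, v y ^ 2) * ∫ y, g y ^ 2 := by
  have h := integral_norm_mul_sq_le (hv.memLp_sub x) hg
  simp only [Real.norm_eq_abs, sq_abs] at h
  rwa [integral_sub_left_eq_self (fun y => v y ^ 2) volume x] at h

theorem conv_sq_le {g : R3 → ℝ} (hg : MemLp g 2 volume) (x : R3) :
    conv v g x ^ 2 ≤ (∫ y, v y ^ 2) * ∫ y, g y ^ 2 := by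
  refine le_trans ?_ (hv.integral_abs_conv_sq_le hg x)
  rw [← sq_abs]
  gcongr
  refine (abs_integral_le_integral_abs).trans (le_of_eq ?_)
  simp only [abs_mul]

theorem abs_conv_le {g : R3 → ℝ} (hg : MemLp g 2 volume) (x : R3) :
    |conv v g x| ≤ √((∫ y, v y ^ 2) * ∫ y, g y ^ 2) :=
  Real.abs_le_sqrt (hv.conv_sq_le hg x)

theorem conv_nonneg {g : R3 → ℝ} (hg : ∀ y, 0 ≤ g y) (x : R3) : 0 ≤ conv v g x := by
  refine integral_nonneg_of_ae ?_
  filter_upwards [hv.ae_nonneg_sub x] with y hy using mul_nonneg hy (hg y)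

/-- The derivative falls on the smooth factor. Because `v` has bounded support, only a bound for
`∇g` on a compact ball is needed, and no decay of `g`. -/
theorem hasFDerivAt_conv {g : R3 → ℝ} (hg : ContDiff ℝ ∞ g) (x : R3) :
    HasFDerivAt (conv v g) (∫ y, v y • fderiv ℝ g (x - y)) x := by
  obtain ⟨R, hR⟩ := hv.support
  have hgc : Continuous (fderiv ℝ g) := hg.continuous_fderiv (by simp)
  obtain ⟨M, hM⟩ := (isCompact_closedBall (0 : R3) (‖x‖ + 1 + R)).exists_bound_of_continuousOn
    hgc.continuousOn
  obtain ⟨M', hM'⟩ := (isCompact_closedBall (0 : R3) (‖x‖ + 1 + R)).exists_bound_of_continuousOn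
    hg.continuous.continuousOn
  have e : conv v g = fun x => ∫ y, v y * g (x - y) := by
    funext x
    rw [conv, ← integral_sub_left_eq_self _ volume x]
    simp
  rw [e]
  have hmem : ∀ y, ‖y‖ ≤ R → ∀ z ∈ Metric.ball x 1, z - y ∈ Metric.closedBall (0 : R3) (‖x‖ + 1 + R) := by
    intro y hy z hz
    rw [mem_closedBall_zero_iff]
    have h1 : ‖z‖ ≤ ‖x‖ + 1 := by
      have := norm_le_norm_add_norm_sub x z
      rw [mem_ball_iff_norm] at hz
      rw [norm_sub_rev] at this
      linarith [norm_sub_rev x z]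
    linarith [norm_sub_le z y]
  refine hasFDerivAt_integral_of_dominated_of_fderiv_le (𝕜 := ℝ) (bound := fun y => |v y| * M)
    (F := fun x y => v y * g (x - y)) (F' := fun x y => v y • fderiv ℝ g (x - y))
    (Metric.ball_mem_nhds x one_pos) ?_ ?_ ?_ ?_ (hv.integrable.abs.mul_const M) ?_
  · exact Filter.Eventually.of_forall fun z =>
      (hv.measurable.mul (hg.continuous.measurable.comp (by fun_prop))).aestronglyMeasurable
  · refine (hv.integrable.abs.mul_const M').mono'
      (hv.measurable.mul (hg.continuous.measurable.comp (by fun_prop))).aestronglyMeasurable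
      (Filter.Eventually.of_forall fun y => ?_)
    rcases le_or_gt ‖y‖ R with hy | hy
    · rw [norm_mul, Real.norm_eq_abs]
      gcongr
      exact hM' _ (hmem y hy x (Metric.mem_ball_self one_pos))
    · simp [hR y hy]
  · exact hv.measurable.aestronglyMeasurable.smul
      (hgc.comp (by fun_prop)).aestronglyMeasurable
  · refine Filter.Eventually.of_forall fun y z hz => ?_
    rcases le_or_gt ‖y‖ R with hy | hy
    · rw [norm_smul, Real.norm_eq_abs]
      gcongr
      exact hM _ (hmem y hy z hz)
    · simp [hR y hy]
  · refine Filter.Eventually.of_forall fun y z hz => ?_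
    have h1 : HasFDerivAt (fun x => g (x - y)) (fderiv ℝ g (z - y)) z := by
      have h0 : HasFDerivAt (fun x : R3 => x - y) (ContinuousLinearMap.id ℝ R3) z :=
        (hasFDerivAt_id z).sub_const y
      have h2 := (hg.differentiable (by simp) (z - y)).hasFDerivAt.comp z h0
      rw [ContinuousLinearMap.comp_id] at h2
      exact h2
    exact h1.const_mul (v y)

theorem differentiable_conv {g : R3 → ℝ} (hg : ContDiff ℝ ∞ g) : Differentiable ℝ (conv v g) :=
  fun x => (hv.hasFDerivAt_conv hg x).differentiableAt

theorem continuous_conv {g : R3 → ℝ} (hg : ContDiff ℝ ∞ g) : Continuous (conv v g) :=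
  (hv.differentiable_conv hg).continuous

theorem pd_conv {g : R3 → ℝ} (hg : ContDiff ℝ ∞ g) (k : Fin 3) :
    pd k (conv v g) = conv v (pd k g) := by
  funext x
  obtain ⟨R, hR⟩ := hv.support
  have hgc : Continuous (fderiv ℝ g) := hg.continuous_fderiv (by simp)
  obtain ⟨M, hM⟩ := (isCompact_closedBall (0 : R3) (‖x‖ + R)).exists_bound_of_continuousOn
    hgc.continuousOn
  have hi : Integrable fun y => v y • fderiv ℝ g (x - y) := by
    refine (hv.integrable.abs.mul_const M).mono' (hv.measurable.aestronglyMeasurable.smul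
      (hgc.comp (by fun_prop)).aestronglyMeasurable) (Filter.Eventually.of_forall fun y => ?_)
    rcases le_or_gt ‖y‖ R with hy | hy
    · rw [norm_smul, Real.norm_eq_abs]
      gcongr
      refine hM _ ?_
      rw [mem_closedBall_zero_iff]
      linarith [norm_sub_le x y]
    · simp [hR y hy]
  rw [pd, (hv.hasFDerivAt_conv hg x).fderiv, ContinuousLinearMap.integral_apply hi, conv,
    ← integral_sub_left_eq_self _ volume x]
  simp [pd]

end IsRegularPotential

/-! ### Bounds for functions in `H²` -/

theorem exists_integral_four_le : ∃ C : ℝ, 0 ≤ C ∧ ∀ f : R3 → ℂ, ContDiff ℝ ∞ f →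
    MemLp f 2 volume → (∀ k, MemLp (pd k f) 2 volume) →
    Integrable (fun x => ‖f x‖ ^ 4) ∧
      (∫ x, ‖f x‖ ^ 4) ^ 2 ≤ C * (∫ x, ‖f x‖ ^ 2) * (∑ k, ∫ x, ‖pd k f x‖ ^ 2) ^ 3 := by
  obtain ⟨C, hC⟩ := exists_lintegral_four_le
  refine ⟨C, C.2, fun f hf hf2 hfd => ?_⟩
  have h := hC f hf hf2
  rw [lintegral_enorm_sq_eq hf2] at h
  simp only [lintegral_enorm_sq_eq (hfd _)] at h
  have hn : ∀ {g : R3 → ℂ}, 0 ≤ ∫ x, ‖g x‖ ^ 2 := integral_nonneg fun x => by positivity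
  rw [← ENNReal.ofReal_sum_of_nonneg (fun k _ => hn), ← ENNReal.ofReal_pow
    (Finset.sum_nonneg fun k _ => hn), ← ENNReal.ofReal_coe_nnreal,
    ← ENNReal.ofReal_mul C.coe_nonneg, ← ENNReal.ofReal_mul (mul_nonneg C.coe_nonneg hn)] at h
  have e : ∀ x, ‖f x‖ₑ ^ 4 = ENNReal.ofReal (‖f x‖ ^ 4) := fun x => by
    rw [ENNReal.ofReal_pow (norm_nonneg _), ofReal_norm]
  simp only [e] at h
  have hm : AEStronglyMeasurable (fun x => ‖f x‖ ^ 4) volume :=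
    (hf.continuous.norm.pow 4).aestronglyMeasurable
  have hi : Integrable fun x => ‖f x‖ ^ 4 := by
    refine ⟨hm, ?_⟩
    rw [hasFiniteIntegral_iff_ofReal (Filter.Eventually.of_forall fun x => by positivity)]
    refine lt_top_iff_ne_top.2 fun h' => ?_
    rw [h'] at h
    simp at h
  refine ⟨hi, ?_⟩
  rw [← ofReal_integral_eq_lintegral_ofReal hi (Filter.Eventually.of_forall fun x => by positivity),
    ← ENNReal.ofReal_pow (integral_nonneg fun x => by positivity)] at h
  refine (ENNReal.ofReal_le_ofReal_iff ?_).1 h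
  exact mul_nonneg (mul_nonneg C.2 hn) (pow_nonneg (Finset.sum_nonneg fun k _ => hn) 3)

/-- Smooth functions with all derivatives up to order two bounded by `M` in `L²` (squared). -/
structure H2Slice (M : ℝ) (f : R3 → ℂ) : Prop where
  smooth : ContDiff ℝ ∞ f
  memLp : MemLp f 2 volume
  memLp_pd : ∀ k, MemLp (pd k f) 2 volume
  memLp_pd_pd : ∀ j k, MemLp (pd j (pd k f)) 2 volume
  le : ∫ x, ‖f x‖ ^ 2 ≤ M
  le_pd : ∀ k, ∫ x, ‖pd k f x‖ ^ 2 ≤ M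
  le_pd_pd : ∀ j k, ∫ x, ‖pd j (pd k f) x‖ ^ 2 ≤ M

theorem contDiff_norm_sq {f : R3 → ℂ} (hf : ContDiff ℝ ∞ f) : ContDiff ℝ ∞ fun x => ‖f x‖ ^ 2 :=
  hf.norm_sq ℝ

theorem pd_norm_sq {f : R3 → ℂ} (hf : ContDiff ℝ ∞ f) (k : Fin 3) (x : R3) :
    pd k (fun x => ‖f x‖ ^ 2) x = 2 * ⟪f x, pd k f x⟫_ℝ := by
  have h := (hf.differentiable (by simp) x).hasFDerivAt.norm_sq
  rw [pd, h.fderiv, smul_apply, nsmul_eq_mul]; rfl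

theorem memLp_norm_sq {f : R3 → ℂ} (hf : ContDiff ℝ ∞ f) (h4 : Integrable fun x => ‖f x‖ ^ 4) :
    MemLp (fun x => ‖f x‖ ^ 2) 2 volume := by
  rw [memLp_two_iff_integrable_sq (contDiff_norm_sq hf).continuous.aestronglyMeasurable]
  exact h4.congr (Filter.Eventually.of_forall fun x => by simp only; ring)

theorem sq_pd_norm_sq_le {f : R3 → ℂ} (hf : ContDiff ℝ ∞ f) (k : Fin 3) (x : R3) :
    pd k (fun x => ‖f x‖ ^ 2) x ^ 2 ≤ 2 * (‖f x‖ ^ 4 + ‖pd k f x‖ ^ 4) := by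
  rw [pd_norm_sq hf]
  have h := abs_real_inner_le_norm (f x) (pd k f x)
  have h2 := pow_le_pow_left₀ (abs_nonneg _) h 2
  rw [sq_abs] at h2
  nlinarith [sq_nonneg (‖f x‖ ^ 2 - ‖pd k f x‖ ^ 2)]

theorem memLp_pd_norm_sq {f : R3 → ℂ} (hf : ContDiff ℝ ∞ f)
    (h4 : Integrable fun x => ‖f x‖ ^ 4) {k : Fin 3} (hk : Integrable fun x => ‖pd k f x‖ ^ 4) :
    MemLp (pd k fun x => ‖f x‖ ^ 2) 2 volume := by
  have hc := (contDiff_pd (contDiff_norm_sq hf) k).continuous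
  rw [memLp_two_iff_integrable_sq hc.aestronglyMeasurable]
  refine ((h4.add hk).const_mul 2).mono' (hc.pow 2).aestronglyMeasurable
    (Filter.Eventually.of_forall fun x => ?_)
  rw [Real.norm_of_nonneg (sq_nonneg _)]
  exact sq_pd_norm_sq_le hf k x

theorem integral_sq_pd_norm_sq_le {f : R3 → ℂ} (hf : ContDiff ℝ ∞ f)
    (h4 : Integrable fun x => ‖f x‖ ^ 4) {k : Fin 3} (hk : Integrable fun x => ‖pd k f x‖ ^ 4) :
    ∫ x, pd k (fun x => ‖f x‖ ^ 2) x ^ 2 ≤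
      2 * (∫ x, ‖f x‖ ^ 4) + 2 * ∫ x, ‖pd k f x‖ ^ 4 := by
  rw [← mul_add, ← integral_add h4 hk, ← integral_const_mul]
  exact integral_mono (memLp_pd_norm_sq hf h4 hk).integrable_sq ((h4.add hk).const_mul 2)
    (sq_pd_norm_sq_le hf k)

theorem H2Slice.nonneg {M : ℝ} {f : R3 → ℂ} (h : H2Slice M f) : 0 ≤ M :=
  (integral_nonneg fun x => by positivity).trans h.le

/-- The `L⁴` norms of `f` and `∇ f` and the sup norms of `v * |f|²` and its gradient are controlled
by the `H²` norm of `f`. -/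
theorem exists_slice_bounds {v : R3 → ℝ} (hv : IsRegularPotential v) (M : ℝ) :
    ∃ A : ℝ, 0 ≤ A ∧ ∀ f, H2Slice M f →
      Integrable (fun x => ‖f x‖ ^ 4) ∧ (∫ x, ‖f x‖ ^ 4 ≤ A) ∧
      (∀ k, Integrable fun x => ‖pd k f x‖ ^ 4) ∧
      (∀ x, |meanField v f x| ≤ A) ∧ ∀ k x, |pd k (meanField v f) x| ≤ A := by
  obtain ⟨C, hC0, hC⟩ := exists_integral_four_le
  set B := √(C * M * (∑ _k : Fin 3, M) ^ 3)
  set A₁ := √((∫ y, v y ^ 2) * B)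
  set A₂ := √((∫ y, v y ^ 2) * (2 * B + 2 * B))
  have hB : 0 ≤ B := Real.sqrt_nonneg _
  have hA₁ : 0 ≤ A₁ := Real.sqrt_nonneg _
  have hA₂ : 0 ≤ A₂ := Real.sqrt_nonneg _
  have hvn : 0 ≤ ∫ y, v y ^ 2 := integral_nonneg fun y => sq_nonneg _
  refine ⟨B + A₁ + A₂, by positivity, fun f hf => ?_⟩
  have hM := hf.nonneg
  have hn : ∀ {g : R3 → ℂ}, 0 ≤ ∫ x, ‖g x‖ ^ 2 := integral_nonneg fun x => by positivity
  -- Used for `f` and for each `∂ₖ f`. The latter is where second derivatives of `f` enter, and it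
  -- controls the gradient of the mean field.
  have key : ∀ g : R3 → ℂ, ContDiff ℝ ∞ g → MemLp g 2 volume → (∀ k, MemLp (pd k g) 2 volume) →
      ∫ x, ‖g x‖ ^ 2 ≤ M → (∀ k, ∫ x, ‖pd k g x‖ ^ 2 ≤ M) →
      Integrable (fun x => ‖g x‖ ^ 4) ∧ ∫ x, ‖g x‖ ^ 4 ≤ B := by
    intro g h1 h2 h3 h4 h5
    obtain ⟨i, h⟩ := hC g h1 h2 h3
    refine ⟨i, Real.le_sqrt_of_sq_le (h.trans ?_)⟩
    have h6 : ∑ k, ∫ x, ‖pd k g x‖ ^ 2 ≤ ∑ _k : Fin 3, M := Finset.sum_le_sum fun k _ => h5 k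
    have h7 : 0 ≤ ∑ k, ∫ x, ‖pd k g x‖ ^ 2 := Finset.sum_nonneg fun k _ => hn
    gcongr
  obtain ⟨i0, b0⟩ := key f hf.smooth hf.memLp hf.memLp_pd hf.le hf.le_pd
  have hk := fun k => key (pd k f) (contDiff_pd hf.smooth k) (hf.memLp_pd k)
    (fun j => hf.memLp_pd_pd j k) (hf.le_pd k) (fun j => hf.le_pd_pd j k)
  refine ⟨i0, by linarith, fun k => (hk k).1, fun x => ?_, fun k x => ?_⟩
  · have h := hv.abs_conv_le (memLp_norm_sq hf.smooth i0) x
    rw [meanField_eq_conv]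
    have e : ∀ y, (‖f y‖ ^ 2) ^ 2 = ‖f y‖ ^ 4 := fun y => by ring
    simp only [e] at h
    have h2 : √((∫ y, v y ^ 2) * ∫ y, ‖f y‖ ^ 4) ≤ A₁ := by
      refine Real.sqrt_le_sqrt ?_
      gcongr
    linarith
  · have h := hv.abs_conv_le (memLp_pd_norm_sq hf.smooth i0 (hk k).1) x
    rw [meanField_eq_conv, hv.pd_conv (contDiff_norm_sq hf.smooth)]
    have h2 : √((∫ y, v y ^ 2) * ∫ y, pd k (fun x => ‖f x‖ ^ 2) y ^ 2) ≤ A₂ := by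
      refine Real.sqrt_le_sqrt ?_
      gcongr
      refine (integral_sq_pd_norm_sq_le hf.smooth i0 (hk k).1).trans ?_
      linarith [(hk k).2]
    linarith

/-- The shear `(x, y) ↦ (x - y, y)` preserves the measure and separates the variables. -/
theorem integral_sub_mul {w g : R3 → ℝ} (hw : Integrable w) (hg : Integrable g) :
    Integrable (fun z : R3 × R3 => w (z.1 - z.2) * g z.2) ∧
    ∫ z : R3 × R3, w (z.1 - z.2) * g z.2 = (∫ x, w x) * ∫ x, g x := by
  have hmp := measurePreserving_sub_prod (volume : Measure R3) (volume : Measure R3)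
  have hi := hw.mul_prod hg
  refine ⟨hmp.integrable_comp_of_integrable hi, ?_⟩
  have h := integral_map (μ := (volume : Measure (R3 × R3))) hmp.measurable.aemeasurable
    (f := fun z : R3 × R3 => w z.1 * g z.2)
    (by rw [show Measure.map _ (volume : Measure (R3 × R3)) = _ from hmp.map_eq]
        exact hi.aestronglyMeasurable)
  rw [show Measure.map _ (volume : Measure (R3 × R3)) = _ from hmp.map_eq, integral_prod_mul] at h
  exact h.symm

theorem integral_sub_mul_fst {w g : R3 → ℝ} (hev : ∀ x, w (-x) = w x) (hw : Integrable w)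
    (hg : Integrable g) : Integrable (fun z : R3 × R3 => w (z.1 - z.2) * g z.1) ∧
    ∫ z : R3 × R3, w (z.1 - z.2) * g z.1 = (∫ x, w x) * ∫ x, g x := by
  obtain ⟨h1, h2⟩ := integral_sub_mul hw hg
  refine ⟨h1.swap.congr (Filter.Eventually.of_forall fun z => ?_), ?_⟩
  · simp only [Function.comp, Prod.fst_swap, Prod.snd_swap]
    rw [← hev, neg_sub]
  · rw [← h2, show (volume : Measure (R3 × R3)) = volume.prod volume from rfl,
      ← integral_prod_swap]
    refine integral_congr_ae (Filter.Eventually.of_forall fun z => ?_)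
    simp only [Prod.fst_swap, Prod.snd_swap]
    rw [← hev, neg_sub]

section Kernels

variable {v : R3 → ℝ} (hv : IsRegularPotential v) {f : R3 → ℂ}

include hv

/-- By `|f(x)|² |f(y)|² ≤ (|f(x)|⁴ + |f(y)|⁴) / 2`, both halves integrate to `∫ v² ∫ |f|⁴` after a
shear. Together with the decay of `∫ |φ|⁴` this is the source of the time decay of `m`. -/
theorem memLp_of_norm_eq (h4 : Integrable fun x => ‖f x‖ ^ 4) {K : R3 × R3 → ℂ} (hK : Measurable K)
    (hn : ∀ z, ‖K z‖ = |v (z.1 - z.2)| * ‖f z.1‖ * ‖f z.2‖) :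
    MemLp K 2 volume ∧ ∫ z, ‖K z‖ ^ 2 ≤ (∫ x, v x ^ 2) * ∫ x, ‖f x‖ ^ 4 := by
  obtain ⟨i1, e1⟩ := integral_sub_mul hv.integrable_sq h4
  obtain ⟨i2, e2⟩ := integral_sub_mul_fst (fun x => by rw [hv.even]) hv.integrable_sq h4
  have hb : ∀ z, ‖K z‖ ^ 2 ≤ 2⁻¹ * (v (z.1 - z.2) ^ 2 * ‖f z.2‖ ^ 4)
      + 2⁻¹ * (v (z.1 - z.2) ^ 2 * ‖f z.1‖ ^ 4) := fun z => by
    rw [hn, mul_pow, mul_pow, sq_abs]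
    nlinarith [mul_nonneg (sq_nonneg (v (z.1 - z.2))) (sq_nonneg (‖f z.1‖ ^ 2 - ‖f z.2‖ ^ 2))]
  have i3 := (i1.const_mul 2⁻¹).add (i2.const_mul 2⁻¹)
  have i4 : Integrable fun z => ‖K z‖ ^ 2 := i3.mono' (hK.norm.pow_const 2).aestronglyMeasurable
    (Filter.Eventually.of_forall fun z => by
      rw [Real.norm_of_nonneg (sq_nonneg _)]; exact hb z)
  refine ⟨(memLp_two_iff_integrable_sq_norm hK.aestronglyMeasurable).2 i4, ?_⟩
  have h := integral_mono i4 i3 hb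
  rw [integral_add' (i1.const_mul 2⁻¹) (i2.const_mul 2⁻¹), integral_const_mul, integral_const_mul,
    e1, e2] at h
  linarith

theorem measurable_sub_kernel : Measurable fun z : R3 × R3 => (v (z.1 - z.2) : ℂ) :=
  Complex.measurable_ofReal.comp (hv.measurable.comp (by fun_prop))

theorem memLp_wKernel (hf : ContDiff ℝ ∞ f)
    (h4 : Integrable fun x => ‖f x‖ ^ 4) : MemLp (wKernel v f) 2 volume := by
  have hc := hf.continuous
  refine (memLp_of_norm_eq hv h4 ?_ fun z => ?_).1
  · exact ((measurable_sub_kernel hv).mul (by fun_prop)).mul (by fun_prop)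
  · simp [wKernel]

theorem memLp_mKernel (hf : ContDiff ℝ ∞ f)
    (h4 : Integrable fun x => ‖f x‖ ^ 4) : MemLp (mKernel v f) 2 volume ∧
    ∫ z, ‖mKernel v f z‖ ^ 2 ≤ (∫ x, v x ^ 2) * ∫ x, ‖f x‖ ^ 4 := by
  have hc := hf.continuous
  refine memLp_of_norm_eq hv h4 ?_ fun z => ?_
  · exact (((measurable_sub_kernel hv).mul (by fun_prop)).mul (by fun_prop)).neg
  · simp [mKernel]

theorem norm_mKernel_le (hf : ContDiff ℝ ∞ f)
    (h4 : Integrable fun x => ‖f x‖ ^ 4) (hm : MemLp (mKernel v f) 2 volume) :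
    ‖hm.toLp‖ ≤ √((∫ x, v x ^ 2) * ∫ x, ‖f x‖ ^ 4) := by
  refine Real.le_sqrt_of_sq_le (le_trans (le_of_eq ?_) (memLp_mKernel hv hf h4).2)
  have h := L2.inner_def (𝕜 := ℝ) hm.toLp hm.toLp
  rw [real_inner_self_eq_norm_sq] at h
  rw [h]
  refine integral_congr_ae ?_
  filter_upwards [hm.coeFn_toLp] with z hz
  rw [hz, real_inner_self_eq_norm_sq]

end Kernels

/-! ### Time derivatives of integrals -/

theorem integrable_prod_of_slices {X : Type*} [MeasurableSpace X] {μ : Measure X} [SFinite μ]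
    {F : ℝ → X → ℝ} {a b C : ℝ} (hm : Measurable (Function.uncurry F))
    (hi : ∀ s ∈ Icc a b, Integrable (F s) μ) (hC : ∀ s ∈ Icc a b, ∫ x, |F s x| ∂μ ≤ C) :
    Integrable (Function.uncurry F) ((volume.restrict (Ioc a b)).prod μ) := by
  rw [integrable_prod_iff hm.aestronglyMeasurable]
  refine ⟨?_, ?_⟩
  · filter_upwards [ae_restrict_mem measurableSet_Ioc] with s hs
    exact hi s (Ioc_subset_Icc_self hs)
  · refine Integrable.mono' (g := fun _ => C) (integrable_const C) ?_ ?_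
    · exact hm.norm.stronglyMeasurable.integral_prod_right'.aestronglyMeasurable
    · filter_upwards [ae_restrict_mem measurableSet_Ioc] with s hs
      rw [Real.norm_of_nonneg (integral_nonneg fun x => norm_nonneg _)]
      exact hC s (Ioc_subset_Icc_self hs)

/-- Fubini for the fundamental theorem of calculus at each point. Unlike differentiation under the
integral, it needs only a uniform `L¹` bound for the derivative and no pointwise majorant. -/
theorem integral_sub_eq_integral_deriv {X : Type*} [MeasurableSpace X] {μ : Measure X} [SFinite μ]
    {h h' : ℝ → X → ℝ} {a b C : ℝ} (hab : a ≤ b)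
    (hd : ∀ s x, HasDerivAt (fun s => h s x) (h' s x) s) (hc : ∀ x, Continuous fun s => h' s x)
    (hm : Measurable (Function.uncurry h'))
    (hi : ∀ s ∈ Icc a b, Integrable (h' s) μ) (hC : ∀ s ∈ Icc a b, ∫ x, |h' s x| ∂μ ≤ C)
    (ha : Integrable (h a) μ) (hb : Integrable (h b) μ) :
    ∫ x, h b x ∂μ - ∫ x, h a x ∂μ = ∫ s in a..b, ∫ x, h' s x ∂μ := by
  have hp := integrable_prod_of_slices hm hi hC
  rw [intervalIntegral_integral_swap (by rwa [uIoc_of_le hab]), ← integral_sub hb ha]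
  refine integral_congr_ae (Filter.Eventually.of_forall fun x => ?_)
  exact (intervalIntegral.integral_eq_sub_of_hasDerivAt (fun s _ => hd s x)
    ((hc x).intervalIntegrable _ _)).symm

theorem intervalIntegrable_integral {X : Type*} [MeasurableSpace X] {μ : Measure X} [SFinite μ]
    {h' : ℝ → X → ℝ} {a b C : ℝ} (hab : a ≤ b) (hm : Measurable (Function.uncurry h'))
    (hi : ∀ s ∈ Icc a b, Integrable (h' s) μ) (hC : ∀ s ∈ Icc a b, ∫ x, |h' s x| ∂μ ≤ C) :
    IntervalIntegrable (fun s => ∫ x, h' s x ∂μ) volume a b := by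
  rw [intervalIntegrable_iff_integrableOn_Ioc_of_le hab]
  exact (integrable_prod_of_slices hm hi hC).integral_prod_left

namespace IsRegularPotential

variable {v : R3 → ℝ} (hv : IsRegularPotential v)

include hv

theorem measurable_kernel {α β : R3 → ℝ} (hα : Measurable α) (hβ : Measurable β) :
    Measurable fun z : R3 × R3 => v (z.1 - z.2) * (α z.1 * β z.2) :=
  (hv.measurable.comp (by fun_prop)).mul (by fun_prop)

/-- By Cauchy–Schwarz `|v| * |β|` is bounded for `β` in `L²`, and a bounded function is integrable
against `α`. -/
theorem integrable_kernel {α β : R3 → ℝ} (hαm : Measurable α) (hβm : Measurable β)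
    (hα : Integrable α) (hβ : MemLp β 2 volume) :
    Integrable (fun z : R3 × R3 => v (z.1 - z.2) * (α z.1 * β z.2)) ∧
      ∫ z : R3 × R3, |v (z.1 - z.2) * (α z.1 * β z.2)| ≤
        √((∫ y, v y ^ 2) * ∫ y, β y ^ 2) * ∫ x, |α x| := by
  set B := √((∫ y, v y ^ 2) * ∫ y, β y ^ 2) with hB
  have hm := hv.measurable_kernel hαm hβm
  have hb : ∀ x, ∫ y, ‖v (x - y) * (α x * β y)‖ ≤ B * |α x| := fun x => by
    have e : ∀ y, ‖v (x - y) * (α x * β y)‖ = |α x| * (|v (x - y)| * |β y|) := fun y => by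
      rw [Real.norm_eq_abs, abs_mul, abs_mul]; ring
    simp only [e]
    rw [integral_const_mul, mul_comm]
    gcongr
    exact Real.le_sqrt_of_sq_le (hv.integral_abs_conv_sq_le hβ x)
  have hi : Integrable (fun z : R3 × R3 => v (z.1 - z.2) * (α z.1 * β z.2)) := by
    refine (integrable_prod_iff hm.aestronglyMeasurable).2 ⟨Filter.Eventually.of_forall fun x => ?_, ?_⟩
    · refine ((hv.integrable_conv hβ x).const_mul (α x)).congr
        (Filter.Eventually.of_forall fun y => ?_)
      simp only; ring
    · refine (hα.abs.const_mul B).mono'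
        hm.norm.stronglyMeasurable.integral_prod_right'.aestronglyMeasurable
        (Filter.Eventually.of_forall fun x => ?_)
      rw [Real.norm_of_nonneg (integral_nonneg fun x => norm_nonneg _)]
      exact hb x
  refine ⟨hi, ?_⟩
  have h1 : ∫ z : R3 × R3, |v (z.1 - z.2) * (α z.1 * β z.2)| =
      ∫ x, ∫ y, |v (x - y) * (α x * β y)| := integral_prod _ hi.abs
  rw [h1, ← integral_const_mul]
  exact integral_mono hi.norm.integral_prod_left (hα.abs.const_mul B) hb

theorem integral_kernel {α β : R3 → ℝ} (hαm : Measurable α) (hβm : Measurable β)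
    (hα : Integrable α) (hβ : MemLp β 2 volume) :
    ∫ z : R3 × R3, v (z.1 - z.2) * (α z.1 * β z.2) = ∫ x, conv v β x * α x := by
  have h1 : ∫ z : R3 × R3, v (z.1 - z.2) * (α z.1 * β z.2) =
      ∫ x, ∫ y, v (x - y) * (α x * β y) :=
    integral_prod _ (hv.integrable_kernel hαm hβm hα hβ).1
  rw [h1]
  refine integral_congr_ae (Filter.Eventually.of_forall fun x => ?_)
  simp only [conv]
  rw [← integral_mul_const]
  refine integral_congr_ae (Filter.Eventually.of_forall fun y => ?_)
  simp only; ring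

theorem integrable_kernel_swap {α β : R3 → ℝ} (hαm : Measurable α) (hβm : Measurable β)
    (hα : Integrable α) (hβ : MemLp β 2 volume) :
    Integrable (fun z : R3 × R3 => v (z.1 - z.2) * (β z.1 * α z.2)) ∧
      (∫ z : R3 × R3, |v (z.1 - z.2) * (β z.1 * α z.2)| ≤
        √((∫ y, v y ^ 2) * ∫ y, β y ^ 2) * ∫ x, |α x|) ∧
      ∫ z : R3 × R3, v (z.1 - z.2) * (β z.1 * α z.2) = ∫ x, conv v β x * α x := by
  have e : ∀ z : R3 × R3, v (z.1 - z.2) * (β z.1 * α z.2) =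
      v (z.swap.1 - z.swap.2) * (α z.swap.1 * β z.swap.2) := fun z => by
    rw [Prod.fst_swap, Prod.snd_swap, ← hv.even, neg_sub, mul_comm (α _)]
  obtain ⟨h1, h2⟩ := hv.integrable_kernel hαm hβm hα hβ
  simp only [e]
  refine ⟨h1.swap, ?_, ?_⟩
  · refine (le_of_eq ?_).trans h2
    exact integral_prod_swap (μ := (volume : Measure R3)) (ν := (volume : Measure R3))
      fun z : R3 × R3 => |v (z.1 - z.2) * (α z.1 * β z.2)|
  · rw [← hv.integral_kernel hαm hβm hα hβ]
    exact integral_prod_swap (μ := (volume : Measure R3)) (ν := (volume : Measure R3))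
      fun z : R3 × R3 => v (z.1 - z.2) * (α z.1 * β z.2)

/-- The change in time of the interaction energy `∫ (v * n) n`. -/
theorem interaction_sub {n n' : ℝ → R3 → ℝ} {a b A B : ℝ} (hab : a ≤ b)
    (hd : ∀ s x, HasDerivAt (fun s => n s x) (n' s x) s)
    (hc : Continuous fun z : ℝ × R3 => n z.1 z.2) (hc' : Continuous fun z : ℝ × R3 => n' z.1 z.2)
    (hi : ∀ s ∈ Icc a b, Integrable (n s)) (h2 : ∀ s ∈ Icc a b, MemLp (n s) 2 volume)
    (hA : ∀ s ∈ Icc a b, ∫ x, n s x ^ 2 ≤ A) (hi' : ∀ s ∈ Icc a b, Integrable (n' s))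
    (hB : ∀ s ∈ Icc a b, ∫ x, |n' s x| ≤ B) :
    IntervalIntegrable (fun s => ∫ x, conv v (n s) x * n' s x) volume a b ∧
    (∫ x, conv v (n b) x * n b x) - ∫ x, conv v (n a) x * n a x =
      2 * ∫ s in a..b, ∫ x, conv v (n s) x * n' s x := by
  have hm : ∀ s, Measurable (n s) := fun s =>
    (hc.comp (by fun_prop : Continuous fun x : R3 => (s, x))).measurable
  have hm' : ∀ s, Measurable (n' s) := fun s =>
    (hc'.comp (by fun_prop : Continuous fun x : R3 => (s, x))).measurable
  have hvn : 0 ≤ ∫ y, v y ^ 2 := integral_nonneg fun y => sq_nonneg _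
  -- As a double integral, the energy has a time derivative that falls on the two densities and
  -- never on `v`. Evenness of `v` makes the two resulting terms equal, which gives the factor 2.
  let h : ℝ → R3 × R3 → ℝ := fun s z => v (z.1 - z.2) * (n s z.1 * n s z.2)
  let h' : ℝ → R3 × R3 → ℝ := fun s z =>
    v (z.1 - z.2) * (n' s z.1 * n s z.2) + v (z.1 - z.2) * (n s z.1 * n' s z.2)
  have k1 : ∀ s ∈ Icc a b, _ := fun s hs => hv.integrable_kernel (hm' s) (hm s) (hi' s hs) (h2 s hs)
  have k2 : ∀ s ∈ Icc a b, _ := fun s hs =>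
    hv.integrable_kernel_swap (hm' s) (hm s) (hi' s hs) (h2 s hs)
  have hB0 : ∀ s ∈ Icc a b, √((∫ y, v y ^ 2) * ∫ y, n s y ^ 2) * ∫ x, |n' s x| ≤
      √((∫ y, v y ^ 2) * A) * B := fun s hs => by
    have : 0 ≤ ∫ x, |n' s x| := integral_nonneg fun x => abs_nonneg _
    exact mul_le_mul (Real.sqrt_le_sqrt (mul_le_mul_of_nonneg_left (hA s hs) hvn)) (hB s hs) this
      (Real.sqrt_nonneg _)
  have hint : ∀ s ∈ Icc a b, Integrable (h' s) := fun s hs => (k1 s hs).1.add (k2 s hs).1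
  have hbd : ∀ s ∈ Icc a b, ∫ z, |h' s z| ≤ 2 * (√((∫ y, v y ^ 2) * A) * B) := fun s hs => by
    have e : ∫ z, |h' s z| ≤ ∫ z : R3 × R3, (|v (z.1 - z.2) * (n' s z.1 * n s z.2)|
        + |v (z.1 - z.2) * (n s z.1 * n' s z.2)|) :=
      integral_mono (hint s hs).abs ((k1 s hs).1.abs.add (k2 s hs).1.abs) fun z => abs_add_le _ _
    rw [integral_add (k1 s hs).1.abs (k2 s hs).1.abs] at e
    linarith [(k1 s hs).2, (k2 s hs).2.1, hB0 s hs]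
  have hmeas : Measurable (Function.uncurry h') := by
    have hv' : Measurable fun q : ℝ × R3 × R3 => v (q.2.1 - q.2.2) := hv.measurable.comp (by fun_prop)
    have c1 : Measurable fun q : ℝ × R3 × R3 => n q.1 q.2.1 :=
      hc.measurable.comp (by fun_prop : Measurable fun q : ℝ × R3 × R3 => (q.1, q.2.1))
    have c2 : Measurable fun q : ℝ × R3 × R3 => n q.1 q.2.2 :=
      hc.measurable.comp (by fun_prop : Measurable fun q : ℝ × R3 × R3 => (q.1, q.2.2))
    have c3 : Measurable fun q : ℝ × R3 × R3 => n' q.1 q.2.1 :=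
      hc'.measurable.comp (by fun_prop : Measurable fun q : ℝ × R3 × R3 => (q.1, q.2.1))
    have c4 : Measurable fun q : ℝ × R3 × R3 => n' q.1 q.2.2 :=
      hc'.measurable.comp (by fun_prop : Measurable fun q : ℝ × R3 × R3 => (q.1, q.2.2))
    exact (hv'.mul (c3.mul c2)).add (hv'.mul (c1.mul c4))
  have hder : ∀ s z, HasDerivAt (fun s => h s z) (h' s z) s := fun s z => by
    have := (((hd s z.1).mul (hd s z.2)).const_mul (v (z.1 - z.2)))
    refine this.congr_deriv ?_
    simp only [h']; ring
  have hcont : ∀ z, Continuous fun s => h' s z := fun z => by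
    have c : ∀ x, Continuous fun s => n s x := fun x =>
      hc.comp (by fun_prop : Continuous fun s : ℝ => (s, x))
    have c' : ∀ x, Continuous fun s => n' s x := fun x =>
      hc'.comp (by fun_prop : Continuous fun s : ℝ => (s, x))
    exact (continuous_const.mul ((c' z.1).mul (c z.2))).add
      (continuous_const.mul ((c z.1).mul (c' z.2)))
  have hval : ∀ s ∈ Icc a b, ∫ z, h' s z = 2 * ∫ x, conv v (n s) x * n' s x := fun s hs => by
    have e1 := hv.integral_kernel (hm' s) (hm s) (hi' s hs) (h2 s hs)
    have e2 := (k2 s hs).2.2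
    rw [show ∫ z, h' s z = (∫ z : R3 × R3, v (z.1 - z.2) * (n' s z.1 * n s z.2))
      + ∫ z : R3 × R3, v (z.1 - z.2) * (n s z.1 * n' s z.2) from
        integral_add (k1 s hs).1 (k2 s hs).1, e1, e2]
    ring
  have hΘ : ∀ s ∈ Icc a b, Integrable (h s) ∧ ∫ z, h s z = ∫ x, conv v (n s) x * n s x :=
    fun s hs => ⟨(hv.integrable_kernel (hm s) (hm s) (hi s hs) (h2 s hs)).1,
      hv.integral_kernel (hm s) (hm s) (hi s hs) (h2 s hs)⟩
  have ha := hΘ a ⟨le_rfl, hab⟩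
  have hb := hΘ b ⟨hab, le_rfl⟩
  have key := integral_sub_eq_integral_deriv hab hder hcont hmeas hint hbd ha.1 hb.1
  have hii := intervalIntegrable_integral hab hmeas hint hbd
  rw [ha.2, hb.2] at key
  refine ⟨?_, ?_⟩
  · refine (hii.const_mul 2⁻¹).congr fun s hs => ?_
    rw [uIoc_of_le hab] at hs
    simp only [hval s (Ioc_subset_Icc_self hs)]
    ring
  · rw [key, ← intervalIntegral.integral_const_mul]
    refine intervalIntegral.integral_congr fun s hs => ?_
    rw [uIcc_of_le hab] at hs
    exact hval s hs

end IsRegularPotential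

/-! ### Mass and interaction energy of the Hartree flow -/

theorem inner_I_mul_self (z : ℂ) : ⟪z, Complex.I * z⟫_ℝ = 0 := by
  simp [Complex.inner]; ring

theorem pd_mul {g h : R3 → ℝ} (hg : Differentiable ℝ g) (hh : Differentiable ℝ h) (k : Fin 3)
    (x : R3) : pd k (fun y => g y * h y) x = pd k g x * h x + g x * pd k h x := by
  rw [pd, fderiv_fun_mul (hg x) (hh x)]
  simp only [add_apply, smul_apply, smul_eq_mul, pd]; ring

theorem pd_I_mul {f : R3 → ℂ} (hf : Differentiable ℝ f) (k : Fin 3) (x : R3) :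
    pd k (fun y => Complex.I * f y) x = Complex.I * pd k f x := by
  rw [pd, fderiv_const_mul (hf x)]; rfl

theorem integral_mul_pd_eq_neg {W F : R3 → ℝ} (hW : Differentiable ℝ W)
    (hF : Differentiable ℝ F) (k : Fin 3) (i1 : Integrable fun x => W x * F x)
    (i2 : Integrable fun x => pd k W x * F x) (i3 : Integrable fun x => W x * pd k F x) :
    ∫ x, W x * pd k F x = -∫ x, pd k W x * F x := by
  have e : pd k (fun x => W x * F x) = fun x => pd k W x * F x + W x * pd k F x :=
    funext fun x => pd_mul hW hF k x
  have h := integral_pd_eq_zero k (hW.mul hF) i1 (by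
    change Integrable (pd k fun x => W x * F x)
    rw [e]; exact i2.add i3)
  change ∫ x, pd k (fun x => W x * F x) x = 0 at h
  rw [e, integral_add i2 i3] at h
  linarith

/-- The current `⟪f, i ∂ₖ f⟫`. -/
def current (k : Fin 3) (f : R3 → ℂ) (x : R3) : ℝ := ⟪f x, Complex.I * pd k f x⟫_ℝ

theorem contDiff_current {f : R3 → ℂ} (hf : ContDiff ℝ ∞ f) (k : Fin 3) :
    ContDiff ℝ ∞ (current k f) :=
  hf.inner ℝ (contDiff_const.mul (contDiff_pd hf k))

theorem pd_current {f : R3 → ℂ} (hf : ContDiff ℝ ∞ f) (k : Fin 3) (x : R3) :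
    pd k (current k f) x = ⟪f x, Complex.I * pd k (pd k f) x⟫_ℝ := by
  have h1 : Differentiable ℝ f := hf.differentiable (by simp)
  have h2 : Differentiable ℝ (pd k f) := (contDiff_pd hf k).differentiable (by simp)
  have h3 : Differentiable ℝ fun y => Complex.I * pd k f y := h2.const_mul _
  change fderiv ℝ (fun y => ⟪f y, Complex.I * pd k f y⟫_ℝ) x _ = _
  rw [fderiv_inner_apply ℝ (h1 x) (h3 x)]
  change ⟪f x, pd k (fun y => Complex.I * pd k f y) x⟫_ℝ + ⟪pd k f x, Complex.I * pd k f x⟫_ℝ = _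
  rw [pd_I_mul h2, inner_I_mul_self, add_zero]

theorem abs_current_le (k : Fin 3) (f : R3 → ℂ) (x : R3) :
    |current k f x| ≤ ‖f x‖ * ‖pd k f x‖ := by
  refine (abs_real_inner_le_norm _ _).trans ?_
  simp

theorem integral_mul_pd_current {W : R3 → ℝ} {f : R3 → ℂ} (hW : Differentiable ℝ W)
    (hf : ContDiff ℝ ∞ f) (k : Fin 3) (i1 : Integrable fun x => W x * current k f x)
    (i2 : Integrable fun x => pd k W x * current k f x)
    (i3 : Integrable fun x => W x * pd k (current k f) x) :
    ∫ x, W x * pd k (current k f) x = -∫ x, pd k W x * current k f x :=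
  integral_mul_pd_eq_neg hW ((contDiff_current hf k).differentiable (by simp)) k i1 i2 i3

theorem integrable_norm_mul_norm {X E F : Type*} [MeasurableSpace X] [NormedAddCommGroup E]
    [NormedAddCommGroup F] {μ : Measure X} {f : X → E} {g : X → F} (hf : MemLp f 2 μ)
    (hg : MemLp g 2 μ) : Integrable (fun x => ‖f x‖ * ‖g x‖) μ :=
  hf.norm.integrable_mul hg.norm

theorem integrable_of_abs_le_mul {W h : R3 → ℝ} {A : ℝ} {u : R3 → ℝ} (hW : Measurable W)
    (hA : ∀ x, |W x| ≤ A) (hh : Measurable h) (hu : Integrable u) (hhu : ∀ x, |h x| ≤ u x) :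
    Integrable fun x => W x * h x := by
  have hA0 : 0 ≤ A := (abs_nonneg _).trans (hA 0)
  refine (hu.const_mul A).mono' (hW.mul hh).aestronglyMeasurable
    (Filter.Eventually.of_forall fun x => ?_)
  rw [norm_mul, Real.norm_eq_abs, Real.norm_eq_abs]
  exact mul_le_mul (hA x) (hhu x) (abs_nonneg _) hA0

theorem H2Slice.integral_mul_pd_current {M A : ℝ} {f : R3 → ℂ} (hf : H2Slice M f) {W : R3 → ℝ}
    (hW : Differentiable ℝ W) (hW' : ∀ k, Measurable (pd k W)) (hA : ∀ x, |W x| ≤ A)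
    (hA' : ∀ k x, |pd k W x| ≤ A) (k : Fin 3) :
    Integrable (fun x => W x * pd k (current k f) x) ∧
      Integrable (fun x => pd k W x * current k f x) ∧
      ∫ x, W x * pd k (current k f) x = -∫ x, pd k W x * current k f x := by
  have hc := contDiff_current hf.smooth k
  have hu := integrable_norm_mul_norm hf.memLp (hf.memLp_pd k)
  have hu' := integrable_norm_mul_norm hf.memLp (hf.memLp_pd_pd k k)
  have i1 := integrable_of_abs_le_mul hW.continuous.measurable hA hc.continuous.measurable hu
    (abs_current_le k f)
  have i2 := integrable_of_abs_le_mul (hW' k) (hA' k) hc.continuous.measurable hu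
    (abs_current_le k f)
  have i3 := integrable_of_abs_le_mul hW.continuous.measurable hA
    (contDiff_pd hc k).continuous.measurable hu' (fun x => by
      rw [pd_current hf.smooth]
      refine (abs_real_inner_le_norm _ _).trans ?_
      simp)
  exact ⟨i3, i2, PairExcitation.integral_mul_pd_current hW hf.smooth k i1 i2 i3⟩

/-- A globally smooth function solving the Hartree equation for times `t ≥ 1`. -/
structure HartreeFlow (v : R3 → ℝ) (φ : ℝ → R3 → ℂ) : Prop where
  smooth : JSmooth φ
  slice : ∀ T : ℝ, ∃ M : ℝ, ∀ t ∈ Icc 1 T, H2Slice M (φ t)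
  equation : ∀ t, 1 ≤ t → ∀ x, td φ t x =
    Complex.I * ∑ k, pd k (pd k (φ t)) x - Complex.I * meanField v (φ t) x * φ t x

namespace HartreeFlow

variable {v : R3 → ℝ} {φ : ℝ → R3 → ℂ}

/-- The local conservation of mass: the real potential contributes `⟨φ, i V φ⟩ = 0`, so only the
divergence of the current remains. -/
theorem density_deriv (h : HartreeFlow v φ) {t : ℝ} (ht : 1 ≤ t) (x : R3) :
    2 * ⟪φ t x, td φ t x⟫_ℝ = 2 * ∑ k, pd k (current k (φ t)) x := by
  have hs := h.smooth.slice t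
  rw [h.equation t ht x, inner_sub_right, Finset.mul_sum, inner_sum]
  simp only [pd_current hs]
  have : ⟪φ t x, Complex.I * meanField v (φ t) x * φ t x⟫_ℝ = 0 := by
    have e : Complex.I * meanField v (φ t) x * φ t x =
        meanField v (φ t) x • (Complex.I * φ t x) := by
      rw [Complex.real_smul]; ring
    rw [e, inner_smul_right, inner_I_mul_self, mul_zero]
  rw [this, sub_zero]

theorem jsmooth_inner {f g : ℝ → R3 → ℂ} (hf : JSmooth f) (hg : JSmooth g) :
    JSmooth fun t x => ⟪f t x, g t x⟫_ℝ :=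
  ContDiff.inner ℝ hf hg

theorem abs_density_deriv_le (h : HartreeFlow v φ) {t : ℝ} (ht : 1 ≤ t) (x : R3) :
    |2 * ⟪φ t x, td φ t x⟫_ℝ| ≤ ∑ k, (‖φ t x‖ ^ 2 + ‖pd k (pd k (φ t)) x‖ ^ 2) := by
  rw [h.density_deriv ht, abs_mul, abs_two]
  refine (mul_le_mul_of_nonneg_left (Finset.abs_sum_le_sum_abs _ _) zero_le_two).trans ?_
  rw [Finset.mul_sum]
  refine Finset.sum_le_sum fun k _ => ?_
  have h1 : |pd k (current k (φ t)) x| ≤ ‖φ t x‖ * ‖pd k (pd k (φ t)) x‖ := by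
    rw [pd_current (h.smooth.slice t)]
    refine (abs_real_inner_le_norm _ _).trans ?_
    simp
  nlinarith [sq_nonneg (‖φ t x‖ - ‖pd k (pd k (φ t)) x‖)]

theorem integrable_density_bound {M : ℝ} {f : R3 → ℂ} (hf : H2Slice M f) :
    Integrable (fun x => ∑ k, (‖f x‖ ^ 2 + ‖pd k (pd k f) x‖ ^ 2)) ∧
      ∫ x, ∑ k, (‖f x‖ ^ 2 + ‖pd k (pd k f) x‖ ^ 2) ≤ 6 * M := by
  have i1 := (memLp_two_iff_integrable_sq_norm hf.memLp.1).1 hf.memLp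
  have i2 := fun k => (memLp_two_iff_integrable_sq_norm (hf.memLp_pd_pd k k).1).1
    (hf.memLp_pd_pd k k)
  have i3 : ∀ k, Integrable fun x => ‖f x‖ ^ 2 + ‖pd k (pd k f) x‖ ^ 2 := fun k => i1.add (i2 k)
  refine ⟨integrable_finsetSum _ fun k _ => i3 k, ?_⟩
  rw [integral_finsetSum _ fun k _ => i3 k]
  have : ∀ k, ∫ x, (‖f x‖ ^ 2 + ‖pd k (pd k f) x‖ ^ 2) ≤ 2 * M := fun k => by
    rw [integral_add i1 (i2 k)]
    linarith [hf.le, hf.le_pd_pd k k]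
  refine (Finset.sum_le_sum fun k _ => this k).trans (le_of_eq ?_)
  simp; ring

theorem integrable_density_deriv (h : HartreeFlow v φ) {M t : ℝ} (ht : 1 ≤ t)
    (hM : H2Slice M (φ t)) : Integrable (fun x => 2 * ⟪φ t x, td φ t x⟫_ℝ) ∧
      ∫ x, |2 * ⟪φ t x, td φ t x⟫_ℝ| ≤ 6 * M := by
  obtain ⟨i, hi⟩ := integrable_density_bound hM
  have hc : Continuous fun x => 2 * ⟪φ t x, td φ t x⟫_ℝ :=
    continuous_const.mul ((jsmooth_inner h.smooth h.smooth.td).slice t).continuous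
  have i' : Integrable fun x => 2 * ⟪φ t x, td φ t x⟫_ℝ :=
    i.mono' hc.aestronglyMeasurable (Filter.Eventually.of_forall fun x => h.abs_density_deriv_le ht x)
  exact ⟨i', (integral_mono i'.abs i (h.abs_density_deriv_le ht)).trans hi⟩

theorem hasDerivAt_density (h : HartreeFlow v φ) (t : ℝ) (x : R3) :
    HasDerivAt (fun s => ‖φ s x‖ ^ 2) (2 * ⟪φ t x, td φ t x⟫_ℝ) t :=
  (h.smooth.hasDerivAt t x).norm_sq

theorem mass_eq (h : HartreeFlow v φ) {t : ℝ} (ht : 1 ≤ t) :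
    ∫ x, ‖φ t x‖ ^ 2 = ∫ x, ‖φ 1 x‖ ^ 2 := by
  obtain ⟨M, hM⟩ := h.slice t
  have hj := jsmooth_inner h.smooth h.smooth.td
  have hint : ∀ s ∈ Icc 1 t, Integrable fun x => ‖φ s x‖ ^ 2 := fun s hs =>
    (memLp_two_iff_integrable_sq_norm (hM s hs).memLp.1).1 (hM s hs).memLp
  have key := integral_sub_eq_integral_deriv (μ := (volume : Measure R3))
    (h := fun s x => ‖φ s x‖ ^ 2) (h' := fun s x => 2 * ⟪φ s x, td φ s x⟫_ℝ) (C := 6 * M) ht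
    h.hasDerivAt_density (fun x => continuous_const.mul (hj.timeSlice x).continuous)
    ((continuous_const.mul hj.continuous).measurable)
    (fun s hs => (h.integrable_density_deriv hs.1 (hM s hs)).1)
    (fun s hs => (h.integrable_density_deriv hs.1 (hM s hs)).2)
    (hint 1 ⟨le_rfl, ht⟩) (hint t ⟨ht, le_rfl⟩)
  have hz : ∀ s ∈ Icc 1 t, ∫ x, 2 * ⟪φ s x, td φ s x⟫_ℝ = 0 := fun s hs => by
    simp only [h.density_deriv hs.1]
    have hk := fun k => (hM s hs).integral_mul_pd_current (W := fun _ => (1 : ℝ)) (A := 1)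
      (by fun_prop) (fun k => by unfold pd; simp) (fun x => by simp)
      (fun k x => by simp [pd]) k
    simp only [one_mul] at hk
    rw [integral_const_mul, integral_finsetSum _ fun k _ => (hk k).1]
    have : ∀ k, ∫ x, pd k (current k (φ s)) x = 0 := fun k => by
      rw [(hk k).2.2]; simp [pd]
    simp [this]
  rw [intervalIntegral.integral_congr (g := fun _ => (0 : ℝ)) fun s hs => by
    rw [uIcc_of_le ht] at hs; exact hz s hs] at key
  simp only [intervalIntegral.integral_zero] at key
  linarith

/-- The interaction energy `∫ (v * |f|²) |f|²`. -/
def interaction (v : R3 → ℝ) (f : R3 → ℂ) : ℝ := ∫ x, meanField v f x * ‖f x‖ ^ 2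

theorem conv_mul_left (v g : R3 → ℝ) (c : ℝ) (x : R3) :
    conv v (fun y => c * g y) x = c * conv v g x := by
  rw [conv, conv, ← integral_const_mul]
  congr 1; funext y; ring

theorem measurable_pd_meanField (hv : IsRegularPotential v) {f : R3 → ℂ} (hf : ContDiff ℝ ∞ f)
    (k : Fin 3) : Continuous (pd k (meanField v f)) := by
  rw [meanField_eq_conv, hv.pd_conv (contDiff_norm_sq hf)]
  exact hv.continuous_conv (contDiff_pd (contDiff_norm_sq hf) k)

theorem integral_meanField_mul_deriv (hv : IsRegularPotential v) (h : HartreeFlow v φ) {t : ℝ}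
    (ht : 1 ≤ t) {M A : ℝ} (hM : H2Slice M (φ t)) (hA : ∀ x, |meanField v (φ t) x| ≤ A)
    (hA' : ∀ k x, |pd k (meanField v (φ t)) x| ≤ A) :
    ∫ x, meanField v (φ t) x * (2 * ⟪φ t x, td φ t x⟫_ℝ) =
      -(2 * ∑ k, ∫ x, pd k (meanField v (φ t)) x * current k (φ t) x) := by
  have hs := h.smooth.slice t
  have hk := hM.integral_mul_pd_current (hv.differentiable_conv (contDiff_norm_sq hs))
    (fun k => (measurable_pd_meanField hv hs k).measurable) hA hA'
  rw [← meanField_eq_conv] at hk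
  simp only [h.density_deriv ht]
  have e : ∀ x, meanField v (φ t) x * (2 * ∑ k, pd k (current k (φ t)) x) =
      2 * ∑ k, meanField v (φ t) x * pd k (current k (φ t)) x := fun x => by
    rw [Finset.mul_sum, Finset.mul_sum, Finset.mul_sum]
    exact Finset.sum_congr rfl fun k _ => by ring
  simp only [e]
  rw [integral_const_mul, integral_finsetSum _ fun k _ => (hk k).1]
  simp only [(hk _).2.2, Finset.sum_neg_distrib, mul_neg]

/-- `s² ∫ (v * |φ|²) |φ|²` is the interaction energy of the density `s |φ|²`, whose change is known.
Conservation of mass and an integration by parts produce the terms with `current`, which later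
cancel against those of the boosted norms. -/
theorem sq_mul_interaction_sub (hv : IsRegularPotential v) (h : HartreeFlow v φ) {a b : ℝ}
    (ha : 1 ≤ a) (hab : a ≤ b) :
    IntervalIntegrable (fun s => s * interaction v (φ s)
      - 2 * s ^ 2 * ∑ k, ∫ x, pd k (meanField v (φ s)) x * current k (φ s) x) volume a b ∧
    b ^ 2 * interaction v (φ b) - a ^ 2 * interaction v (φ a) =
      2 * ∫ s in a..b, (s * interaction v (φ s)
        - 2 * s ^ 2 * ∑ k, ∫ x, pd k (meanField v (φ s)) x * current k (φ s) x) := by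
  obtain ⟨M, hM⟩ := h.slice b
  obtain ⟨A, hA0, hA⟩ := exists_slice_bounds hv M
  have hM' : ∀ s ∈ Icc a b, H2Slice M (φ s) := fun s hs => hM s ⟨ha.trans hs.1, hs.2⟩
  have hj := jsmooth_inner h.smooth h.smooth.td
  have hcn : Continuous fun z : ℝ × R3 => ‖φ z.1 z.2‖ ^ 2 := h.smooth.continuous.norm.pow 2
  have hs0 : ∀ s ∈ Icc a b, 0 ≤ s := fun s hs => by linarith [hs.1]
  have hn1 : ∀ s ∈ Icc a b, Integrable fun x => ‖φ s x‖ ^ 2 := fun s hs =>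
    (memLp_two_iff_integrable_sq_norm (hM' s hs).memLp.1).1 (hM' s hs).memLp
  have hn2 : ∀ s ∈ Icc a b, MemLp (fun x => ‖φ s x‖ ^ 2) 2 volume := fun s hs =>
    memLp_norm_sq (h.smooth.slice s) (hA _ (hM' s hs)).1
  have hdd : ∀ s ∈ Icc a b, _ := fun s hs =>
    h.integrable_density_deriv (ha.trans hs.1) (hM' s hs)
  obtain ⟨k1, k2⟩ := hv.interaction_sub (n := fun s x => s * ‖φ s x‖ ^ 2)
    (n' := fun s x => ‖φ s x‖ ^ 2 + s * (2 * ⟪φ s x, td φ s x⟫_ℝ)) (A := b ^ 2 * A)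
    (B := M + b * (6 * M)) hab
    (fun s x => by
      refine ((hasDerivAt_id s).mul (h.hasDerivAt_density s x)).congr_deriv ?_
      simp)
    (continuous_fst.mul hcn)
    (hcn.add (continuous_fst.mul (continuous_const.mul hj.continuous)))
    (fun s hs => (hn1 s hs).const_mul s) (fun s hs => (hn2 s hs).const_mul s)
    (fun s hs => by
      have e : ∀ x, (s * ‖φ s x‖ ^ 2) ^ 2 = s ^ 2 * ‖φ s x‖ ^ 4 := fun x => by ring
      simp only [e]
      rw [integral_const_mul]
      have := (hA _ (hM' s hs)).2.1
      have h1 := hs0 s hs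
      have h2 := hs.2
      gcongr)
    (fun s hs => (hn1 s hs).add ((hdd s hs).1.const_mul s))
    (fun s hs => by
      have h1 := hs0 s hs
      have hle : ∀ x, |‖φ s x‖ ^ 2 + s * (2 * ⟪φ s x, td φ s x⟫_ℝ)| ≤
          ‖φ s x‖ ^ 2 + s * |2 * ⟪φ s x, td φ s x⟫_ℝ| := fun x => by
        refine (abs_add_le _ _).trans ?_
        rw [abs_of_nonneg (sq_nonneg ‖φ s x‖), abs_mul s, abs_of_nonneg h1]
      refine (integral_mono ((hn1 s hs).add ((hdd s hs).1.const_mul s)).abs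
        ((hn1 s hs).add ((hdd s hs).1.abs.const_mul s)) hle).trans ?_
      rw [integral_add' (hn1 s hs) ((hdd s hs).1.abs.const_mul s), integral_const_mul]
      have h3 := (hM' s hs).nonneg
      have h4 : s * ∫ x, |2 * ⟪φ s x, td φ s x⟫_ℝ| ≤ b * (6 * M) :=
        mul_le_mul hs.2 (hdd s hs).2 (integral_nonneg fun x => abs_nonneg _) (h1.trans hs.2)
      linarith [(hM' s hs).le])
  have hval : ∀ s ∈ Icc a b, ∫ x, conv v (fun y => s * ‖φ s y‖ ^ 2) x
      * (‖φ s x‖ ^ 2 + s * (2 * ⟪φ s x, td φ s x⟫_ℝ)) = s * interaction v (φ s)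
        - 2 * s ^ 2 * ∑ k, ∫ x, pd k (meanField v (φ s)) x * current k (φ s) x := by
    intro s hs
    have hb := hA _ (hM' s hs)
    have hg := integral_meanField_mul_deriv hv h (ha.trans hs.1) (hM' s hs) hb.2.2.2.1 hb.2.2.2.2
    have hmV : Measurable (meanField v (φ s)) :=
      (hv.continuous_conv (contDiff_norm_sq (h.smooth.slice s))).measurable
    have i1 : Integrable fun x => meanField v (φ s) x * ‖φ s x‖ ^ 2 :=
      integrable_of_abs_le_mul hmV hb.2.2.2.1
        (contDiff_norm_sq (h.smooth.slice s)).continuous.measurable (hn1 s hs)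
        (fun x => (abs_of_nonneg (sq_nonneg _)).le)
    have i2 : Integrable fun x => meanField v (φ s) x * (2 * ⟪φ s x, td φ s x⟫_ℝ) :=
      integrable_of_abs_le_mul hmV hb.2.2.2.1
        (continuous_const.mul (hj.slice s).continuous).measurable (hdd s hs).1.abs
        (fun x => le_rfl)
    have e : ∀ x, conv v (fun y => s * ‖φ s y‖ ^ 2) x
        * (‖φ s x‖ ^ 2 + s * (2 * ⟪φ s x, td φ s x⟫_ℝ)) =
        s * (meanField v (φ s) x * ‖φ s x‖ ^ 2)
          + s ^ 2 * (meanField v (φ s) x * (2 * ⟪φ s x, td φ s x⟫_ℝ)) := fun x => by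
      rw [conv_mul_left, meanField_eq_conv]; ring
    simp only [e]
    rw [integral_add (i1.const_mul _) (i2.const_mul _), integral_const_mul, integral_const_mul, hg,
      interaction]
    ring
  have hΘ : ∀ s, ∫ x, conv v (fun y => s * ‖φ s y‖ ^ 2) x * (s * ‖φ s x‖ ^ 2) =
      s ^ 2 * interaction v (φ s) := fun s => by
    rw [interaction, ← integral_const_mul]
    refine integral_congr_ae (Filter.Eventually.of_forall fun x => ?_)
    simp only [conv_mul_left, meanField_eq_conv]
    ring
  simp only [hΘ] at k2
  refine ⟨k1.congr fun s hs => ?_, ?_⟩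
  · rw [uIoc_of_le hab] at hs
    exact hval s (Ioc_subset_Icc_self hs)
  · rw [k2]
    congr 1
    refine intervalIntegral.integral_congr fun s hs => ?_
    rw [uIcc_of_le hab] at hs
    exact hval s hs

end HartreeFlow

/-! ### The virial inequality -/

theorem fderiv_eq_sum_pd (g : R3 → ℝ) (y x : R3) : fderiv ℝ g y x = ∑ j, x j * pd j g y := by
  have hx : x = ∑ k, x k • EuclideanSpace.single k (1 : ℝ) := by
    have := (EuclideanSpace.basisFun (Fin 3) ℝ).sum_repr x
    simpa using this.symm
  conv_lhs => rw [hx]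
  simp only [map_sum, map_smul]; rfl

theorem ae_fst_ne_snd : ∀ᵐ z : R3 × R3, z.1 ≠ z.2 := by
  have h := (measurePreserving_sub_prod (volume : Measure R3)
    (volume : Measure R3)).quasiMeasurePreserving.ae (ae_fst (Measure.ae_ne volume (0 : R3)))
  filter_upwards [h] with z hz using sub_ne_zero.1 hz

theorem integral_comp_smul_prod (F : R3 × R3 → ℝ) {τ : ℝ} (hτ : 0 < τ) :
    ∫ z, F (τ • z) = (τ ^ 6)⁻¹ * ∫ z, F z := by
  have h := Measure.integral_comp_smul ((volume : Measure R3).prod (volume : Measure R3)) F τ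
  have h6 : Module.finrank ℝ (R3 × R3) = 6 := by simp [Module.finrank_prod]
  rw [h6, abs_of_nonneg (by positivity), smul_eq_mul] at h
  exact h

namespace IsRegularPotential

variable {v : R3 → ℝ} (hv : IsRegularPotential v)

include hv

/-- The dilation by 2 dominates all `v(x / τ)` with `1 ≤ τ ≤ 2`. Being again a regular potential, it
provides an integrable majorant in the virial argument. -/
theorem dilate : IsRegularPotential fun x => v ((2 : ℝ)⁻¹ • x) := by
  have h2 : ∀ x : R3, x ≠ 0 → (2 : ℝ)⁻¹ • x ≠ 0 := fun x hx => smul_ne_zero (by norm_num) hx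
  obtain ⟨R, hR⟩ := hv.support
  have hm : Measurable fun x : R3 => v ((2 : ℝ)⁻¹ • x) := hv.measurable.comp (by fun_prop)
  refine ⟨hm, fun x => ?_, fun x hx => hv.nonneg _ (h2 x hx), ⟨2 * R, fun x hx => hR _ ?_⟩, ?_,
    fun σ hσ x hx => ?_, fun x hx => ?_⟩
  · rw [smul_neg, hv.even]
  · rw [norm_smul, Real.norm_of_nonneg (by norm_num)]; linarith
  · rw [memLp_two_iff_integrable_sq hm.aestronglyMeasurable]
    exact hv.integrable_sq.comp_smul (by norm_num : (2 : ℝ)⁻¹ ≠ 0)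
  · have := hv.scaling σ hσ _ (h2 x hx)
    rwa [smul_comm] at this
  · exact ContinuousAt.comp (g := v) (hv.continuousAt _ (h2 x hx))
      (continuous_const_smul (2 : ℝ)⁻¹).continuousAt

theorem le_dilate {τ : ℝ} (h1 : 1 ≤ τ) (h2 : τ ≤ 2) {x : R3} (hx : x ≠ 0) :
    v (τ⁻¹ • x) ≤ v ((2 : ℝ)⁻¹ • x) := by
  have hτ : 0 < τ := by linarith
  have hx' : τ⁻¹ • x ≠ 0 := smul_ne_zero (inv_ne_zero hτ.ne') hx
  have h := hv.scaling (2 / τ) ((one_le_div hτ).2 h2) _ hx'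
  rw [smul_smul, inv_div, show τ / 2 * τ⁻¹ = 2⁻¹ by field_simp] at h
  refine le_trans ?_ h
  exact le_mul_of_one_le_left (hv.nonneg _ hx') ((one_le_div hτ).2 h2)

/-- Formally `2 ∫ (v * n) q`, with `q = 3 n + x · ∇n`, is the derivative at `τ = 1` of the
interaction energy `Θ(τ)` of the dilated density `τ³ n(τ x)`. A change of variables shows that
`Θ(τ)` is the energy of `n` for the potential `v(x / τ)`, so the scaling property gives `Θ(τ) ≥ τ
Θ(1)` and the derivative at 1 is at least `Θ(1)`. The potential is never differentiated. -/
theorem virial_le {n : R3 → ℝ} (hn : ContDiff ℝ ∞ n) (hn0 : ∀ x, 0 ≤ n x) (hi : Integrable n)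
    (h2 : MemLp n 2 volume) (hq : Integrable fun x => 3 * n x + ∑ j, x j * pd j n x) :
    ∫ x, conv v n x * n x ≤ 2 * ∫ x, conv v n x * (3 * n x + ∑ j, x j * pd j n x) := by
  set q : R3 → ℝ := fun x => 3 * n x + ∑ j, x j * pd j n x with hqdef
  have hqc : Continuous q := by
    refine (continuous_const.mul hn.continuous).add (continuous_finsetSum _ fun j _ => ?_)
    exact (by fun_prop : Continuous fun x : R3 => x j).mul (contDiff_pd hn j).continuous
  have hnm := hn.continuous.measurable
  have hqm := hqc.measurable
  -- The dilation preserving `∫ n`, followed by its derivative in `τ`.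
  set N : ℝ → R3 → ℝ := fun τ x => τ ^ 3 * n (τ • x) with hN
  set N' : ℝ → R3 → ℝ := fun τ x => τ ^ 2 * q (τ • x) with hN'
  have hd : ∀ τ x, HasDerivAt (fun τ => N τ x) (N' τ x) τ := by
    intro τ x
    have h1 : HasDerivAt (fun τ : ℝ => τ • x) x τ := by
      simpa using (hasDerivAt_id τ).smul_const x
    have h3 : HasDerivAt (fun τ : ℝ => n (τ • x)) (fderiv ℝ n (τ • x) x) τ :=
      (hn.differentiable (by simp) (τ • x)).hasFDerivAt.comp_hasDerivAt τ h1
    have h4 := (hasDerivAt_pow 3 τ).mul h3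
    refine h4.congr_deriv ?_
    rw [fderiv_eq_sum_pd]
    simp only [hN', hqdef, PiLp.smul_apply, smul_eq_mul, mul_assoc, ← Finset.mul_sum]
    push_cast
    ring
  have hpos : ∀ τ ∈ Icc (1 : ℝ) 2, 0 < τ := fun τ hτ => by linarith [hτ.1]
  have hsm : ∀ (g : R3 → ℝ) {τ : ℝ}, 0 < τ → ∫ x, g (τ • x) = (τ ^ 3)⁻¹ * ∫ x, g x := by
    intro g τ hτ
    have h := Measure.integral_comp_smul (volume : Measure R3) g τ
    rw [abs_of_nonneg (by positivity), smul_eq_mul] at h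
    simpa using h
  have ki : ∀ τ ∈ Icc (1 : ℝ) 2, Integrable (N τ) := fun τ hτ =>
    (hi.comp_smul (hpos τ hτ).ne').const_mul _
  have ki' : ∀ τ ∈ Icc (1 : ℝ) 2, Integrable (N' τ) := fun τ hτ =>
    (hq.comp_smul (hpos τ hτ).ne').const_mul _
  have k2 : ∀ τ ∈ Icc (1 : ℝ) 2, MemLp (N τ) 2 volume := fun τ hτ => by
    have hc : Continuous (N τ) := continuous_const.mul (hn.continuous.comp (by fun_prop))
    rw [memLp_two_iff_integrable_sq hc.aestronglyMeasurable]
    refine ((h2.integrable_sq.comp_smul (hpos τ hτ).ne').const_mul ((τ ^ 3) ^ 2)).congr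
      (Filter.Eventually.of_forall fun x => ?_)
    simp only [hN]; ring
  have kA : ∀ τ ∈ Icc (1 : ℝ) 2, ∫ x, N τ x ^ 2 ≤ 8 * ∫ x, n x ^ 2 := fun τ hτ => by
    have hτ0 := hpos τ hτ
    have e : ∀ x, N τ x ^ 2 = τ ^ 6 * n (τ • x) ^ 2 := fun x => by simp only [hN]; ring
    simp only [e]
    rw [integral_const_mul, hsm (fun x => n x ^ 2) hτ0, ← mul_assoc,
      show τ ^ 6 * (τ ^ 3)⁻¹ = τ ^ 3 by field_simp]
    refine mul_le_mul_of_nonneg_right ?_ (integral_nonneg fun x => sq_nonneg _)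
    calc τ ^ 3 ≤ 2 ^ 3 := pow_le_pow_left₀ hτ0.le hτ.2 3
      _ = 8 := by norm_num
  have kB : ∀ τ ∈ Icc (1 : ℝ) 2, ∫ x, |N' τ x| ≤ ∫ x, |q x| := fun τ hτ => by
    have hτ0 := hpos τ hτ
    have e : ∀ x, |N' τ x| = τ ^ 2 * |q (τ • x)| := fun x => by
      simp only [hN', abs_mul, abs_of_nonneg (sq_nonneg τ)]
    simp only [e]
    rw [integral_const_mul, hsm (fun x => |q x|) hτ0, ← mul_assoc,
      show τ ^ 2 * (τ ^ 3)⁻¹ = τ⁻¹ by field_simp]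
    exact mul_le_of_le_one_left (integral_nonneg fun x => abs_nonneg _)
      (inv_le_one_of_one_le₀ hτ.1)
  have key : ∀ σ ∈ Icc (1 : ℝ) 2,
      IntervalIntegrable (fun τ => ∫ x, conv v (N τ) x * N' τ x) volume 1 σ ∧
      (∫ x, conv v (N σ) x * N σ x) - ∫ x, conv v (N 1) x * N 1 x =
      2 * ∫ τ in (1 : ℝ)..σ, ∫ x, conv v (N τ) x * N' τ x := by
    intro σ hσ
    have hsub : ∀ τ ∈ Icc (1 : ℝ) σ, τ ∈ Icc (1 : ℝ) 2 := fun τ hτ => ⟨hτ.1, hτ.2.trans hσ.2⟩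
    exact hv.interaction_sub hσ.1 hd
      ((continuous_fst.pow 3).mul (hn.continuous.comp (by fun_prop)))
      ((continuous_fst.pow 2).mul (hqc.comp (by fun_prop))) (fun τ hτ => ki τ (hsub τ hτ))
      (fun τ hτ => k2 τ (hsub τ hτ)) (fun τ hτ => kA τ (hsub τ hτ))
      (fun τ hτ => ki' τ (hsub τ hτ)) (fun τ hτ => kB τ (hsub τ hτ))
  have hNm : ∀ τ, Measurable (N τ) := fun τ =>
    measurable_const.mul (hnm.comp (by fun_prop))
  have hN'm : ∀ τ, Measurable (N' τ) := fun τ =>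
    measurable_const.mul (hqm.comp (by fun_prop))
  have hb : ∀ τ ∈ Icc (1 : ℝ) 2, ∫ x, conv v (N τ) x * N' τ x =
      τ⁻¹ * ∫ z : R3 × R3, v (τ⁻¹ • (z.1 - z.2)) * (q z.1 * n z.2) := fun τ hτ => by
    have hτ0 := hpos τ hτ
    rw [← hv.integral_kernel (hN'm τ) (hNm τ) (ki' τ hτ) (k2 τ hτ)]
    have h := integral_comp_smul_prod
      (fun z : R3 × R3 => v (τ⁻¹ • (z.1 - z.2)) * (q z.1 * n z.2)) hτ0
    have e : ∀ z : R3 × R3, v (z.1 - z.2) * (N' τ z.1 * N τ z.2) =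
        τ ^ 5 * (v (τ⁻¹ • ((τ • z).1 - (τ • z).2)) * (q (τ • z).1 * n (τ • z).2)) := fun z => by
      simp only [hN, hN', Prod.smul_fst, Prod.smul_snd, ← smul_sub, smul_smul,
        inv_mul_cancel₀ hτ0.ne', one_smul]
      ring
    simp only [e]
    rw [integral_const_mul, h]
    field_simp
  have hΘ : ∀ τ ∈ Icc (1 : ℝ) 2, ∫ x, conv v (N τ) x * N τ x =
      ∫ z : R3 × R3, v (τ⁻¹ • (z.1 - z.2)) * (n z.1 * n z.2) := fun τ hτ => by
    have hτ0 := hpos τ hτ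
    rw [← hv.integral_kernel (hNm τ) (hNm τ) (ki τ hτ) (k2 τ hτ)]
    have h := integral_comp_smul_prod
      (fun z : R3 × R3 => v (τ⁻¹ • (z.1 - z.2)) * (n z.1 * n z.2)) hτ0
    have e : ∀ z : R3 × R3, v (z.1 - z.2) * (N τ z.1 * N τ z.2) =
        τ ^ 6 * (v (τ⁻¹ • ((τ • z).1 - (τ • z).2)) * (n (τ • z).1 * n (τ • z).2)) := fun z => by
      simp only [hN, Prod.smul_fst, Prod.smul_snd, ← smul_sub, smul_smul,
        inv_mul_cancel₀ hτ0.ne', one_smul]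
      ring
    simp only [e]
    rw [integral_const_mul, h]
    field_simp
  have hdil := hv.dilate
  have hvτ : ∀ τ : ℝ, Measurable fun z : R3 × R3 => v (τ⁻¹ • (z.1 - z.2)) := fun τ =>
    hv.measurable.comp (by fun_prop)
  have hdom : ∀ τ ∈ Icc (1 : ℝ) 2, ∀ g : R3 × R3 → ℝ, ∀ᵐ z : R3 × R3,
      ‖v (τ⁻¹ • (z.1 - z.2)) * g z‖ ≤ |v ((2 : ℝ)⁻¹ • (z.1 - z.2)) * g z| := by
    intro τ hτ g
    filter_upwards [ae_fst_ne_snd] with z hz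
    have hz' : z.1 - z.2 ≠ 0 := sub_ne_zero.2 hz
    have h0 : 0 ≤ v (τ⁻¹ • (z.1 - z.2)) :=
      hv.nonneg _ (smul_ne_zero (inv_ne_zero (hpos τ hτ).ne') hz')
    have h1 := hv.le_dilate hτ.1 hτ.2 hz'
    rw [Real.norm_eq_abs, abs_mul, abs_mul, abs_of_nonneg h0, abs_of_nonneg (h0.trans h1)]
    gcongr
  -- This is where `σ v(x) ≤ v(x / σ)` and the nonnegativity of the density are used.
  have hΘle : ∀ σ ∈ Icc (1 : ℝ) 2, σ * (∫ x, conv v n x * n x) ≤ ∫ x, conv v (N σ) x * N σ x := by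
    intro σ hσ
    rw [hΘ σ hσ, ← hv.integral_kernel hnm hnm hi h2, ← integral_const_mul]
    have i1 := (hv.integrable_kernel hnm hnm hi h2).1.const_mul σ
    have i2 : Integrable fun z : R3 × R3 => v (σ⁻¹ • (z.1 - z.2)) * (n z.1 * n z.2) :=
      (hdil.integrable_kernel hnm hnm hi h2).1.abs.mono'
        ((hvτ σ).mul (by fun_prop)).aestronglyMeasurable (hdom σ hσ _)
    refine integral_mono_ae i1 i2 ?_
    filter_upwards [ae_fst_ne_snd] with z hz
    simp only [← mul_assoc]
    have h := hv.scaling σ hσ.1 _ (sub_ne_zero.2 hz)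
    have h0 := hn0 z.1
    have h0' := hn0 z.2
    gcongr
  -- Dominated convergence, with the dilated potential `v(x / 2)` as majorant. One-sided continuity
  -- at 1 is all that the comparison needs.
  have hcont : ContinuousWithinAt (fun τ : ℝ => ∫ z : R3 × R3, v (τ⁻¹ • (z.1 - z.2)) * (q z.1 * n z.2))
      (Icc 1 2) 1 := by
    have i2 := (hdil.integrable_kernel hqm hnm hq h2).1.abs
    refine tendsto_integral_filter_of_dominated_convergence _ ?_ ?_ i2 ?_
    · exact Filter.Eventually.of_forall fun τ => ((hvτ τ).mul (by fun_prop)).aestronglyMeasurable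
    · filter_upwards [self_mem_nhdsWithin] with τ hτ using hdom τ hτ _
    · filter_upwards [ae_fst_ne_snd] with z hz
      have hc : ContinuousAt (fun τ : ℝ => v (τ⁻¹ • (z.1 - z.2))) 1 := by
        refine ContinuousAt.comp (g := v) (f := fun τ : ℝ => τ⁻¹ • (z.1 - z.2)) ?_ ?_
        · exact hv.continuousAt _ (by simpa using sub_ne_zero.2 hz)
        · exact (continuousAt_inv₀ one_ne_zero).smul continuousAt_const
      exact ((hc.mul continuousAt_const).continuousWithinAt (s := Icc 1 2)).tendsto
  have hN1 : N 1 = n := by funext x; simp [hN]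
  have hN'1 : N' 1 = q := by funext x; simp [hN']
  have hbc : ContinuousWithinAt (fun τ => ∫ x, conv v (N τ) x * N' τ x) (Icc 1 2) 1 := by
    have h := ((continuousAt_inv₀ (one_ne_zero (α := ℝ))).continuousWithinAt
      (s := Icc (1 : ℝ) 2)).mul hcont
    exact h.congr (fun τ hτ => hb τ hτ) (hb 1 ⟨le_rfl, one_le_two⟩)
  set P := ∫ x, conv v n x * n x with hP
  have hb1 : (∫ x, conv v (N 1) x * N' 1 x) = ∫ x, conv v n x * q x := by rw [hN1, hN'1]
  -- If `∫ (v * n) q < P / 2`, let `c` be the midpoint of the two. By continuity the derivative is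
  -- less than `2 c` on some `[1, σ]`, so `Θ(σ) - Θ(1) ≤ 2 c (σ - 1) < (σ - 1) P`, contradicting
  -- `Θ(σ) ≥ σ P`.
  by_contra hlt
  push Not at hlt
  set c := ((∫ x, conv v n x * q x) + P / 2) / 2 with hc
  have hlt' : (∫ x, conv v (N 1) x * N' 1 x) < c := by rw [hb1, hc]; linarith
  have hev := hbc.eventually_lt_const hlt'
  rw [nhdsWithin_Icc_eq_nhdsGE one_lt_two] at hev
  obtain ⟨σ', hσ', hsub⟩ := mem_nhdsGE_iff_exists_Icc_subset.1 hev
  set σ := min σ' 2 with hσ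
  have hσ1 : 1 < σ := lt_min hσ' one_lt_two
  have hσI : σ ∈ Icc (1 : ℝ) 2 := ⟨hσ1.le, min_le_right _ _⟩
  have hle : ∫ τ in (1 : ℝ)..σ, ∫ x, conv v (N τ) x * N' τ x ≤ ∫ _ in (1 : ℝ)..σ, c :=
    intervalIntegral.integral_mono_on hσI.1 (key σ hσI).1 intervalIntegrable_const
      fun τ hτ => le_of_lt (hsub ⟨hτ.1, hτ.2.trans (min_le_left _ _)⟩)
  rw [intervalIntegral.integral_const, smul_eq_mul] at hle
  have h1 := (key σ hσI).2
  have h2 := hΘle σ hσI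
  rw [hN1, ← hP] at h1
  have h3 : 0 < (σ - 1) * (P - 2 * c) := mul_pos (sub_pos.2 hσ1) (by rw [hc]; linarith)
  nlinarith

end IsRegularPotential

open HartreeFlow

theorem pd_coord (j k : Fin 3) (x : R3) :
    pd k (fun x : R3 => x j) x = if j = k then 1 else 0 := by
  have h : HasFDerivAt (fun x : R3 => x j) (EuclideanSpace.proj j : R3 →L[ℝ] ℝ) x :=
    (EuclideanSpace.proj j : R3 →L[ℝ] ℝ).hasFDerivAt
  rw [pd, h.fderiv]
  simp

theorem contDiff_coord (j : Fin 3) : ContDiff ℝ ∞ fun x : R3 => x j :=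
  (EuclideanSpace.proj j : R3 →L[ℝ] ℝ).contDiff

/-- Integration by parts turns `∫ x · ∇V n` into `-∫ V div(x n)`, and `div(x n) = 3 n + x · ∇n` is
the integrand in the virial inequality. -/
theorem virial_meanField {v : R3 → ℝ} (hv : IsRegularPotential v) {M : ℝ} {f : R3 → ℂ}
    (hf : H2Slice M f) (hx : ∀ j, MemLp (fun x : R3 => x j • f x) 2 volume) :
    (∀ j, Integrable fun x : R3 => pd j (meanField v f) x * (x j * ‖f x‖ ^ 2)) ∧
      ∑ j, ∫ x : R3, pd j (meanField v f) x * (x j * ‖f x‖ ^ 2) ≤ -(interaction v f / 2) := by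
  obtain ⟨A, -, hA⟩ := exists_slice_bounds hv M
  obtain ⟨h4, -, hp4, hV, hV'⟩ := hA f hf
  have hs := hf.smooth
  have hn := contDiff_norm_sq hs
  set V := meanField v f with hVdef
  have hVd : Differentiable ℝ V := hv.differentiable_conv hn
  have hVm : Measurable V := hVd.continuous.measurable
  have hV'm : ∀ k, Measurable (pd k V) := fun k => (measurable_pd_meanField hv hs k).measurable
  have hF : ∀ j, ContDiff ℝ ∞ fun x : R3 => x j * ‖f x‖ ^ 2 := fun j => (contDiff_coord j).mul hn
  have hFd := fun j => (hF j).differentiable (by simp)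
  have hpd : ∀ j x, pd j (fun x : R3 => x j * ‖f x‖ ^ 2) x =
      ‖f x‖ ^ 2 + x j * pd j (fun x => ‖f x‖ ^ 2) x := fun j x => by
    rw [pd_mul ((contDiff_coord j).differentiable (by simp)) (hn.differentiable (by simp)),
      pd_coord, if_pos rfl, one_mul]
  have i0 : Integrable fun x => ‖f x‖ ^ 2 :=
    (memLp_two_iff_integrable_sq_norm hf.memLp.1).1 hf.memLp
  have iF : ∀ j, Integrable fun x : R3 => x j * ‖f x‖ ^ 2 := fun j =>
    (integrable_norm_mul_norm (hx j) hf.memLp).mono' (hF j).continuous.aestronglyMeasurable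
      (Filter.Eventually.of_forall fun x => le_of_eq (by simp [sq, mul_assoc]))
  have hcp : ∀ j, Continuous fun x : R3 => x j * pd j (fun x => ‖f x‖ ^ 2) x := fun j =>
    (contDiff_coord j).continuous.mul (contDiff_pd hn j).continuous
  have iG : ∀ j, Integrable fun x : R3 => x j * pd j (fun x => ‖f x‖ ^ 2) x := fun j => by
    refine ((integrable_norm_mul_norm (hx j) (hf.memLp_pd j)).const_mul 2).mono'
      (hcp j).aestronglyMeasurable (Filter.Eventually.of_forall fun x => ?_)
    rw [pd_norm_sq hs, norm_mul, norm_mul, norm_smul, Real.norm_ofNat]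
    have := norm_inner_le_norm (𝕜 := ℝ) (f x) (pd j f x)
    have h0 := norm_nonneg (x j)
    nlinarith
  have iP : ∀ j, Integrable (pd j fun x : R3 => x j * ‖f x‖ ^ 2) := fun j =>
    (i0.add (iG j)).congr (Filter.Eventually.of_forall fun x => (hpd j x).symm)
  have k2 := fun j => integrable_of_abs_le_mul (hV'm j) (hV' j) (hF j).continuous.measurable
    (iF j).abs fun x => le_rfl
  have k1 := fun j => integrable_of_abs_le_mul hVm hV (hF j).continuous.measurable
    (iF j).abs fun x => le_rfl
  have k3 := fun j => integrable_of_abs_le_mul hVm hV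
    (contDiff_pd (hF j) j).continuous.measurable (iP j).abs fun x => le_rfl
  refine ⟨k2, ?_⟩
  have e : ∀ j, ∫ x : R3, pd j V x * (x j * ‖f x‖ ^ 2) =
      -∫ x : R3, V x * pd j (fun x : R3 => x j * ‖f x‖ ^ 2) x := fun j => by
    rw [integral_mul_pd_eq_neg hVd (hFd j) j (k1 j) (k2 j) (k3 j), neg_neg]
  have hqe : ∀ x : R3, 3 * ‖f x‖ ^ 2 + ∑ j, x j * pd j (fun x => ‖f x‖ ^ 2) x =
      ∑ j, pd j (fun x : R3 => x j * ‖f x‖ ^ 2) x := fun x => by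
    simp only [hpd, Finset.sum_add_distrib]; simp
  have hvir := hv.virial_le hn (fun x => sq_nonneg _) i0 (memLp_norm_sq hs h4)
    (by simp only [hqe]; exact integrable_finsetSum _ fun j _ => iP j)
  simp only [hqe] at hvir
  rw [← meanField_eq_conv, ← hVdef] at hvir
  simp only [e, Finset.sum_neg_distrib]
  rw [← integral_finsetSum _ fun j _ => k3 j]
  simp only [← Finset.mul_sum]
  rw [interaction]
  linarith

/-! ### The pseudoconformal derivatives -/

/-- The pseudoconformal derivative `(xⱼ / 2 + i t ∂ⱼ) f`. -/
def boost (t : ℝ) (j : Fin 3) (f : R3 → ℂ) (x : R3) : ℂ :=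
  (x j / 2) • f x + t • (Complex.I * pd j f x)

theorem contDiff_boost {f : R3 → ℂ} (hf : ContDiff ℝ ∞ f) (t : ℝ) (j : Fin 3) :
    ContDiff ℝ ∞ (boost t j f) :=
  (((contDiff_coord j).div_const 2).smul hf).add
    ((contDiff_const.mul (contDiff_pd hf j)).const_smul t)

theorem jsmooth_boost {φ : ℝ → R3 → ℂ} (hφ : JSmooth φ) (j : Fin 3) :
    JSmooth fun t => boost t j (φ t) := by
  have h1 : ContDiff ℝ ∞ fun z : ℝ × R3 => z.2 j := (contDiff_coord j).comp contDiff_snd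
  exact ((h1.div_const 2).smul hφ).add (contDiff_fst.smul (contDiff_const.mul (hφ.pd j)))

theorem pd_smul {a : R3 → ℝ} {f : R3 → ℂ} (ha : Differentiable ℝ a) (hf : Differentiable ℝ f)
    (k : Fin 3) (x : R3) :
    pd k (fun y => a y • f y) x = a x • pd k f x + pd k a x • f x := by
  rw [pd, fderiv_fun_smul (ha x) (hf x)]
  rfl

theorem pd_const_smul {f : R3 → ℂ} (hf : Differentiable ℝ f) (c : ℝ)
    (k : Fin 3) (x : R3) : pd k (fun y => c • f y) x = c • pd k f x := by
  rw [pd, fderiv_fun_const_smul (hf x)]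
  rfl

theorem pd_add {E : Type*} [NormedAddCommGroup E] [NormedSpace ℝ E] {f g : R3 → E}
    (hf : Differentiable ℝ f) (hg : Differentiable ℝ g)
    (k : Fin 3) (x : R3) : pd k (fun y => f y + g y) x = pd k f x + pd k g x := by
  rw [pd, fderiv_fun_add (hf x) (hg x)]
  rfl

theorem pd_half_coord (j k : Fin 3) (x : R3) :
    pd k (fun x : R3 => x j / 2) x = if j = k then 2⁻¹ else 0 := by
  have e : (fun x : R3 => x j / 2) = fun x : R3 => x j * (fun _ : R3 => (2 : ℝ)⁻¹) x := by
    funext x; rw [div_eq_mul_inv]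
  rw [e, pd_mul ((contDiff_coord j).differentiable (by simp)) (by fun_prop), pd_coord]
  have : pd k (fun _ : R3 => (2 : ℝ)⁻¹) x = 0 := by simp [pd]
  rw [this]; split_ifs <;> simp

theorem pd_boost {f : R3 → ℂ} (hf : ContDiff ℝ ∞ f) (t : ℝ) (j k : Fin 3) (x : R3) :
    pd k (boost t j f) x = boost t j (pd k f) x + (if j = k then (2 : ℝ)⁻¹ else 0) • f x := by
  have h1 : Differentiable ℝ fun x : R3 => x j / 2 :=
    ((contDiff_coord j).div_const 2).differentiable (by simp)
  have h2 := hf.differentiable (by simp)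
  have h3 := (contDiff_pd hf j).differentiable (by simp)
  have h4 : Differentiable ℝ fun x => Complex.I * pd j f x := h3.const_mul _
  change pd k (fun x : R3 => (x j / 2) • f x + t • (Complex.I * pd j f x)) x = _
  rw [pd_add (h1.fun_smul h2) (h4.fun_const_smul t), pd_const_smul h4, pd_I_mul h3, pd_smul h1 h2,
    pd_half_coord, pd_pd_comm hf, boost]
  abel

theorem sum_pd_pd_boost {f : R3 → ℂ} (hf : ContDiff ℝ ∞ f) (t : ℝ) (j : Fin 3) (x : R3) :
    ∑ k, pd k (pd k (boost t j f)) x = (x j / 2) • ∑ k, pd k (pd k f) x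
      + t • (Complex.I * ∑ k, pd k (pd k (pd j f)) x) + pd j f x := by
  have e : ∀ k, pd k (pd k (boost t j f)) x = (x j / 2) • pd k (pd k f) x
      + t • (Complex.I * pd k (pd k (pd j f)) x) + (if j = k then (1 : ℝ) else 0) • pd k f x := by
    intro k
    have hk := contDiff_pd hf k
    have e1 : pd k (boost t j f) = fun x =>
        boost t j (pd k f) x + (if j = k then (2 : ℝ)⁻¹ else 0) • f x :=
      funext fun x => pd_boost hf t j k x
    have h2 := hf.differentiable (by simp)
    rw [e1, pd_add ((contDiff_boost hk t j).differentiable (by simp)) (h2.fun_const_smul _),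
      pd_boost hk, pd_const_smul h2, boost, pd_pd_comm hk j k, pd_pd_comm hf j k, add_assoc,
      ← add_smul]
    congr 2
    split_ifs <;> norm_num
  simp only [e, Finset.sum_add_distrib, ← Finset.smul_sum, Finset.mul_sum]
  simp

namespace HartreeFlow

variable {v : R3 → ℝ} {φ : ℝ → R3 → ℂ}

/-- `xⱼ / 2 + i t ∂ⱼ` commutes with the free operator `i ∂ₜ + Δ`, so the boosted function solves the
same equation up to the commutator with the mean field. -/
theorem td_boost (hv : IsRegularPotential v) (h : HartreeFlow v φ) {t : ℝ} (ht : 1 ≤ t)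
    (j : Fin 3) (x : R3) :
    td (fun s => boost s j (φ s)) t x = Complex.I * ∑ k, pd k (pd k (boost t j (φ t))) x
      - Complex.I * meanField v (φ t) x * boost t j (φ t) x
      + (t * pd j (meanField v (φ t)) x) • φ t x := by
  have hs := h.smooth.slice t
  have hVd : Differentiable ℝ (meanField v (φ t)) := hv.differentiable_conv (contDiff_norm_sq hs)
  have e1 : td (fun s => boost s j (φ s)) t x = (x j / 2) • td φ t x
      + (t • (Complex.I * pd j (td φ t) x) + Complex.I * pd j (φ t) x) := by
    have d2 := (h.smooth.pd j).hasDerivAt t x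
    rw [h.smooth.td_pd] at d2
    have d := ((h.smooth.hasDerivAt t x).const_smul (x j / 2)).add
      ((hasDerivAt_id t).smul (d2.const_mul Complex.I))
    have := d.deriv
    simp only [id, one_smul] at this
    exact this
  have e2 : td φ t = fun x => Complex.I * ∑ k, pd k (pd k (φ t)) x
      + (-1 : ℝ) • (meanField v (φ t) x • (Complex.I * φ t x)) := by
    funext x
    rw [h.equation t ht x, Complex.real_smul, Complex.real_smul]; push_cast; ring
  have hd := hs.differentiable (by simp)
  have hL : ∀ k, Differentiable ℝ (pd k (pd k (φ t))) := fun k =>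
    (contDiff_pd (contDiff_pd hs k) k).differentiable (by simp)
  have hL' : Differentiable ℝ fun x => ∑ k, pd k (pd k (φ t)) x :=
    Differentiable.fun_sum fun k _ => hL k
  have hVf : Differentiable ℝ fun x => meanField v (φ t) x • (Complex.I * φ t x) :=
    hVd.smul (hd.const_mul _)
  have e3 : pd j (fun x => ∑ k, pd k (pd k (φ t)) x) x = ∑ k, pd k (pd k (pd j (φ t))) x := by
    rw [pd, fderiv_fun_sum fun k _ => hL k x, sum_apply]
    refine Finset.sum_congr rfl fun k _ => ?_
    change pd j (pd k (pd k (φ t))) x = _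
    rw [pd_pd_comm (contDiff_pd hs k) j k, pd_pd_comm hs j k]
  have e4 : pd j (td φ t) x = Complex.I * ∑ k, pd k (pd k (pd j (φ t))) x
      - Complex.I * (meanField v (φ t) x * pd j (φ t) x + pd j (meanField v (φ t)) x * φ t x) := by
    rw [e2, pd_add (hL'.const_mul _) (hVf.fun_const_smul _), pd_const_smul hVf,
      pd_smul hVd (hd.const_mul _), pd_I_mul hd, pd_I_mul hL', e3]
    simp only [Complex.real_smul]; push_cast; ring
  rw [e1, e4, h.equation t ht x, sum_pd_pd_boost hs, boost]
  simp only [Complex.real_smul]; push_cast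
  have := Complex.I_sq
  linear_combination (-(t * pd j (meanField v (φ t)) x * φ t x : ℂ)) * this

theorem inner_td_boost (hv : IsRegularPotential v) (h : HartreeFlow v φ) {t : ℝ} (ht : 1 ≤ t)
    (j : Fin 3) (x : R3) :
    2 * ⟪boost t j (φ t) x, td (fun s => boost s j (φ s)) t x⟫_ℝ =
      2 * ∑ k, pd k (current k (boost t j (φ t))) x
      + 2 * t * (pd j (meanField v (φ t)) x * ⟪boost t j (φ t) x, φ t x⟫_ℝ) := by
  have hs := contDiff_boost (h.smooth.slice t) t j
  rw [td_boost hv h ht, inner_add_right, inner_sub_right, Finset.mul_sum, inner_sum,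
    inner_smul_right]
  simp only [pd_current hs]
  have : ⟪boost t j (φ t) x, Complex.I * meanField v (φ t) x * boost t j (φ t) x⟫_ℝ = 0 := by
    have e : Complex.I * meanField v (φ t) x * boost t j (φ t) x =
        meanField v (φ t) x • (Complex.I * boost t j (φ t) x) := by
      rw [Complex.real_smul]; ring
    rw [e, inner_smul_right, inner_I_mul_self, mul_zero]
  rw [this]; ring

end HartreeFlow

/-! ### Localized pseudoconformal energy -/

/-- The derivatives of `f` that control the localization error for `boost t j f`. -/
def errorDensity (j : Fin 3) (f : R3 → ℂ) (x : R3) : ℝ :=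
  ‖f x‖ ^ 2 + ∑ k, (‖pd k f x‖ ^ 2 + ‖pd k (pd j f) x‖ ^ 2)

/-- The density of the time derivative of the localized quantity `∫ ζ² |boost t j f|²`. -/
def flux (v : R3 → ℝ) (R t : ℝ) (j : Fin 3) (f : R3 → ℂ) (x : R3) : ℝ :=
  -(2 * ∑ k, pd k (fun y => cutoff R y ^ 2) x * current k (boost t j f) x)
    + 2 * t * (cutoff R x ^ 2 * (pd j (meanField v f) x * ⟪boost t j f x, f x⟫_ℝ))

theorem pd_cutoff_sq (R : ℝ) (k : Fin 3) (x : R3) :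
    pd k (fun y => cutoff R y ^ 2) x = 2 * cutoff R x * pd k (cutoff R) x := by
  have hd := (contDiff_cutoff R).differentiable (by simp)
  simp only [sq]
  rw [pd_mul hd hd]; ring

/-- The gradient of the cut-off is `O(1/R)` and is supported in `|x| ≤ 2 R`, so it absorbs one
factor `xⱼ` uniformly in `R`. -/
theorem exists_abs_pd_cutoff_mul_le : ∃ C : ℝ, 0 ≤ C ∧ ∀ R, 1 ≤ R → ∀ (j k : Fin 3) (x : R3),
    |pd k (cutoff R) x| ≤ C ∧ |pd k (cutoff R) x| * |x j / 2| ≤ C := by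
  obtain ⟨C, hC0, hC⟩ := exists_pd_cutoff_le
  refine ⟨C, hC0, fun R hR j k x => ?_⟩
  have hR0 : 0 < R := by linarith
  have h1 := hC R hR0 k x
  refine ⟨h1.trans (div_le_self hC0 hR), ?_⟩
  rcases le_or_gt ‖x‖ (2 * R) with hx | hx
  · have hj : |x j / 2| ≤ R := by
      have := PiLp.norm_apply_le x j
      rw [Real.norm_eq_abs] at this
      rw [abs_div, abs_two]; linarith
    calc |pd k (cutoff R) x| * |x j / 2| ≤ C / R * R := by gcongr
      _ = C := by field_simp
  · rw [pd_cutoff_eq_zero_of_gt hR0 k hx]; simpa using hC0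

/-- The derivative of `ζ²` leaves one factor `ζ` for the boosted function, and `∇ζ` absorbs the
weight `xⱼ` in its derivative. The error therefore involves only the localized energy and unweighted
`H²` densities, with a constant independent of `R`, as needed for Grönwall. -/
theorem exists_abs_flux_le (v : R3 → ℝ) (T A : ℝ) : ∃ L : ℝ, 0 ≤ L ∧
    ∀ R, 1 ≤ R → ∀ t ∈ Icc 1 T, ∀ (j : Fin 3) (f : R3 → ℂ), ContDiff ℝ ∞ f →
      (∀ x, |pd j (meanField v f) x| ≤ A) → ∀ x,
      |flux v R t j f x| ≤ L * (cutoff R x ^ 2 * ‖boost t j f x‖ ^ 2 + errorDensity j f x) := by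
  obtain ⟨C, hC0, hC⟩ := exists_abs_pd_cutoff_mul_le
  -- `18 = 2 · 3 · 3`: the factor in `flux`, the constant for each direction, and the three
  -- directions. The second summand bounds the force term.
  refine ⟨18 * C * T ^ 2 + |T| * |A|, by positivity, fun R hR t ht j f hf hA x => ?_⟩
  set ζ := cutoff R x with hζ
  have hζ0 : 0 ≤ ζ := cutoff_nonneg R x
  have hζ1 : ζ ≤ 1 := cutoff_le_one R x
  set ψ := boost t j f x with hψ
  have ht0 : 0 ≤ t := by linarith [ht.1]
  have hT1 : 1 ≤ T := ht.1.trans ht.2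
  have hk : ∀ k, |pd k (fun y => cutoff R y ^ 2) x * current k (boost t j f) x| ≤
      3 * C * T ^ 2 * (ζ ^ 2 * ‖ψ‖ ^ 2
        + (‖f x‖ ^ 2 + ‖pd k f x‖ ^ 2 + ‖pd k (pd j f) x‖ ^ 2)) := by
    intro k
    obtain ⟨c1, c2⟩ := hC R hR j k x
    set p := |pd k (cutoff R) x|
    have hp0 : 0 ≤ p := abs_nonneg _
    have hn : ‖pd k (boost t j f) x‖ ≤
        |x j / 2| * ‖pd k f x‖ + T * ‖pd k (pd j f) x‖ + ‖f x‖ := by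
      rw [pd_boost hf, boost, pd_pd_comm hf j k]
      refine (norm_add_le _ _).trans (add_le_add ((norm_add_le _ _).trans ?_) ?_)
      · rw [norm_smul, norm_smul, norm_mul, Complex.norm_I, one_mul, Real.norm_eq_abs,
          Real.norm_of_nonneg ht0]
        have := ht.2
        gcongr
      · rw [norm_smul]
        refine mul_le_of_le_one_left (norm_nonneg _) ?_
        split_ifs <;> norm_num
    have hS : p * ‖pd k (boost t j f) x‖ ≤
        C * (‖pd k f x‖ + T * ‖pd k (pd j f) x‖ + ‖f x‖) := by
      calc p * ‖pd k (boost t j f) x‖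
          ≤ p * (|x j / 2| * ‖pd k f x‖ + T * ‖pd k (pd j f) x‖ + ‖f x‖) := by gcongr
        _ = (p * |x j / 2|) * ‖pd k f x‖ + p * (T * ‖pd k (pd j f) x‖ + ‖f x‖) := by ring
        _ ≤ C * ‖pd k f x‖ + C * (T * ‖pd k (pd j f) x‖ + ‖f x‖) := by gcongr
        _ = _ := by ring
    have hc := abs_current_le k (boost t j f) x
    rw [pd_cutoff_sq, abs_mul, abs_mul, abs_mul, abs_two, abs_of_nonneg hζ0]
    set a := ‖pd k f x‖
    set b := ‖pd k (pd j f) x‖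
    set d := ‖f x‖
    have ha : 0 ≤ a := norm_nonneg _
    have hb : 0 ≤ b := norm_nonneg _
    have hd : 0 ≤ d := norm_nonneg _
    have hT2 : 1 ≤ T ^ 2 := one_le_pow₀ hT1
    calc 2 * ζ * p * |current k (boost t j f) x|
        ≤ 2 * ζ * p * (‖ψ‖ * ‖pd k (boost t j f) x‖) := by gcongr
      _ = 2 * (ζ * ‖ψ‖) * (p * ‖pd k (boost t j f) x‖) := by ring
      _ ≤ 2 * (ζ * ‖ψ‖) * (C * (a + T * b + d)) := by gcongr
      _ = C * (2 * (ζ * ‖ψ‖) * (a + T * b + d)) := by ring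
      _ ≤ C * (3 * T ^ 2 * (ζ ^ 2 * ‖ψ‖ ^ 2 + (d ^ 2 + a ^ 2 + b ^ 2))) := by
          refine mul_le_mul_of_nonneg_left ?_ hC0
          have e1 : 2 * (ζ * ‖ψ‖) * (a + T * b + d) ≤
              (ζ * ‖ψ‖) ^ 2 + (a + T * b + d) ^ 2 := two_mul_le_add_sq _ _
          have e2 : (a + T * b + d) ^ 2 ≤ 3 * (a ^ 2 + (T * b) ^ 2 + d ^ 2) := by
            nlinarith [sq_nonneg (a - T * b), sq_nonneg (a - d), sq_nonneg (T * b - d)]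
          have e3 : a ^ 2 ≤ T ^ 2 * a ^ 2 := le_mul_of_one_le_left (sq_nonneg _) hT2
          have e4 : d ^ 2 ≤ T ^ 2 * d ^ 2 := le_mul_of_one_le_left (sq_nonneg _) hT2
          have e5 : (ζ * ‖ψ‖) ^ 2 ≤ T ^ 2 * (ζ * ‖ψ‖) ^ 2 :=
            le_mul_of_one_le_left (sq_nonneg _) hT2
          have e6 : 0 ≤ T ^ 2 * (ζ * ‖ψ‖) ^ 2 := by positivity
          nlinarith
      _ = _ := by ring
  have hA0 : |A| = A := abs_of_nonneg ((abs_nonneg _).trans (hA x))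
  have h2 : |2 * t * (ζ ^ 2 * (pd j (meanField v f) x * ⟪ψ, f x⟫_ℝ))| ≤
      |T| * |A| * (ζ ^ 2 * ‖ψ‖ ^ 2 + errorDensity j f x) := by
    have hin := abs_real_inner_le_norm ψ (f x)
    have he : ‖f x‖ ^ 2 ≤ errorDensity j f x := le_add_of_nonneg_right (by positivity)
    have hζ2 : ζ ^ 2 ≤ 1 := pow_le_one₀ hζ0 hζ1
    have hpdV := hA x
    rw [abs_mul, abs_mul, abs_mul, abs_mul, abs_two, abs_of_nonneg ht0,
      abs_of_nonneg (sq_nonneg ζ), abs_of_nonneg (by linarith : (0 : ℝ) ≤ T), hA0]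
    have hA' : 0 ≤ A := hA0 ▸ abs_nonneg A
    calc 2 * t * (ζ ^ 2 * (|pd j (meanField v f) x| * |⟪ψ, f x⟫_ℝ|))
        ≤ 2 * T * (ζ ^ 2 * (A * (‖ψ‖ * ‖f x‖))) := by
          have := ht.2
          gcongr
      _ = T * A * (ζ ^ 2 * (2 * ‖ψ‖ * ‖f x‖)) := by ring
      _ ≤ T * A * (ζ ^ 2 * (‖ψ‖ ^ 2 + ‖f x‖ ^ 2)) := by
          have := two_mul_le_add_sq ‖ψ‖ ‖f x‖
          gcongr
      _ ≤ T * A * (ζ ^ 2 * ‖ψ‖ ^ 2 + errorDensity j f x) := by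
          have : ζ ^ 2 * ‖f x‖ ^ 2 ≤ ‖f x‖ ^ 2 := mul_le_of_le_one_left (sq_nonneg _) hζ2
          have : ζ ^ 2 * (‖ψ‖ ^ 2 + ‖f x‖ ^ 2) ≤ ζ ^ 2 * ‖ψ‖ ^ 2 + errorDensity j f x := by
            rw [mul_add]; linarith
          gcongr
  have h1 : |-(2 * ∑ k, pd k (fun y => cutoff R y ^ 2) x * current k (boost t j f) x)| ≤
      18 * C * T ^ 2 * (ζ ^ 2 * ‖ψ‖ ^ 2 + errorDensity j f x) := by
    rw [abs_neg, abs_mul, abs_two]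
    have := (Finset.abs_sum_le_sum_abs
      (fun k => pd k (fun y => cutoff R y ^ 2) x * current k (boost t j f) x)
      Finset.univ).trans (Finset.sum_le_sum fun k _ => hk k)
    rw [← Finset.mul_sum] at this
    have hle : ∑ k, (ζ ^ 2 * ‖ψ‖ ^ 2 + (‖f x‖ ^ 2 + ‖pd k f x‖ ^ 2 + ‖pd k (pd j f) x‖ ^ 2)) ≤
        3 * (ζ ^ 2 * ‖ψ‖ ^ 2 + errorDensity j f x) := by
      simp only [errorDensity, Fin.sum_univ_three]
      nlinarith [sq_nonneg ‖pd 0 f x‖, sq_nonneg ‖pd 1 f x‖, sq_nonneg ‖pd 2 f x‖,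
        sq_nonneg ‖pd 0 (pd j f) x‖, sq_nonneg ‖pd 1 (pd j f) x‖, sq_nonneg ‖pd 2 (pd j f) x‖]
    have h3 : 3 * C * T ^ 2 * ∑ k, (ζ ^ 2 * ‖ψ‖ ^ 2
        + (‖f x‖ ^ 2 + ‖pd k f x‖ ^ 2 + ‖pd k (pd j f) x‖ ^ 2)) ≤
        3 * C * T ^ 2 * (3 * (ζ ^ 2 * ‖ψ‖ ^ 2 + errorDensity j f x)) := by gcongr
    linarith
  rw [flux]
  refine (abs_add_le _ _).trans ((add_le_add h1 h2).trans (le_of_eq ?_))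
  ring

theorem integrable_errorDensity {M : ℝ} {f : R3 → ℂ} (hf : H2Slice M f) (j : Fin 3) :
    Integrable (errorDensity j f) ∧ ∫ x, errorDensity j f x ≤ 7 * M := by
  have i0 := (memLp_two_iff_integrable_sq_norm hf.memLp.1).1 hf.memLp
  have i1 := fun k => (memLp_two_iff_integrable_sq_norm (hf.memLp_pd k).1).1 (hf.memLp_pd k)
  have i2 := fun k => (memLp_two_iff_integrable_sq_norm (hf.memLp_pd_pd k j).1).1
    (hf.memLp_pd_pd k j)
  have i3 : ∀ k ∈ (Finset.univ : Finset (Fin 3)),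
    Integrable fun x => ‖pd k f x‖ ^ 2 + ‖pd k (pd j f) x‖ ^ 2 := fun k _ => (i1 k).add (i2 k)
  have i4 := integrable_finsetSum _ i3
  refine ⟨i0.add i4, ?_⟩
  simp only [errorDensity]
  rw [integral_add i0 i4, integral_finsetSum _ i3]
  have : ∀ k ∈ (Finset.univ : Finset (Fin 3)),
      ∫ x, (‖pd k f x‖ ^ 2 + ‖pd k (pd j f) x‖ ^ 2) ≤ 2 * M := fun k _ => by
    rw [integral_add (i1 k) (i2 k)]
    linarith [hf.le_pd k, hf.le_pd_pd k j]
  have h2 := Finset.sum_le_sum this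
  simp only [Finset.sum_const, Finset.card_univ, Fintype.card_fin, nsmul_eq_mul] at h2
  push_cast at h2
  linarith [hf.le]

namespace HartreeFlow

variable {v : R3 → ℝ} {φ : ℝ → R3 → ℂ}

/-- The localized pseudoconformal quantity `∫ ζ² |boost t j f|²`. -/
def localEnergy (R t : ℝ) (j : Fin 3) (f : R3 → ℂ) : ℝ :=
  ∫ x, cutoff R x ^ 2 * ‖boost t j f x‖ ^ 2

theorem integrable_cutoff_sq_mul {R : ℝ} (hR : 0 < R) {g : R3 → ℝ} (hg : Continuous g) :
    Integrable fun x => cutoff R x ^ 2 * g x := by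
  refine Continuous.integrable_of_hasCompactSupport
    (((contDiff_cutoff R).continuous.pow 2).mul hg) ?_
  have h : HasCompactSupport fun x => cutoff R x ^ 2 := by
    simp only [sq]
    exact (hasCompactSupport_cutoff hR).mul_right
  exact h.mul_right

theorem continuousOn_integral_cutoff {R : ℝ} (hR : 0 < R) {g : ℝ → R3 → ℝ} (s : Set ℝ)
    (hg : Continuous fun z : ℝ × R3 => g z.1 z.2) :
    ContinuousOn (fun t => ∫ x, cutoff R x ^ 2 * g t x) s := by
  refine continuousOn_integral_of_compact_support (isCompact_closedBall (0 : R3) (2 * R)) ?_ ?_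
  · exact ((((contDiff_cutoff R).continuous.comp continuous_snd).pow 2).mul hg).continuousOn
  · intro p x _ hx
    rw [mem_closedBall_zero_iff, not_le] at hx
    rw [cutoff_eq_zero hR hx.le]; ring

theorem integral_cutoff_sub {ψ : ℝ → R3 → ℂ} (hψ : JSmooth ψ) {R : ℝ} (hR : 0 < R) {a b : ℝ}
    (hab : a ≤ b) :
    ContinuousOn (fun s => ∫ x, cutoff R x ^ 2 * (2 * ⟪ψ s x, td ψ s x⟫_ℝ)) (Icc a b) ∧
    (∫ x, cutoff R x ^ 2 * ‖ψ b x‖ ^ 2) - ∫ x, cutoff R x ^ 2 * ‖ψ a x‖ ^ 2 =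
      ∫ s in a..b, ∫ x, cutoff R x ^ 2 * (2 * ⟪ψ s x, td ψ s x⟫_ℝ) := by
  have hc : Continuous fun z : ℝ × R3 => 2 * ⟪ψ z.1 z.2, td ψ z.1 z.2⟫_ℝ :=
    continuous_const.mul (jsmooth_inner hψ hψ.td).continuous
  have hsl : ∀ s, Continuous fun x => 2 * ⟪ψ s x, td ψ s x⟫_ℝ :=
    fun s => hc.comp (by fun_prop : Continuous fun x : R3 => (s, x))
  have hst : ∀ x, Continuous fun s => 2 * ⟪ψ s x, td ψ s x⟫_ℝ :=
    fun x => hc.comp (by fun_prop : Continuous fun s : ℝ => (s, x))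
  have hm : Measurable (Function.uncurry fun (s : ℝ) (x : R3) =>
      cutoff R x ^ 2 * (2 * ⟪ψ s x, td ψ s x⟫_ℝ)) :=
    ((((contDiff_cutoff R).continuous.comp continuous_snd).pow 2).mul hc).measurable
  have hc1 := continuousOn_integral_cutoff hR (g := fun s x => 2 * ⟪ψ s x, td ψ s x⟫_ℝ)
    (Icc a b) hc
  have hc2 := continuousOn_integral_cutoff hR (g := fun s x => |2 * ⟪ψ s x, td ψ s x⟫_ℝ|)
    (Icc a b) hc.abs
  obtain ⟨C, hC⟩ := isCompact_Icc.bddAbove_image hc2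
  have hd : ∀ s x, HasDerivAt (fun s => cutoff R x ^ 2 * ‖ψ s x‖ ^ 2)
      (cutoff R x ^ 2 * (2 * ⟪ψ s x, td ψ s x⟫_ℝ)) s :=
    fun s x => ((hψ.hasDerivAt s x).norm_sq).const_mul _
  have hCs : ∀ s ∈ Icc a b, ∫ x, |cutoff R x ^ 2 * (2 * ⟪ψ s x, td ψ s x⟫_ℝ)| ≤ C :=
    fun s hs => by
      have e : ∀ x, |cutoff R x ^ 2 * (2 * ⟪ψ s x, td ψ s x⟫_ℝ)| =
          cutoff R x ^ 2 * |2 * ⟪ψ s x, td ψ s x⟫_ℝ| := fun x => by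
        rw [abs_mul (cutoff R x ^ 2), abs_of_nonneg (sq_nonneg (cutoff R x))]
      simp only [e]
      exact hC (mem_image_of_mem _ hs)
  exact ⟨hc1, integral_sub_eq_integral_deriv hab hd (fun x => continuous_const.mul (hst x)) hm
    (fun s _ => integrable_cutoff_sq_mul hR (hsl s)) hCs
    (integrable_cutoff_sq_mul hR ((hψ.slice a).continuous.norm.pow 2))
    (integrable_cutoff_sq_mul hR ((hψ.slice b).continuous.norm.pow 2))⟩

theorem integral_flux (hv : IsRegularPotential v) (h : HartreeFlow v φ) {R : ℝ} (hR : 0 < R)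
    {t : ℝ} (ht : 1 ≤ t) (j : Fin 3) :
    ∫ x, cutoff R x ^ 2 * (2 * ⟪boost t j (φ t) x, td (fun s => boost s j (φ s)) t x⟫_ℝ) =
      ∫ x, flux v R t j (φ t) x := by
  have hs := h.smooth.slice t
  have hb := contDiff_boost hs t j
  have hη : ContDiff ℝ ∞ fun x => cutoff R x ^ 2 := (contDiff_cutoff R).pow 2
  have hηd := hη.differentiable (by simp)
  have hcs : HasCompactSupport fun x => cutoff R x ^ 2 := by
    simp only [sq]
    exact (hasCompactSupport_cutoff hR).mul_right
  have hVc := measurable_pd_meanField hv hs j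
  have i1 : ∀ k, Integrable fun x => cutoff R x ^ 2 * pd k (current k (boost t j (φ t))) x :=
    fun k => integrable_cutoff_sq_mul hR (contDiff_pd (contDiff_current hb k) k).continuous
  have i0 : ∀ k, Integrable fun x => cutoff R x ^ 2 * current k (boost t j (φ t)) x :=
    fun k => integrable_cutoff_sq_mul hR (contDiff_current hb k).continuous
  have i2 : ∀ k, Integrable fun x =>
      pd k (fun y => cutoff R y ^ 2) x * current k (boost t j (φ t)) x := fun k => by
    refine Continuous.integrable_of_hasCompactSupport
      ((contDiff_pd hη k).continuous.mul (contDiff_current hb k).continuous) ?_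
    exact (hcs.fderiv_apply (𝕜 := ℝ) _).mul_right
  have i3 : Integrable fun x => cutoff R x ^ 2 *
      (pd j (meanField v (φ t)) x * ⟪boost t j (φ t) x, φ t x⟫_ℝ) :=
    integrable_cutoff_sq_mul hR (hVc.mul (hb.continuous.inner hs.continuous))
  have e : ∀ x, cutoff R x ^ 2
      * (2 * ⟪boost t j (φ t) x, td (fun s => boost s j (φ s)) t x⟫_ℝ) =
      2 * (∑ k, cutoff R x ^ 2 * pd k (current k (boost t j (φ t))) x)
      + 2 * t * (cutoff R x ^ 2 *
        (pd j (meanField v (φ t)) x * ⟪boost t j (φ t) x, φ t x⟫_ℝ)) := fun x => by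
    rw [inner_td_boost hv h ht, ← Finset.mul_sum]; ring
  have i4 : Integrable fun x => -(2 * ∑ k, pd k (fun y => cutoff R y ^ 2) x
      * current k (boost t j (φ t)) x) := ((integrable_finsetSum _ fun k _ => i2 k).const_mul 2).neg
  simp only [e, flux]
  rw [integral_add ((integrable_finsetSum _ fun k _ => i1 k).const_mul 2) (i3.const_mul _),
    integral_add i4 (i3.const_mul _),
    integral_neg, integral_const_mul, integral_const_mul 2, integral_finsetSum _ fun k _ => i1 k,
    integral_finsetSum _ fun k _ => i2 k]
  simp only [PairExcitation.integral_mul_pd_current hηd hb _ (i0 _) (i2 _) (i1 _),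
    Finset.sum_neg_distrib]
  ring

theorem localEnergy_sub (hv : IsRegularPotential v) (h : HartreeFlow v φ) {R : ℝ} (hR : 0 < R)
    {a b : ℝ} (ha : 1 ≤ a) (hab : a ≤ b) (j : Fin 3) :
    ContinuousOn (fun s => ∫ x, flux v R s j (φ s) x) (Icc a b) ∧
    localEnergy R b j (φ b) - localEnergy R a j (φ a) =
      ∫ s in a..b, ∫ x, flux v R s j (φ s) x := by
  have hψ := jsmooth_boost h.smooth j
  obtain ⟨k1, k2⟩ := integral_cutoff_sub hψ hR hab
  have hfl : ∀ s ∈ Icc a b, ∫ x, cutoff R x ^ 2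
      * (2 * ⟪boost s j (φ s) x, td (fun s => boost s j (φ s)) s x⟫_ℝ) =
      ∫ x, flux v R s j (φ s) x := fun s hs => integral_flux hv h hR (ha.trans hs.1) j
  refine ⟨k1.congr fun s hs => (hfl s hs).symm, k2.trans ?_⟩
  refine intervalIntegral.integral_congr fun s hs => ?_
  rw [uIcc_of_le hab] at hs
  exact hfl s hs

end HartreeFlow

/-! ### Persistence and evolution of the pseudoconformal norm -/

theorem tendsto_integral_cutoff {g : R3 → ℝ} (hg : Continuous g) (hi : Integrable g) :
    Filter.Tendsto (fun N : ℕ => ∫ x, cutoff (N + 1) x ^ 2 * g x) Filter.atTop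
      (nhds (∫ x, g x)) := by
  refine tendsto_integral_of_dominated_convergence (fun x => ‖g x‖) (fun N => ?_) hi.norm
    (fun N => Filter.Eventually.of_forall fun x => ?_)
    (Filter.Eventually.of_forall fun x => ?_)
  · exact (((contDiff_cutoff _).continuous.pow 2).mul hg).aestronglyMeasurable
  · rw [norm_mul, Real.norm_of_nonneg (sq_nonneg _)]
    exact mul_le_of_le_one_left (norm_nonneg _)
      (pow_le_one₀ (cutoff_nonneg _ x) (cutoff_le_one _ x))
  · simpa using ((tendsto_cutoff x).pow 2).mul_const (g x)

theorem integrable_of_integral_cutoff_le {g : R3 → ℝ} {B : ℝ} (hg : Continuous g)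
    (hg0 : ∀ x, 0 ≤ g x) (hB : ∀ N : ℕ, ∫ x, cutoff (N + 1) x ^ 2 * g x ≤ B) :
    Integrable g ∧ ∫ x, g x ≤ B := by
  have hr : Filter.Tendsto (fun N : ℕ => (N : ℝ) + 1) Filter.atTop Filter.atTop :=
    Filter.tendsto_atTop_add_const_right _ _ tendsto_natCast_atTop_atTop
  have hcov := aecover_closedBall (μ := (volume : Measure R3)) (x := (0 : R3)) hr
  have hi : Integrable g := by
    refine hcov.integrable_of_integral_norm_bounded B
      (fun N => hg.continuousOn.integrableOn_compact (isCompact_closedBall _ _))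
      (Filter.Eventually.of_forall fun N => le_trans ?_ (hB N))
    have hN : (0 : ℝ) < N + 1 := by positivity
    have hint := integrable_cutoff_sq_mul hN hg
    refine le_trans (le_of_eq ?_) (setIntegral_le_integral (s := Metric.closedBall 0 ((N : ℝ) + 1))
      hint (Filter.Eventually.of_forall fun x => mul_nonneg (sq_nonneg _) (hg0 x)))
    refine setIntegral_congr_fun measurableSet_closedBall fun x hx => ?_
    rw [mem_closedBall_zero_iff] at hx
    simp [cutoff_eq_one hN hx, abs_of_nonneg (hg0 x)]
  exact ⟨hi, le_of_tendsto' (tendsto_integral_cutoff hg hi) hB⟩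

theorem tendsto_flux (v : R3 → ℝ) (t : ℝ) (j : Fin 3) (f : R3 → ℂ) (x : R3) :
    Filter.Tendsto (fun N : ℕ => flux v (N + 1) t j f x) Filter.atTop
      (nhds (2 * t * (pd j (meanField v f) x * ⟪boost t j f x, f x⟫_ℝ))) := by
  refine tendsto_const_nhds.congr' ?_
  filter_upwards [Filter.eventually_ge_atTop ⌈‖x‖⌉₊] with N hN
  have h1 : ‖x‖ ≤ N := (Nat.le_ceil _).trans (by exact_mod_cast hN)
  have h0 : (0 : ℝ) < N + 1 := by positivity
  rw [flux]
  simp only [pd_cutoff_sq, pd_cutoff_eq_zero_of_lt h0 _ (by linarith : ‖x‖ < N + 1),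
    cutoff_eq_one h0 (by linarith : ‖x‖ ≤ N + 1)]
  simp

theorem continuous_flux {v : R3 → ℝ} (hv : IsRegularPotential v) (R t : ℝ) (j : Fin 3)
    {f : R3 → ℂ} (hf : ContDiff ℝ ∞ f) : Continuous (flux v R t j f) := by
  have hb := contDiff_boost hf t j
  have h1 : ∀ k, Continuous fun x =>
      pd k (fun y => cutoff R y ^ 2) x * current k (boost t j f) x := fun k =>
    (contDiff_pd ((contDiff_cutoff R).pow 2) k).continuous.mul (contDiff_current hb k).continuous
  have h2 : Continuous fun x => ⟪boost t j f x, f x⟫_ℝ := hb.continuous.inner hf.continuous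
  exact ((continuous_const.mul (continuous_finsetSum _ fun k _ => h1 k)).neg).add
    (continuous_const.mul (((contDiff_cutoff R).continuous.pow 2).mul
      ((measurable_pd_meanField hv hf j).mul h2)))

namespace HartreeFlow

variable {v : R3 → ℝ} {φ : ℝ → R3 → ℂ}

theorem localEnergy_nonneg (R t : ℝ) (j : Fin 3) (f : R3 → ℂ) : 0 ≤ localEnergy R t j f :=
  integral_nonneg fun x => by positivity

theorem localEnergy_le {R : ℝ} (hR : 0 < R) {t : ℝ} {j : Fin 3} {f : R3 → ℂ}
    (hf : ContDiff ℝ ∞ f) (hi : Integrable fun x => ‖boost t j f x‖ ^ 2) :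
    localEnergy R t j f ≤ ∫ x, ‖boost t j f x‖ ^ 2 := by
  refine integral_mono
    (integrable_cutoff_sq_mul hR ((contDiff_boost hf t j).continuous.norm.pow 2)) hi fun x => ?_
  exact mul_le_of_le_one_left (sq_nonneg _)
      (pow_le_one₀ (cutoff_nonneg _ x) (cutoff_le_one _ x))

theorem abs_integral_flux_le {M L : ℝ} {R : ℝ} (hR : 0 < R) {t : ℝ} {j : Fin 3} {f : R3 → ℂ}
    (hf : H2Slice M f) (hL0 : 0 ≤ L) (hL : ∀ x, |flux v R t j f x| ≤
      L * (cutoff R x ^ 2 * ‖boost t j f x‖ ^ 2 + errorDensity j f x)) :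
    |∫ x, flux v R t j f x| ≤ L * (localEnergy R t j f + 7 * M) := by
  have i1 : Integrable fun x => cutoff R x ^ 2 * ‖boost t j f x‖ ^ 2 :=
    integrable_cutoff_sq_mul hR ((contDiff_boost hf.smooth t j).continuous.norm.pow 2)
  obtain ⟨i2, h2⟩ := integrable_errorDensity hf j
  have i3 : Integrable fun x =>
      L * (cutoff R x ^ 2 * ‖boost t j f x‖ ^ 2 + errorDensity j f x) := (i1.add i2).const_mul L
  have h := norm_integral_le_of_norm_le (f := flux v R t j f) i3 (Filter.Eventually.of_forall hL)
  rw [integral_const_mul, integral_add i1 i2] at h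
  refine h.trans ?_
  gcongr
  exact le_rfl

/-- Persistence of the weighted norm: Grönwall for the localized energies has constants independent
of the radius, and letting the radius grow yields integrability at later times. -/
theorem exists_integral_boost_le (hv : IsRegularPotential v) (h : HartreeFlow v φ)
    (h1 : ∀ j, Integrable fun x => ‖boost 1 j (φ 1) x‖ ^ 2) (T : ℝ) :
    ∃ B : ℝ, ∀ t ∈ Icc 1 T, ∀ j, Integrable (fun x => ‖boost t j (φ t) x‖ ^ 2) ∧
      ∫ x, ‖boost t j (φ t) x‖ ^ 2 ≤ B := by
  rcases lt_or_ge T 1 with hT | hT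
  · exact ⟨0, fun t ht => absurd (ht.1.trans ht.2) (not_le.2 hT)⟩
  obtain ⟨M, hM⟩ := h.slice T
  obtain ⟨A, hA0, hA⟩ := exists_slice_bounds hv M
  obtain ⟨L, hL0, hL⟩ := exists_abs_flux_le v T A
  have hM0 := (hM 1 ⟨le_rfl, hT⟩).nonneg
  -- Chosen so that `L (E + 7 M) ≤ β (E + 1)`: with `E + 1` as unknown the inequality becomes
  -- homogeneous.
  set β := L * (1 + 7 * M) with hβ
  have hβ0 : 0 ≤ β := by positivity
  set K : ℝ := ∑ j, ∫ x, ‖boost 1 j (φ 1) x‖ ^ 2 with hK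
  have hKj : ∀ j, ∫ x, ‖boost 1 j (φ 1) x‖ ^ 2 ≤ K := fun j =>
    Finset.single_le_sum (f := fun j => ∫ x, ‖boost 1 j (φ 1) x‖ ^ 2)
      (fun j _ => integral_nonneg fun x => sq_nonneg _) (Finset.mem_univ j)
  have hKp : 0 ≤ K := (integral_nonneg fun x => sq_nonneg _).trans (hKj 0)
  refine ⟨(K + 1) * Real.exp (β * T), fun t ht j => ?_⟩
  refine integrable_of_integral_cutoff_le
    ((contDiff_boost (h.smooth.slice t) t j).continuous.norm.pow 2) (fun x => sq_nonneg _)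
    fun N => ?_
  have hR : (0 : ℝ) < N + 1 := by positivity
  have hR1 : (1 : ℝ) ≤ N + 1 := by simp
  have hcE : ContinuousOn (fun s => localEnergy (N + 1) s j (φ s)) (Icc 1 T) :=
    continuousOn_integral_cutoff hR (g := fun s x => ‖boost s j (φ s) x‖ ^ 2) _
      ((jsmooth_boost h.smooth j).continuous.norm.pow 2)
  have hG := le_mul_exp_of_le_add_integral (a := 1) (b := T) (A := K + 1)
    (y := fun s => localEnergy (N + 1) s j (φ s) + 1) (β := fun _ => β) (B := fun s => β * s)
    (hcE.add continuousOn_const) continuousOn_const (fun _ _ => hβ0) (by fun_prop)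
    (fun s _ => by simpa using (hasDerivAt_id s).const_mul β)
    (fun s hs => by
      obtain ⟨hc, he⟩ := localEnergy_sub hv h hR le_rfl hs.1 j
      have hle : ∫ τ in (1 : ℝ)..s, ∫ x, flux v (N + 1) τ j (φ τ) x ≤
          ∫ τ in (1 : ℝ)..s, β * (localEnergy (N + 1) τ j (φ τ) + 1) := by
        refine intervalIntegral.integral_mono_on hs.1
          (hc.intervalIntegrable_of_Icc hs.1)
          (ContinuousOn.intervalIntegrable_of_Icc hs.1 (continuousOn_const.mul
            ((hcE.mono (Icc_subset_Icc_right hs.2)).add continuousOn_const))) fun τ hτ => ?_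
        have hτ' : τ ∈ Icc 1 T := ⟨hτ.1, hτ.2.trans hs.2⟩
        have hb := abs_integral_flux_le hR (hM τ hτ') hL0
          (hL _ hR1 τ hτ' j (φ τ) (h.smooth.slice τ) ((hA _ (hM τ hτ')).2.2.2.2 j))
        refine (le_abs_self _).trans (hb.trans ?_)
        rw [hβ, mul_assoc]
        refine mul_le_mul_of_nonneg_left ?_ hL0
        have := localEnergy_nonneg (N + 1) τ j (φ τ)
        nlinarith
      have h0 := (localEnergy_le hR (h.smooth.slice 1) (h1 j)).trans (hKj j)
      linarith)
    ht
  have hexp : Real.exp (β * t - β * 1) ≤ Real.exp (β * T) := by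
    apply Real.exp_le_exp.2
    nlinarith [ht.2]
  have : (K + 1) * Real.exp (β * t - β * 1) ≤ (K + 1) * Real.exp (β * T) := by gcongr
  change localEnergy (N + 1) t j (φ t) ≤ _
  linarith

/-- The localized identity as the radius tends to infinity. At a fixed point the terms with a
derivative of the cut-off vanish once the radius exceeds `|x|`, and the uniform bound on the flux
permits dominated convergence in space and then in time. -/
theorem integral_boost_sub (hv : IsRegularPotential v) (h : HartreeFlow v φ)
    (h1 : ∀ j, Integrable fun x => ‖boost 1 j (φ 1) x‖ ^ 2) {a b : ℝ} (ha : 1 ≤ a) (hab : a ≤ b)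
    (j : Fin 3) :
    IntervalIntegrable (fun s => ∫ x, 2 * s * (pd j (meanField v (φ s)) x
      * ⟪boost s j (φ s) x, φ s x⟫_ℝ)) volume a b ∧
    (∫ x, ‖boost b j (φ b) x‖ ^ 2) - ∫ x, ‖boost a j (φ a) x‖ ^ 2 =
      ∫ s in a..b, ∫ x, 2 * s * (pd j (meanField v (φ s)) x
        * ⟪boost s j (φ s) x, φ s x⟫_ℝ) := by
  obtain ⟨B, hB⟩ := exists_integral_boost_le hv h h1 b
  obtain ⟨M, hM⟩ := h.slice b
  obtain ⟨A, hA0, hA⟩ := exists_slice_bounds hv M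
  obtain ⟨L, hL0, hL⟩ := exists_abs_flux_le v b A
  have hI : ∀ s ∈ Icc a b, s ∈ Icc 1 b := fun s hs => ⟨ha.trans hs.1, hs.2⟩
  have hR : ∀ N : ℕ, (0 : ℝ) < N + 1 := fun N => by positivity
  have hR1 : ∀ N : ℕ, (1 : ℝ) ≤ N + 1 := fun N => by simp
  have hfl : ∀ (N : ℕ), ∀ s ∈ Icc a b, ∀ x, |flux v (N + 1) s j (φ s) x| ≤
      L * (cutoff (N + 1) x ^ 2 * ‖boost s j (φ s) x‖ ^ 2 + errorDensity j (φ s) x) :=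
    fun N s hs => hL _ (hR1 N) s (hI s hs) j (φ s) (h.smooth.slice s)
      ((hA _ (hM s (hI s hs))).2.2.2.2 j)
  have hbd : ∀ (N : ℕ), ∀ s ∈ Icc a b, ‖∫ x, flux v (N + 1) s j (φ s) x‖ ≤ L * (B + 7 * M) :=
    fun N s hs => by
      refine (abs_integral_flux_le (hR N) (hM s (hI s hs)) hL0 (hfl N s hs)).trans ?_
      have hb := hB s (hI s hs) j
      have := (localEnergy_le (hR N) (h.smooth.slice s) hb.1).trans hb.2
      gcongr
  have hlim : ∀ s ∈ Icc a b, Filter.Tendsto (fun N : ℕ => ∫ x, flux v (N + 1) s j (φ s) x)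
      Filter.atTop (nhds (∫ x, 2 * s * (pd j (meanField v (φ s)) x
        * ⟪boost s j (φ s) x, φ s x⟫_ℝ))) := fun s hs => by
    have i1 := (hB s (hI s hs) j).1
    have i2 := (integrable_errorDensity (hM s (hI s hs)) j).1
    refine tendsto_integral_of_dominated_convergence _
      (fun N => (continuous_flux hv (N + 1) s j (h.smooth.slice s)).aestronglyMeasurable)
      ((i1.add i2).const_mul L) (fun N => Filter.Eventually.of_forall fun x => ?_)
      (Filter.Eventually.of_forall fun x => tendsto_flux v s j (φ s) x)
    refine (hfl N s hs x).trans ?_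
    refine mul_le_mul_of_nonneg_left (add_le_add_left ?_ _) hL0
    exact mul_le_of_le_one_left (sq_nonneg _)
      (pow_le_one₀ (cutoff_nonneg _ x) (cutoff_le_one _ x))
  have hcont := fun N : ℕ => localEnergy_sub hv h (hR N) ha hab j
  have hii : ∀ N : ℕ, IntervalIntegrable (fun s => ∫ x, flux v (N + 1) s j (φ s) x) volume a b :=
    fun N => (hcont N).1.intervalIntegrable_of_Icc hab
  have hsub : uIoc a b ⊆ Icc a b := by rw [uIoc_of_le hab]; exact Ioc_subset_Icc_self
  have hae : ∀ᵐ s ∂volume.restrict (uIoc a b), s ∈ Icc a b := by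
    filter_upwards [ae_restrict_mem measurableSet_uIoc] with s hs using hsub hs
  have hmeas : AEStronglyMeasurable (fun s => ∫ x, 2 * s * (pd j (meanField v (φ s)) x
      * ⟪boost s j (φ s) x, φ s x⟫_ℝ)) (volume.restrict (uIoc a b)) :=
    aestronglyMeasurable_of_tendsto_ae Filter.atTop (fun N => (hii N).def'.1)
      (hae.mono fun s hs => hlim s hs)
  refine ⟨?_, ?_⟩
  · refine (intervalIntegrable_const (c := L * (B + 7 * M))).mono_fun hmeas ?_
    filter_upwards [hae] with s hs
    refine (le_of_tendsto' (hlim s hs).norm fun N => hbd N s hs).trans (le_abs_self _)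
  · have hb := fun t (ht : t ∈ Icc a b) => tendsto_integral_cutoff
      ((contDiff_boost (h.smooth.slice t) t j).continuous.norm.pow 2) (hB t (hI t ht) j).1
    have l1 := (hb b ⟨hab, le_rfl⟩).sub (hb a ⟨le_rfl, hab⟩)
    have l2 := intervalIntegral.tendsto_integral_filter_of_dominated_convergence
      (fun _ => L * (B + 7 * M)) (Filter.Eventually.of_forall fun N => (hii N).def'.1)
      (Filter.Eventually.of_forall fun N => Filter.Eventually.of_forall fun s hs =>
        hbd N s (hsub hs)) intervalIntegrable_const
      (Filter.Eventually.of_forall fun s hs => hlim s (hsub hs))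
    exact tendsto_nhds_unique (l1.congr fun N => (hcont N).2) l2

end HartreeFlow

/-! ### The pseudoconformal energy -/

theorem smul_coord_eq (t : ℝ) (j : Fin 3) (f : R3 → ℂ) (x : R3) :
    x j • f x = (2 : ℝ) • boost t j f x - (2 * t) • (Complex.I * pd j f x) := by
  rw [boost, smul_add, smul_smul, smul_smul, mul_div_cancel₀ _ (two_ne_zero' ℝ),
    add_sub_cancel_right]

theorem inner_boost_self (t : ℝ) (j : Fin 3) (f : R3 → ℂ) (x : R3) :
    ⟪boost t j f x, f x⟫_ℝ = 2⁻¹ * (x j * ‖f x‖ ^ 2) + t * current j f x := by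
  rw [boost, inner_add_left, real_inner_smul_left, real_inner_smul_left,
    real_inner_self_eq_norm_sq, real_inner_comm, current]
  ring

theorem memLp_coord_smul {M t : ℝ} {f : R3 → ℂ} (hf : H2Slice M f) {j : Fin 3}
    (hi : Integrable fun x => ‖boost t j f x‖ ^ 2) :
    MemLp (fun x : R3 => x j • f x) 2 volume := by
  have hb : MemLp (boost t j f) 2 volume := (memLp_two_iff_integrable_sq_norm
    (contDiff_boost hf.smooth t j).continuous.aestronglyMeasurable).2 hi
  have h := (hb.const_smul (2 : ℝ)).sub (((hf.memLp_pd j).const_mul Complex.I).const_smul (2 * t))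
  exact h.congr_norm (((contDiff_coord j).continuous.smul hf.smooth.continuous).aestronglyMeasurable)
    (Filter.Eventually.of_forall fun x => by rw [smul_coord_eq t]; rfl)

/-- The phase `exp(-i |x|² / 4t)`. -/
def phase (t : ℝ) (x : R3) : ℂ := Complex.exp ((-(‖x‖ ^ 2 / (4 * t)) : ℝ) * Complex.I)

theorem contDiff_phase (t : ℝ) : ContDiff ℝ ∞ (phase t) := by
  have h1 : ContDiff ℝ ∞ fun x : R3 => -(‖x‖ ^ 2 / (4 * t)) :=
    ((contDiff_id.norm_sq ℝ).div_const _).neg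
  exact ((Complex.ofRealCLM.contDiff.comp h1).mul contDiff_const).cexp

theorem norm_phase (t : ℝ) (x : R3) : ‖phase t x‖ = 1 := Complex.norm_exp_ofReal_mul_I _

/-- A gauge transformation: it does not change `|f|`, and it turns the boost into `t` times a
gradient, so that inequalities for gradients gain powers of `1 / t`. -/
theorem pd_phase_mul {t : ℝ} (ht : t ≠ 0) {f : R3 → ℂ} (hf : ContDiff ℝ ∞ f) (j : Fin 3) (x : R3) :
    pd j (fun x => phase t x * f x) x = -(Complex.I / t) * (phase t x * boost t j f x) := by
  have h1 : HasFDerivAt (fun x : R3 => ‖x‖ ^ 2) (2 • innerSL ℝ x) x := by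
    simpa using (hasFDerivAt_id x).norm_sq
  have h2 : HasFDerivAt (fun x : R3 => -(‖x‖ ^ 2 / (4 * t))) (-((4 * t)⁻¹ • 2 • innerSL ℝ x)) x :=
    (h1.mul_const (4 * t)⁻¹).neg
  have h3 := ((Complex.ofRealCLM.hasFDerivAt.comp x h2).mul_const Complex.I).cexp
  have h4 : HasFDerivAt (phase t) _ x := h3
  have h5 := h4.mul (hf.differentiable (by simp) x).hasFDerivAt
  have h6 : pd j (fun x => phase t x * f x) x = _ :=
    congrArg (fun L => L (EuclideanSpace.single j 1)) h5.fderiv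
  rw [h6]
  have hin : innerSL ℝ x (EuclideanSpace.single j 1) = x j := by
    rw [innerSL_apply_apply, real_inner_comm, EuclideanSpace.inner_single_left]; simp
  simp only [add_apply, smul_apply, ContinuousLinearMap.comp_apply, neg_apply, hin, smul_eq_mul,
    Complex.ofRealCLM_apply, Function.comp]
  change phase t x * pd j f x + f x * (phase t x * (Complex.I * _)) = _
  simp only [boost, Complex.real_smul]
  have htc : (t : ℂ) ≠ 0 := by exact_mod_cast ht
  push_cast
  field_simp
  have := Complex.I_sq
  rw [nsmul_eq_mul]
  push_cast
  linear_combination (8 * phase t x * pd j f x * t) * this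

/-- The interpolated Sobolev inequality applied to `phase t * f` rather than to `f`. -/
theorem exists_integral_four_le_boost : ∃ C : ℝ, 0 ≤ C ∧ ∀ (M t : ℝ) (f : R3 → ℂ), 0 < t →
    H2Slice M f → (∀ j, Integrable fun x => ‖boost t j f x‖ ^ 2) →
    (∫ x, ‖f x‖ ^ 4) ^ 2 ≤
      C * (∫ x, ‖f x‖ ^ 2) * ((∑ j, ∫ x, ‖boost t j f x‖ ^ 2) / t ^ 2) ^ 3 := by
  obtain ⟨C, hC0, hC⟩ := exists_integral_four_le
  refine ⟨C, hC0, fun M t f ht hf hi => ?_⟩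
  have hn : ∀ x, ‖phase t x * f x‖ = ‖f x‖ := fun x => by rw [norm_mul, norm_phase, one_mul]
  have hs : ContDiff ℝ ∞ fun x => phase t x * f x := (contDiff_phase t).mul hf.smooth
  have hp : ∀ j x, ‖pd j (fun x => phase t x * f x) x‖ ^ 2 = ‖boost t j f x‖ ^ 2 / t ^ 2 :=
    fun j x => by
      rw [pd_phase_mul ht.ne' hf.smooth, norm_mul, norm_mul, norm_phase, norm_neg, norm_div,
        Complex.norm_I, Complex.norm_real, Real.norm_of_nonneg ht.le]
      field_simp
  have h := (hC _ hs (hf.memLp.congr_norm hs.continuous.aestronglyMeasurable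
    (Filter.Eventually.of_forall fun x => (hn x).symm)) fun j => by
      rw [memLp_two_iff_integrable_sq_norm (contDiff_pd hs j).continuous.aestronglyMeasurable]
      simp only [hp]
      exact (hi j).div_const _).2
  simp only [hn, hp, integral_div] at h
  rwa [← Finset.sum_div] at h

/-- From `n(x) n(y) ≤ (n(x)² + n(y)²) / 2` and `v ≥ 0`. Here the short range of `v` enters through
`∫ v < ∞`. -/
theorem IsRegularPotential.integral_conv_mul_self_le {v : R3 → ℝ} (hv : IsRegularPotential v)
    {n : R3 → ℝ} (hn : Continuous n) (hi : Integrable n) (h2 : MemLp n 2 volume) :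
    ∫ x, conv v n x * n x ≤ (∫ x, v x) * ∫ x, n x ^ 2 := by
  have hm := hn.measurable
  obtain ⟨i1, e1⟩ := integral_sub_mul hv.integrable h2.integrable_sq
  obtain ⟨i2, e2⟩ := integral_sub_mul_fst hv.even hv.integrable h2.integrable_sq
  rw [← hv.integral_kernel hm hm hi h2]
  have hle : ∫ z : R3 × R3, v (z.1 - z.2) * (n z.1 * n z.2) ≤
      ∫ z : R3 × R3, (2⁻¹ * (v (z.1 - z.2) * n z.1 ^ 2) + 2⁻¹ * (v (z.1 - z.2) * n z.2 ^ 2)) := by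
    refine integral_mono_ae (hv.integrable_kernel hm hm hi h2).1
      ((i2.const_mul _).add (i1.const_mul _)) ?_
    filter_upwards [ae_fst_ne_snd] with z hz
    have h0 := hv.nonneg _ (sub_ne_zero.2 hz)
    nlinarith [mul_nonneg h0 (sq_nonneg (n z.1 - n z.2))]
  rw [integral_add (i2.const_mul _) (i1.const_mul _), integral_const_mul, integral_const_mul,
    e1, e2] at hle
  linarith

namespace HartreeFlow

variable {v : R3 → ℝ} {φ : ℝ → R3 → ℂ}

theorem interaction_nonneg (hv : IsRegularPotential v) (f : R3 → ℂ) : 0 ≤ interaction v f :=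
  integral_nonneg fun x => mul_nonneg (hv.conv_nonneg (fun _ => sq_nonneg _) x) (sq_nonneg _)

/-- The kinetic part `∑ⱼ ∫ |(xⱼ / 2 + i t ∂ⱼ) f|²` of the pseudoconformal energy. -/
def boostNorm (t : ℝ) (f : R3 → ℂ) : ℝ := ∑ j, ∫ x, ‖boost t j f x‖ ^ 2

theorem boostNorm_nonneg (t : ℝ) (f : R3 → ℂ) : 0 ≤ boostNorm t f :=
  Finset.sum_nonneg fun _ _ => integral_nonneg fun _ => sq_nonneg _

/-- The pseudoconformal energy. -/
def pcEnergy (v : R3 → ℝ) (t : ℝ) (f : R3 → ℂ) : ℝ := boostNorm t f + t ^ 2 * interaction v f / 2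

theorem integral_source_eq (hv : IsRegularPotential v) {M s : ℝ} {f : R3 → ℂ} (hf : H2Slice M f)
    (hi : ∀ j, Integrable fun x => ‖boost s j f x‖ ^ 2) :
    ∑ j, ∫ x, 2 * s * (pd j (meanField v f) x * ⟪boost s j f x, f x⟫_ℝ) =
      s * (∑ j, ∫ x : R3, pd j (meanField v f) x * (x j * ‖f x‖ ^ 2))
        + 2 * s ^ 2 * ∑ j, ∫ x, pd j (meanField v f) x * current j f x := by
  obtain ⟨A, hA0, hA⟩ := exists_slice_bounds hv M
  have hb := hA f hf
  have i1 := (virial_meanField hv hf fun j => memLp_coord_smul hf (hi j)).1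
  have i2 : ∀ j, Integrable fun x => pd j (meanField v f) x * current j f x := fun j =>
    (hf.integral_mul_pd_current (hv.differentiable_conv (contDiff_norm_sq hf.smooth))
      (fun k => (measurable_pd_meanField hv hf.smooth k).measurable)
      hb.2.2.2.1 hb.2.2.2.2 j).2.1
  rw [Finset.mul_sum, Finset.mul_sum, ← Finset.sum_add_distrib]
  refine Finset.sum_congr rfl fun j _ => ?_
  rw [← integral_const_mul, ← integral_const_mul,
    ← integral_add ((i1 j).const_mul _) ((i2 j).const_mul _)]
  refine integral_congr_ae (Filter.Eventually.of_forall fun x => ?_)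
  simp only [inner_boost_self]
  ring

/-- The terms `∂ₖV · current` from the boosted norms and from `t² I / 2` are opposite. What remains
is the virial term plus the derivative of the explicit weight `t²`. -/
theorem pcEnergy_sub (hv : IsRegularPotential v) (h : HartreeFlow v φ)
    (h1 : ∀ j, Integrable fun x => ‖boost 1 j (φ 1) x‖ ^ 2) {b : ℝ} (hb : 1 ≤ b) :
    IntervalIntegrable (fun s => s * ((∑ j, ∫ x : R3, pd j (meanField v (φ s)) x
        * (x j * ‖φ s x‖ ^ 2)) + interaction v (φ s))) volume 1 b ∧
    pcEnergy v b (φ b) - pcEnergy v 1 (φ 1) =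
      ∫ s in (1 : ℝ)..b, s * ((∑ j, ∫ x : R3, pd j (meanField v (φ s)) x
        * (x j * ‖φ s x‖ ^ 2)) + interaction v (φ s)) := by
  obtain ⟨B, hB⟩ := exists_integral_boost_le hv h h1 b
  obtain ⟨M, hM⟩ := h.slice b
  obtain ⟨k1, k2⟩ := sq_mul_interaction_sub hv h le_rfl hb
  have k3 := fun j => integral_boost_sub hv h h1 le_rfl hb j
  have k4 := IntervalIntegrable.sum Finset.univ fun j _ => (k3 j).1
  have e : ∀ s ∈ Icc 1 b, s * ((∑ j, ∫ x : R3, pd j (meanField v (φ s)) x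
      * (x j * ‖φ s x‖ ^ 2)) + interaction v (φ s)) =
      (∑ j, ∫ x, 2 * s * (pd j (meanField v (φ s)) x * ⟪boost s j (φ s) x, φ s x⟫_ℝ))
      + (s * interaction v (φ s) - 2 * s ^ 2 * ∑ k, ∫ x, pd k (meanField v (φ s)) x
        * current k (φ s) x) := fun s hs => by
    rw [integral_source_eq hv (hM s hs) fun j => (hB s hs j).1]; ring
  have k5 : IntervalIntegrable (fun s =>
      ∑ j, ∫ x, 2 * s * (pd j (meanField v (φ s)) x * ⟪boost s j (φ s) x, φ s x⟫_ℝ))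
      volume 1 b := by
    refine k4.congr fun s _ => ?_
    simp only [Finset.sum_apply]
  refine ⟨(k5.add k1).congr fun s hs => ?_, ?_⟩
  · rw [uIoc_of_le hb] at hs
    exact (e s (Ioc_subset_Icc_self hs)).symm
  · rw [intervalIntegral.integral_congr (g := fun s =>
      (∑ j, ∫ x, 2 * s * (pd j (meanField v (φ s)) x * ⟪boost s j (φ s) x, φ s x⟫_ℝ))
      + (s * interaction v (φ s) - 2 * s ^ 2 * ∑ k, ∫ x, pd k (meanField v (φ s)) x
        * current k (φ s) x)) fun s hs => by
          rw [uIcc_of_le hb] at hs; exact e s hs,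
      intervalIntegral.integral_add k5 k1,
      intervalIntegral.integral_finsetSum fun j _ => (k3 j).1]
    simp only [← (k3 _).2, Finset.sum_sub_distrib]
    simp only [pcEnergy, boostNorm]
    linarith

/-- The identity for `s² I(s)` exhibits it as a primitive; division by `s² ≥ 1` keeps continuity. -/
theorem continuousOn_interaction (hv : IsRegularPotential v) (h : HartreeFlow v φ) (T : ℝ) :
    ContinuousOn (fun s => interaction v (φ s)) (Icc 1 T) := by
  rcases lt_or_ge T 1 with hT | hT
  · rw [Icc_eq_empty (not_le.2 hT)]; exact continuousOn_empty _
  have hi := (sq_mul_interaction_sub hv h le_rfl hT).1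
  have hc := intervalIntegral.continuousOn_primitive_interval
    ((intervalIntegrable_iff' enorm_ne_top).1 hi)
  rw [uIcc_of_le hT] at hc
  have hc2 : ContinuousOn (fun s : ℝ => (s ^ 2)⁻¹ * (interaction v (φ 1)
      + 2 * ∫ r in (1 : ℝ)..s, (r * interaction v (φ r)
        - 2 * r ^ 2 * ∑ k, ∫ x, pd k (meanField v (φ r)) x * current k (φ r) x))) (Icc 1 T) :=
    ((continuousOn_id.pow 2).inv₀ fun s hs => by
      have : 0 < s := by linarith [hs.1]
      simp [this.ne']).mul (continuousOn_const.add (continuousOn_const.mul hc))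
  refine hc2.congr fun s hs => ?_
  have := (sq_mul_interaction_sub hv h le_rfl hs.1).2
  have h0 : s ≠ 0 := by linarith [hs.1]
  simp only [← this]
  field_simp
  ring

theorem continuousOn_pcEnergy (hv : IsRegularPotential v) (h : HartreeFlow v φ)
    (h1 : ∀ j, Integrable fun x => ‖boost 1 j (φ 1) x‖ ^ 2) (T : ℝ) :
    ContinuousOn (fun s => pcEnergy v s (φ s)) (Icc 1 T) := by
  rcases lt_or_ge T 1 with hT | hT
  · rw [Icc_eq_empty (not_le.2 hT)]; exact continuousOn_empty _
  have hi := (pcEnergy_sub hv h h1 hT).1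
  have hc := intervalIntegral.continuousOn_primitive_interval
    ((intervalIntegrable_iff' enorm_ne_top).1 hi)
  rw [uIcc_of_le hT] at hc
  refine ((continuousOn_const (c := pcEnergy v 1 (φ 1))).add hc).congr fun s hs => ?_
  exact eq_add_of_sub_eq' (pcEnergy_sub hv h h1 hs.1).2

/-- The virial term is at most `-I / 2`, and the explicit weight contributes `I`; their sum leaves
`I / 2`. -/
theorem pcEnergy_le (hv : IsRegularPotential v) (h : HartreeFlow v φ)
    (h1 : ∀ j, Integrable fun x => ‖boost 1 j (φ 1) x‖ ^ 2) {b : ℝ} (hb : 1 ≤ b) :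
    pcEnergy v b (φ b) ≤ pcEnergy v 1 (φ 1)
      + ∫ s in (1 : ℝ)..b, s * interaction v (φ s) / 2 := by
  obtain ⟨B, hB⟩ := exists_integral_boost_le hv h h1 b
  obtain ⟨M, hM⟩ := h.slice b
  obtain ⟨k1, k2⟩ := pcEnergy_sub hv h h1 hb
  have : ∫ s in (1 : ℝ)..b, s * ((∑ j, ∫ x : R3, pd j (meanField v (φ s)) x
      * (x j * ‖φ s x‖ ^ 2)) + interaction v (φ s)) ≤
      ∫ s in (1 : ℝ)..b, s * interaction v (φ s) / 2 := by
    refine intervalIntegral.integral_mono_on hb k1 (ContinuousOn.intervalIntegrable_of_Icc hb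
      ((continuousOn_id.mul (continuousOn_interaction hv h b)).div_const 2)) fun s hs => ?_
    have h0 : 0 ≤ s := by linarith [hs.1]
    have hvir := (virial_meanField hv (hM s hs)
      fun j => memLp_coord_smul (hM s hs) (hB s hs j).1).2
    have := mul_le_mul_of_nonneg_left hvir h0
    linarith
  linarith

end HartreeFlow

/-! ### Decay of the Hartree flow -/

namespace HartreeFlow

variable {v : R3 → ℝ} {φ : ℝ → R3 → ℂ}

theorem boostNorm_le_pcEnergy (hv : IsRegularPotential v) (t : ℝ) (f : R3 → ℂ) :
    boostNorm t f ≤ pcEnergy v t f := by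
  have := mul_nonneg (sq_nonneg t) (interaction_nonneg hv f)
  rw [pcEnergy]; linarith

theorem pcEnergy_nonneg (hv : IsRegularPotential v) (t : ℝ) (f : R3 → ℂ) : 0 ≤ pcEnergy v t f :=
  (boostNorm_nonneg t f).trans (boostNorm_le_pcEnergy hv t f)

theorem interaction_le (hv : IsRegularPotential v) {M : ℝ} {f : R3 → ℂ} (hf : H2Slice M f) :
    interaction v f ≤ (∫ x, v x) * ∫ x, ‖f x‖ ^ 4 := by
  obtain ⟨A, -, hA⟩ := exists_slice_bounds hv M
  have h := hv.integral_conv_mul_self_le (contDiff_norm_sq hf.smooth).continuous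
    ((memLp_two_iff_integrable_sq_norm hf.memLp.1).1 hf.memLp)
    (memLp_norm_sq hf.smooth (hA f hf).1)
  refine h.trans (le_of_eq ?_)
  congr 2
  funext x; ring

/-- The crude first pass: `s I / 2 = (s² I / 2) / s` is at most the energy divided by `s`, and
Grönwall with `B = log` gives linear growth. -/
theorem pcEnergy_le_mul (hv : IsRegularPotential v) (h : HartreeFlow v φ)
    (h1 : ∀ j, Integrable fun x => ‖boost 1 j (φ 1) x‖ ^ 2) {t : ℝ} (ht : 1 ≤ t) :
    pcEnergy v t (φ t) ≤ pcEnergy v 1 (φ 1) * t := by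
  have hcE := continuousOn_pcEnergy hv h h1 t
  have hinv : ContinuousOn (fun s : ℝ => s⁻¹) (Icc 1 t) :=
    continuousOn_inv₀.mono fun s hs => by
      have : 0 < s := by linarith [hs.1]
      exact this.ne'
  have hG := le_mul_exp_of_le_add_integral (a := 1) (b := t) (A := pcEnergy v 1 (φ 1))
    (y := fun s => pcEnergy v s (φ s)) (β := fun s => s⁻¹) (B := Real.log)
    hcE hinv (fun s hs => inv_nonneg.2 (by linarith [hs.1]))
    (Real.continuousOn_log.mono fun s hs => by
      have : 0 < s := by linarith [hs.1]
      exact this.ne')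
    (fun s hs => Real.hasDerivAt_log (by linarith [hs.1]))
    (fun s hs => by
      have hle : ∫ r in (1 : ℝ)..s, r * interaction v (φ r) / 2 ≤
          ∫ r in (1 : ℝ)..s, r⁻¹ * pcEnergy v r (φ r) := by
        refine intervalIntegral.integral_mono_on hs.1
          (ContinuousOn.intervalIntegrable_of_Icc hs.1
            ((continuousOn_id.mul (continuousOn_interaction hv h s)).div_const 2))
          (ContinuousOn.intervalIntegrable_of_Icc hs.1
            ((hinv.mul hcE).mono (Icc_subset_Icc_right hs.2))) fun r hr => ?_
        have hr0 : 0 < r := by linarith [hr.1]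
        rw [le_inv_mul_iff₀ hr0, pcEnergy]
        have := boostNorm_nonneg r (φ r)
        linarith
      linarith [pcEnergy_le hv h h1 hs.1]) ⟨ht, le_rfl⟩
  rwa [Real.log_one, sub_zero, Real.exp_log (by linarith)] at hG

/-- Conservation of mass makes the constant uniform in time. The power `3 / 2` of the boosted norm
is written `K √K`. -/
theorem exists_integral_four_le_div (hv : IsRegularPotential v) (h : HartreeFlow v φ)
    (h1 : ∀ j, Integrable fun x => ‖boost 1 j (φ 1) x‖ ^ 2) :
    ∃ c : ℝ, 0 ≤ c ∧ ∀ t, 1 ≤ t → ∫ x, ‖φ t x‖ ^ 4 ≤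
      c * (boostNorm t (φ t) * √(boostNorm t (φ t))) / t ^ 3 := by
  obtain ⟨C, hC0, hC⟩ := exists_integral_four_le_boost
  set m := ∫ x, ‖φ 1 x‖ ^ 2
  have hm : 0 ≤ m := integral_nonneg fun x => sq_nonneg _
  refine ⟨√(C * m), Real.sqrt_nonneg _, fun t ht => ?_⟩
  obtain ⟨B, hB⟩ := exists_integral_boost_le hv h h1 t
  obtain ⟨M, hM⟩ := h.slice t
  have ht0 : 0 < t := by linarith
  have hI : t ∈ Icc 1 t := ⟨ht, le_rfl⟩
  have hk := hC M t (φ t) ht0 (hM t hI) fun j => (hB t hI j).1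
  rw [h.mass_eq ht] at hk
  change _ ≤ C * m * (boostNorm t (φ t) / t ^ 2) ^ 3 at hk
  set K := boostNorm t (φ t)
  have hK : 0 ≤ K := boostNorm_nonneg _ _
  refine le_of_sq_le_sq ?_ (by positivity)
  refine hk.trans (le_of_eq ?_)
  rw [div_pow, div_pow, mul_pow, mul_pow, Real.sq_sqrt (by positivity), Real.sq_sqrt hK]
  field_simp

/-- The second pass: one factor `√K` in `∫ |φ|⁴ ≤ c K √K / t³` is estimated by the linear growth,
`√K ≤ √(E₁ t)`, and the remaining `K` by the energy. The coefficient becomes `a s^{-3/2}`, whose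
integral over `[1, ∞)` is `2 a`. -/
theorem exists_pcEnergy_le (hv : IsRegularPotential v) (h : HartreeFlow v φ)
    (h1 : ∀ j, Integrable fun x => ‖boost 1 j (φ 1) x‖ ^ 2) :
    ∃ C : ℝ, ∀ t, 1 ≤ t → pcEnergy v t (φ t) ≤ C := by
  obtain ⟨c, hc0, hc⟩ := exists_integral_four_le_div hv h h1
  set E₁ := pcEnergy v 1 (φ 1)
  have hE₁ : 0 ≤ E₁ := pcEnergy_nonneg hv 1 (φ 1)
  set N := ∫ x, v x
  have hN : 0 ≤ N := integral_nonneg_of_ae hv.ae_nonneg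
  set a := N / 2 * c * √E₁ with ha
  have ha0 : 0 ≤ a := by positivity
  refine ⟨E₁ * Real.exp (2 * a), fun t ht => ?_⟩
  have hcE := continuousOn_pcEnergy hv h h1 t
  have hpos : ∀ s ∈ Icc 1 t, 0 < s := fun s hs => by linarith [hs.1]
  have hsq : ContinuousOn (fun s : ℝ => a * (√s / s ^ 2)) (Icc 1 t) :=
    continuousOn_const.mul (Real.continuous_sqrt.continuousOn.div (continuousOn_id.pow 2)
      fun s hs => by have := hpos s hs; simp [this.ne'])
  have hG := le_mul_exp_of_le_add_integral (a := 1) (b := t) (A := E₁)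
    (y := fun s => pcEnergy v s (φ s)) (β := fun s => a * (√s / s ^ 2))
    (B := fun s => -(2 * a) * (√s)⁻¹)
    hcE hsq (fun s _ => by positivity)
    (continuousOn_const.mul (Real.continuous_sqrt.continuousOn.inv₀ fun s hs =>
      (Real.sqrt_pos.2 (hpos s hs)).ne'))
    (fun s hs => by
      have hs0 := hpos s (Ioo_subset_Icc_self hs)
      have hr := Real.sqrt_pos.2 hs0
      have hd := ((Real.hasDerivAt_sqrt hs0.ne').inv hr.ne').const_mul (-(2 * a))
      refine hd.congr_deriv ?_
      have e : s = √s ^ 2 := (Real.sq_sqrt hs0.le).symm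
      have e2 : s ^ 2 = √s ^ 4 := by rw [show √s ^ 4 = (√s ^ 2) ^ 2 by ring, ← e]
      rw [e2]
      field_simp)
    (fun s hs => by
      have hle : ∫ r in (1 : ℝ)..s, r * interaction v (φ r) / 2 ≤
          ∫ r in (1 : ℝ)..s, a * (√r / r ^ 2) * pcEnergy v r (φ r) := by
        refine intervalIntegral.integral_mono_on hs.1
          (ContinuousOn.intervalIntegrable_of_Icc hs.1
            ((continuousOn_id.mul (continuousOn_interaction hv h s)).div_const 2))
          (ContinuousOn.intervalIntegrable_of_Icc hs.1
            ((hsq.mul hcE).mono (Icc_subset_Icc_right hs.2))) fun r hr => ?_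
        have hr0 : 0 < r := by linarith [hr.1]
        obtain ⟨M, hM⟩ := h.slice r
        have hint := interaction_le hv (hM r ⟨hr.1, le_rfl⟩)
        have hQ := hc r hr.1
        have hKE := boostNorm_le_pcEnergy hv r (φ r)
        have hE := pcEnergy_le_mul hv h h1 hr.1
        have hK := boostNorm_nonneg r (φ r)
        have hE0 := pcEnergy_nonneg hv r (φ r)
        set K := boostNorm r (φ r)
        set E := pcEnergy v r (φ r)
        have hsK : √K ≤ √E₁ * √r := by
          rw [← Real.sqrt_mul hE₁]
          exact Real.sqrt_le_sqrt (hKE.trans hE)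
        calc r * interaction v (φ r) / 2 ≤ r * (N * ∫ x, ‖φ r x‖ ^ 4) / 2 := by gcongr
          _ ≤ r * (N * (c * (K * √K) / r ^ 3)) / 2 := by gcongr
          _ ≤ r * (N * (c * (E * (√E₁ * √r)) / r ^ 3)) / 2 := by gcongr
          _ = a * (√r / r ^ 2) * E := by
              rw [ha]; field_simp
      linarith [pcEnergy_le hv h h1 hs.1]) ⟨ht, le_rfl⟩
  refine hG.trans ?_
  refine mul_le_mul_of_nonneg_left (Real.exp_le_exp.2 ?_) hE₁
  have : 0 ≤ 2 * a * (√t)⁻¹ := by positivity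
  simp only [Real.sqrt_one, inv_one]
  linarith

theorem exists_integral_four_decay (hv : IsRegularPotential v) (h : HartreeFlow v φ)
    (h1 : ∀ j, Integrable fun x => ‖boost 1 j (φ 1) x‖ ^ 2) :
    ∃ C : ℝ, 0 ≤ C ∧ ∀ t, 1 ≤ t → ∫ x, ‖φ t x‖ ^ 4 ≤ C / t ^ 3 := by
  obtain ⟨c, hc0, hc⟩ := exists_integral_four_le_div hv h h1
  obtain ⟨E, hE⟩ := exists_pcEnergy_le hv h h1
  have hE0 : 0 ≤ E := (pcEnergy_nonneg hv 1 (φ 1)).trans (hE 1 le_rfl)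
  refine ⟨c * (E * √E), by positivity, fun t ht => (hc t ht).trans ?_⟩
  have hK := (boostNorm_le_pcEnergy hv t (φ t)).trans (hE t ht)
  have ht0 : 0 < t := by linarith
  gcongr

end HartreeFlow

/-! ### Smooth Hartree solutions -/

theorem memLp_two_and_integral_sq_le {F : Type*} [NormedAddCommGroup F] {f : R3 → ℂ} {g : R3 → F}
    {M : ℝ≥0} (hf : Continuous f) (hle : ∀ x, ‖f x‖ ≤ ‖g x‖) (hg : eLpNorm g 2 volume ≤ M) :
    MemLp f 2 volume ∧ ∫ x, ‖f x‖ ^ 2 ≤ (M : ℝ) ^ 2 := by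
  have h1 : eLpNorm f 2 volume ≤ M :=
    (eLpNorm_mono_ae (Filter.Eventually.of_forall hle)).trans hg
  have hm : MemLp f 2 volume :=
    ⟨hf.aestronglyMeasurable, h1.trans_lt ENNReal.coe_lt_top⟩
  refine ⟨hm, ?_⟩
  have h2 := eLpNorm_pow_eq_lintegral (μ := (volume : Measure R3)) f two_ne_zero
  rw [lintegral_enorm_sq_eq hm, Nat.cast_ofNat] at h2
  have h3 : ENNReal.ofReal (∫ x, ‖f x‖ ^ 2) ≤ ENNReal.ofReal ((M : ℝ) ^ 2) := by
    rw [← h2, ENNReal.ofReal_pow M.coe_nonneg, ENNReal.ofReal_coe_nnreal]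
    gcongr
  exact (ENNReal.ofReal_le_ofReal_iff (by positivity)).1 h3

namespace IsSmoothHartreeSolution

variable {v : R3 → ℝ} {φ : ℝ → R3 → ℂ}

theorem contDiff_slice (h : IsSmoothHartreeSolution v φ) {t : ℝ} (ht : 0 ≤ t) :
    ContDiff ℝ ∞ (φ t) :=
  h.smooth.comp_contDiff (f := fun x : R3 => (t, x)) (by fun_prop) fun x => ⟨ht, mem_univ x⟩

theorem exists_slice (h : IsSmoothHartreeSolution v φ) (T : ℝ) :
    ∃ M : ℝ, ∀ t ∈ Icc 0 T, H2Slice M (φ t) := by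
  obtain ⟨M, hM⟩ := h.sobolev T
  refine ⟨(M : ℝ) ^ 2, fun t ht => ?_⟩
  have hs := h.contDiff_slice ht.1
  have k0 := memLp_two_and_integral_sq_le hs.continuous
    (fun x => (norm_iteratedFDeriv_zero (𝕜 := ℝ)).ge) (hM t ht 0 (by norm_num))
  have k1 := fun k => memLp_two_and_integral_sq_le (contDiff_pd hs k).continuous
    (fun x => (norm_pd_le k (φ t) x).trans (norm_iteratedFDeriv_one (𝕜 := ℝ) (φ t)).ge)
    (hM t ht 1 (by norm_num))
  have k2 := fun j k => memLp_two_and_integral_sq_le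
    (contDiff_pd (contDiff_pd hs k) j).continuous (norm_pd_pd_le hs j k) (hM t ht 2 le_rfl)
  exact ⟨hs, k0.1, fun k => (k1 k).1, fun j k => (k2 j k).1, k0.2, fun k => (k1 k).2,
    fun j k => (k2 j k).2⟩

/-- The solution is smooth only on `t ≥ 0`. Composing with a smooth time change that takes
nonnegative values and is the identity near `[1, ∞)` gives a function smooth for all times, which
removes one-sided derivatives from the argument. -/
theorem exists_hartreeFlow (h : IsSmoothHartreeSolution v φ) :
    ∃ Φ : ℝ → R3 → ℂ, HartreeFlow v Φ ∧ ∀ t, 1 ≤ t → Φ t = φ t := by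
  -- The transition vanishes for `t ≤ 1/4` and equals 1 for `t ≥ 1/2`, so `θ ≥ 0` everywhere and `θ
  -- t = t` in a neighbourhood of every `t ≥ 1`.
  set θ : ℝ → ℝ := fun t => Real.smoothTransition (4 * t - 1) * t with hθ
  have hθc : ContDiff ℝ ∞ θ :=
    (Real.smoothTransition.contDiff.comp (by fun_prop)).mul contDiff_id
  have hθ0 : ∀ t, 0 ≤ θ t := fun t => by
    rcases le_or_gt t 0 with ht | ht
    · simp only [hθ]; rw [Real.smoothTransition.zero_of_nonpos (by linarith)]; simp
    · exact mul_nonneg (Real.smoothTransition.nonneg _) ht.le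
  have hθ1 : ∀ t, 1 / 2 ≤ t → θ t = t := fun t ht => by
    simp only [hθ]; rw [Real.smoothTransition.one_of_one_le (by linarith), one_mul]
  have heq : ∀ t, 1 / 2 ≤ t → φ (θ t) = φ t := fun t ht => by rw [hθ1 t ht]
  refine ⟨fun t => φ (θ t), ⟨?_, fun T => ?_, fun t ht x => ?_⟩, fun t ht => heq t (by linarith)⟩
  · exact h.smooth.comp_contDiff (f := fun z : ℝ × R3 => (θ z.1, z.2))
      ((hθc.comp contDiff_fst).prodMk contDiff_snd) fun z => ⟨hθ0 z.1, mem_univ _⟩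
  · obtain ⟨M, hM⟩ := h.exists_slice T
    refine ⟨M, fun t ht => ?_⟩
    simp only [heq t (by linarith [ht.1])]
    exact hM t ⟨by linarith [ht.1], ht.2⟩
  · have ht0 : (0 : ℝ) < t := by linarith
    have hd : td (fun t => φ (θ t)) t x = derivWithin (fun s => φ s x) (Ici 0) t := by
      rw [derivWithin_of_mem_nhds (Ici_mem_nhds ht0), td]
      refine Filter.EventuallyEq.deriv_eq ?_
      filter_upwards [lt_mem_nhds (by linarith : 1 / 2 < t)] with s hs
      rw [heq s hs.le]
    have he := h.equation t ht0.le x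
    rw [laplacian_eq_sum_pd (h.contDiff_slice ht0.le)] at he
    simp only [hd, heq t (by linarith)]
    have := Complex.I_sq
    linear_combination (-Complex.I) * he + derivWithin (fun s => φ s x) (Ici 0) t * this

end IsSmoothHartreeSolution

/-- Completing the square, with `momentumDensity j f = ⟨f, i ∂ⱼ f⟩`. The density is thus a sum of
terms that are nonnegative for a repulsive potential, and its integrability passes to each boosted
term. -/
theorem pseudoconformalDensity_one (v : R3 → ℝ) (f : R3 → ℂ) (x : R3) :
    pseudoconformalDensity v 1 f x =
      ∑ j, ‖boost 1 j f x‖ ^ 2 + meanField v f x * ‖f x‖ ^ 2 / 2 := by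
  have hb : ∀ j, ‖boost 1 j f x‖ ^ 2 =
      x j ^ 2 / 4 * ‖f x‖ ^ 2 + x j * momentumDensity j f x + ‖pderiv j f x‖ ^ 2 := fun j => by
    have hin : ⟪f x, Complex.I * pd j f x⟫_ℝ = momentumDensity j f x := by
      rw [momentumDensity, pderiv_eq_pd]
      simp [Complex.inner]; ring
    rw [boost, norm_add_sq_real, real_inner_smul_left, real_inner_smul_right, hin, norm_smul,
      norm_smul, norm_mul, Complex.norm_I, norm_one, pderiv_eq_pd, mul_pow, Real.norm_eq_abs,
      sq_abs]
    ring
  simp only [hb, Finset.sum_add_distrib, ← Finset.sum_mul, pseudoconformalDensity, massDensity,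
    energyDensity]
  rw [EuclideanSpace.norm_sq_eq]
  simp only [Real.norm_eq_abs, sq_abs, ← Finset.sum_div]
  ring

theorem integrable_boost_one {v : R3 → ℝ} (hv : IsRegularPotential v) {f : R3 → ℂ}
    (hf : ContDiff ℝ ∞ f) (hE : Integrable (pseudoconformalDensity v 1 f)) (j : Fin 3) :
    Integrable fun x => ‖boost 1 j f x‖ ^ 2 := by
  refine hE.mono' ((contDiff_boost hf 1 j).continuous.norm.pow 2).aestronglyMeasurable
    (Filter.Eventually.of_forall fun x => ?_)
  rw [pseudoconformalDensity_one, Real.norm_of_nonneg (sq_nonneg _)]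
  have h1 := Finset.single_le_sum (f := fun j => ‖boost 1 j f x‖ ^ 2)
    (fun j _ => sq_nonneg _) (Finset.mem_univ j)
  have h2 : 0 ≤ meanField v f x * ‖f x‖ ^ 2 :=
    mul_nonneg (hv.conv_nonneg (fun _ => sq_nonneg _) x) (sq_nonneg _)
  linarith

theorem exists_integral_four_le_of_solution {v : R3 → ℝ} {φ : ℝ → R3 → ℂ}
    (hv : IsRegularPotential v) (h : IsSmoothHartreeSolution v φ)
    (hE : Integrable (pseudoconformalDensity v 1 (φ 1))) :
    ∃ C : ℝ, 0 ≤ C ∧ ∀ t, 0 ≤ t → ∫ x, ‖φ t x‖ ^ 4 ≤ C / (1 + t) ^ 3 := by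
  obtain ⟨Φ, hΦ, hΦφ⟩ := h.exists_hartreeFlow
  obtain ⟨C, hC0, hC⟩ := exists_integral_four_decay hv hΦ (by
    rw [hΦφ 1 le_rfl]
    exact integrable_boost_one hv (h.contDiff_slice zero_le_one) hE)
  obtain ⟨M, hM⟩ := h.exists_slice 1
  obtain ⟨A, hA0, hA⟩ := exists_slice_bounds hv M
  -- `8 = 2³`: `1 + t ≤ 2 t` for `t ≥ 1`, and `1 + t ≤ 2` for `t ≤ 1`, where the `H²` bound on `[0,
  -- 1]` replaces decay.
  refine ⟨8 * (C + A), by positivity, fun t ht => ?_⟩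
  have h1 : (0 : ℝ) < (1 + t) ^ 3 := by positivity
  rcases le_or_gt 1 t with h1t | h1t
  · have hQ := hC t h1t
    rw [hΦφ t h1t] at hQ
    refine hQ.trans ?_
    rw [div_le_div_iff₀ (by positivity) h1]
    have : (1 + t) ^ 3 ≤ (2 * t) ^ 3 := pow_le_pow_left₀ (by linarith) (by linarith) 3
    have h3 : 0 ≤ 8 * A * t ^ 3 := by positivity
    calc C * (1 + t) ^ 3 ≤ C * (2 * t) ^ 3 := by gcongr
      _ ≤ 8 * (C + A) * t ^ 3 := by nlinarith
  · refine (hA _ (hM t ⟨ht, h1t.le⟩)).2.1.trans ?_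
    rw [le_div_iff₀ h1]
    have : (1 + t) ^ 3 ≤ 2 ^ 3 := pow_le_pow_left₀ (by linarith) (by linarith) 3
    calc A * (1 + t) ^ 3 ≤ A * 2 ^ 3 := by gcongr
      _ ≤ 8 * (C + A) := by linarith

theorem norm_sh_le_of_solution {v : R3 → ℝ} {φ : ℝ → R3 → ℂ} (hv : IsRegularPotential v)
    (h : IsSmoothHartreeSolution v φ) (hE : Integrable (pseudoconformalDensity v 1 (φ 1))) :
    ∃ C : ℝ, ∀ T : ℝ, 0 ≤ T → ∀ k : ℝ → Kernel, IsPairSolution v φ T k →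
      ‖sh (k T)‖ ≤ C * (1 + ‖sh (k 0)‖) := by
  obtain ⟨C, hC0, hC⟩ := exists_integral_four_le_of_solution hv h hE
  set N := ∫ x, v x ^ 2
  have hN : 0 ≤ N := integral_nonneg fun x => sq_nonneg _
  have hb : ∀ t, 0 ≤ t → Integrable (fun x => ‖φ t x‖ ^ 4) ∧
      ∃ A, ∀ x, |meanField v (φ t) x| ≤ A := fun t ht => by
    obtain ⟨M, hM⟩ := h.exists_slice t
    obtain ⟨A, -, hA⟩ := exists_slice_bounds hv M
    have := hA _ (hM t ⟨ht, le_rfl⟩)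
    exact ⟨this.1, A, this.2.2.2.1⟩
  refine exists_bound_of_decay (C := √(N * C)) hv.even (Real.sqrt_nonneg _) (fun t ht => ?_)
    (fun t ht => memLp_wKernel hv (h.contDiff_slice ht) (hb t ht).1)
    (fun t ht => (memLp_mKernel hv (h.contDiff_slice ht) (hb t ht).1).1) (fun t ht => ?_)
  · obtain ⟨A, hA⟩ := (hb t ht).2
    refine memLp_top_of_bound ?_ A (Filter.Eventually.of_forall hA)
    exact (hv.continuous_conv (contDiff_norm_sq (h.contDiff_slice ht))).aestronglyMeasurable
  · refine (norm_mKernel_le hv (h.contDiff_slice ht) (hb t ht).1 _).trans ?_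
    have h1 : (0 : ℝ) < 1 + t := by linarith
    have e : √(((1 + t) ^ 3)⁻¹) = (1 + t) ^ (-(3 / 2) : ℝ) := by
      rw [Real.sqrt_eq_rpow, ← Real.rpow_natCast, ← Real.rpow_neg h1.le, ← Real.rpow_mul h1.le]
      norm_num
    rw [← e, ← Real.sqrt_mul (by positivity)]
    refine Real.sqrt_le_sqrt ?_
    rw [mul_assoc, ← div_eq_mul_inv]
    exact mul_le_mul_of_nonneg_left (hC t ht) hN

end PairExcitation

end

theorem mainTheorem4 (v : PairExcitation.R3 → ℝ) (φ : ℝ → PairExcitation.R3 → ℂ)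
    (hv : PairExcitation.IsCutoffPotential v)
    (hv2 : MeasureTheory.MemLp v 2 MeasureTheory.volume)
    (hφ : PairExcitation.IsSmoothHartreeSolution v φ)
    (hE : MeasureTheory.Integrable (PairExcitation.pseudoconformalDensity v 1 (φ 1))
      MeasureTheory.volume) :
    ∃ C : ℝ, ∀ T : ℝ, 0 ≤ T → ∀ k : ℝ → PairExcitation.Kernel,
      PairExcitation.IsPairSolution v φ T k →
        ‖PairExcitation.sh (k T)‖ ≤ C * (1 + ‖PairExcitation.sh (k 0)‖) := by
  exact PairExcitation.norm_sh_le_of_solution (hv.isRegular hv2) hφ hE
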